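/- Let $\mathbb{T}^d=(\mathbb{R}/\mathbb{Z})^d$, let $k\ge 2$ and $p\ge 1$ be integers with $2p>k-1$, let $U\subset\mathbb{R}^2$ be a neighbourhood of $(0,0)$ and let $\Lambda\subset\mathbb{R}^m$. Let $F:U\times\mathbb{T}^d\times\Lambda\to\mathbb{R}^2\times\mathbb{T}^d$ be a map of the form $$F(x,y,\theta,\lambda)=\begin{pmatrix} x+c(\theta,\lambda)\,y\\ y+a_k(\theta,\lambda)\,x^k+A(x,y,\theta,\lambda)\\ \theta+\omega+d_p(\theta,\lambda)\,x^p+B(x,y,\theta,\lambda)\end{pmatrix},$$ analytic (in all variables) in a neighbourhood of each point of $U\times\mathbb{T}^d\times\Lambda$, where, for every $\theta\in\mathbb{T}^d$ and $\lambda\in\Lambda$, as $(x,y)\to(0,0)$, $$A=y\,O(\|(x,y)\|^{k-1})+O(\|(x,y)\|^{k+1}),\qquad B=y\,O(\|(x,y)\|^{p-1})+O(\|(x,y)\|^{p+1}).$$ Write $\bar h(\lambda)=\int_{\mathbb{T}^d}h(\theta,\lambda)\,d\theta$ for the average over $\mathbb{T}^d$. Assume that $\bar c(\lambda)>0$ and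 $\bar a_k(\lambda)>0$ for all $\lambda\in\Lambda$, and that $\omega\in\mathbb{R}^d$ is Diophantine: there are $C>0$ and $\tau\ge d$ with $|\omega\cdot n-l|\ge C|n|^{-\tau}$ for all $n\in\mathbb{Z}^d\setminus\{0\}$ and $l\in\mathbb{Z}$, where $|n|=|n_1|+\dots+|n_d|$. Then for every compact set $\Lambda_0\subset\Lambda$ (in particular for $\Lambda_0=\Lambda$ if $\Lambda$ is compact) there exist $\rho>0$, an open set $V\subset\mathbb{R}^m$ containing $\Lambda_0$, and a map $K:[0,\rho)\times\mathbb{T}^d\times V\to\mathbb{R}^2\times\mathbb{T}^d$ that is $C^1$ on $[0,\rho)\times\mathbb{T}^d\times V$ and analytic on $(0,\rho)\times\mathbb{T}^d\times V$, of the form $$K(u,\theta,\lambda)=\bigl(u^2,\ \bar K^y_{k+1}(\lambda)u^{k+1},\ \theta+\bar K^\theta_{2p-k+1}(\lambda)u^{2p-k+1}\bigr)+\bigl(O(u^3),\,O(u^{k+2}),\,O(u^{2p-k+2})\bigr),$$ with constants in the $O$'s uniform on $[0,\rho)\times\mathbb{T}^d\times\Lambda_0$, and a map, polynomial in $u$,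 $$R(u,\theta,\lambda)=\bigl(u+\bar R^x_k(\lambda)u^k+\bar R^x_{2k-1}(\lambda)u^{2k-1},\ \theta+\omega\bigr),$$ with $\bar R^x_k(\lambda)<0$ for $\lambda\in\Lambda_0$ and $\bar R^x_{2k-1}$ analytic on $V$, such that for $\lambda\in\Lambda_0$, $\theta\in\mathbb{T}^d$ and $u\in(0,\rho)$ the first component of $R(u,\theta,\lambda)$ lies in $(0,u)$, and such that for all $(u,\theta,\lambda)\in[0,\rho)\times\mathbb{T}^d\times\Lambda_0$ one has $K(u,\theta,\lambda)\in U\times\mathbb{T}^d$ and $$F(K(u,\theta,\lambda),\lambda)=K(R(u,\theta,\lambda),\lambda).$$ Moreover, for $\lambda\in\Lambda_0$, $$\bar K^y_{k+1}(\lambda)=-\sqrt{\frac{2\,\bar a_k(\lambda)}{\bar c(\lambda)(k+1)}},\quad \bar K^\theta_{2p-k+1}(\lambda)=-\frac{\bar d_p(\lambda)}{2p-k+1}\sqrt{\frac{2(k+1)}{\bar c(\lambda)\bar a_k(\lambda)}},\quad \bar R^x_k(\lambda)=-\sqrt{\frac{\bar c(\lambda)\bar a_k(\lambda)}{2(k+1)}}.$$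 In particular the image of $K(\cdot,\cdot,\lambda)$ is a local stable manifold of the parabolic torus $\{x=y=0\}$: it is invariant, and for all $(u,\theta,\lambda)\in[0,\rho)\times\mathbb{T}^d\times\Lambda_0$ the $(x,y)$-components of the iterates $F(\cdot,\lambda)^n(K(u,\theta,\lambda))$ tend to $(0,0)$ as $n\to\infty$. -/

import Mathlib

open Set Filter Topology MeasureTheory Asymptotics

noncomputable section

/-- The real torus `(ℝ/ℤ)^d`. -/
abbrev Torus (d : ℕ) : Type := UnitAddTorus (Fin d)

/-- The projection `ℝ^d → (ℝ/ℤ)^d`. -/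
def toTorus {d : ℕ} (v : Fin d → ℝ) : Torus d := fun i => (v i : UnitAddCircle)

/-- `ω` is Diophantine (for maps): there are `C > 0` and `τ ≥ d` with
`|ω · n - l| ≥ C |n|^(-τ)` for all `n ∈ ℤ^d \ {0}`, `l ∈ ℤ`, where `|n| = |n_1| + ... + |n_d|`. -/
def IsDiophantine {d : ℕ} (ω : Fin d → ℝ) : Prop :=
  ∃ C : ℝ, 0 < C ∧ ∃ τ : ℝ, (d : ℝ) ≤ τ ∧ ∀ n : Fin d → ℤ, n ≠ 0 → ∀ l : ℤ,
    C * (∑ i, |(n i : ℝ)|) ^ (-τ) ≤ |∑ i, ω i * (n i : ℝ) - (l : ℝ)|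

/-- The average over the torus; the volume of `(ℝ/ℤ)^d` is `1`. -/
def torusAvg {d m : ℕ} {E : Type*} [NormedAddCommGroup E] [NormedSpace ℝ E]
    (h : Torus d → (Fin m → ℝ) → E) (lam : Fin m → ℝ) : E :=
  ∫ θ : Torus d, h θ lam

/-- `f(x, y) = y O(‖(x, y)‖^(n-1)) + O(‖(x, y)‖^(n+1))` as `(x, y) → (0, 0)`. -/
def HasReducedOrder {E : Type*} [NormedAddCommGroup E] [NormedSpace ℝ E]
    (n : ℕ) (f : ℝ × ℝ → E) : Prop :=
  ∃ f₁ f₂ : ℝ × ℝ → E, (∀ z, f z = z.2 • f₁ z + f₂ z) ∧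
    f₁ =O[𝓝 (0, 0)] (fun z => ‖z‖ ^ (n - 1)) ∧ f₂ =O[𝓝 (0, 0)] (fun z => ‖z‖ ^ (n + 1))

/-- The map in reduced form on `ℝ² × (ℝ/ℤ)^d`, at the parameter `lam`:
`(x, y, θ) ↦ (x + c y, y + a x^k + A, θ + ω + b x^p + B)`. -/
def reducedMap {d m : ℕ} (k p : ℕ) (ω : Fin d → ℝ)
    (c a : Torus d → (Fin m → ℝ) → ℝ) (b : Torus d → (Fin m → ℝ) → Fin d → ℝ)
    (A : ℝ × ℝ → Torus d → (Fin m → ℝ) → ℝ) (B : ℝ × ℝ → Torus d → (Fin m → ℝ) → Fin d → ℝ)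
    (lam : Fin m → ℝ) (q : ℝ × ℝ × Torus d) : ℝ × ℝ × Torus d :=
  (q.1 + c q.2.2 lam * q.2.1,
   q.2.1 + a q.2.2 lam * q.1 ^ k + A (q.1, q.2.1) q.2.2 lam,
   q.2.2 + toTorus (ω + q.1 ^ p • b q.2.2 lam + B (q.1, q.2.1) q.2.2 lam))

/-- The lift of `reducedMap` to the universal cover, as a function of `(x, y, θ, lam)` with
`θ ∈ ℝ^d`; analyticity of the map means analyticity of this lift. -/
def reducedLift {d m : ℕ} (k p : ℕ) (ω : Fin d → ℝ)
    (c a : Torus d → (Fin m → ℝ) → ℝ) (b : Torus d → (Fin m → ℝ) → Fin d → ℝ)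
    (A : ℝ × ℝ → Torus d → (Fin m → ℝ) → ℝ) (B : ℝ × ℝ → Torus d → (Fin m → ℝ) → Fin d → ℝ)
    (q : ℝ × ℝ × (Fin d → ℝ) × (Fin m → ℝ)) : ℝ × ℝ × (Fin d → ℝ) :=
  (q.1 + c (toTorus q.2.2.1) q.2.2.2 * q.2.1,
   q.2.1 + a (toTorus q.2.2.1) q.2.2.2 * q.1 ^ k + A (q.1, q.2.1) (toTorus q.2.2.1) q.2.2.2,
   q.2.2.1 + (ω + q.1 ^ p • b (toTorus q.2.2.1) q.2.2.2
     + B (q.1, q.2.1) (toTorus q.2.2.1) q.2.2.2))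

/-- The polynomial map `R(u, θ, lam) = (u + r₁(lam) u^k + r₂(lam) u^(2k-1), θ + ω)`. -/
def polyR {d m : ℕ} (k : ℕ) (ω : Fin d → ℝ) (r₁ r₂ : (Fin m → ℝ) → ℝ)
    (u : ℝ) (θ : Torus d) (lam : Fin m → ℝ) : ℝ × Torus d :=
  (u + r₁ lam * u ^ k + r₂ lam * u ^ (2 * k - 1), θ + toTorus ω)

/-- The lift to the universal cover of a map `K(u, θ, lam)` with values in `ℝ² × (ℝ/ℤ)^d` whose
angular component is `θ + κ(u, θ, lam)` modulo `1`. -/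
def liftParam {d m : ℕ} (K : ℝ → Torus d → (Fin m → ℝ) → ℝ × ℝ × Torus d)
    (κ : ℝ → Torus d → (Fin m → ℝ) → Fin d → ℝ)
    (q : ℝ × (Fin d → ℝ) × (Fin m → ℝ)) : ℝ × ℝ × (Fin d → ℝ) :=
  ((K q.1 (toTorus q.2.1) q.2.2).1, (K q.1 (toTorus q.2.1) q.2.2).2.1,
    q.2.1 + κ q.1 (toTorus q.2.1) q.2.2)

end

/-! ### Bounded separately holomorphic functions are jointly analytic -/

section Osgood

/-! Look for the manifold in blown-up form, K = (u² X, u^(k+1) Y, θ + u^q Z) with q = 2p - k + 1,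
and for inner dynamics u ↦ ρ u with ρ = 1 + r₁ u^(k-1) + r₂ u^(2k-2). For these weights the
invariance equation divides out to D(ρ) W(ρ u, θ + ω) - W(u, θ) = u^(k-1) g(u, W, θ), where W = (X,
Y, Z) and D(y) = diag(y², y^(k+1), y^q). The field g is analytic at u = 0, and there it equals (c Y,
a X^k, X^p b). The condition 2p > k - 1 says q ≥ 1. This is `exists_parabolicData`, and
`ParabolicData.invariance` goes back to the original coordinates.

Formal solution. Adding u^n v(λ) - u^(n+k-1) ψ(θ, λ) to W changes the coefficient of u^(n+k-1) in
the error by the constant (in θ) r₁ (n + D'(1)) v, minus ∂g(0, w₀) v, minus ψ(θ + ω) - ψ(θ)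
(`isLittleO_step`). The oscillating part is removed by a cohomological equation over the Diophantine
rotation (`exists_cohomological_solution`: Fourier coefficients of analytic functions decay
exponentially and absorb the small divisors). The averages give a linear system for v, which is
invertible except at n = k - 1, where the free coefficient of u^(2k-1) in R is used
(`exists_averaged_solution`). The averaged equations at order 0 determine w₀ and r₁, up to the
choice of the sign that makes r₁ negative. Hence there are approximate solutions of every order
(`exists_formal`).

True solution. In the variable w = u^(-(k-1)) the inner dynamics is close to the translation w ↦ w -
(k-1) r₁, with r₁ < 0, so it maps a wedge L + |Im w| < Re w into itself and increases Re w by a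
definite amount ν (`exists_innerStep_bound`). The correction to an approximate solution is a fixed
point of an operator whose pointwise Lipschitz factors are 1 + O(1/Re w) along the orbit and O(1/Re
w) at the point. With the weight (Re w)^(-N) one step of the orbit gains a factor of about 1 - N ν /
Re w, which wins for N large (`exists_fixedPoint`). The constants that decide how large N must be
come from g and r₁ alone, so the approximate solution can be chosen afterwards, of order adapted to
N (`exists_complexModel`). Working on a complex domain makes the limit analytic. Real values and
periodicity pass from the iterates to the limit.

Regularity at u = 0. The correction is O(u²) on complex balls of radius proportional to u, so by a
Cauchy estimate its derivative is O(u), and its extension by zero is C¹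
(`contDiffOn_of_zero_of_nonpos`). Since ρ lies in (0, 1), orbits on the manifold have u → 0.

Analyticity of limits, series and integrals is always obtained in the same way: holomorphic on
complex lines and bounded implies analytic (`GateauxOn.analyticOnNhd`). Real analytic data are
transported by extensions to uniform complex neighbourhoods (`exists_extension`). -/

lemma mapsTo_closedBall_of_norm_le {X F : Type*} [NormedAddCommGroup F] {f : X → F} {s : Set X} {M : ℝ} {x : X} (hx : x ∈ s)
    (hb : ∀ y ∈ s, ‖f y‖ ≤ M) : MapsTo f s (Metric.closedBall (f x) (2 * M)) := fun y hy => by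
  rw [Metric.mem_closedBall, dist_eq_norm]
  linarith [norm_sub_le (f y) (f x), hb y hy, hb x hx]

variable {F : Type*} [NormedAddCommGroup F] [NormedSpace ℂ F]

lemma norm_dslope_le_of_norm_le {f : ℂ → F} {c : ℂ} {r M : ℝ}
    (hd : DifferentiableOn ℂ f (Metric.ball c r)) (hb : ∀ z ∈ Metric.ball c r, ‖f z‖ ≤ M) {z : ℂ}
    (hz : z ∈ Metric.ball c r) : ‖dslope f c z‖ ≤ 2 * M / r :=
  Complex.norm_dslope_le_div_of_mapsTo_ball hd
    (mapsTo_closedBall_of_norm_le (Metric.mem_ball_self (Metric.nonempty_ball.1 ⟨z, hz⟩)) hb) hz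

variable [CompleteSpace F]

/-- Off the centre this is a difference quotient in `u`, hence holomorphic in `t`. At the centre it
is a limit of such quotients, uniform in `t`: the Schwarz lemma, applied to ψ and then to its slope,
makes the slope Lipschitz at `c` with a constant depending on `M` and `r` only. No joint continuity
of ψ is needed. -/
lemma differentiableOn_dslope_param {ψ : ℂ → ℂ → F} {c : ℂ} {r M : ℝ} (hr : 0 < r) {S : Set ℂ}
    (hS : IsOpen S) (hb : ∀ u ∈ Metric.ball c r, ∀ t ∈ S, ‖ψ u t‖ ≤ M)
    (hu : ∀ t ∈ S, DifferentiableOn ℂ (fun u => ψ u t) (Metric.ball c r))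
    (ht : ∀ u ∈ Metric.ball c r, DifferentiableOn ℂ (fun t => ψ u t) S)
    {u : ℂ} (hu' : u ∈ Metric.ball c r) :
    DifferentiableOn ℂ (fun t => dslope (fun u => ψ u t) c u) S := by
  have hc : c ∈ Metric.ball c r := Metric.mem_ball_self hr
  have key : ∀ v ∈ Metric.ball c r, v ≠ c →
      DifferentiableOn ℂ (fun t => dslope (fun u => ψ u t) c v) S := by
    intro v hv hvc
    simp only [dslope_of_ne _ hvc, slope_def_module]
    exact ((ht v hv).sub (ht c hc)).const_smul _
  by_cases huc : u = c
  · subst huc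
    let v : ℕ → ℂ := fun n => u + (r / 2 : ℝ) * (1 / ((n : ℝ) + 1) : ℝ)
    have hvd : ∀ n, dist (v n) u = r / 2 * (1 / ((n : ℝ) + 1)) := by
      intro n
      rw [dist_eq_norm]
      simp only [v, add_sub_cancel_left, norm_mul, Complex.norm_real, Real.norm_eq_abs]
      rw [abs_of_pos (by positivity), abs_of_pos (by positivity)]
    have hv1 : ∀ n, v n ∈ Metric.ball u r := by
      intro n
      rw [Metric.mem_ball, hvd]
      have : 1 / ((n : ℝ) + 1) ≤ 1 := by
        rw [div_le_one (by positivity)]; linarith [(Nat.cast_nonneg n : (0:ℝ) ≤ n)]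
      nlinarith
    have hvt : Tendsto (fun n => dist (v n) u) atTop (𝓝 0) := by
      simp only [hvd]
      simpa using tendsto_one_div_add_atTop_nhds_zero_nat.const_mul (r / 2)
    refine TendstoLocallyUniformlyOn.differentiableOn (φ := atTop)
      (F := fun n t => dslope (fun u => ψ u t) u (v n)) ?_ (.of_forall fun n => ?_) hS
    · refine TendstoUniformlyOn.tendstoLocallyUniformlyOn ?_
      rw [Metric.tendstoUniformlyOn_iff]
      intro ε hε
      have h2 := hvt.const_mul (2 * (2 * M / r) / r)
      rw [mul_zero] at h2
      filter_upwards [h2.eventually (gt_mem_nhds hε)] with n hn t hts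
      refine lt_of_le_of_lt ?_ hn
      rw [dist_comm]
      have hd := (Complex.differentiableOn_dslope (Metric.ball_mem_nhds u hr)).2 (hu t hts)
      refine Complex.dist_le_div_mul_dist_of_mapsTo_ball hd
        (mapsTo_closedBall_of_norm_le hc fun z hz => ?_) (hv1 n)
      exact norm_dslope_le_of_norm_le (hu t hts) (fun y hy => hb y hy t hts) hz
    · refine key _ (hv1 n) fun h => ?_
      have := hvd n
      rw [h, dist_self] at this
      have : 0 < r / 2 * (1 / ((n : ℝ) + 1)) := by positivity
      linarith
  · exact key u hu' huc

/-- Iterated divided differences of a bounded holomorphic function. -/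
lemma iterate_dslope_bound {φ : ℂ → F} {c : ℂ} {r M : ℝ} (hr : 0 < r)
    (hd : DifferentiableOn ℂ φ (Metric.ball c r)) (hb : ∀ z ∈ Metric.ball c r, ‖φ z‖ ≤ M) (n : ℕ) :
    DifferentiableOn ℂ ((Function.swap dslope c)^[n] φ) (Metric.ball c r) ∧
      ∀ z ∈ Metric.ball c r, ‖(Function.swap dslope c)^[n] φ z‖ ≤ M * (2 / r) ^ n := by
  induction n with
  | zero => simpa using ⟨hd, hb⟩
  | succ n ih =>
    rw [Function.iterate_succ_apply']
    refine ⟨(Complex.differentiableOn_dslope (Metric.ball_mem_nhds c hr)).2 ih.1, fun z hz => ?_⟩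
    refine (norm_dslope_le_of_norm_le ih.1 ih.2 hz).trans_eq ?_
    rw [pow_succ]; ring

/-- The Taylor series with coefficients written as iterated divided differences. Each division costs
a factor 2 / r in the Schwarz bound, so half of the radius is lost, but the coefficients now inherit
holomorphy in further parameters from `differentiableOn_dslope_param`. -/
lemma hasSum_iterate_dslope {φ : ℂ → F} {c : ℂ} {r M : ℝ} (hr : 0 < r)
    (hd : DifferentiableOn ℂ φ (Metric.ball c r)) (hb : ∀ z ∈ Metric.ball c r, ‖φ z‖ ≤ M) {z : ℂ}
    (hz : ‖z - c‖ < r / 2) :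
    HasSum (fun n => (z - c) ^ n • (Function.swap dslope c)^[n] φ c) (φ z) := by
  have hzb : z ∈ Metric.ball c r := by
    rw [Metric.mem_ball, dist_eq_norm]; linarith
  have hcb : c ∈ Metric.ball c r := Metric.mem_ball_self hr
  have hq : ‖z - c‖ * (2 / r) < 1 := by
    rw [← mul_div_assoc, div_lt_one hr]; linarith
  have hq0 : 0 ≤ ‖z - c‖ * (2 / r) := by positivity
  have hM : 0 ≤ M := (norm_nonneg _).trans (hb c hcb)
  have hs : Summable (fun n => (z - c) ^ n • (Function.swap dslope c)^[n] φ c) := by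
    refine Summable.of_norm_bounded ((summable_geometric_of_lt_one hq0 hq).mul_left M) fun n => ?_
    rw [norm_smul, norm_pow, mul_pow]
    nlinarith [(iterate_dslope_bound hr hd hb n).2 c hcb, pow_nonneg (norm_nonneg (z - c)) n]
  have hfin : ∀ n, ∑ j ∈ Finset.range n, (z - c) ^ j • (Function.swap dslope c)^[j] φ c =
      φ z - (z - c) ^ n • (Function.swap dslope c)^[n] φ z := by
    intro n
    induction n with
    | zero => simp
    | succ n ih =>
      rw [Finset.sum_range_succ, ih, Function.iterate_succ_apply', pow_succ, mul_smul]
      have := sub_smul_dslope ((Function.swap dslope c)^[n] φ) c z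
      change _ = φ z - (z - c) ^ n • (z - c) • dslope ((Function.swap dslope c)^[n] φ) c z
      rw [this, smul_sub]; abel
  have ht : Tendsto (fun n => (z - c) ^ n • (Function.swap dslope c)^[n] φ z) atTop (𝓝 0) := by
    refine squeeze_zero_norm (a := fun n => M * (‖z - c‖ * (2 / r)) ^ n) (fun n => ?_) ?_
    · rw [norm_smul, norm_pow, mul_pow]
      nlinarith [(iterate_dslope_bound hr hd hb n).2 z hzb, pow_nonneg (norm_nonneg (z - c)) n]
    · simpa using (tendsto_pow_atTop_nhds_zero_of_lt_one hq0 hq).const_mul M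
  have h1 := hs.hasSum.tendsto_sum_nat
  simp only [hfin] at h1
  have h2 := tendsto_nhds_unique h1 (tendsto_const_nhds.sub ht)
  rw [sub_zero] at h2
  rw [← h2]; exact hs.hasSum

/-- **Osgood's lemma**: a bounded separately holomorphic function is analytic. -/
theorem analyticAt_of_separately {N : ℕ} : ∀ {F : Type*} [NormedAddCommGroup F] [NormedSpace ℂ F]
    [CompleteSpace F] (f : (Fin N → ℂ) → F) (z₀ : Fin N → ℂ) {r M : ℝ}, 0 < r →
    (∀ z ∈ Metric.ball z₀ r, ‖f z‖ ≤ M) →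
    (∀ z ∈ Metric.ball z₀ r, ∀ i,
      DifferentiableAt ℂ (fun t => f (Function.update z i t)) (z i)) → AnalyticAt ℂ f z₀ := by
  -- The target space is quantified inside the induction because the hypothesis is used with values
  -- in ℓ¹(F): all Taylor coefficients in the first variable are treated as one function of the
  -- remaining variables.
  induction N with
  | zero =>
    intro F _ _ _ f z₀ r M _ _ _
    have : f = fun _ => f z₀ := funext fun z => by rw [Subsingleton.elim z z₀]
    rw [this]; exact analyticAt_const
  | succ N ih =>
    intro F _ _ _ f z₀ r M hr hb hd
    set c := z₀ 0
    set w₀ : Fin N → ℂ := Fin.tail z₀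
    have hcons : ∀ u ∈ Metric.ball c r, ∀ w ∈ Metric.ball w₀ r,
        (Fin.cons u w : Fin (N + 1) → ℂ) ∈ Metric.ball z₀ r := by
      intro u hu w hw
      rw [Metric.mem_ball, dist_pi_lt_iff hr] at hw ⊢
      intro i
      refine Fin.cases ?_ (fun j => ?_) i
      · simpa using hu
      · rw [Fin.cons_succ]; exact hw j
    have hM : 0 ≤ M := (norm_nonneg _).trans (hb z₀ (Metric.mem_ball_self hr))
    have hcb : c ∈ Metric.ball c r := Metric.mem_ball_self hr
    let φ : (Fin N → ℂ) → ℂ → F := fun w u => f (Fin.cons u w)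
    have hφd : ∀ w ∈ Metric.ball w₀ r, DifferentiableOn ℂ (φ w) (Metric.ball c r) := by
      intro w hw u hu
      have := hd _ (hcons u hu w hw) 0
      simp only [Fin.update_cons_zero, Fin.cons_zero] at this
      exact this.differentiableWithinAt
    have hφb : ∀ w ∈ Metric.ball w₀ r, ∀ u ∈ Metric.ball c r, ‖φ w u‖ ≤ M :=
      fun w hw u hu => hb _ (hcons u hu w hw)
    let S : (Fin N → ℂ) → Fin N → Set ℂ := fun w i => {t | Function.update w i t ∈ Metric.ball w₀ r}
    have hSo : ∀ w i, IsOpen (S w i) := fun w i =>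
      Metric.isOpen_ball.preimage (f := fun t => Function.update w i t)
        (continuous_const.update i continuous_id)
    have hit : ∀ n, ∀ w i, ∀ u ∈ Metric.ball c r, DifferentiableOn ℂ
        (fun t => (Function.swap dslope c)^[n] (φ (Function.update w i t)) u) (S w i) := by
      intro n w i
      induction n with
      | zero =>
        intro u hu t ht
        have := hd _ (hcons u hu _ ht) i.succ
        simp only [← Fin.cons_update, Fin.cons_succ, Function.update_self,
          Function.update_idem] at this
        exact this.differentiableWithinAt
      | succ n ihn =>
        intro u hu
        simp only [Function.iterate_succ_apply']
        exact differentiableOn_dslope_param hr (hSo w i)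
          (ψ := fun u t => (Function.swap dslope c)^[n] (φ (Function.update w i t)) u)
          (fun u hu t ht => (iterate_dslope_bound hr (hφd _ ht) (hφb _ ht) n).2 u hu)
          (fun t ht => (iterate_dslope_bound hr (hφd _ ht) (hφb _ ht) n).1) ihn hu
    set a : ℕ → (Fin N → ℂ) → F := fun n w => (Function.swap dslope c)^[n] (φ w) c
    have hab : ∀ n, ∀ w ∈ Metric.ball w₀ r, ‖a n w‖ ≤ M * (2 / r) ^ n := fun n w hw =>
      (iterate_dslope_bound hr (hφd _ hw) (hφb _ hw) n).2 c hcb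
    -- The coefficients are bounded by M (2/r)^n, so the weight σ^n with σ = r / 4 makes them
    -- summable like M 2^(-n).
    let σ := r / 4
    have hσ : 0 < σ := by positivity
    let single := fun n => lp.singleContinuousLinearMap ℂ (fun _ : ℕ => F) 1 n
    have hsingle : ∀ n x, ‖single n x‖ = ‖x‖ := fun n x => by
      simp only [single, lp.singleContinuousLinearMap_apply]
      exact lp.norm_single (E := fun _ : ℕ => F) one_pos n x
    let G : ℕ → (Fin N → ℂ) → lp (fun _ : ℕ => F) 1 := fun n w => single n ((σ : ℂ) ^ n • a n w)
    have hGb : ∀ n, ∀ w ∈ Metric.ball w₀ r, ‖G n w‖ ≤ M * (1 / 2) ^ n := by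
      intro n w hw
      have h := mul_le_mul_of_nonneg_left (hab n w hw) (pow_nonneg hσ.le n)
      have e : σ ^ n * (M * (2 / r) ^ n) = M * (1 / 2) ^ n := by
        rw [show (1 / 2 : ℝ) = σ * (2 / r) by simp only [σ]; field_simp; norm_num, mul_pow]; ring
      simp only [G, hsingle, norm_smul, norm_pow, Complex.norm_real, Real.norm_eq_abs,
        abs_of_pos hσ]
      rwa [e] at h
    have hsum : Summable fun n : ℕ => M * (1 / 2 : ℝ) ^ n := summable_geometric_two.mul_left M
    let Φ : (Fin N → ℂ) → lp (fun _ : ℕ => F) 1 := fun w => ∑' n, G n w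
    have hΦ : AnalyticAt ℂ Φ w₀ := by
      refine ih Φ w₀ hr (M := ∑' n : ℕ, M * (1 / 2 : ℝ) ^ n)
        (fun w hw => tsum_of_norm_bounded hsum.hasSum fun n => hGb n w hw) fun w hw i => ?_
      have h1 : DifferentiableOn ℂ (fun t => ∑' n, G n (Function.update w i t)) (S w i) :=
        Complex.differentiableOn_tsum_of_summable_norm hsum
          (fun n => (single n).differentiable.comp_differentiableOn
            ((hit n w i c hcb).const_smul _)) (hSo w i) fun n t ht => hGb n _ ht
      exact h1.differentiableAt ((hSo w i).mem_nhds (by simpa [S] using hw))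
    let ev := fun n => lp.evalCLM ℂ (fun _ : ℕ => F) 1 n
    have hev : ∀ n, ‖ev n‖ ≤ 1 := fun n =>
      ContinuousLinearMap.opNorm_le_bound _ zero_le_one fun x => by
        rw [one_mul]; exact lp.norm_apply_le_norm one_ne_zero x n
    -- Summation of the power series as an operator on ℓ¹(F) depending analytically on `u`; the
    -- weights σ^n are undone here. Then f(u, w) = T(u) Φ(w), a bilinear expression in two analytic
    -- functions of separate variables.
    let T : ℂ → (lp (fun _ : ℕ => F) 1 →L[ℂ] F) := fun u => ∑' n, ((u - c) / σ) ^ n • ev n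
    let B := Metric.ball c (σ / 2)
    have hTb : ∀ n, ∀ u ∈ B, ‖((u - c) / σ) ^ n • ev n‖ ≤ (1 / 2 : ℝ) ^ n := by
      intro n u hu
      rw [Metric.mem_ball, dist_eq_norm] at hu
      rw [norm_smul, norm_pow, norm_div, Complex.norm_real, Real.norm_eq_abs, abs_of_pos hσ]
      have : ‖u - c‖ / σ ≤ 1 / 2 := by rw [div_le_iff₀ hσ]; linarith
      calc _ ≤ (1 / 2 : ℝ) ^ n * 1 := by gcongr; exact hev n
        _ = _ := mul_one _
    have hT : AnalyticAt ℂ T c := by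
      refine DifferentiableOn.analyticAt (s := B) ?_ (Metric.ball_mem_nhds _ (by positivity))
      exact Complex.differentiableOn_tsum_of_summable_norm summable_geometric_two
        (fun n => by fun_prop) Metric.isOpen_ball hTb
    let p0 : (Fin (N + 1) → ℂ) →L[ℂ] ℂ := ContinuousLinearMap.proj 0
    let pt : (Fin (N + 1) → ℂ) →L[ℂ] (Fin N → ℂ) :=
      ContinuousLinearMap.pi fun i => ContinuousLinearMap.proj i.succ
    have h1 : AnalyticAt ℂ (fun z => T (p0 z)) z₀ :=
      AnalyticAt.comp (g := T) (f := p0) hT (p0.analyticAt z₀)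
    have h2 : AnalyticAt ℂ (fun z => Φ (pt z)) z₀ :=
      AnalyticAt.comp (g := Φ) (f := pt) hΦ (pt.analyticAt _)
    have h3 : AnalyticAt ℂ (fun z => (T (p0 z)) (Φ (pt z))) z₀ := by
      let b := (ContinuousLinearMap.id ℂ (lp (fun _ : ℕ => F) 1 →L[ℂ] F))
      exact (b.analyticAt_bilinear (T (p0 z₀), Φ (pt z₀))).comp₂ h1 h2
    refine h3.congr ?_
    filter_upwards [Metric.ball_mem_nhds z₀ (show 0 < σ / 2 by positivity)] with z hz
    rw [Metric.mem_ball, dist_pi_lt_iff (by positivity)] at hz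
    have hu : z 0 ∈ B := hz 0
    have hw : pt z ∈ Metric.ball w₀ r := by
      rw [Metric.mem_ball, dist_pi_lt_iff hr]
      intro i
      refine (hz i.succ).trans ?_
      simp only [σ]; linarith
    have hΦs : HasSum (fun n => G n (pt z)) (Φ (pt z)) :=
      (Summable.of_norm_bounded hsum fun n => hGb n _ hw).hasSum
    have hevΦ : ∀ n, ev n (Φ (pt z)) = (σ : ℂ) ^ n • a n (pt z) := by
      intro n
      have h := hΦs.mapL (ev n)
      refine h.unique ?_
      have h4 : ∀ m, m ≠ n → ev n (G m (pt z)) = 0 := fun m hm => by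
        simp only [ev, G, single, lp.singleContinuousLinearMap_apply]
        exact lp.single_apply_ne 1 m _ (Ne.symm hm)
      have h5 : ev n (G n (pt z)) = (σ : ℂ) ^ n • a n (pt z) := by
        simp only [ev, G, single, lp.singleContinuousLinearMap_apply]
        exact lp.single_apply_self (E := fun _ : ℕ => F) 1 n _
      rw [← h5]
      exact hasSum_single n h4
    have hTs : HasSum (fun n => ((p0 z - c) / σ) ^ n • ev n) (T (p0 z)) :=
      (Summable.of_norm_bounded summable_geometric_two fun n => hTb n _ hu).hasSum
    have h6 := hTs.mapL (ContinuousLinearMap.apply ℂ F (Φ (pt z)))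
    simp only [ContinuousLinearMap.apply_apply, smul_apply, hevΦ] at h6
    have h7 := hasSum_iterate_dslope hr (hφd _ hw) (hφb _ hw) (z := z 0) (by
      have := hz 0
      rw [dist_eq_norm] at this
      refine this.trans ?_
      simp only [σ]; linarith)
    have h8 : φ (pt z) (z 0) = f z := by
      simp only [φ]
      congr 1
      exact Fin.cons_self_tail z
    rw [h8] at h7
    refine h6.unique (h7.congr_fun fun n => ?_)
    rw [smul_smul, ← mul_pow, div_mul_cancel₀]
    · rfl
    · exact_mod_cast hσ.ne'

end Osgood

/-! ### Holomorphy along complex lines -/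

section Gateaux

variable {E F : Type*} [NormedAddCommGroup E] [NormedSpace ℂ E]
  [NormedAddCommGroup F] [NormedSpace ℂ F]

/-- `f` is complex differentiable along every line, at the points of `s`. -/
def GateauxOn (f : E → F) (s : Set E) : Prop :=
  ∀ z ∈ s, ∀ v, DifferentiableAt ℂ (fun t : ℂ => f (z + t • v)) 0

lemma GateauxOn.differentiableAt_line {f : E → F} {s : Set E} (hf : GateauxOn f s) {z v : E} {t : ℂ}
    (ht : z + t • v ∈ s) : DifferentiableAt ℂ (fun t : ℂ => f (z + t • v)) t := by
  have h1 : DifferentiableAt ℂ (fun t' : ℂ => f (z + t • v + t' • v)) (t - t) := by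
    rw [sub_self]; exact hf _ ht v
  have h2 := h1.comp (f := fun t' : ℂ => t' - t) t (by fun_prop : DifferentiableAt ℂ (fun t' : ℂ => t' - t) t)
  refine h2.congr_of_eventuallyEq (.of_forall fun t' => ?_)
  simp only [Function.comp_apply, add_assoc, ← add_smul, add_sub_cancel]

lemma DifferentiableOn.gateauxOn {f : E → F} {s : Set E} (hs : IsOpen s)
    (hf : DifferentiableOn ℂ f s) : GateauxOn f s := fun z hz v => by
  have h : DifferentiableAt ℂ f (z + (0 : ℂ) • v) := by
    simpa using hf.differentiableAt (hs.mem_nhds hz)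
  exact h.comp (0 : ℂ) (by fun_prop : DifferentiableAt ℂ (fun t : ℂ => z + t • v) 0)

/-- In the coordinates of a basis, holomorphy on lines contains separate holomorphy, and Osgood's
lemma applies. Later only restrictions to complex lines have to be examined. -/
theorem GateauxOn.analyticOnNhd [FiniteDimensional ℂ E] [CompleteSpace F] {f : E → F} {s : Set E}
    (hf : GateauxOn f s) (hs : IsOpen s) {M : ℝ} (hb : ∀ z ∈ s, ‖f z‖ ≤ M) :
    AnalyticOnNhd ℂ f s := by
  intro z₀ hz₀
  let e := (Module.finBasis ℂ E).equivFunL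
  have ho : IsOpen (e.symm ⁻¹' s) := hs.preimage e.symm.continuous
  obtain ⟨r, hr, hrs⟩ := Metric.isOpen_iff.1 ho (e z₀) (by simpa using hz₀)
  have h := analyticAt_of_separately (fun z => f (e.symm z)) (e z₀) hr (M := M)
    (fun z hz => hb _ (hrs hz)) fun z hz i => by
      have h1 : ∀ t : ℂ, Function.update z i t = z + (t - z i) • Pi.single i (1 : ℂ) := by
        intro t
        ext j
        by_cases hj : j = i
        · subst hj; simp
        · simp [hj]
      have h2 := hf _ (hrs hz) (e.symm (Pi.single i (1 : ℂ)))
      have h3 : (fun t => f (e.symm (Function.update z i t))) = fun t =>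
          (fun t : ℂ => f (e.symm z + t • e.symm (Pi.single i (1 : ℂ)))) (t - z i) := by
        funext t
        simp only [h1, map_add, map_smul]
      rw [h3]
      rw [← sub_self (z i)] at h2
      exact h2.comp (f := fun t : ℂ => t - z i) (z i) (by fun_prop : DifferentiableAt ℂ (fun t : ℂ => t - z i) (z i))
  have h5 := AnalyticAt.comp (g := fun z => f (e.symm z)) (f := e) h
    ((e : E →L[ℂ] (Fin (Module.finrank ℂ E) → ℂ)).analyticAt z₀)
  simpa [Function.comp_def] using h5

/-- Lipschitz estimate for bounded holomorphic functions. -/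
lemma dist_le_of_bounded {f : E → F} {x : E} {r M : ℝ} (hf : DifferentiableOn ℂ f (Metric.ball x r))
    (hb : ∀ z ∈ Metric.ball x r, ‖f z‖ ≤ M) {y z : E} (hy : dist y x < r / 2) (hz : dist z x < r / 2) :
    dist (f y) (f z) ≤ 8 * M / r * dist y z := by
  have hr : 0 < r := by linarith [dist_nonneg (x := y) (y := x)]
  have hsub : ∀ y, dist y x < r / 2 → Metric.ball y (r / 2) ⊆ Metric.ball x r := by
    intro y hy
    refine Metric.ball_subset_ball' ?_
    linarith
  have hM : 0 ≤ M := (norm_nonneg _).trans (hb x (Metric.mem_ball_self hr))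
  -- Close points are compared by the Schwarz lemma on the ball of radius r / 2 about one of them;
  -- for distant points the trivial bound 2M is already small against the distance.
  by_cases hyz : dist y z < r / 2
  · have h := Complex.dist_le_div_mul_dist_of_mapsTo_ball (hf.mono (hsub z hz))
      (mapsTo_closedBall_of_norm_le (Metric.mem_ball_self (by positivity)) fun w hw =>
        hb w (hsub z hz hw)) (z := y) hyz
    refine h.trans ?_
    have : 2 * M / (r / 2) ≤ 8 * M / r := by
      rw [div_le_div_iff₀ (by positivity) hr]; nlinarith
    gcongr
  · have hym := hb y (hsub y hy (Metric.mem_ball_self (by positivity)))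
    have hzm := hb z (hsub z hz (Metric.mem_ball_self (by positivity)))
    have h1 : dist (f y) (f z) ≤ 2 * M := by
      rw [dist_eq_norm]; linarith [norm_sub_le (f y) (f z)]
    refine h1.trans ?_
    rw [div_mul_eq_mul_div, le_div_iff₀ hr]
    nlinarith

end Gateaux

/-! ### Limits, series and integrals of holomorphic functions -/

section Limits

variable {F : Type*} [NormedAddCommGroup F] [NormedSpace ℂ F]

/-- A bounded pointwise limit of holomorphic functions on a disc is holomorphic. -/
lemma differentiableAt_of_tendsto_of_bounded [CompleteSpace F] {f : ℕ → ℂ → F} {g : ℂ → F} {c : ℂ} {r M : ℝ}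
    (hr : 0 < r) (hf : ∀ n, DifferentiableOn ℂ (f n) (Metric.ball c r))
    (hb : ∀ n, ∀ z ∈ Metric.ball c r, ‖f n z‖ ≤ M)
    (hg : ∀ z ∈ Metric.ball c r, Tendsto (fun n => f n z) atTop (𝓝 (g z))) :
    DifferentiableAt ℂ g c := by
  have hM : 0 ≤ M := (norm_nonneg _).trans (hb 0 c (Metric.mem_ball_self hr))
  have hsub : Metric.ball c (r / 2) ⊆ Metric.ball c r := Metric.ball_subset_ball (by linarith)
  have hgl : ∀ y ∈ Metric.ball c (r / 2), ∀ z ∈ Metric.ball c (r / 2),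
      dist (g y) (g z) ≤ 8 * M / r * dist y z := fun y hy z hz =>
    le_of_tendsto ((hg y (hsub hy)).dist (hg z (hsub hz)))
      (.of_forall fun n => dist_le_of_bounded (hf n) (hb n) hy hz)
  have hL : 0 ≤ 8 * M / r := by positivity
  -- The functions share the Lipschitz constant 8M / r on the half disc, which upgrades pointwise to
  -- locally uniform convergence.
  have hloc : TendstoLocallyUniformlyOn f g atTop (Metric.ball c (r / 2)) := by
    rw [Metric.tendstoLocallyUniformlyOn_iff]
    intro ε hε x hx
    let δ := ε / 4 / (8 * M / r + 1)
    have hδ : 0 < δ := by positivity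
    refine ⟨_, inter_mem_nhdsWithin (Metric.ball c (r / 2)) (Metric.ball_mem_nhds x hδ), ?_⟩
    filter_upwards [(Metric.tendsto_nhds.1 (hg x (hsub hx))) (ε / 4) (by positivity)] with n hn y hy
    have hyx : 8 * M / r * dist y x ≤ ε / 4 := by
      have h1 : dist y x ≤ δ := hy.2.le
      calc _ ≤ (8 * M / r + 1) * δ := by gcongr; linarith
        _ = ε / 4 := mul_div_cancel₀ _ (by positivity)
    have h2 := hgl y hy.1 x hx
    have h3 := dist_le_of_bounded (hf n) (hb n) hy.1 hx
    have h4 := dist_triangle4 (g y) (g x) (f n x) (f n y)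
    rw [dist_comm (g x), dist_comm (f n x) (f n y)] at h4
    linarith
  exact (hloc.differentiableOn (.of_forall fun n => (hf n).mono hsub)
    Metric.isOpen_ball).differentiableAt (Metric.ball_mem_nhds _ (by positivity))

/-- Holomorphic dependence of an integral on a parameter. -/
lemma differentiableAt_integral_of_bounded {α : Type*} [MeasurableSpace α] {μ : Measure α}
    [IsFiniteMeasure μ] {f : α → ℂ → F} {c : ℂ} {r M : ℝ} (hr : 0 < r)
    (hm : ∀ z ∈ Metric.ball c r, AEStronglyMeasurable (fun a => f a z) μ)
    (hd : ∀ a, DifferentiableOn ℂ (f a) (Metric.ball c r))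
    (hb : ∀ a, ∀ z ∈ Metric.ball c r, ‖f a z‖ ≤ M) :
    DifferentiableAt ℂ (fun z => ∫ a, f a z ∂μ) c := by
  have hcb : c ∈ Metric.ball c r := Metric.mem_ball_self hr
  let v : ℕ → ℂ := fun n => c + (r / 2 * (1 / ((n : ℝ) + 1)) : ℝ)
  have hvd : ∀ n, dist (v n) c = r / 2 * (1 / ((n : ℝ) + 1)) := by
    intro n
    rw [dist_eq_norm]
    simp only [v, add_sub_cancel_left, Complex.norm_real, Real.norm_eq_abs]
    rw [abs_of_pos (by positivity)]
  have hv1 : ∀ n, v n ∈ Metric.ball c r := by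
    intro n
    rw [Metric.mem_ball, hvd]
    have : 1 / ((n : ℝ) + 1) ≤ 1 := by
      rw [div_le_one (by positivity)]; linarith [(Nat.cast_nonneg n : (0:ℝ) ≤ n)]
    nlinarith
  have hvne : ∀ n, v n ≠ c := fun n h => by
    have := hvd n
    rw [h, dist_self] at this
    have : 0 < r / 2 * (1 / ((n : ℝ) + 1)) := by positivity
    linarith
  have hvt : Tendsto v atTop (𝓝[≠] c) := by
    refine tendsto_nhdsWithin_iff.2 ⟨tendsto_iff_dist_tendsto_zero.2 ?_, .of_forall hvne⟩
    simp only [hvd]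
    simpa using tendsto_one_div_add_atTop_nhds_zero_nat.const_mul (r / 2)
  have hda : ∀ a, ∀ z ∈ Metric.ball c r, DifferentiableAt ℂ (f a) z := fun a z hz =>
    (hd a).differentiableAt (Metric.isOpen_ball.mem_nhds hz)
  -- The derivative is a pointwise limit of difference quotients along one fixed sequence, hence
  -- measurable in `a`.
  have hm' : AEStronglyMeasurable (fun a => deriv (f a) c) μ := by
    refine aestronglyMeasurable_of_tendsto_ae (f := fun n a => slope (f a) c (v n)) atTop
      (fun n => ?_) (.of_forall fun a => ?_)
    · simp only [slope_def_module]
      exact ((hm _ (hv1 n)).sub (hm _ hcb)).const_smul _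
    · exact (hasDerivAt_iff_tendsto_slope.1 (hda a c hcb).hasDerivAt).comp hvt
  refine (hasDerivAt_integral_of_dominated_loc_of_deriv_le (s := Metric.ball c (r / 2))
    (F := fun z a => f a z) (F' := fun z a => deriv (f a) z) (bound := fun _ => 2 * M / (r / 2))
    (Metric.ball_mem_nhds _ (by positivity)) ?_ ?_ hm' ?_ (integrable_const _) ?_).2.differentiableAt
  · filter_upwards [Metric.ball_mem_nhds c hr] with z hz using hm z hz
  · exact Integrable.of_bound (hm c hcb) M (.of_forall fun a => hb a c hcb)
  · refine .of_forall fun a z hz => ?_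
    have hsub : Metric.ball z (r / 2) ⊆ Metric.ball c r := by
      refine Metric.ball_subset_ball' ?_
      rw [Metric.mem_ball] at hz
      linarith
    exact Complex.norm_deriv_le_div_of_mapsTo_ball ((hd a).mono hsub)
      (mapsTo_closedBall_of_norm_le (Metric.mem_ball_self (by positivity)) fun w hw =>
        hb a w (hsub hw)) (by positivity)
  · exact .of_forall fun a z hz => (hda a z (Metric.ball_subset_ball (by linarith) hz)).hasDerivAt

variable {E : Type*} [NormedAddCommGroup E] [NormedSpace ℂ E]

lemma exists_ball_line {s : Set E} (hs : IsOpen s) {z : E} (hz : z ∈ s) (v : E) :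
    ∃ r > 0, ∀ t ∈ Metric.ball (0 : ℂ) r, z + t • v ∈ s := by
  have : ContinuousAt (fun t : ℂ => z + t • v) 0 := by fun_prop
  exact Metric.mem_nhds_iff.1 (this.preimage_mem_nhds (hs.mem_nhds (by simpa using hz)))

lemma GateauxOn.of_tendsto [CompleteSpace F] {f : ℕ → E → F} {g : E → F} {s : Set E} {M : ℝ} (hs : IsOpen s)
    (hf : ∀ n, GateauxOn (f n) s) (hb : ∀ n, ∀ z ∈ s, ‖f n z‖ ≤ M)
    (hg : ∀ z ∈ s, Tendsto (fun n => f n z) atTop (𝓝 (g z))) : GateauxOn g s := by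
  intro z hz v
  obtain ⟨r, hr, h⟩ := exists_ball_line hs hz v
  exact differentiableAt_of_tendsto_of_bounded (f := fun n t => f n (z + t • v)) hr
    (fun n t ht => ((hf n).differentiableAt_line (h t ht)).differentiableWithinAt)
    (fun n t ht => hb n _ (h t ht)) fun t ht => hg _ (h t ht)

lemma GateauxOn.tsum [CompleteSpace F] {ι : Type*} {f : ι → E → F} {s : Set E} {b : ι → ℝ} (hs : IsOpen s)
    (hf : ∀ n, GateauxOn (f n) s) (hb : ∀ n, ∀ z ∈ s, ‖f n z‖ ≤ b n) (hsum : Summable b) :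
    GateauxOn (fun z => ∑' n, f n z) s := by
  intro z hz v
  obtain ⟨r, hr, h⟩ := exists_ball_line hs hz v
  exact (Complex.differentiableOn_tsum_of_summable_norm (F := fun n t => f n (z + t • v)) hsum
    (fun n t ht => ((hf n).differentiableAt_line (h t ht)).differentiableWithinAt)
    Metric.isOpen_ball fun n t ht => hb n _ (h t ht)).differentiableAt (Metric.ball_mem_nhds _ hr)

lemma GateauxOn.integral {α : Type*} [MeasurableSpace α] {μ : Measure α} [IsFiniteMeasure μ]
    {f : α → E → F} {s : Set E} {M : ℝ} (hs : IsOpen s) (hf : ∀ a, GateauxOn (f a) s)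
    (hm : ∀ z ∈ s, AEStronglyMeasurable (fun a => f a z) μ) (hb : ∀ a, ∀ z ∈ s, ‖f a z‖ ≤ M) :
    GateauxOn (fun z => ∫ a, f a z ∂μ) s := by
  intro z hz v
  obtain ⟨r, hr, h⟩ := exists_ball_line hs hz v
  exact differentiableAt_integral_of_bounded (f := fun a t => f a (z + t • v)) hr
    (fun t ht => hm _ (h t ht))
    (fun n t ht => ((hf n).differentiableAt_line (h t ht)).differentiableWithinAt)
    fun n t ht => hb n _ (h t ht)

end Limits

/-! ### Real forms and complex extensions of real analytic functions -/

section RealForm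

/-- `E` is a real form of the complex normed space `EC`. -/
class RealForm (E : Type*) (EC : outParam Type*) [NormedAddCommGroup E] [NormedSpace ℝ E]
    [NormedAddCommGroup EC] [NormedSpace ℂ EC] where
  inc : E →+ EC
  re : EC →+ E
  im : EC →+ E
  inc_smul : ∀ (r : ℝ) (x : E), inc (r • x) = (r : ℂ) • inc x
  norm_inc : ∀ x, ‖inc x‖ = ‖x‖
  norm_re_le : ∀ z, ‖re z‖ ≤ ‖z‖
  norm_im_le : ∀ z, ‖im z‖ ≤ ‖z‖
  re_inc : ∀ x, re (inc x) = x
  im_inc : ∀ x, im (inc x) = 0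
  re_I_smul : ∀ z, re (Complex.I • z) = -im z
  im_I_smul : ∀ z, im (Complex.I • z) = re z
  inc_re_add : ∀ z, inc (re z) + Complex.I • inc (im z) = z

namespace RealForm

instance : RealForm ℝ ℂ where
  inc := Complex.ofRealHom.toAddMonoidHom
  re := Complex.reAddGroupHom
  im := Complex.imAddGroupHom
  inc_smul r x := by simp
  norm_inc x := by simp
  norm_re_le z := Complex.abs_re_le_norm z
  norm_im_le z := Complex.abs_im_le_norm z
  re_inc x := by simp
  im_inc x := by simp
  re_I_smul z := by simp
  im_I_smul z := by simp
  inc_re_add z := by simp [mul_comm Complex.I, Complex.re_add_im]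

instance {ι : Type*} [Fintype ι] : RealForm (ι → ℝ) (ι → ℂ) where
  inc := { toFun := fun x i => (x i : ℂ), map_zero' := by ext; simp, map_add' := by intros; ext; simp }
  re := { toFun := fun x i => (x i).re, map_zero' := by ext; simp, map_add' := by intros; ext; simp }
  im := { toFun := fun x i => (x i).im, map_zero' := by ext; simp, map_add' := by intros; ext; simp }
  inc_smul r x := by ext; simp
  norm_inc x := by simp [Pi.norm_def]
  norm_re_le z := (pi_norm_le_iff_of_nonneg (norm_nonneg _)).2 fun i =>
    (Complex.abs_re_le_norm (z i)).trans (norm_le_pi_norm z i)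
  norm_im_le z := (pi_norm_le_iff_of_nonneg (norm_nonneg _)).2 fun i =>
    (Complex.abs_im_le_norm (z i)).trans (norm_le_pi_norm z i)
  re_inc x := by ext; simp
  im_inc x := by ext; simp
  re_I_smul z := by ext; simp
  im_I_smul z := by ext; simp
  inc_re_add z := by ext; simp [mul_comm Complex.I, Complex.re_add_im]

variable {E EC F FC : Type*} [NormedAddCommGroup E] [NormedSpace ℝ E]
  [NormedAddCommGroup EC] [NormedSpace ℂ EC] [NormedAddCommGroup F] [NormedSpace ℝ F]
  [NormedAddCommGroup FC] [NormedSpace ℂ FC] [RealForm E EC] [RealForm F FC]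

instance : RealForm (E × F) (EC × FC) where
  inc := (inc (E := E)).prodMap (inc (E := F))
  re := (re (E := E)).prodMap (re (E := F))
  im := (im (E := E)).prodMap (im (E := F))
  inc_smul r x := by simp [inc_smul, Prod.ext_iff]
  norm_inc x := by simp [Prod.norm_def, norm_inc]
  norm_re_le z := by simpa [Prod.norm_def] using max_le_max (norm_re_le z.1) (norm_re_le z.2)
  norm_im_le z := by simpa [Prod.norm_def] using max_le_max (norm_im_le z.1) (norm_im_le z.2)
  re_inc x := Prod.ext (re_inc x.1) (re_inc x.2)
  im_inc x := Prod.ext (im_inc x.1) (im_inc x.2)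
  re_I_smul z := Prod.ext (re_I_smul z.1) (re_I_smul z.2)
  im_I_smul z := Prod.ext (im_I_smul z.1) (im_I_smul z.2)
  inc_re_add z := Prod.ext (inc_re_add z.1) (inc_re_add z.2)

lemma dist_inc (x y : E) : dist (inc x) (inc y) = dist x y := by
  rw [dist_eq_norm, dist_eq_norm, ← map_sub, norm_inc]

lemma dist_re_le (z w : EC) : dist (re z : E) (re w) ≤ dist z w := by
  rw [dist_eq_norm, dist_eq_norm, ← map_sub]; exact norm_re_le _

lemma isometry_inc : Isometry (inc : E → EC) := .of_dist_eq dist_inc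

lemma inc_injective : Function.Injective (inc : E → EC) := isometry_inc.injective

lemma inc_mem_ball {x y : E} {r : ℝ} : (inc y : EC) ∈ Metric.ball (inc x) r ↔ y ∈ Metric.ball x r := by
  rw [Metric.mem_ball, Metric.mem_ball, dist_inc]

lemma re_smul (r : ℝ) (z : EC) : (re ((r : ℂ) • z) : E) = r • re z := by
  conv_lhs => rw [← inc_re_add (E := E) z, smul_add, smul_comm, ← inc_smul, ← inc_smul, map_add, re_inc,
    re_I_smul, im_inc, neg_zero, add_zero]

lemma im_smul (r : ℝ) (z : EC) : (im ((r : ℂ) • z) : E) = r • im z := by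
  conv_lhs => rw [← inc_re_add (E := E) z, smul_add, smul_comm, ← inc_smul, ← inc_smul, map_add, im_inc,
    im_I_smul, re_inc, zero_add]

/-- The inclusion of a real form as a continuous `ℝ`-linear map. -/
noncomputable def incL : E →L[ℝ] EC where
  toFun := inc
  map_add' := map_add _
  map_smul' r x := by simp [inc_smul]
  cont := isometry_inc.continuous

/-- The real part as a continuous `ℝ`-linear map. -/
noncomputable def reL : EC →L[ℝ] E :=
  LinearMap.mkContinuous
    { toFun := re, map_add' := map_add _, map_smul' := fun r z => by
        rw [← Complex.coe_smul, re_smul]; rfl } 1 fun z => by simpa using norm_re_le z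

lemma analyticAt_re {g : EC → FC} {x : E} (hg : AnalyticAt ℂ g (inc x)) :
    AnalyticAt ℝ (fun y => (re (g (inc y)) : F)) x := by
  have h1 : AnalyticAt ℝ g (incL x) := hg.restrictScalars
  have h2 := AnalyticAt.comp (f := (incL : E →L[ℝ] EC)) h1 ((incL : E →L[ℝ] EC).analyticAt x)
  exact ((reL : FC →L[ℝ] F).analyticAt _).comp h2

lemma analyticAt_of_inc_eq {g : EC → FC} {f : E → F} {x : E} (hg : AnalyticAt ℂ g (inc x))
    (h : ∀ᶠ y in 𝓝 x, g (inc y) = inc (f y)) : AnalyticAt ℝ f x :=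
  (analyticAt_re (F := F) hg).congr (h.mono fun y hy => by simp only [hy, re_inc])

variable (E) in
/-- The complex coordinates attached to a real basis. -/
noncomputable def coord [FiniteDimensional ℂ EC] {N : ℕ} (b : Module.Basis (Fin N) ℝ E) (i : Fin N) :
    EC →L[ℂ] ℂ :=
  LinearMap.toContinuousLinearMap
    { toFun := fun z => (b.repr (re z) i : ℂ) + Complex.I * (b.repr (im z) i : ℂ)
      map_add' := fun z w => by simp; ring
      map_smul' := fun c z => by
        have h1 : (re (c • z) : E) = c.re • re z - c.im • im z := by
          conv_lhs => rw [← Complex.re_add_im c, add_smul, mul_smul, map_add, re_smul, re_smul,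
            re_I_smul, smul_neg, ← sub_eq_add_neg]
        have h2 : (im (c • z) : E) = c.re • im z + c.im • re z := by
          conv_lhs => rw [← Complex.re_add_im c, add_smul, mul_smul, map_add, im_smul, im_smul,
            im_I_smul]
        rw [h1, h2]
        apply Complex.ext <;> simp [sub_eq_add_neg, add_comm] }

lemma coord_inc [FiniteDimensional ℂ EC] {N : ℕ} (b : Module.Basis (Fin N) ℝ E) (i : Fin N) (x : E) :
    coord E b i (inc x) = (b.repr x i : ℂ) := by
  simp [coord, re_inc, im_inc]

/-- Every germ of a real analytic function extends to a germ of a complex analytic function. -/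
theorem exists_analyticAt_inc_eq [FiniteDimensional ℝ E] [FiniteDimensional ℂ EC] [CompleteSpace FC]
    {f : E → F} {x : E} (hf : AnalyticAt ℝ f x) :
    ∃ g : EC → FC, AnalyticAt ℂ g (inc x) ∧ ∀ᶠ y in 𝓝 x, g (inc y) = inc (f y) := by
  obtain ⟨p, R, hp⟩ := hf
  set N := Module.finrank ℝ E
  let b : Module.Basis (Fin N) ℝ E := Module.finBasis ℝ E
  let l := coord (EC := EC) E b
  obtain ⟨A, hA⟩ : ∃ A : ℝ, ∀ i, ‖l i‖ ≤ A :=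
    ⟨∑ i, ‖l i‖, fun i => Finset.single_le_sum (f := fun i => ‖l i‖)
      (fun _ _ => norm_nonneg _) (Finset.mem_univ i)⟩
  obtain ⟨B, hB⟩ : ∃ B : ℝ, ∀ i, ‖b i‖ ≤ B :=
    ⟨∑ i, ‖b i‖, fun i => Finset.single_le_sum (f := fun i => ‖b i‖)
      (fun _ _ => norm_nonneg _) (Finset.mem_univ i)⟩
  -- Each coefficient of the real series is expanded in a real basis, and the real coordinates are
  -- replaced by their complex linear extensions. There are N^n multi-indices, so the norms grow at
  -- most by a factor (N |A| |B|)^n and the radius stays positive.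
  let q : FormalMultilinearSeries ℂ EC FC := fun n => ∑ s : Fin n → Fin N,
    ((ContinuousMultilinearMap.mkPiAlgebra ℂ (Fin n) ℂ).compContinuousLinearMap
      fun j => l (s j)).smulRight (inc (p n fun j => b (s j)))
  have hq : ∀ n y, q n (fun _ => inc y) = inc (p n fun _ => y) := by
    intro n y
    have hy : (fun _ : Fin n => y) = fun _ => ∑ i, b.repr y i • b i := by
      funext; exact (b.sum_repr y).symm
    conv_rhs => rw [hy, ContinuousMultilinearMap.map_sum]
    simp only [q, ContinuousMultilinearMap.map_smul_univ, map_sum, inc_smul]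
    simp [l, coord_inc]
  have hqn : ∀ n, ‖q n‖ ≤ ‖p n‖ * (N * |A| * |B|) ^ n := by
    intro n
    have h1 : ∀ s : Fin n → Fin N, ‖((ContinuousMultilinearMap.mkPiAlgebra ℂ (Fin n) ℂ
        ).compContinuousLinearMap fun j => l (s j)).smulRight (inc (p n fun j => b (s j)) : FC)‖ ≤
        ‖p n‖ * (|A| * |B|) ^ n := by
      intro s
      have h2 : ‖(inc (p n fun j => b (s j)) : FC)‖ ≤ ‖p n‖ * |B| ^ n := by
        rw [norm_inc]
        refine (p n).le_opNorm_mul_pow_of_le (b := |B|) ((pi_norm_le_iff_of_nonneg (abs_nonneg _)).2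
          fun j => (hB _).trans (le_abs_self B))
      refine ContinuousMultilinearMap.opNorm_le_bound (by positivity) fun m => ?_
      rw [ContinuousMultilinearMap.smulRight_apply, norm_smul]
      have h3 : ‖((ContinuousMultilinearMap.mkPiAlgebra ℂ (Fin n) ℂ).compContinuousLinearMap
          fun j => l (s j)) m‖ ≤ |A| ^ n * ∏ j, ‖m j‖ := by
        simp only [ContinuousMultilinearMap.compContinuousLinearMap_apply,
          ContinuousMultilinearMap.mkPiAlgebra_apply, norm_prod]
        have : |A| ^ n * ∏ j, ‖m j‖ = ∏ j, (|A| * ‖m j‖) := by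
          rw [Finset.prod_mul_distrib]; simp
        rw [this]
        refine Finset.prod_le_prod (fun _ _ => norm_nonneg _) fun j _ => ?_
        exact (l (s j)).le_of_opNorm_le ((hA _).trans (le_abs_self A)) _
      calc _ ≤ (|A| ^ n * ∏ j, ‖m j‖) * (‖p n‖ * |B| ^ n) := by gcongr
        _ = _ := by rw [mul_pow]; ring
    refine (norm_sum_le _ _).trans ((Finset.sum_le_sum fun s _ => h1 s).trans_eq ?_)
    simp [mul_pow]; ring
  have hqr : 0 < q.radius := by
    obtain ⟨r, hr0, hr⟩ := ENNReal.lt_iff_exists_nnreal_btwn.1 (hp.r_pos.trans_le hp.r_le)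
    obtain ⟨C, hC, hCb⟩ := p.norm_mul_pow_le_of_lt_radius hr
    let D : NNReal := ⟨N * |A| * |B| + 1, by positivity⟩
    have hD : (0 : ℝ) < D := by change (0 : ℝ) < N * |A| * |B| + 1; positivity
    have hr0' : (0 : ℝ) < r := by exact_mod_cast hr0
    refine lt_of_lt_of_le ?_ (q.le_radius_of_bound (r := r / D) C fun n => ?_)
    · have h : (0 : NNReal) < r / D := by
        rw [← NNReal.coe_pos, NNReal.coe_div]; positivity
      exact_mod_cast h
    · refine le_trans ?_ (hCb n)
      have h5 : (N * |A| * |B|) ^ n ≤ (D : ℝ) ^ n :=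
        pow_le_pow_left₀ (by positivity) (by change _ ≤ N * |A| * |B| + 1; linarith) n
      calc ‖q n‖ * ((r / D : NNReal) : ℝ) ^ n ≤ (‖p n‖ * (D : ℝ) ^ n) * ((r / D : NNReal) : ℝ) ^ n := by
            gcongr; exact (hqn n).trans (by gcongr)
        _ = ‖p n‖ * (r : ℝ) ^ n := by
            rw [NNReal.coe_div, div_pow]; field_simp
  refine ⟨fun z => q.sum (z - inc x), ?_, ?_⟩
  · have h := (q.hasFPowerSeriesOnBall hqr).comp_sub (inc x)
    rw [zero_add] at h
    exact h.analyticAt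
  · have hcont : ContinuousAt (fun y : E => (inc y - inc x : EC)) x :=
      (isometry_inc.continuous.sub continuous_const).continuousAt
    filter_upwards [Metric.eball_mem_nhds x hp.r_pos,
      hcont.preimage_mem_nhds (Metric.eball_mem_nhds _ (ε := q.radius) hqr)] with y hy1 hy2
    have h1 := hp.hasSum_sub hy1
    have h2 := h1.map (inc : F →+ FC) isometry_inc.continuous
    have h3 := (q.hasFPowerSeriesOnBall hqr).hasSum (y := inc y - inc x) (by simpa using hy2)
    rw [zero_add] at h3
    refine h3.unique (h2.congr_fun fun n => ?_)
    rw [← map_sub, hq]; rfl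

/-- A holomorphic function is determined by its values at the real points. -/
theorem eqOn_of_eq_inc [CompleteSpace FC] {s : Set EC} (hs : IsOpen s) (hconv : Convex ℝ s)
    (hre : ∀ z ∈ s, (inc (re z : E) : EC) ∈ s) {g₁ g₂ : EC → FC} (h₁ : DifferentiableOn ℂ g₁ s)
    (h₂ : DifferentiableOn ℂ g₂ s) (h : ∀ y : E, inc y ∈ s → g₁ (inc y) = g₂ (inc y)) :
    EqOn g₁ g₂ s := by
  intro z hz
  -- This complex line takes real values at real parameters and passes through `z` at t = i. The
  -- preimage of a convex set is convex, hence connected, so the one-variable identity theorem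
  -- applies along it.
  let γ : ℂ → EC := fun t => inc (re z : E) + t • inc (im z : E)
  have hγ : Differentiable ℂ γ := by fun_prop
  let T : Set ℂ := γ ⁻¹' s
  have hTo : IsOpen T := hs.preimage hγ.continuous
  have hTc : Convex ℝ T := by
    intro a ha b hb u v hu hv huv
    have := hconv ha hb hu hv huv
    have e : u • γ a + v • γ b = γ (u • a + v • b) := by
      have huv' : (u : ℂ) + v = 1 := by exact_mod_cast huv
      simp only [γ, ← Complex.coe_smul, smul_eq_mul]
      linear_combination (norm := module) huv' • (inc (re z : E) : EC)
    rw [e] at this; exact this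
  have h0 : (0 : ℂ) ∈ T := by simpa [T, γ] using hre z hz
  have hI : Complex.I ∈ T := by simpa [T, γ, inc_re_add] using hz
  have ha : ∀ g : EC → FC, DifferentiableOn ℂ g s → AnalyticOnNhd ℂ (g ∘ γ) T := fun g hg =>
    DifferentiableOn.analyticOnNhd (hg.comp hγ.differentiableOn fun t ht => ht) hTo
  have hfr : ∃ᶠ t in 𝓝[≠] (0 : ℂ), (g₁ ∘ γ) t = (g₂ ∘ γ) t := by
    have ht : Tendsto (fun t : ℝ => (t : ℂ)) (𝓝[≠] 0) (𝓝[≠] 0) := by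
      refine tendsto_nhdsWithin_iff.2 ⟨?_, ?_⟩
      · exact (Complex.continuous_ofReal.tendsto' 0 0 (by simp)).mono_left nhdsWithin_le_nhds
      · filter_upwards [self_mem_nhdsWithin] with t ht
        simpa using ht
    refine ht.frequently (Eventually.frequently ?_)
    have : ∀ᶠ t : ℝ in 𝓝 0, (t : ℂ) ∈ T :=
      Complex.continuous_ofReal.continuousAt.preimage_mem_nhds (hTo.mem_nhds (by simpa using h0))
    filter_upwards [nhdsWithin_le_nhds this] with t ht
    have e : γ t = inc (re z + t • im z : E) := by simp [γ, inc_smul]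
    have ht' : γ t ∈ s := ht
    rw [e] at ht'
    simp only [Function.comp_apply, e]
    exact h _ ht'
  have := (ha g₁ h₁).eqOn_of_preconnected_of_frequently_eq (ha g₂ h₂) hTc.isPreconnected h0 hfr hI
  simpa [γ, inc_re_add] using this

lemma inc_re_mem_ball {x : E} {z : EC} {r : ℝ} (hz : z ∈ Metric.ball (inc x) r) :
    (inc (re z : E) : EC) ∈ Metric.ball (inc x) r := by
  rw [inc_mem_ball, Metric.mem_ball]
  have := dist_re_le (E := E) z (inc x)
  rw [re_inc] at this
  exact this.trans_lt hz

theorem eqOn_ball_of_eq_inc [CompleteSpace FC] {x : E} {r : ℝ} {g₁ g₂ : EC → FC}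
    (h₁ : DifferentiableOn ℂ g₁ (Metric.ball (inc x) r))
    (h₂ : DifferentiableOn ℂ g₂ (Metric.ball (inc x) r))
    (h : ∀ y ∈ Metric.ball x r, g₁ (inc y) = g₂ (inc y)) : EqOn g₁ g₂ (Metric.ball (inc x) r) :=
  eqOn_of_eq_inc (E := E) Metric.isOpen_ball (convex_ball _ _) (fun _ hz => inc_re_mem_ball hz) h₁ h₂
    fun y hy => h y (inc_mem_ball.1 hy)

/-- A real analytic function extends holomorphically to a uniform complex neighbourhood of a
compact set and of its translates by periods. -/
theorem exists_extension [FiniteDimensional ℝ E] [FiniteDimensional ℂ EC] [CompleteSpace FC]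
    {f : E → F} {K : Set E} (hK : IsCompact K) (hf : ∀ x ∈ K, AnalyticAt ℝ f x) {P : Set E}
    (hP : ∀ p ∈ P, ∀ x, f (x + p) = f x) :
    ∃ r > 0, ∃ M : ℝ, ∃ g : EC → FC, ∀ x ∈ K, ∀ p ∈ P,
      DifferentiableOn ℂ g (Metric.ball (inc (x + p)) r) ∧
      (∀ z ∈ Metric.ball (inc (x + p)) r, ‖g z‖ ≤ M) ∧
      ∀ y ∈ Metric.ball (x + p) r, g (inc y) = inc (f y) := by
  have hloc : ∃ r > 0, ∃ M : ℝ, ∀ x ∈ K, ∃ g : EC → FC,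
      DifferentiableOn ℂ g (Metric.ball (inc x) r) ∧
      (∀ z ∈ Metric.ball (inc x) r, ‖g z‖ ≤ M) ∧ ∀ y ∈ Metric.ball x r, g (inc y) = inc (f y) := by
    -- Compactness is used for a radius and a bound common to all centres; the extensions themselves
    -- may still depend on the centre.
    refine hK.induction_on (p := fun K => ∃ r > 0, ∃ M : ℝ, ∀ x ∈ K, ∃ g : EC → FC,
      DifferentiableOn ℂ g (Metric.ball (inc x) r) ∧
      (∀ z ∈ Metric.ball (inc x) r, ‖g z‖ ≤ M) ∧ ∀ y ∈ Metric.ball x r, g (inc y) = inc (f y))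
      ⟨1, one_pos, 0, by simp⟩ ?_ ?_ ?_
    · rintro s t hst ⟨r, hr, M, h⟩
      exact ⟨r, hr, M, fun x hx => h x (hst hx)⟩
    · rintro s t ⟨r, hr, M, h⟩ ⟨r', hr', M', h'⟩
      refine ⟨min r r', lt_min hr hr', max M M', ?_⟩
      rintro x (hx | hx)
      · obtain ⟨g, h1, h2, h3⟩ := h x hx
        exact ⟨g, h1.mono (Metric.ball_subset_ball (min_le_left _ _)),
          fun z hz => (h2 z (Metric.ball_subset_ball (min_le_left _ _) hz)).trans (le_max_left _ _),
          fun y hy => h3 y (Metric.ball_subset_ball (min_le_left _ _) hy)⟩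
      · obtain ⟨g, h1, h2, h3⟩ := h' x hx
        exact ⟨g, h1.mono (Metric.ball_subset_ball (min_le_right _ _)),
          fun z hz => (h2 z (Metric.ball_subset_ball (min_le_right _ _) hz)).trans (le_max_right _ _),
          fun y hy => h3 y (Metric.ball_subset_ball (min_le_right _ _) hy)⟩
    · intro x hx
      obtain ⟨g, hg, hgf⟩ := exists_analyticAt_inc_eq (EC := EC) (FC := FC) (hf x hx)
      obtain ⟨r₁, hr₁, h1⟩ := Metric.eventually_nhds_iff_ball.1 hg.eventually_analyticAt
      obtain ⟨r₂, hr₂, h2⟩ := Metric.eventually_nhds_iff_ball.1 hgf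
      obtain ⟨r₃, hr₃, h3⟩ := Metric.eventually_nhds_iff_ball.1
        (hg.continuousAt.norm.eventually_le_const (lt_add_one _))
      let r := min r₁ (min r₂ r₃) / 2
      have hr : 0 < r := by positivity
      have hr1 : r + r ≤ r₁ := by simp only [r, add_halves]; exact min_le_left _ _
      have hr2 : r + r ≤ r₂ := by
        simp only [r, add_halves]; exact (min_le_right _ _).trans (min_le_left _ _)
      have hr3 : r + r ≤ r₃ := by
        simp only [r, add_halves]; exact (min_le_right _ _).trans (min_le_right _ _)
      refine ⟨Metric.ball x r, mem_nhdsWithin_of_mem_nhds (Metric.ball_mem_nhds x hr), r, hr,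
        ‖g (inc x)‖ + 1, fun y hy => ⟨g, ?_, ?_, ?_⟩⟩
      all_goals rw [Metric.mem_ball] at hy
      · intro z hz
        refine (h1 z ?_).differentiableAt.differentiableWithinAt
        refine Metric.ball_subset_ball' ?_ hz
        rw [dist_inc]; linarith
      · intro z hz
        refine h3 z (Metric.ball_subset_ball' ?_ hz)
        rw [dist_inc]; linarith
      · intro z hz
        exact h2 z (Metric.ball_subset_ball' (by linarith) hz)
  obtain ⟨r, hr, M, h⟩ := hloc
  choose! G hG1 hG2 hG3 using h
  let D : EC → E × E → Prop := fun z w => w.1 ∈ K ∧ w.2 ∈ P ∧ z ∈ Metric.ball (inc (w.1 + w.2)) r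
  classical
  -- Glueing: any available local extension, translated by a period, is used. Two choices agree
  -- since the intersection of two balls with real centres is convex and stable under taking real
  -- parts, so that the identity theorem holds on it.
  let g : EC → FC := fun z => if h : ∃ w, D z w then G h.choose.1 (z - inc h.choose.2) else 0
  have hmem : ∀ (x p : E) (z : EC), z ∈ Metric.ball (inc (x + p)) r ↔
      z - inc p ∈ Metric.ball (inc x) r := by
    intro x p z
    simp only [Metric.mem_ball, dist_eq_norm, map_add]
    rw [sub_sub, add_comm (inc p)]
  have hd : ∀ x ∈ K, ∀ p ∈ P, DifferentiableOn ℂ (fun z => G x (z - inc p))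
      (Metric.ball (inc (x + p)) r) := fun x hx p hp =>
    (hG1 x hx).comp (by fun_prop) fun z hz => (hmem x p z).1 hz
  have hval : ∀ x ∈ K, ∀ p ∈ P, ∀ y : E, (inc y : EC) ∈ Metric.ball (inc (x + p)) r →
      G x (inc y - inc p) = inc (f y) := by
    intro x hx p hp y hy
    rw [← map_sub, hG3 x hx]
    · rw [← hP p hp (y - p), sub_add_cancel]
    · rw [hmem, ← map_sub, inc_mem_ball] at hy; exact hy
  have hg : ∀ x ∈ K, ∀ p ∈ P, EqOn g (fun z => G x (z - inc p)) (Metric.ball (inc (x + p)) r) := by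
    intro x hx p hp z hz
    have hex : ∃ w, D z w := ⟨(x, p), hx, hp, hz⟩
    simp only [g, dif_pos hex]
    obtain ⟨h1, h2, h3⟩ := hex.choose_spec
    refine eqOn_of_eq_inc (E := E) (s := Metric.ball (inc (hex.choose.1 + hex.choose.2)) r ∩
      Metric.ball (inc (x + p)) r) (Metric.isOpen_ball.inter Metric.isOpen_ball)
      ((convex_ball _ _).inter (convex_ball _ _))
      (fun z hz => ⟨inc_re_mem_ball hz.1, inc_re_mem_ball hz.2⟩)
      ((hd _ h1 _ h2).mono inter_subset_left) ((hd x hx p hp).mono inter_subset_right) ?_ ⟨h3, hz⟩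
    intro y hy
    rw [hval _ h1 _ h2 y hy.1, hval x hx p hp y hy.2]
  refine ⟨r, hr, M, g, fun x hx p hp => ⟨(hd x hx p hp).congr (hg x hx p hp), ?_, ?_⟩⟩
  · intro z hz
    rw [hg x hx p hp hz]
    exact hG2 x hx _ ((hmem x p z).1 hz)
  · intro y hy
    have hy' := inc_mem_ball (EC := EC).2 hy
    rw [hg x hx p hp hy']
    exact hval x hx p hp y hy'

end RealForm

end RealForm

/-! ### Functions on the torus and periodic functions on its universal cover -/

section TorusBasics

variable {d : ℕ}

lemma toTorus_add (v w : Fin d → ℝ) : toTorus (v + w) = toTorus v + toTorus w := by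
  ext i; simp [toTorus]

lemma isOpenQuotientMap_toTorus : IsOpenQuotientMap (toTorus (d := d)) :=
  IsOpenQuotientMap.piMap fun _ => QuotientAddGroup.isOpenQuotientMap_mk

lemma toTorus_eq_iff {v w : Fin d → ℝ} :
    toTorus v = toTorus w ↔ ∃ n : Fin d → ℤ, w = v + fun i => (n i : ℝ) := by
  constructor
  · intro h
    have h1 : ∀ i, ∃ k : ℤ, w i = v i + k := by
      intro i
      have h2 : (v i : UnitAddCircle) = (w i : UnitAddCircle) := congrFun h i
      obtain ⟨k, hk⟩ := AddSubgroup.mem_zmultiples_iff.1 (QuotientAddGroup.eq.1 h2)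
      exact ⟨k, by rw [zsmul_one] at hk; linarith⟩
    choose n hn using h1
    exact ⟨n, funext hn⟩
  · rintro ⟨n, rfl⟩
    ext i
    simp [toTorus]

/-- A section of the projection onto the torus. -/
noncomputable def torusLift : Torus d → Fin d → ℝ :=
  Function.surjInv isOpenQuotientMap_toTorus.surjective

@[simp] lemma toTorus_torusLift (θ : Torus d) : toTorus (torusLift θ) = θ :=
  Function.surjInv_eq _ θ

/-- Functions on `ℝ^d × Y` that are `ℤ^d`-periodic in the first variable. -/
def TorusPeriodic {Y α : Type*} (f : (Fin d → ℝ) × Y → α) : Prop :=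
  ∀ (n : Fin d → ℤ) (v : Fin d → ℝ) (y : Y), f ((v + fun i => (n i : ℝ)), y) = f (v, y)

lemma eq_of_toTorus_eq {α : Type*} {f : (Fin d → ℝ) → α}
    (hf : ∀ (n : Fin d → ℤ) v, f (v + fun i => (n i : ℝ)) = f v) {v w : Fin d → ℝ}
    (h : toTorus v = toTorus w) : f v = f w := by
  obtain ⟨n, rfl⟩ := toTorus_eq_iff.1 h
  exact (hf n v).symm

/-- The section of the projection is an arbitrary choice, but on a periodic function it only
expresses passage to the quotient, so continuity is read off from the quotient map. -/
lemma continuous_comp_torusLift {α : Type*} [TopologicalSpace α] {f : (Fin d → ℝ) → α}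
    (hf : ∀ (n : Fin d → ℤ) v, f (v + fun i => (n i : ℝ)) = f v) (hc : Continuous f) :
    Continuous (fun θ : Torus d => f (torusLift θ)) := by
  refine isOpenQuotientMap_toTorus.isQuotientMap.continuous_iff.2 (hc.congr fun v => ?_)
  exact eq_of_toTorus_eq hf (by simp)

lemma exists_add_int (v : Fin d → ℝ) : ∃ x ∈ Icc (0 : Fin d → ℝ) 1, ∃ n : Fin d → ℤ,
    v = x + fun i => (n i : ℝ) :=
  ⟨fun i => Int.fract (v i), ⟨fun _ => Int.fract_nonneg _, fun _ => (Int.fract_lt_one _).le⟩,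
    fun i => ⌊v i⌋, funext fun i => (Int.fract_add_floor (v i)).symm⟩

instance : IsProbabilityMeasure (volume : Measure (Torus d)) := by
  have : IsProbabilityMeasure (volume : Measure UnitAddCircle) := ⟨by simp⟩
  infer_instance

lemma integral_torusLift_add {E : Type*} [NormedAddCommGroup E] [NormedSpace ℝ E]
    {f : (Fin d → ℝ) → E} (hf : ∀ (n : Fin d → ℤ) v, f (v + fun i => (n i : ℝ)) = f v)
    (w : Fin d → ℝ) : ∫ θ : Torus d, f (torusLift θ + w) = ∫ θ : Torus d, f (torusLift θ) := by
  rw [← integral_add_right_eq_self (μ := (volume : Measure (Torus d)))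
    (fun θ : Torus d => f (torusLift θ)) (toTorus w)]
  refine integral_congr_ae (.of_forall fun θ => ?_)
  exact eq_of_toTorus_eq hf (by simp [toTorus_add])

lemma mFourierCoeff_eq_integral_volume (f : Torus d → ℂ) (n : Fin d → ℤ) :
    UnitAddTorus.mFourierCoeff f n = ∫ θ : Torus d, UnitAddTorus.mFourier (-n) θ * f θ := by
  have h : (AddCircle.haarAddCircle : Measure (AddCircle (1 : ℝ))) = volume := by
    rw [AddCircle.volume_eq_smul_haarAddCircle]; simp
  change ∫ θ, UnitAddTorus.mFourier (-n) θ • f θ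
    ∂(Measure.pi fun _ => (AddCircle.haarAddCircle : Measure (AddCircle (1 : ℝ)))) = _
  rw [h]; rfl

end TorusBasics

/-! ### Characters, exponential sums and small divisors -/

section Characters

variable {d : ℕ}

/-- The character `exp (2 π i n · z)`, on `ℂ^d`. -/
noncomputable def torusChar (n : Fin d → ℤ) (z : Fin d → ℂ) : ℂ :=
  Complex.exp (2 * Real.pi * Complex.I * ∑ i, n i * z i)

lemma mFourier_toTorus (n : Fin d → ℤ) (v : Fin d → ℝ) :
    UnitAddTorus.mFourier n (toTorus v) = torusChar n (RealForm.inc v) := by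
  have h1 : UnitAddTorus.mFourier n (toTorus v) = ∏ i, fourier (n i) ((v i : ℝ) : UnitAddCircle) := rfl
  have h2 : (RealForm.inc v : Fin d → ℂ) = fun i => (v i : ℂ) := rfl
  rw [h1, torusChar, h2, Finset.mul_sum, Complex.exp_sum]
  refine Finset.prod_congr rfl fun i _ => ?_
  rw [fourier_coe_apply]
  congr 1
  simp; ring

lemma differentiable_torusChar (n : Fin d → ℤ) : Differentiable ℂ (torusChar n) := by
  unfold torusChar; fun_prop

lemma torusChar_add (n : Fin d → ℤ) (z w : Fin d → ℂ) :
    torusChar n (z + w) = torusChar n z * torusChar n w := by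
  simp only [torusChar, ← Complex.exp_add, ← mul_add, ← Finset.sum_add_distrib, Pi.add_apply]

lemma norm_torusChar (n : Fin d → ℤ) (z : Fin d → ℂ) :
    ‖torusChar n z‖ = Real.exp (-(2 * Real.pi * ∑ i, n i * (z i).im)) := by
  rw [torusChar, Complex.norm_exp]
  congr 1
  have h : (∑ i, (n i : ℂ) * z i).im = ∑ i, n i * (z i).im := by
    rw [Complex.im_sum]; exact Finset.sum_congr rfl fun i _ => by simp
  rw [show (2 * Real.pi * Complex.I * ∑ i, (n i : ℂ) * z i) =
    ((2 * Real.pi : ℝ) : ℂ) * (Complex.I * ∑ i, (n i : ℂ) * z i) by push_cast; ring,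
    Complex.re_ofReal_mul, Complex.I_mul_re, h]
  ring

/-- The `ℓ¹` norm of an integer vector. -/
def l1norm (n : Fin d → ℤ) : ℝ := ∑ i, |(n i : ℝ)|

lemma norm_torusChar_le (n : Fin d → ℤ) {z : Fin d → ℂ} {r : ℝ} (hz : ∀ i, |(z i).im| ≤ r) :
    ‖torusChar n z‖ ≤ Real.exp (2 * Real.pi * (r * l1norm n)) := by
  rw [norm_torusChar, Real.exp_le_exp, ← mul_neg]
  refine mul_le_mul_of_nonneg_left ?_ (by positivity)
  rw [← Finset.sum_neg_distrib, l1norm, Finset.mul_sum]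
  refine Finset.sum_le_sum fun i _ => (neg_le_abs _).trans ?_
  rw [abs_mul, mul_comm]
  exact mul_le_mul_of_nonneg_right (hz i) (abs_nonneg _)

lemma torusChar_inc_add_int (n k : Fin d → ℤ) (z : Fin d → ℂ) :
    torusChar n (z + RealForm.inc fun i => (k i : ℝ)) = torusChar n z := by
  rw [torusChar_add]
  have h : torusChar n (RealForm.inc fun i => (k i : ℝ)) = 1 := by
    rw [← mFourier_toTorus]
    have h0 : toTorus (fun i => (k i : ℝ)) = toTorus (0 : Fin d → ℝ) :=
      toTorus_eq_iff.2 ⟨-k, by ext i; simp⟩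
    rw [h0, mFourier_toTorus]
    simp [torusChar]
  rw [h, mul_one]

lemma summable_exp_l1norm {a : ℝ} (ha : 0 < a) : ∀ d : ℕ,
    Summable fun n : Fin d → ℤ => Real.exp (-(a * l1norm n))
  | 0 => Summable.of_finite
  | d + 1 => by
    have h1 : Summable fun n : ℤ => Real.exp (-(a * |(n : ℝ)|)) := by
      have h : Summable fun n : ℕ => Real.exp (-(a * n)) := by
        have := Real.summable_exp_nat_mul_iff.2 (neg_lt_zero.2 ha)
        refine this.congr fun n => ?_
        congr 1; ring
      refine Summable.of_nat_of_neg (h.congr fun n => ?_) (h.congr fun n => ?_) <;> simp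
    have h2 := h1.mul_of_nonneg (summable_exp_l1norm ha d) (fun _ => (Real.exp_pos _).le)
      fun _ => (Real.exp_pos _).le
    refine ((Fin.consEquiv (fun _ => ℤ)).summable_iff).1 (h2.congr fun x => ?_)
    simp only [Function.comp_apply, Fin.consEquiv, Equiv.coe_fn_mk, l1norm, Fin.sum_univ_succ,
      Fin.cons_zero, Fin.cons_succ]
    rw [← Real.exp_add]; congr 1; ring

/-- Half of the exponential decay pays for the power. The power will be the small divisor, and the
other half keeps the Fourier series summable. -/
lemma pow_mul_exp_neg_le {a : ℝ} (ha : 0 < a) (T : ℕ) {x : ℝ} (hx : 0 ≤ x) :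
    x ^ T * Real.exp (-(2 * a * x)) ≤ (T.factorial / a ^ T) * Real.exp (-(a * x)) := by
  have h := Real.pow_div_factorial_le_exp (x := a * x) (by positivity) T
  rw [div_le_iff₀ (by positivity), mul_pow] at h
  have h2 : Real.exp (-(2 * a * x)) = Real.exp (-(a * x)) * Real.exp (-(a * x)) := by
    rw [← Real.exp_add]; congr 1; ring
  have h3 : Real.exp (a * x) * Real.exp (-(a * x)) = 1 := by
    rw [← Real.exp_add]; simp
  rw [h2, ← mul_assoc]
  refine mul_le_mul_of_nonneg_right ?_ (Real.exp_pos _).le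
  rw [le_div_iff₀ (by positivity)]
  calc _ = (a ^ T * x ^ T) * Real.exp (-(a * x)) := by ring
    _ ≤ (Real.exp (a * x) * T.factorial) * Real.exp (-(a * x)) := by gcongr
    _ = T.factorial := by rw [mul_right_comm, h3, one_mul]

lemma one_le_l1norm {n : Fin d → ℤ} (hn : n ≠ 0) : 1 ≤ l1norm n := by
  obtain ⟨i, hi⟩ := Function.ne_iff.1 hn
  have h1 : (1 : ℝ) ≤ |(n i : ℝ)| := by
    rw [← Int.cast_abs]; exact_mod_cast Int.one_le_abs hi
  exact h1.trans (Finset.single_le_sum (f := fun i => |(n i : ℝ)|) (fun _ _ => abs_nonneg _)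
    (Finset.mem_univ i))

/-- With y the signed distance from x to the nearest integer, the left-over modulus is 2 |sin π y|,
and Jordan's inequality on |π y| ≤ π / 2 gives |sin π y| ≥ 2 |y|. -/
lemma norm_exp_two_pi_sub_one_ge (x : ℝ) :
    4 * |x - round x| ≤ ‖Complex.exp (2 * Real.pi * Complex.I * x) - 1‖ := by
  set y := x - round x
  have h1 : Complex.exp (2 * Real.pi * Complex.I * x) =
      Complex.exp (Complex.I * ((2 * Real.pi * y : ℝ) : ℂ)) := by
    rw [Complex.exp_eq_exp_iff_exists_int]
    exact ⟨round x, by simp only [y]; push_cast; ring⟩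
  have hy : |y| ≤ 1 / 2 := abs_sub_round x
  rw [h1, Complex.norm_exp_I_mul_ofReal_sub_one, norm_mul, Real.norm_eq_abs, Real.norm_eq_abs,
    abs_two, show 2 * Real.pi * y / 2 = Real.pi * y by ring]
  have h2 := Real.mul_abs_le_abs_sin (x := Real.pi * y) (by
    rw [abs_mul, abs_of_pos Real.pi_pos]; nlinarith [Real.pi_pos])
  rw [abs_mul, abs_of_pos Real.pi_pos, ← mul_assoc, div_mul_cancel₀ _ Real.pi_ne_zero] at h2
  linarith

/-- The small divisors of a Diophantine vector. -/
lemma IsDiophantine.exists_divisor_bound {ω : Fin d → ℝ} (hω : IsDiophantine ω) :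
    ∃ C : ℝ, 0 < C ∧ ∃ T : ℕ, ∀ n : Fin d → ℤ, n ≠ 0 →
      ‖(torusChar n (RealForm.inc ω) - 1)⁻¹‖ ≤ C * l1norm n ^ T ∧
        torusChar n (RealForm.inc ω) - 1 ≠ 0 := by
  obtain ⟨C, hC, τ, hτ, h⟩ := hω
  -- The factor 4 is the one of `norm_exp_two_pi_sub_one_ge`. Rounding τ up to a natural exponent is
  -- harmless because |n| ≥ 1.
  refine ⟨(4 * C)⁻¹, by positivity, ⌈τ⌉₊, fun n hn => ?_⟩
  have hN := one_le_l1norm hn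
  have h1 := norm_exp_two_pi_sub_one_ge (∑ i, ω i * n i)
  have h2 := h n hn (round (∑ i, ω i * (n i : ℝ)))
  have h3 : Complex.exp (2 * Real.pi * Complex.I * ((∑ i, ω i * n i : ℝ) : ℂ)) =
      torusChar n (RealForm.inc ω) := by
    have : (RealForm.inc ω : Fin d → ℂ) = fun i => (ω i : ℂ) := rfl
    rw [torusChar, this]; push_cast; simp only [mul_comm]
  rw [h3] at h1
  have h4 : 0 < C * l1norm n ^ (-τ) := by positivity
  have h5 : 4 * (C * l1norm n ^ (-τ)) ≤ ‖torusChar n (RealForm.inc ω) - 1‖ :=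
    (mul_le_mul_of_nonneg_left h2 (by norm_num)).trans h1
  refine ⟨?_, fun h0 => ?_⟩
  · rw [norm_inv]
    refine (inv_anti₀ (by positivity) h5).trans ?_
    rw [← mul_assoc, mul_inv, Real.rpow_neg (by positivity), inv_inv]
    refine mul_le_mul_of_nonneg_left ?_ (by positivity)
    rw [← Real.rpow_natCast]
    exact Real.rpow_le_rpow_of_exponent_le hN (Nat.le_ceil τ)
  · rw [h0, norm_zero] at h5; linarith

end Characters

section

open RealForm

/-! ### Extension to a complex strip and decay of Fourier coefficients -/

section Strip

variable {d m : ℕ}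

/-- The complex strip of width `r` over `ℝ^d`, times a complex ball around `lam₀`. -/
def torusStrip (d : ℕ) (lam₀ : Fin m → ℝ) (r : ℝ) : Set ((Fin d → ℂ) × (Fin m → ℂ)) :=
  {q | ‖(im q.1 : Fin d → ℝ)‖ < r ∧ q.2 ∈ Metric.ball (inc lam₀) r}

lemma continuous_im : Continuous (im : (Fin d → ℂ) → (Fin d → ℝ)) :=
  continuous_pi fun i => Complex.continuous_im.comp (continuous_apply i)

lemma isOpen_torusStrip (lam₀ : Fin m → ℝ) (r : ℝ) : IsOpen (torusStrip d lam₀ r) :=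
  (isOpen_lt (continuous_im.comp continuous_fst).norm continuous_const).inter
    (Metric.isOpen_ball.preimage continuous_snd)

/-- The nearest real point is the real part, an integer translate of a point of the unit cube. Thus
the uniform extension over a compact cube and its translates covers the whole strip. -/
lemma exists_mem_ball_of_mem_torusStrip {lam₀ : Fin m → ℝ} {r : ℝ}
    {q : (Fin d → ℂ) × (Fin m → ℂ)} (hq : q ∈ torusStrip d lam₀ r) :
    ∃ x ∈ Icc (0 : Fin d → ℝ) 1, ∃ n : Fin d → ℤ,
      q ∈ Metric.ball (inc ((x, lam₀) + ((fun i => (n i : ℝ)), (0 : Fin m → ℝ)))) r := by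
  obtain ⟨x, hx, n, hn⟩ := exists_add_int (re q.1 : Fin d → ℝ)
  refine ⟨x, hx, n, ?_⟩
  rw [Prod.mk_add_mk, add_zero, ← hn]
  have h : inc (((re q.1 : Fin d → ℝ), lam₀)) = ((inc (re q.1 : Fin d → ℝ), inc lam₀) :
    (Fin d → ℂ) × (Fin m → ℂ)) := rfl
  rw [h, Metric.mem_ball, Prod.dist_eq, max_lt_iff]
  refine ⟨?_, hq.2⟩
  have h2 : q.1 - inc (re q.1 : Fin d → ℝ) = Complex.I • inc (im q.1 : Fin d → ℝ) := by
    conv_lhs => rw [← inc_re_add (E := Fin d → ℝ) q.1, map_add, re_inc]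
    have : (re (Complex.I • (inc (im q.1 : Fin d → ℝ) : Fin d → ℂ)) : Fin d → ℝ) = 0 := by
      rw [re_I_smul, im_inc, neg_zero]
    rw [this]; simp
  rw [dist_eq_norm, h2, norm_smul, Complex.norm_I, one_mul, norm_inc]
  exact hq.1

/-- Periodic real analytic functions extend to a complex strip. -/
theorem exists_torusStrip_extension {h : (Fin d → ℝ) × (Fin m → ℝ) → ℝ} (hp : TorusPeriodic h)
    {lam₀ : Fin m → ℝ} (ha : ∀ v, AnalyticAt ℝ h (v, lam₀)) :
    ∃ r > 0, ∃ M : ℝ, ∃ H : (Fin d → ℂ) × (Fin m → ℂ) → ℂ,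
      DifferentiableOn ℂ H (torusStrip d lam₀ r) ∧ (∀ q ∈ torusStrip d lam₀ r, ‖H q‖ ≤ M) ∧
      (∀ v, ∀ lam ∈ Metric.ball lam₀ r, H (inc v, inc lam) = (h (v, lam) : ℂ)) ∧
      ∀ (n : Fin d → ℤ), ∀ q ∈ torusStrip d lam₀ r, H (q.1 + inc (fun i => (n i : ℝ)), q.2) = H q := by
  let K : Set ((Fin d → ℝ) × (Fin m → ℝ)) := Icc 0 1 ×ˢ {lam₀}
  have hK : IsCompact K := isCompact_Icc.prod isCompact_singleton
  let P : Set ((Fin d → ℝ) × (Fin m → ℝ)) := range fun n : Fin d → ℤ => ((fun i => (n i : ℝ)), 0)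
  have hP : ∀ p ∈ P, ∀ x, h (x + p) = h x := by
    rintro _ ⟨n, rfl⟩ ⟨v, lam⟩
    rw [Prod.mk_add_mk, add_zero]; exact hp n v lam
  obtain ⟨r, hr, M, H, hH⟩ := exists_extension hK (by rintro ⟨x, l⟩ ⟨hx, rfl⟩; exact ha x) hP
  have hd : DifferentiableOn ℂ H (torusStrip d lam₀ r) := by
    intro q hq
    obtain ⟨x, hx, n, hn⟩ := exists_mem_ball_of_mem_torusStrip hq
    exact ((hH (x, lam₀) ⟨hx, rfl⟩ _ ⟨n, rfl⟩).1.differentiableAt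
      (Metric.isOpen_ball.mem_nhds hn)).differentiableWithinAt
  have hreal : ∀ v, ∀ lam ∈ Metric.ball lam₀ r, H (inc v, inc lam) = (h (v, lam) : ℂ) := by
    intro v lam hl
    obtain ⟨x, hx, n, hn⟩ := exists_add_int v
    refine (hH (x, lam₀) ⟨hx, rfl⟩ _ ⟨n, rfl⟩).2.2 (v, lam) ?_
    rw [Prod.mk_add_mk, add_zero, ← hn, Metric.mem_ball, Prod.dist_eq, dist_self]
    exact max_lt hr hl
  refine ⟨r, hr, M, H, hd, ?_, hreal, ?_⟩
  · intro q hq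
    obtain ⟨x, hx, n, hn⟩ := exists_mem_ball_of_mem_torusStrip hq
    exact (hH (x, lam₀) ⟨hx, rfl⟩ _ ⟨n, rfl⟩).2.1 q hn
  · intro n q hq
    have hshift : ∀ q ∈ torusStrip d lam₀ r,
        ((q.1 + inc (fun i => (n i : ℝ)), q.2) : (Fin d → ℂ) × (Fin m → ℂ)) ∈ torusStrip d lam₀ r :=
      fun q hq => ⟨by rw [map_add, im_inc, add_zero]; exact hq.1, hq.2⟩
    -- Periodicity holds at real points and passes to the strip, which is convex and stable under
    -- real parts, by the identity theorem.
    refine eqOn_of_eq_inc (E := (Fin d → ℝ) × (Fin m → ℝ)) (isOpen_torusStrip lam₀ r) ?_ ?_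
      (g₁ := fun q : (Fin d → ℂ) × (Fin m → ℂ) => H (q.1 + inc (fun i => (n i : ℝ)), q.2))
      (hd.comp (by fun_prop) hshift) hd ?_ hq
    · refine Convex.inter ?_ ?_
      · have : Convex ℝ {z : (Fin d → ℂ) | ‖(im z : Fin d → ℝ)‖ < r} := by
          have h1 : {z : (Fin d → ℂ) | ‖(im z : Fin d → ℝ)‖ < r} =
              (({ toFun := im, map_add' := map_add _, map_smul' := fun c z => by
                    rw [← Complex.coe_smul, im_smul]; rfl } : (Fin d → ℂ) →ₗ[ℝ] (Fin d → ℝ)) ⁻¹'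
                Metric.ball 0 r) := by
            ext z; simp
          rw [h1]
          exact (convex_ball _ _).linear_preimage _
        exact this.linear_preimage (LinearMap.fst ℝ _ _)
      · exact (convex_ball _ _).linear_preimage (LinearMap.snd ℝ _ _)
    · intro z hz
      refine ⟨?_, inc_re_mem_ball hz.2⟩
      change ‖(im (inc (re z.1 : Fin d → ℝ) : Fin d → ℂ) : Fin d → ℝ)‖ < r
      rw [im_inc, norm_zero]; exact hr
    · rintro ⟨v, lam⟩ hy
      have hl : lam ∈ Metric.ball lam₀ r := inc_mem_ball.1 hy.2
      have h1 := hreal (v + fun i => (n i : ℝ)) lam hl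
      rw [hp n v lam, ← hreal v lam hl] at h1
      rw [map_add] at h1
      exact h1

variable {lam₀ : Fin m → ℝ} {r M : ℝ} {H : (Fin d → ℂ) × (Fin m → ℂ) → ℂ}

/-- The Fourier coefficients of a function on the strip. -/
noncomputable def stripCoeff (H : (Fin d → ℂ) × (Fin m → ℂ) → ℂ) (n : Fin d → ℤ)
    (l : Fin m → ℂ) : ℂ :=
  ∫ θ : Torus d, torusChar (-n) (inc (torusLift θ)) * H (inc (torusLift θ), l)

lemma mem_torusStrip_inc_add {z : Fin d → ℂ} {l : Fin m → ℂ} (h : (z, l) ∈ torusStrip d lam₀ r)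
    (v : Fin d → ℝ) : (inc v + z, l) ∈ torusStrip d lam₀ r :=
  ⟨by rw [map_add, im_inc, zero_add]; exact h.1, h.2⟩

lemma mem_torusStrip_inc {l : Fin m → ℂ} (hl : l ∈ Metric.ball (inc lam₀) r) (v : Fin d → ℝ) :
    (inc v, l) ∈ torusStrip d lam₀ r :=
  ⟨by simp only [im_inc, norm_zero]; exact Metric.nonempty_ball.1 ⟨l, hl⟩, hl⟩

lemma strip_integrand_periodic
    (hper : ∀ (n : Fin d → ℤ), ∀ q ∈ torusStrip d lam₀ r, H (q.1 + inc (fun i => (n i : ℝ)), q.2) = H q)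
    {l : Fin m → ℂ} {z : Fin d → ℂ} (hz : (z, l) ∈ torusStrip d lam₀ r) (n : Fin d → ℤ)
    (k : Fin d → ℤ) (v : Fin d → ℝ) :
    torusChar n (inc (v + fun i => (k i : ℝ)) + z) * H (inc (v + fun i => (k i : ℝ)) + z, l) =
      torusChar n (inc v + z) * H (inc v + z, l) := by
  rw [map_add, add_right_comm, torusChar_inc_add_int, hper k (inc v + z, l)
    (mem_torusStrip_inc_add hz v)]

lemma continuous_strip_integrand (hd : DifferentiableOn ℂ H (torusStrip d lam₀ r))
    {l : Fin m → ℂ} {z : Fin d → ℂ} (hz : (z, l) ∈ torusStrip d lam₀ r) (n : Fin d → ℤ) :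
    Continuous fun v : Fin d → ℝ => torusChar n (inc v + z) * H (inc v + z, l) := by
  have h1 : Continuous fun v : Fin d → ℝ => (inc v + z : Fin d → ℂ) :=
    isometry_inc.continuous.add continuous_const
  refine ((differentiable_torusChar n).continuous.comp h1).mul ?_
  exact hd.continuousOn.comp_continuous (h1.prodMk continuous_const)
    fun v => mem_torusStrip_inc_add hz v

lemma gateauxOn_stripCoeff (hd : DifferentiableOn ℂ H (torusStrip d lam₀ r))
    (hb : ∀ q ∈ torusStrip d lam₀ r, ‖H q‖ ≤ M)
    (hper : ∀ (n : Fin d → ℤ), ∀ q ∈ torusStrip d lam₀ r, H (q.1 + inc (fun i => (n i : ℝ)), q.2) = H q)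
    (n : Fin d → ℤ) : GateauxOn (stripCoeff H n) (Metric.ball (inc lam₀) r) := by
  refine GateauxOn.integral (M := M) Metric.isOpen_ball (fun θ => ?_) (fun l hl => ?_)
    fun θ l hl => ?_
  · refine DifferentiableOn.gateauxOn Metric.isOpen_ball (DifferentiableOn.const_mul ?_ _)
    exact hd.comp (by fun_prop) fun l hl => mem_torusStrip_inc hl _
  · have h1 : (((0 : Fin d → ℂ)), l) ∈ torusStrip d lam₀ r := by
      simpa using mem_torusStrip_inc (d := d) hl 0
    have h2 := continuous_comp_torusLift (strip_integrand_periodic hper h1 (-n))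
      (continuous_strip_integrand hd h1 (-n))
    simp only [add_zero] at h2
    exact h2.aestronglyMeasurable
  · rw [norm_mul, norm_torusChar]
    have : (∑ i, ((-n) i : ℝ) * ((inc (torusLift θ) : Fin d → ℂ) i).im) = 0 :=
      Finset.sum_eq_zero fun i _ => by
        have : ((inc (torusLift θ) : Fin d → ℂ) i).im = 0 := Complex.ofReal_im _
        rw [this, mul_zero]
    rw [this]
    simpa using hb _ (mem_torusStrip_inc hl _)

/-- Exponential decay of the Fourier coefficients, by a shift of the contour. -/
lemma norm_stripCoeff_le (hr : 0 < r) (hd : DifferentiableOn ℂ H (torusStrip d lam₀ r))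
    (hb : ∀ q ∈ torusStrip d lam₀ r, ‖H q‖ ≤ M)
    (hper : ∀ (n : Fin d → ℤ), ∀ q ∈ torusStrip d lam₀ r, H (q.1 + inc (fun i => (n i : ℝ)), q.2) = H q)
    (n : Fin d → ℤ) {l : Fin m → ℂ} (hl : l ∈ Metric.ball (inc lam₀) r) :
    ‖stripCoeff H n l‖ ≤ M * Real.exp (-(Real.pi * r * l1norm n)) := by
  -- The direction of the contour shift: n · w is the ℓ¹ norm of n, while |w i| ≤ 1 keeps the
  -- shifted contour inside the strip.
  let w : Fin d → ℝ := fun i => ((n i).sign : ℝ)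
  have hw : ∀ i, |w i| ≤ 1 := fun i => by
    simp only [w]
    rw [← Int.cast_abs]
    rcases lt_trichotomy (n i) 0 with h | h | h <;> simp [h, Int.sign_eq_neg_one_of_neg,
      Int.sign_eq_one_of_pos]
  have hwn : ‖w‖ ≤ 1 := (pi_norm_le_iff_of_nonneg zero_le_one).2 hw
  let S : Set ℂ := {t | |t.im| < r}
  have hSo : IsOpen S := isOpen_lt (continuous_abs.comp Complex.continuous_im) continuous_const
  have hSc : Convex ℝ S := by
    have : S = Complex.imLm ⁻¹' Metric.ball 0 r := by ext; simp [S]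
    rw [this]; exact (convex_ball (0 : ℝ) r).linear_preimage Complex.imLm
  have him : ∀ t : ℂ, (im (t • (inc w : Fin d → ℂ)) : Fin d → ℝ) = t.im • w := by
    intro t
    ext i
    change (t * (w i : ℂ)).im = _
    simp
  have hmem : ∀ t ∈ S, (t • (inc w : Fin d → ℂ), l) ∈ torusStrip d lam₀ r := by
    intro t ht
    refine ⟨?_, hl⟩
    rw [him, norm_smul]
    exact (mul_le_of_le_one_right (norm_nonneg _) hwn).trans_lt ht
  let φ : ℂ → ℂ := fun t => ∫ θ : Torus d, torusChar (-n) (inc (torusLift θ) + t • inc w) *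
    H (inc (torusLift θ) + t • inc w, l)
  have hφb : ∀ (θ : Torus d), ∀ t ∈ S, ‖torusChar (-n) (inc (torusLift θ) + t • inc w) *
      H (inc (torusLift θ) + t • inc w, l)‖ ≤ Real.exp (2 * Real.pi * (t.im * l1norm n)) * M := by
    intro θ t ht
    rw [norm_mul]
    have h1 := hb _ (mem_torusStrip_inc_add (hmem t ht) (torusLift θ))
    have h2 : ‖torusChar (-n) (inc (torusLift θ) + t • inc w)‖ =
        Real.exp (2 * Real.pi * (t.im * l1norm n)) := by
      rw [norm_torusChar, ← mul_neg, l1norm]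
      refine congrArg (fun x => Real.exp (2 * Real.pi * x)) ?_
      rw [← Finset.sum_neg_distrib, Finset.mul_sum]
      refine Finset.sum_congr rfl fun i _ => ?_
      have h3 : ((inc (torusLift θ) + t • inc w : Fin d → ℂ) i).im = t.im * w i := by
        have h4 : (im (inc (torusLift θ) + t • inc w : Fin d → ℂ) : Fin d → ℝ) i = (t.im • w) i := by
          rw [map_add, im_inc, zero_add, him]
        exact h4
      rw [h3]
      simp only [Pi.neg_apply, Int.cast_neg, w, neg_mul, neg_neg]
      have h5 : (n i : ℝ) * ((n i).sign : ℝ) = |(n i : ℝ)| := by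
        rw [← Int.cast_abs, ← Int.cast_mul, Int.mul_sign_self, Int.abs_eq_natAbs]
      rw [← h5]; ring
    rw [h2]; gcongr
  have hφd : DifferentiableOn ℂ φ S := by
    intro t ht
    obtain ⟨ε, hε, hεS⟩ := Metric.isOpen_iff.1 hSo t ht
    have hM : 0 ≤ M := (norm_nonneg _).trans (hb _ (hmem t ht))
    refine (differentiableAt_integral_of_bounded (c := t) (r := ε)
      (M := Real.exp (2 * Real.pi * (r * l1norm n)) * M) hε ?_ ?_ ?_).differentiableWithinAt
    · intro s hs
      exact (continuous_comp_torusLift (strip_integrand_periodic hper (hmem s (hεS hs)) (-n))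
        (continuous_strip_integrand hd (hmem s (hεS hs)) (-n))).aestronglyMeasurable
    · intro θ
      refine DifferentiableOn.mul ?_ ?_
      · exact ((differentiable_torusChar (-n)).comp (by fun_prop)).differentiableOn
      · exact hd.comp (by fun_prop) fun s hs => mem_torusStrip_inc_add (hmem s (hεS hs)) _
    · intro θ s hs
      refine (hφb θ s (hεS hs)).trans ?_
      have h1 : s.im ≤ r := (le_abs_self _).trans (le_of_lt (hεS hs))
      have h2 : 0 ≤ l1norm n := Finset.sum_nonneg fun i _ => abs_nonneg _
      gcongr
  -- For real shifts this is translation invariance of the integral over the torus; the identity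
  -- theorem extends it to complex shifts.
  have hconst : EqOn φ (fun _ => stripCoeff H n l) S := by
    refine eqOn_of_eq_inc (E := ℝ) hSo hSc (fun z hz => ?_) hφd (differentiableOn_const _) ?_
    · change |((z.re : ℂ)).im| < r
      simpa using hr
    · intro y hy
      have h1 : (((0 : Fin d → ℂ)), l) ∈ torusStrip d lam₀ r := by
        simpa using mem_torusStrip_inc (d := d) hl 0
      have h2 := integral_torusLift_add (f := fun v => torusChar (-n) (inc v + 0) * H (inc v + 0, l))
        (strip_integrand_periodic hper h1 (-n)) (y • w)
      simp only [add_zero] at h2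
      simp only [φ, stripCoeff]
      rw [← h2]
      refine integral_congr_ae (.of_forall fun θ => ?_)
      have h3 : (inc (torusLift θ + y • w) : Fin d → ℂ) =
          inc (torusLift θ) + (inc y : ℂ) • inc w := by
        rw [map_add, inc_smul]; rfl
      simp only [h3]
  have him2 : (-(((r / 2 : ℝ) : ℂ) * Complex.I)).im = -(r / 2) := by
    rw [Complex.neg_im, Complex.im_ofReal_mul, Complex.I_im, mul_one]
  -- Evaluation at the shift -(r/2) i, where the character contributes exp(-π r |n|).
  have hI : -(((r / 2 : ℝ) : ℂ) * Complex.I) ∈ S := by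
    change |(-(((r / 2 : ℝ) : ℂ) * Complex.I)).im| < r
    rw [him2, abs_neg, abs_of_pos (by positivity)]
    linarith
  rw [show stripCoeff H n l = φ _ from (hconst hI).symm]
  refine (norm_integral_le_of_norm_le_const (.of_forall fun θ => hφb θ _ hI)).trans_eq ?_
  rw [him2]
  simp only [probReal_univ, mul_one]
  rw [mul_comm]; congr 2; ring

end Strip

/-! ### The cohomological equation over a Diophantine rotation -/

section SmallDivisors

variable {d m : ℕ}

lemma TorusPeriodic.continuous_comp_torusLift {Y X : Type*} [TopologicalSpace X]
    {h : (Fin d → ℝ) × Y → X} (hp : TorusPeriodic h) {y : Y} (hc : Continuous fun v => h (v, y)) :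
    Continuous (fun θ : Torus d => h (torusLift θ, y)) :=
  _root_.continuous_comp_torusLift (f := fun v => h (v, y)) (fun n v => hp n v y) hc

/-- The average of a periodic analytic function is analytic. -/
theorem analyticAt_torus_average {h : (Fin d → ℝ) × (Fin m → ℝ) → ℝ} (hp : TorusPeriodic h)
    {lam₀ : Fin m → ℝ} (ha : ∀ v, AnalyticAt ℝ h (v, lam₀)) :
    AnalyticAt ℝ (fun lam => ∫ θ : Torus d, h (torusLift θ, lam)) lam₀ := by
  obtain ⟨r, hr, M, H, hd, hb, hreal, hper⟩ := exists_torusStrip_extension hp ha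
  have hg := (gateauxOn_stripCoeff hd hb hper 0).analyticOnNhd Metric.isOpen_ball
    (fun l hl => norm_stripCoeff_le hr hd hb hper 0 hl)
  refine analyticAt_of_inc_eq (hg _ (Metric.mem_ball_self hr)) ?_
  filter_upwards [Metric.ball_mem_nhds lam₀ hr] with lam hlam
  rw [stripCoeff]
  change _ = ((∫ θ : Torus d, h (torusLift θ, lam) : ℝ) : ℂ)
  rw [← integral_complex_ofReal]
  refine integral_congr_ae (.of_forall fun θ => ?_)
  simp only [neg_zero, hreal _ lam hlam]
  simp [torusChar]

/-- Solution of the cohomological equation over a Diophantine rotation, for analytic periodic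
functions with zero average. -/
theorem exists_cohomological_solution {ω : Fin d → ℝ} (hω : IsDiophantine ω)
    {h : (Fin d → ℝ) × (Fin m → ℝ) → ℝ} (hp : TorusPeriodic h) {V : Set (Fin m → ℝ)}
    (ha : ∀ v, ∀ lam ∈ V, AnalyticAt ℝ h (v, lam))
    (havg : ∀ lam ∈ V, ∫ θ : Torus d, h (torusLift θ, lam) = 0) :
    ∃ ψ : (Fin d → ℝ) × (Fin m → ℝ) → ℝ, TorusPeriodic ψ ∧
      (∀ v, ∀ lam ∈ V, AnalyticAt ℝ ψ (v, lam)) ∧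
      ∀ v, ∀ lam ∈ V, ψ (v + ω, lam) - ψ (v, lam) = h (v, lam) := by
  obtain ⟨C, hC, T, hdiv⟩ := hω.exists_divisor_bound
  let hc : (Fin d → ℤ) → (Fin m → ℝ) → ℂ := fun n lam =>
    ∫ θ : Torus d, torusChar (-n) (inc (torusLift θ)) * (h (torusLift θ, lam) : ℂ)
  -- For n = 0 the convention 0⁻¹ = 0 drops the constant mode, which is consistent since the average
  -- of `h` vanishes.
  let D : (Fin d → ℤ) → ℂ := fun n => (torusChar n (inc ω) - 1)⁻¹
  let Ψ : (Fin d → ℝ) × (Fin m → ℝ) → ℂ := fun q =>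
    ∑' n, hc n q.2 * D n * torusChar n (inc q.1)
  have hD0 : D 0 = 0 := by simp [D, torusChar]
  -- The width of the strip depends on the parameter, so analyticity is local. The local extensions
  -- need no glueing because all of them restrict to the one Fourier series Ψ at real points.
  have hloc : ∀ lam₀ ∈ V, ∃ r > 0, ∃ ΨC : (Fin d → ℂ) × (Fin m → ℂ) → ℂ,
      AnalyticOnNhd ℂ ΨC (torusStrip d lam₀ r) ∧
      (∀ v : Fin d → ℝ, ∀ lam ∈ Metric.ball lam₀ r, ΨC (inc v, inc lam) = Ψ (v, lam)) ∧
      (∀ v : Fin d → ℝ, Summable fun n => hc n lam₀ * D n * torusChar n (inc v)) ∧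
      Summable fun n => hc n lam₀ := by
    intro lam₀ hlam₀
    obtain ⟨r, hr, M, H, hd, hb, hreal, hper⟩ :=
      exists_torusStrip_extension hp fun v => ha v lam₀ hlam₀
    have hM : 0 ≤ M := (norm_nonneg _).trans (hb _ (mem_torusStrip_inc (Metric.mem_ball_self hr) 0))
    have hcoef : ∀ n, ∀ lam ∈ Metric.ball lam₀ r, stripCoeff H n (inc lam) = hc n lam := by
      intro n lam hlam
      simp only [stripCoeff, hc, hreal _ lam hlam]
    -- On the strip of width r / 4 the decay exp(-π r |n|) of the coefficients meets the growth
    -- exp(π r |n| / 2) of the characters. What remains is exp(-2a |n|), half of which absorbs the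
    -- small divisor.
    let a := Real.pi * r / 4
    have hpos : 0 < a := by have := Real.pi_pos; positivity
    let K := M * C * (T.factorial / a ^ T)
    have hbound : ∀ n, ∀ q ∈ torusStrip d lam₀ (r / 4),
        ‖stripCoeff H n q.2 * D n * torusChar n q.1‖ ≤ K * Real.exp (-(a * l1norm n)) := by
      rintro n ⟨z, l⟩ ⟨hz, hl⟩
      by_cases hn : n = 0
      · subst hn
        rw [hD0]; simp only [mul_zero, zero_mul, norm_zero]; positivity
      have h1 := norm_stripCoeff_le hr hd hb hper n
        (Metric.ball_subset_ball (by linarith : r / 4 ≤ r) hl)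
      have h2 := (hdiv n hn).1
      have h3 : ‖torusChar n z‖ ≤ Real.exp (2 * Real.pi * (r / 4 * l1norm n)) :=
        norm_torusChar_le n fun i => ((norm_le_pi_norm (im z : Fin d → ℝ) i).trans_lt hz).le
      have h4 := pow_mul_exp_neg_le hpos T (zero_le_one.trans (one_le_l1norm hn))
      have h5 : Real.exp (-(Real.pi * r * l1norm n)) * Real.exp (2 * Real.pi * (r / 4 * l1norm n)) =
          Real.exp (-(2 * a * l1norm n)) := by
        rw [← Real.exp_add]; congr 1; simp only [a]; ring
      rw [norm_mul, norm_mul]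
      have h0 : 0 ≤ l1norm n := zero_le_one.trans (one_le_l1norm hn)
      calc _ ≤ M * Real.exp (-(Real.pi * r * l1norm n)) * (C * l1norm n ^ T) *
            Real.exp (2 * Real.pi * (r / 4 * l1norm n)) := by gcongr
        _ = M * C * (l1norm n ^ T * (Real.exp (-(Real.pi * r * l1norm n)) *
            Real.exp (2 * Real.pi * (r / 4 * l1norm n)))) := by ring
        _ ≤ M * C * ((T.factorial / a ^ T) * Real.exp (-(a * l1norm n))) := by
            rw [h5]; gcongr
        _ = _ := by ring
    have hsum : Summable fun n : Fin d → ℤ => K * Real.exp (-(a * l1norm n)) :=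
      (summable_exp_l1norm hpos d).mul_left K
    have hin : ∀ v : Fin d → ℝ, ∀ lam ∈ Metric.ball lam₀ (r / 4),
        ((inc v, inc lam) : (Fin d → ℂ) × (Fin m → ℂ)) ∈ torusStrip d lam₀ (r / 4) :=
      fun v lam hl => mem_torusStrip_inc (inc_mem_ball.2 hl) v
    have hr4 : Metric.ball lam₀ (r / 4) ⊆ Metric.ball lam₀ r :=
      Metric.ball_subset_ball (by linarith)
    have hself : lam₀ ∈ Metric.ball lam₀ (r / 4) := Metric.mem_ball_self (by positivity)
    refine ⟨r / 4, by positivity, fun q => ∑' n, stripCoeff H n q.2 * D n * torusChar n q.1,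
      ?_, ?_, ?_, ?_⟩
    · have hG : GateauxOn (fun q : (Fin d → ℂ) × (Fin m → ℂ) =>
          ∑' n, stripCoeff H n q.2 * D n * torusChar n q.1) (torusStrip d lam₀ (r / 4)) := by
        refine GateauxOn.tsum (isOpen_torusStrip _ _) (fun n => ?_) hbound hsum
        refine DifferentiableOn.gateauxOn (isOpen_torusStrip _ _) ?_
        have hs : DifferentiableOn ℂ (stripCoeff H n) (Metric.ball (inc lam₀) r) :=
          ((gateauxOn_stripCoeff hd hb hper n).analyticOnNhd Metric.isOpen_ball
            (fun l hl => norm_stripCoeff_le hr hd hb hper n hl)).differentiableOn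
        refine DifferentiableOn.mul (DifferentiableOn.mul_const ?_ _) ?_
        · exact hs.comp differentiable_snd.differentiableOn fun q hq =>
            Metric.ball_subset_ball (by linarith) hq.2
        · exact ((differentiable_torusChar n).comp differentiable_fst).differentiableOn
      exact hG.analyticOnNhd (isOpen_torusStrip _ _) (M := ∑' n, K * Real.exp (-(a * l1norm n)))
        fun q hq => tsum_of_norm_bounded hsum.hasSum fun n => hbound n q hq
    · intro v lam hl
      exact tsum_congr fun n => by rw [hcoef n lam (hr4 hl)]
    · intro v
      refine Summable.of_norm_bounded hsum fun n => ?_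
      rw [← hcoef n lam₀ (hr4 hself)]
      exact hbound n (inc v, inc lam₀) (hin v lam₀ hself)
    · refine Summable.of_norm_bounded
        ((summable_exp_l1norm (a := Real.pi * r) (by have := Real.pi_pos; positivity) d).mul_left M)
        fun n => ?_
      rw [← hcoef n lam₀ (hr4 hself)]
      exact norm_stripCoeff_le hr hd hb hper n (Metric.mem_ball_self hr)
  -- The right-hand side is real, so the real part of the complex solution solves the same equation.
  refine ⟨fun q => (Ψ q).re, ?_, ?_, ?_⟩
  · intro n v lam
    simp only [Ψ, map_add, torusChar_inc_add_int]
  · intro v lam hlam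
    obtain ⟨r, hr, ΨC, hΨ, hreal, -⟩ := hloc lam hlam
    have h1 := analyticAt_re (E := (Fin d → ℝ) × (Fin m → ℝ)) (F := ℝ) (x := (v, lam))
      (hΨ (inc v, inc lam) (mem_torusStrip_inc (Metric.mem_ball_self hr) v))
    refine h1.congr ?_
    have : ∀ᶠ q : (Fin d → ℝ) × (Fin m → ℝ) in 𝓝 (v, lam), q.2 ∈ Metric.ball lam r :=
      continuous_snd.continuousAt.preimage_mem_nhds (Metric.ball_mem_nhds lam hr)
    filter_upwards [this] with q hq
    exact congrArg Complex.re (hreal q.1 q.2 hq)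
  · intro v lam hlam
    obtain ⟨-, -, -, -, -, hs, hs'⟩ := hloc lam hlam
    have hcont : Continuous fun v => h (v, lam) := by
      refine continuous_iff_continuousAt.2 fun v => ?_
      exact (ha v lam hlam).continuousAt.comp (f := fun v => (v, lam)) (by fun_prop)
    let f : C(Torus d, ℂ) := ⟨fun θ => (h (torusLift θ, lam) : ℂ),
      Complex.continuous_ofReal.comp (hp.continuous_comp_torusLift hcont)⟩
    have hf : UnitAddTorus.mFourierCoeff f = fun n => hc n lam := by
      funext n
      rw [mFourierCoeff_eq_integral_volume]
      refine integral_congr_ae (.of_forall fun θ => ?_)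
      simp only [f, ContinuousMap.coe_mk]
      rw [← mFourier_toTorus, toTorus_torusLift]
    have hF := UnitAddTorus.hasSum_mFourier_series_apply_of_summable (f := f)
      (by rw [hf]; exact hs') (toTorus v)
    rw [hf] at hF
    simp only [mFourier_toTorus, smul_eq_mul] at hF
    have hfv : f (toTorus v) = (h (v, lam) : ℂ) := by
      simp only [f, ContinuousMap.coe_mk]
      rw [eq_of_toTorus_eq (f := fun v => h (v, lam)) (fun n v => hp n v lam)
        (toTorus_torusLift (toTorus v))]
    rw [hfv] at hF
    have hc0 : hc 0 lam = 0 := by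
      have h1 : hc 0 lam = ((∫ θ : Torus d, h (torusLift θ, lam) : ℝ) : ℂ) := by
        rw [← integral_complex_ofReal]
        refine integral_congr_ae (.of_forall fun θ => ?_)
        simp [torusChar]
      rw [h1, havg lam hlam, Complex.ofReal_zero]
    have hΨ := (hs (v + ω)).hasSum.sub (hs v).hasSum
    have : Ψ (v + ω, lam) - Ψ (v, lam) = (h (v, lam) : ℂ) := by
      refine hΨ.unique (hF.congr_fun fun n => ?_)
      by_cases hn : n = 0
      · subst hn; simp [hD0, hc0]
      · have h1 := (hdiv n hn).2
        rw [map_add, torusChar_add]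
        simp only [D]
        field_simp
    rw [← Complex.sub_re, this, Complex.ofReal_re]

end SmallDivisors

/-! ### Analytic division by powers of the first variable -/

section Division

set_option linter.unusedSectionVars false

variable {E EC F FC : Type*} [NormedAddCommGroup E] [NormedSpace ℝ E]
  [NormedAddCommGroup EC] [NormedSpace ℂ EC] [NormedAddCommGroup F] [NormedSpace ℝ F]
  [NormedAddCommGroup FC] [NormedSpace ℂ FC] [RealForm E EC] [RealForm F FC]

/-- Division by the first variable, with remainder. -/
noncomputable def uDiv (f : ℝ × E → F) (q : ℝ × E) : F := dslope (fun u => f (u, q.2)) 0 q.1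

lemma segment_mem_ball {u τ r : ℝ} {z z₀ : E} (h : (u, z) ∈ Metric.ball ((0 : ℝ), z₀) r)
    (hτ : τ ∈ Icc (0 : ℝ) 1) : (τ * u, z) ∈ Metric.ball ((0 : ℝ), z₀) r := by
  simp only [Metric.mem_ball, Prod.dist_eq, max_lt_iff, dist_zero_right, Real.norm_eq_abs] at h ⊢
  refine ⟨lt_of_le_of_lt ?_ h.1, h.2⟩
  rw [abs_mul, abs_of_nonneg hτ.1]
  exact mul_le_of_le_one_left (abs_nonneg _) hτ.2

/-- The integral over `τ ∈ [0, 1]` of `h (τ u, z)` depends analytically on `(u, z)`. -/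
lemma analyticAt_integral_segment [FiniteDimensional ℝ E] [FiniteDimensional ℂ EC] [CompleteSpace F]
    [CompleteSpace FC] {h : ℝ × E → F} {z₀ : E} (hh : AnalyticAt ℝ h (0, z₀)) :
    AnalyticAt ℝ (fun q : ℝ × E => ∫ τ in (0 : ℝ)..1, h (τ * q.1, q.2)) (0, z₀) := by
  obtain ⟨r, hr, M, g, hg⟩ := exists_extension (FC := FC) (K := {((0 : ℝ), z₀)}) (P := {0})
    isCompact_singleton (by rintro _ rfl; exact hh) (by rintro _ rfl x; rw [add_zero])
  obtain ⟨hd, hb, hreal⟩ := hg _ rfl _ rfl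
  rw [add_zero] at hd hb hreal
  -- Truncation to [0, 1] makes the integrand bounded, continuous and holomorphic for every real τ,
  -- as the lemma on parameter integrals requires, without changing it on the range of integration.
  let c : ℝ → ℝ := fun τ => max 0 (min τ 1)
  have hc : ∀ τ, c τ ∈ Icc (0 : ℝ) 1 := fun τ =>
    ⟨le_max_left _ _, max_le zero_le_one (min_le_right _ _)⟩
  have hcont : Continuous c := continuous_const.max (continuous_id.min continuous_const)
  let B : Set (ℂ × EC) := Metric.ball (inc ((0 : ℝ), z₀)) r
  have hmem : ∀ τ, ∀ q ∈ B, ((c τ : ℂ) * q.1, q.2) ∈ B := by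
    intro τ q hq
    have h0 : (inc ((0 : ℝ), z₀) : ℂ × EC) = (0, inc z₀) := by
      change (((0 : ℝ) : ℂ), inc z₀) = _
      rw [Complex.ofReal_zero]
    simp only [B, h0, Metric.mem_ball, Prod.dist_eq, max_lt_iff, dist_zero_right] at hq ⊢
    refine ⟨lt_of_le_of_lt ?_ hq.1, hq.2⟩
    rw [norm_mul, Complex.norm_real, Real.norm_eq_abs, abs_of_nonneg (hc τ).1]
    exact mul_le_of_le_one_left (norm_nonneg _) (hc τ).2
  let μ : Measure ℝ := volume.restrict (Ioc 0 1)
  let G : ℂ × EC → FC := fun q => ∫ τ, g ((c τ : ℂ) * q.1, q.2) ∂μ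
  have hGat : GateauxOn G B := by
    refine GateauxOn.integral (M := M) Metric.isOpen_ball (fun τ => ?_) (fun q hq => ?_)
      fun τ q hq => hb _ (hmem τ q hq)
    · exact DifferentiableOn.gateauxOn Metric.isOpen_ball
        (hd.comp (by fun_prop) fun q hq => hmem τ q hq)
    · have : Continuous fun τ => g ((c τ : ℂ) * q.1, q.2) :=
        hd.continuousOn.comp_continuous (by fun_prop) fun τ => hmem τ q hq
      exact this.aestronglyMeasurable
  have hGb : ∀ q ∈ B, ‖G q‖ ≤ M := fun q hq => by
    refine (norm_integral_le_of_norm_le_const (.of_forall fun τ => hb _ (hmem τ q hq))).trans_eq ?_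
    simp [μ]
  refine analyticAt_of_inc_eq (hGat.analyticOnNhd Metric.isOpen_ball hGb _
    (Metric.mem_ball_self hr)) ?_
  filter_upwards [Metric.ball_mem_nhds ((0 : ℝ), z₀) hr] with q hq
  have e : ∀ τ, g ((c τ : ℂ) * (inc q : ℂ × EC).1, (inc q : ℂ × EC).2) = inc (h (c τ * q.1, q.2)) := by
    intro τ
    rw [← hreal _ (segment_mem_ball hq (hc τ))]
    congr 1
    refine Prod.ext ?_ rfl
    change (c τ : ℂ) * (q.1 : ℂ) = ((c τ * q.1 : ℝ) : ℂ)
    push_cast; rfl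
  have hci : Continuous fun τ => h (c τ * q.1, q.2) := by
    have h1 : Continuous fun τ => (inc (h (c τ * q.1, q.2)) : FC) := by
      simp only [← e]
      exact hd.continuousOn.comp_continuous (by fun_prop)
        fun τ => hmem τ _ (inc_mem_ball.2 hq)
    exact (isometry_inc (E := F)).isEmbedding.continuous_iff.2 h1
  have hint : Integrable (fun τ => h (c τ * q.1, q.2)) μ := by
    have : IntegrableOn (fun τ => h (c τ * q.1, q.2)) (Icc 0 1) volume :=
      hci.continuousOn.integrableOn_compact isCompact_Icc
    exact this.mono_set Ioc_subset_Icc_self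
  simp only [G, e]
  have h2 := (incL : F →L[ℝ] FC).integral_comp_comm hint
  refine h2.trans ?_
  change inc _ = inc _
  congr 1
  rw [intervalIntegral.integral_of_le zero_le_one]
  refine setIntegral_congr_fun measurableSet_Ioc fun τ hτ => ?_
  have : c τ = τ := by
    simp only [c]; rw [min_eq_left hτ.2, max_eq_right hτ.1.le]
  simp only [this]

/-- Hadamard's formula: the quotient (f(u, z) - f(0, z)) / u is the integral over τ in [0, 1] of
∂f/∂u at (τ u, z). This gives analyticity jointly in u and the remaining variables. -/
theorem analyticAt_uDiv [FiniteDimensional ℝ E] [FiniteDimensional ℂ EC] [CompleteSpace F]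
    [CompleteSpace FC] {f : ℝ × E → F} {z₀ : E} (hf : AnalyticAt ℝ f (0, z₀)) :
    AnalyticAt ℝ (uDiv f) (0, z₀) := by
  let h : ℝ × E → F := fun q => fderiv ℝ f q (1, 0)
  have hh : AnalyticAt ℝ h (0, z₀) :=
    ((ContinuousLinearMap.apply ℝ F ((1 : ℝ), (0 : E))).analyticAt _).comp hf.fderiv
  refine (analyticAt_integral_segment (FC := FC) hh).congr ?_
  obtain ⟨r, hr, hball⟩ := Metric.eventually_nhds_iff_ball.1
    (hf.eventually_analyticAt.and hh.eventually_analyticAt)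
  filter_upwards [Metric.ball_mem_nhds ((0 : ℝ), z₀) hr] with q hq
  have hder : ∀ u, (u, q.2) ∈ Metric.ball ((0 : ℝ), z₀) r →
      HasDerivAt (fun u => f (u, q.2)) (h (u, q.2)) u := by
    intro u hu
    have h1 := (hball _ hu).1.differentiableAt.hasFDerivAt
    have h2 : HasDerivAt (fun u : ℝ => (u, q.2)) ((1 : ℝ), (0 : E)) u :=
      (hasDerivAt_id u).prodMk (hasDerivAt_const u q.2)
    exact h1.comp_hasDerivAt u h2
  by_cases hu : q.1 = 0
  · have h0 := hder q.1 hq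
    rw [hu] at h0
    simp [uDiv, hu, dslope_same, h0.deriv]
  · have hseg : ∀ τ ∈ Icc (0 : ℝ) 1, (τ * q.1, q.2) ∈ Metric.ball ((0 : ℝ), z₀) r :=
      fun τ hτ => segment_mem_ball hq hτ
    have hd1 : ∀ τ ∈ uIcc (0 : ℝ) 1,
        HasDerivAt (fun τ => f (τ * q.1, q.2)) (q.1 • h (τ * q.1, q.2)) τ := by
      intro τ hτ
      rw [uIcc_of_le zero_le_one] at hτ
      have h1 := (hder _ (hseg τ hτ)).scomp τ (hasDerivAt_mul_const q.1)
      exact h1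
    have hcont : ContinuousOn (fun τ => q.1 • h (τ * q.1, q.2)) (uIcc (0 : ℝ) 1) := by
      intro τ hτ
      rw [uIcc_of_le zero_le_one] at hτ
      have h1 : ContinuousAt (fun τ => h (τ * q.1, q.2)) τ :=
        (hball _ (hseg τ hτ)).2.continuousAt.comp (f := fun τ : ℝ => (τ * q.1, q.2)) (by fun_prop)
      exact (h1.const_smul q.1).continuousWithinAt
    have h2 := intervalIntegral.integral_eq_sub_of_hasDerivAt hd1 hcont.intervalIntegrable
    rw [intervalIntegral.integral_smul] at h2
    simp only [one_mul, zero_mul] at h2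
    simp only [uDiv]
    rw [dslope_of_ne _ hu, slope_def_module, sub_zero, ← h2, smul_smul, inv_mul_cancel₀ hu, one_smul]

theorem analyticAt_uDiv_iterate [FiniteDimensional ℝ E] [FiniteDimensional ℂ EC] [CompleteSpace F]
    [CompleteSpace FC] {f : ℝ × E → F} {z₀ : E} (hf : AnalyticAt ℝ f (0, z₀)) (n : ℕ) :
    AnalyticAt ℝ (uDiv^[n] f) (0, z₀) := by
  induction n with
  | zero => exact hf
  | succ n ih => rw [Function.iterate_succ_apply']; exact analyticAt_uDiv (FC := FC) ih

lemma uDiv_iterate_apply (f : ℝ × E → F) (n : ℕ) (q : ℝ × E) :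
    uDiv^[n] f q = (Function.swap dslope 0)^[n] (fun u => f (u, q.2)) q.1 := by
  induction n generalizing q with
  | zero => rfl
  | succ n ih =>
    rw [Function.iterate_succ_apply', Function.iterate_succ_apply', uDiv]
    simp only [ih]

/-- The bound forces the divided differences at 0 of order less than n to vanish, since each
division lowers the order by one; hence n divisions lose no remainder. -/
lemma iterate_dslope_of_isBigO [CompleteSpace F] {φ : ℝ → F} (hφ : AnalyticAt ℝ φ 0) {n : ℕ}
    (hO : φ =O[𝓝 0] fun u => u ^ n) (u : ℝ) : u ^ n • (Function.swap dslope 0)^[n] φ u = φ u := by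
  have key : ∀ n, ∀ φ : ℝ → F, AnalyticAt ℝ φ 0 → (φ =O[𝓝 0] fun u => u ^ n) →
      ∀ k < n, (Function.swap dslope 0)^[k] φ 0 = 0 := by
    intro n
    induction n with
    | zero => intro φ _ _ k hk; omega
    | succ n ih =>
      intro φ hφ hO k hk
      have h0 : φ 0 = 0 := by
        simpa using hO.eq_zero_imp.self_of_nhds
      cases k with
      | zero => simpa using h0
      | succ k =>
        rw [Function.iterate_succ_apply]
        have ha : AnalyticAt ℝ (dslope φ 0) 0 := by
          obtain ⟨p, hp⟩ := hφ
          exact ⟨_, hp.has_fpower_series_dslope_fslope⟩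
        refine ih (dslope φ 0) ha ?_ k (by omega)
        obtain ⟨C, hC⟩ := hO.bound
        have h1 : ∀ᶠ u in 𝓝[≠] (0 : ℝ), ‖dslope φ 0 u‖ ≤ C * ‖u ^ n‖ := by
          filter_upwards [nhdsWithin_le_nhds hC, self_mem_nhdsWithin] with u hu hu0
          have hu0' : u ≠ 0 := hu0
          rw [dslope_of_ne _ hu0', slope_def_module, h0, sub_zero, sub_zero, norm_smul, norm_inv]
          rw [inv_mul_le_iff₀ (norm_pos_iff.2 hu0')]
          refine hu.trans_eq ?_
          rw [pow_succ, norm_mul]; ring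
        have h2 : ‖dslope φ 0 0‖ ≤ C * ‖(0 : ℝ) ^ n‖ := by
          have e1 : Tendsto (fun u => ‖dslope φ 0 u‖) (𝓝[≠] 0) (𝓝 ‖dslope φ 0 0‖) :=
            ha.continuousAt.norm.tendsto.mono_left nhdsWithin_le_nhds
          have e2 : Tendsto (fun u : ℝ => C * ‖u ^ n‖) (𝓝[≠] 0) (𝓝 (C * ‖(0 : ℝ) ^ n‖)) :=
            (by fun_prop : Continuous fun u : ℝ => C * ‖u ^ n‖).continuousAt.tendsto.mono_left
              nhdsWithin_le_nhds
          exact le_of_tendsto_of_tendsto e1 e2 h1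
        refine IsBigO.of_bound C ?_
        rw [← nhdsNE_sup_pure, eventually_sup]
        exact ⟨h1, h2⟩
  have := pow_sub_smul_iterate_dslope_of_zero n (key n φ hφ hO) u
  simpa using this

lemma uDiv_iterate_of_isBigO [CompleteSpace F] {f : ℝ × E → F} {z : E} {n : ℕ}
    (hf : AnalyticAt ℝ (fun u => f (u, z)) 0) (hO : (fun u => f (u, z)) =O[𝓝 0] fun u => u ^ n)
    (u : ℝ) : u ^ n • uDiv^[n] f (u, z) = f (u, z) := by
  rw [uDiv_iterate_apply]; exact iterate_dslope_of_isBigO hf hO u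

end Division

/-! ### The weights of the blow-up -/

section DiagPow

variable {𝕜 : Type*} [NontriviallyNormedField 𝕜] {d : ℕ}

/-- The diagonal operator `(X, Y, Z) ↦ (y² X, y^(k+1) Y, y^q Z)`. -/
noncomputable def diagPow (k q : ℕ) (y : 𝕜) :
    (𝕜 × 𝕜 × (Fin d → 𝕜)) →L[𝕜] (𝕜 × 𝕜 × (Fin d → 𝕜)) :=
  y ^ 2 • (ContinuousLinearMap.inl 𝕜 𝕜 (𝕜 × (Fin d → 𝕜)) ∘L ContinuousLinearMap.fst 𝕜 _ _) +
  y ^ (k + 1) • (ContinuousLinearMap.inr 𝕜 𝕜 (𝕜 × (Fin d → 𝕜)) ∘L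
    ContinuousLinearMap.inl 𝕜 𝕜 (Fin d → 𝕜) ∘L ContinuousLinearMap.fst 𝕜 _ _ ∘L
    ContinuousLinearMap.snd 𝕜 _ _) +
  y ^ q • (ContinuousLinearMap.inr 𝕜 𝕜 (𝕜 × (Fin d → 𝕜)) ∘L
    ContinuousLinearMap.inr 𝕜 𝕜 (Fin d → 𝕜) ∘L ContinuousLinearMap.snd 𝕜 _ _ ∘L
    ContinuousLinearMap.snd 𝕜 _ _)

@[simp] lemma diagPow_apply (k q : ℕ) (y : 𝕜) (w : 𝕜 × 𝕜 × (Fin d → 𝕜)) :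
    diagPow k q y w = (y ^ 2 * w.1, y ^ (k + 1) * w.2.1, y ^ q • w.2.2) := by
  simp [diagPow]

@[simp] lemma diagPow_one (k q : ℕ) :
    diagPow (d := d) k q (1 : 𝕜) = ContinuousLinearMap.id 𝕜 _ := by
  ext w <;> simp

/-- The derivative of `diagPow` at `1`. -/
noncomputable def diagWeight (k q : ℕ) :
    (𝕜 × 𝕜 × (Fin d → 𝕜)) →L[𝕜] (𝕜 × 𝕜 × (Fin d → 𝕜)) :=
  (2 : 𝕜) • (ContinuousLinearMap.inl 𝕜 𝕜 (𝕜 × (Fin d → 𝕜)) ∘L ContinuousLinearMap.fst 𝕜 _ _) +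
  ((k + 1 : ℕ) : 𝕜) • (ContinuousLinearMap.inr 𝕜 𝕜 (𝕜 × (Fin d → 𝕜)) ∘L
    ContinuousLinearMap.inl 𝕜 𝕜 (Fin d → 𝕜) ∘L ContinuousLinearMap.fst 𝕜 _ _ ∘L
    ContinuousLinearMap.snd 𝕜 _ _) +
  (q : 𝕜) • (ContinuousLinearMap.inr 𝕜 𝕜 (𝕜 × (Fin d → 𝕜)) ∘L
    ContinuousLinearMap.inr 𝕜 𝕜 (Fin d → 𝕜) ∘L ContinuousLinearMap.snd 𝕜 _ _ ∘L
    ContinuousLinearMap.snd 𝕜 _ _)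

@[simp] lemma diagWeight_apply (k q : ℕ) (w : 𝕜 × 𝕜 × (Fin d → 𝕜)) :
    diagWeight k q w = (2 * w.1, ((k : 𝕜) + 1) * w.2.1, (q : 𝕜) • w.2.2) := by
  simp [diagWeight]

lemma hasStrictDerivAt_diagPow (k q : ℕ) :
    HasStrictDerivAt (diagPow (d := d) k q) (diagWeight (𝕜 := 𝕜) k q) 1 := by
  have h : ∀ n : ℕ, HasStrictDerivAt (fun y : 𝕜 => y ^ n) (n : 𝕜) 1 := fun n => by
    simpa using hasStrictDerivAt_pow n (1 : 𝕜)
  have h3 : ∀ (n : ℕ) (T : (𝕜 × 𝕜 × (Fin d → 𝕜)) →L[𝕜] (𝕜 × 𝕜 × (Fin d → 𝕜))),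
      HasStrictDerivAt (fun y : 𝕜 => y ^ n • T) ((n : 𝕜) • T) 1 := fun n T => (h n).smul_const T
  have h4 := fun T₁ T₂ T₃ => ((h3 2 T₁).add (h3 (k + 1) T₂)).add (h3 q T₃)
  rw [Nat.cast_ofNat] at h4
  exact h4 _ _ _

lemma differentiable_diagPow (k q : ℕ) : Differentiable 𝕜 (diagPow (𝕜 := 𝕜) (d := d) k q) := by
  unfold diagPow; fun_prop

end DiagPow

/-! ### How one correction changes the error -/

section StepExpansion

variable {E : Type*} [NormedAddCommGroup E] [NormedSpace ℝ E]

/-- An analytic function has an integer order of vanishing: after division by u^n the quotient is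
analytic and vanishes at 0. -/
lemma isBigO_succ_of_isLittleO [CompleteSpace E] {φ : ℝ → E} (hφ : AnalyticAt ℝ φ 0) {n : ℕ}
    (ho : φ =o[𝓝 0] fun u => u ^ n) : φ =O[𝓝 0] fun u => u ^ (n + 1) := by
  set ψ := (Function.swap dslope 0)^[n] φ with hψ
  have e : ∀ u, u ^ n • ψ u = φ u := iterate_dslope_of_isBigO hφ ho.isBigO
  have ha : AnalyticAt ℝ ψ 0 := by
    obtain ⟨P, hP⟩ := hφ
    exact ⟨_, hP.has_fpower_series_iterate_dslope_fslope n⟩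
  have h0 : ψ 0 = 0 := by
    have h1 : Tendsto ψ (𝓝[≠] 0) (𝓝 (ψ 0)) := ha.continuousAt.tendsto.mono_left nhdsWithin_le_nhds
    refine tendsto_nhds_unique h1 ?_
    rw [← isLittleO_one_iff ℝ]
    have h2 := (isBigO_refl (fun u : ℝ => (u ^ n)⁻¹) (𝓝[≠] 0)).smul_isLittleO
      (ho.mono nhdsWithin_le_nhds)
    refine h2.congr' ?_ ?_
    · filter_upwards [self_mem_nhdsWithin] with u hu
      rw [← e u, smul_smul, inv_mul_cancel₀ (pow_ne_zero n hu), one_smul]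
    · filter_upwards [self_mem_nhdsWithin] with u hu
      rw [smul_eq_mul, inv_mul_cancel₀ (pow_ne_zero n hu)]
  have h3 : ψ =O[𝓝 0] fun u : ℝ => u := by
    simpa [h0] using ha.differentiableAt.isBigO_sub
  have h4 := (isBigO_refl (fun u : ℝ => u ^ n) (𝓝 0)).smul h3
  refine h4.congr e fun u => ?_
  rw [smul_eq_mul, pow_succ]

/-- The change of the error of the invariance equation when terms of degree `n` and `n + k - 1` are
added to the parameterization `W`. -/
theorem isLittleO_step {D : ℝ → E →L[ℝ] E} {D₀ : E →L[ℝ] E} (hD : HasStrictDerivAt D D₀ 1)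
    (hD1 : D 1 = ContinuousLinearMap.id ℝ E) {Wp W : ℝ → E} {w₀ : E}
    (hWp : ∃ W', HasStrictDerivAt Wp W' 0) (hWp0 : Wp 0 = w₀) (hW : ContinuousAt W 0) (hW0 : W 0 = w₀)
    {G : ℝ × E → E} {G' : ℝ × E →L[ℝ] E} (hG : HasStrictFDerivAt G G' (0, w₀))
    {n k : ℕ} (hk : 2 ≤ k) {v ψp ψ : E} {r₁ r₂ σ : ℝ} (hv : 1 ≤ n ∨ v = 0)
    (hσ : n = k - 1 ∨ σ = 0) :
    (fun u : ℝ =>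
      (D (1 + r₁ * u ^ (k - 1) + (r₂ + σ) * u ^ (2 * k - 2))
          (Wp ((1 + r₁ * u ^ (k - 1) + (r₂ + σ) * u ^ (2 * k - 2)) * u) +
            ((1 + r₁ * u ^ (k - 1) + (r₂ + σ) * u ^ (2 * k - 2)) * u) ^ n • v +
            ((1 + r₁ * u ^ (k - 1) + (r₂ + σ) * u ^ (2 * k - 2)) * u) ^ (n + k - 1) • ψp) -
        (W u + u ^ n • v + u ^ (n + k - 1) • ψ) -
        u ^ (k - 1) • G (u, W u + u ^ n • v + u ^ (n + k - 1) • ψ)) -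
      (D (1 + r₁ * u ^ (k - 1) + r₂ * u ^ (2 * k - 2))
          (Wp ((1 + r₁ * u ^ (k - 1) + r₂ * u ^ (2 * k - 2)) * u)) - W u - u ^ (k - 1) • G (u, W u)) -
      u ^ (n + k - 1) • (r₁ • ((n : ℝ) • v + D₀ v) + σ • D₀ w₀ + ψp - ψ - G' (0, v)))
      =o[𝓝 0] fun u : ℝ => u ^ (n + k - 1) := by
  obtain ⟨W', hWp⟩ := hWp
  set N := n + k - 1 with hN
  set ρ : ℝ → ℝ := fun u => 1 + r₁ * u ^ (k - 1) + r₂ * u ^ (2 * k - 2) with hρ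
  set ρ' : ℝ → ℝ := fun u => 1 + r₁ * u ^ (k - 1) + (r₂ + σ) * u ^ (2 * k - 2) with hρ'
  have hρc : Continuous ρ := by fun_prop
  have hρc' : Continuous ρ' := by fun_prop
  have z1 : k - 1 ≠ 0 := by omega
  have z2 : 2 * k - 2 ≠ 0 := by omega
  have zN : N ≠ 0 := by omega
  have hρ0 : ρ 0 = 1 := by simp [hρ, z1, z2]
  have hρ0' : ρ' 0 = 1 := by simp [hρ', z1, z2]
  have h1 : Tendsto ρ (𝓝 0) (𝓝 1) := hρ0 ▸ hρc.tendsto 0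
  have h1' : Tendsto ρ' (𝓝 0) (𝓝 1) := hρ0' ▸ hρc'.tendsto 0
  -- Effect of σ. The map (y, u) ↦ D(y) Wp(y u) is compared at two moving points, hence the strict
  -- derivatives; at (1, 0) its derivative in y is D₀ w₀. The points differ by σ u^(2k-2), which is
  -- of order N because σ ≠ 0 only if n = k - 1.
  have T1 : (fun u => D (ρ' u) (Wp (ρ' u * u)) - D (ρ u) (Wp (ρ u * u)) - u ^ N • σ • D₀ w₀)
      =o[𝓝 0] fun u : ℝ => u ^ N := by
    have hp : HasStrictFDerivAt (fun q : ℝ × ℝ => q.1 * q.2)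
        ((1 : ℝ) • ContinuousLinearMap.snd ℝ ℝ ℝ + (0 : ℝ) • ContinuousLinearMap.fst ℝ ℝ ℝ) (1, 0) := by
      have e1 : HasStrictFDerivAt (Prod.fst : ℝ × ℝ → ℝ) (ContinuousLinearMap.fst ℝ ℝ ℝ) (1, 0) :=
        hasStrictFDerivAt_fst
      have e2 : HasStrictFDerivAt (Prod.snd : ℝ × ℝ → ℝ) (ContinuousLinearMap.snd ℝ ℝ ℝ) (1, 0) :=
        hasStrictFDerivAt_snd
      exact e1.mul e2
    have hW1 : HasStrictFDerivAt Wp (ContinuousLinearMap.toSpanSingleton ℝ W')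
        ((fun q : ℝ × ℝ => q.1 * q.2) (1, 0)) := by simpa using hWp.hasStrictFDerivAt
    have hD2 : HasStrictFDerivAt (fun q : ℝ × ℝ => D q.1)
        (ContinuousLinearMap.toSpanSingleton ℝ D₀ ∘L ContinuousLinearMap.fst ℝ ℝ ℝ) (1, 0) :=
      HasStrictFDerivAt.comp (x := ((1 : ℝ), (0 : ℝ))) (hg := hD.hasStrictFDerivAt) (hf := hasStrictFDerivAt_fst)
    have hΦ := hD2.clm_apply (hW1.comp ((1 : ℝ), (0 : ℝ)) hp)
    have ht : Tendsto (fun u : ℝ => ((ρ' u, u), (ρ u, u))) (𝓝 0) (𝓝 (((1 : ℝ), (0 : ℝ)), ((1 : ℝ), (0 : ℝ)))) :=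
      (h1'.prodMk_nhds tendsto_id).prodMk_nhds (h1.prodMk_nhds tendsto_id)
    have h2 := hΦ.isLittleO.comp_tendsto ht
    have hd : ∀ u, ρ' u - ρ u = σ * u ^ N := by
      intro u
      rw [show ρ' u - ρ u = σ * u ^ (2 * k - 2) by simp only [hρ, hρ']; ring]
      rcases hσ with h | h
      · rw [show 2 * k - 2 = N by omega]
      · rw [h, zero_mul, zero_mul]
    have h3 : (fun u => D (ρ' u) (Wp (ρ' u * u)) - D (ρ u) (Wp (ρ u * u)) - u ^ N • σ • D₀ w₀)
        =o[𝓝 0] fun u : ℝ => ((σ * u ^ N, 0) : ℝ × ℝ) := by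
      refine h2.congr (fun u => ?_) fun u => ?_
      · simp [hd, hWp0, hD1, smul_smul, mul_comm σ]
      · simp [hd]
    refine h3.trans_isBigO (IsBigO.of_bound |σ| (.of_forall fun u => ?_))
    simp only [Prod.norm_def, norm_mul, norm_zero, norm_pow, Real.norm_eq_abs]
    exact (max_eq_left (by positivity)).le
  -- Effect of the term of degree n: after removal of u^n, the derivative of y ↦ D(y) y^n v at 1 is
  -- multiplied by ρ' - 1 = r₁ u^(k-1) + o(u^(k-1)).
  have T2 : (fun u => D (ρ' u) ((ρ' u * u) ^ n • v) - u ^ n • v - u ^ N • r₁ • ((n : ℝ) • v + D₀ v))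
      =o[𝓝 0] fun u : ℝ => u ^ N := by
    have hΨ : HasStrictDerivAt (fun y : ℝ => D y (y ^ n • v)) (D₀ v + (n : ℝ) • v) 1 := by
      have := hD.clm_apply ((hasStrictDerivAt_pow n (1 : ℝ)).smul_const v)
      simpa [hD1] using this
    have h2 : (fun u => D (ρ' u) (ρ' u ^ n • v) - v - (ρ' u - 1) • (D₀ v + (n : ℝ) • v))
        =o[𝓝 0] fun u => ρ' u - 1 := by
      have := hΨ.hasDerivAt.hasFDerivAt.isLittleO.comp_tendsto h1'
      refine this.congr (fun u => ?_) fun u => rfl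
      simp [hD1]
    have hsub : (fun u => ρ' u - 1 - r₁ * u ^ (k - 1)) =o[𝓝 0] fun u : ℝ => u ^ (k - 1) := by
      have : (fun u : ℝ => (r₂ + σ) * u ^ (2 * k - 2)) =o[𝓝 0] fun u : ℝ => u ^ (k - 1) :=
        (isLittleO_pow_pow (by omega)).const_mul_left _
      refine this.congr (fun u => ?_) fun u => rfl
      simp only [hρ']; ring
    have hbig : (fun u => ρ' u - 1) =O[𝓝 0] fun u : ℝ => u ^ (k - 1) := by
      have := hsub.isBigO.add ((isBigO_refl (fun u : ℝ => u ^ (k - 1)) (𝓝 0)).const_mul_left r₁)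
      refine this.congr (fun u => by ring) fun u => rfl
    have h3 : (fun u => D (ρ' u) (ρ' u ^ n • v) - v - u ^ (k - 1) • r₁ • ((n : ℝ) • v + D₀ v))
        =o[𝓝 0] fun u : ℝ => u ^ (k - 1) := by
      have h4 := hsub.smul_isBigO (isBigO_const_const (D₀ v + (n : ℝ) • v) (one_ne_zero (α := ℝ)) (𝓝 0))
      have h5 := (h2.trans_isBigO hbig).add (h4.congr_right fun u => by rw [smul_eq_mul, mul_one])
      refine h5.congr (fun u => ?_) fun u => rfl
      module
    have h6 := (isBigO_refl (fun u : ℝ => u ^ n) (𝓝 0)).smul_isLittleO h3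
    refine h6.congr (fun u => ?_) fun u => ?_
    · rw [hN, show n + k - 1 = n + (k - 1) by omega, mul_pow, pow_add]
      simp only [map_smul]
      module
    · rw [hN, show n + k - 1 = n + (k - 1) by omega, pow_add, smul_eq_mul]
  -- In the term of degree N the dynamics acts trivially to leading order, since ρ' → 1.
  have T3 : (fun u => D (ρ' u) ((ρ' u * u) ^ N • ψp) - u ^ N • ψp) =o[𝓝 0] fun u : ℝ => u ^ N := by
    have h2 : (fun u => D (ρ' u) (ρ' u ^ N • ψp) - ψp) =o[𝓝 0] fun _ : ℝ => (1 : ℝ) := by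
      rw [isLittleO_one_iff]
      have hc : ContinuousAt (fun y : ℝ => D y (y ^ N • ψp) - ψp) 1 :=
        (hD.hasDerivAt.continuousAt.clm_apply (by fun_prop)).sub continuousAt_const
      have := hc.tendsto.comp h1'
      simpa [hD1, Function.comp_def] using this
    have h6 := (isBigO_refl (fun u : ℝ => u ^ N) (𝓝 0)).smul_isLittleO h2
    refine h6.congr (fun u => ?_) fun u => by rw [smul_eq_mul, mul_one]
    rw [mul_pow]
    simp only [map_smul]
    module
  -- Linearization of G. Only `v` contributes, since N > n; the alternative in `hv` ensures that the
  -- arguments still tend to w₀ when n = 0.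
  have T4 : (fun u => u ^ (k - 1) • (G (u, W u + u ^ n • v + u ^ N • ψ) - G (u, W u)) - u ^ N • G' (0, v))
      =o[𝓝 0] fun u : ℝ => u ^ N := by
    have hc1 : Tendsto (fun u : ℝ => u ^ n • v) (𝓝 0) (𝓝 0) := by
      rcases hv with h | h
      · have : Continuous fun u : ℝ => u ^ n • v := by fun_prop
        simpa [show n ≠ 0 by omega] using this.tendsto 0
      · simp [h]
    have hc2 : Tendsto (fun u : ℝ => u ^ N • ψ) (𝓝 0) (𝓝 0) := by
      have : Continuous fun u : ℝ => u ^ N • ψ := by fun_prop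
      simpa [zN] using this.tendsto 0
    have hc3 : Tendsto W (𝓝 0) (𝓝 w₀) := hW0 ▸ hW.tendsto
    have hc4 : Tendsto (fun u : ℝ => W u + u ^ n • v + u ^ N • ψ) (𝓝 0) (𝓝 w₀) := by
      simpa using (hc3.add hc1).add hc2
    have ht : Tendsto (fun u : ℝ => ((u, W u + u ^ n • v + u ^ N • ψ), (u, W u))) (𝓝 0)
        (𝓝 (((0 : ℝ), w₀), ((0 : ℝ), w₀))) :=
      (tendsto_id.prodMk_nhds hc4).prodMk_nhds (tendsto_id.prodMk_nhds hc3)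
    have h2 := hG.isLittleO.comp_tendsto ht
    have hkn : (fun u : ℝ => u ^ N • ψ) =o[𝓝 0] fun u : ℝ => u ^ n := by
      have := (isLittleO_pow_pow (𝕜 := ℝ) (show n < N by omega)).smul_isBigO
        (isBigO_const_const ψ (one_ne_zero (α := ℝ)) (𝓝 0))
      exact this.congr_right fun u => by rw [smul_eq_mul, mul_one]
    have hvn : (fun u : ℝ => u ^ n • v) =O[𝓝 0] fun u : ℝ => u ^ n := by
      have := (isBigO_refl (fun u : ℝ => u ^ n) (𝓝 0)).smul
        (isBigO_const_const v (one_ne_zero (α := ℝ)) (𝓝 0))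
      exact this.congr_right fun u => by rw [smul_eq_mul, mul_one]
    have h3 : (fun u : ℝ => (((0 : ℝ), u ^ n • v + u ^ N • ψ) : ℝ × E)) =O[𝓝 0] fun u : ℝ => u ^ n :=
      (isBigO_zero _ _).prod_left (hvn.add hkn.isBigO)
    have h4 : (fun u => G (u, W u + u ^ n • v + u ^ N • ψ) - G (u, W u) - G' (0, u ^ n • v + u ^ N • ψ))
        =o[𝓝 0] fun u : ℝ => u ^ n := by
      refine IsLittleO.trans_isBigO ?_ h3
      refine h2.congr (fun u => ?_) fun u => ?_
      · simp [add_assoc, -map_sub]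
      · simp [add_assoc]
    have h5 : (fun u : ℝ => G' (0, u ^ N • ψ)) =o[𝓝 0] fun u : ℝ => u ^ n :=
      ((G' ∘L ContinuousLinearMap.inr ℝ ℝ E).isBigO_comp _ _).trans_isLittleO hkn
    have h6 := (isBigO_refl (fun u : ℝ => u ^ (k - 1)) (𝓝 0)).smul_isLittleO (h4.add h5)
    refine h6.congr (fun u => ?_) fun u => ?_
    · have e1 : ((0 : ℝ), u ^ n • v + u ^ N • ψ) = u ^ n • ((0 : ℝ), v) + ((0 : ℝ), u ^ N • ψ) := by simp
      rw [e1, map_add, map_smul, hN, show n + k - 1 = n + (k - 1) by omega, pow_add]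
      module
    · rw [hN, show n + k - 1 = n + (k - 1) by omega, pow_add, smul_eq_mul, mul_comm]
  refine (((T1.add T2).add T3).sub T4).congr (fun u => ?_) fun u => rfl
  simp only [map_add]
  module

end StepExpansion

/-! ### The equation in blown-up coordinates and its averages -/

section Parabolic

/-- The space of blown-up coordinates `(X, Y, Z)`. -/
abbrev Chart (d : ℕ) : Type := ℝ × ℝ × (Fin d → ℝ)

/-- The space of pairs `(θ, lam)`. -/
abbrev AngPar (d m : ℕ) : Type := (Fin d → ℝ) × (Fin m → ℝ)

variable {d m : ℕ}

lemma AnalyticAt.real_sqrt {E : Type*} [NormedAddCommGroup E] [NormedSpace ℝ E] {f : E → ℝ} {x : E}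
    (hf : AnalyticAt ℝ f x) (h : f x ≠ 0) : AnalyticAt ℝ (fun y => √(f y)) x :=
  ((Real.contDiffAt_sqrt (n := ⊤) h).analyticAt).comp hf

lemma AnalyticAt.chart_mk {E : Type*} [NormedAddCommGroup E] [NormedSpace ℝ E] {f : E → Chart d} {x : E}
    (h1 : AnalyticAt ℝ (fun y => (f y).1) x) (h2 : AnalyticAt ℝ (fun y => (f y).2.1) x)
    (h3 : ∀ i, AnalyticAt ℝ (fun y => (f y).2.2 i) x) : AnalyticAt ℝ f x :=
  h1.prod (h2.prod (AnalyticAt.pi h3))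

lemma AnalyticAt.chart_fst {E : Type*} [NormedAddCommGroup E] [NormedSpace ℝ E] {f : E → Chart d} {x : E}
    (h : AnalyticAt ℝ f x) : AnalyticAt ℝ (fun y => (f y).1) x :=
  analyticAt_fst.comp h

lemma AnalyticAt.chart_mid {E : Type*} [NormedAddCommGroup E] [NormedSpace ℝ E] {f : E → Chart d} {x : E}
    (h : AnalyticAt ℝ f x) : AnalyticAt ℝ (fun y => (f y).2.1) x :=
  analyticAt_fst.comp (analyticAt_snd.comp h)

lemma AnalyticAt.chart_ang {E : Type*} [NormedAddCommGroup E] [NormedSpace ℝ E] {f : E → Chart d} {x : E}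
    (h : AnalyticAt ℝ f x) (i : Fin d) : AnalyticAt ℝ (fun y => (f y).2.2 i) x :=
  analyticAt_pi_iff.1 (analyticAt_snd.comp (analyticAt_snd.comp h)) i

/-- The average of a real function on the torus, in terms of its lift. -/
noncomputable def liftAvg (f : AngPar d m → ℝ) (lam : Fin m → ℝ) : ℝ :=
  ∫ θ : Torus d, f (torusLift θ, lam)

lemma integrable_torusLift {f : AngPar d m → ℝ} (hp : TorusPeriodic f) {lam : Fin m → ℝ}
    (ha : ∀ v, AnalyticAt ℝ f (v, lam)) : Integrable fun θ : Torus d => f (torusLift θ, lam) := by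
  have hc : Continuous fun θ : Torus d => f (torusLift θ, lam) :=
    hp.continuous_comp_torusLift (continuous_iff_continuousAt.2 fun v =>
      (ha v).continuousAt.comp (f := fun v => (v, lam)) (by fun_prop))
  rw [← integrableOn_univ]
  exact hc.continuousOn.integrableOn_compact isCompact_univ

lemma liftAvg_add_const_sub_mul {f c : AngPar d m → ℝ} (hf : TorusPeriodic f) (hc : TorusPeriodic c)
    {lam : Fin m → ℝ} (haf : ∀ v, AnalyticAt ℝ f (v, lam)) (hac : ∀ v, AnalyticAt ℝ c (v, lam))
    (κ s : (Fin m → ℝ) → ℝ) :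
    liftAvg (fun x => f x + κ x.2 - c x * s x.2) lam =
      liftAvg f lam + κ lam - liftAvg c lam * s lam := by
  have h1 := integrable_torusLift hf haf
  have h2 := (integrable_torusLift hc hac).mul_const (s lam)
  simp only [liftAvg]
  have h3 : Integrable fun θ : Torus d => f (torusLift θ, lam) + κ lam := h1.add (integrable_const _)
  rw [integral_sub h3 h2, integral_add h1 (integrable_const _),
    integral_mul_const]
  simp

lemma exists_cohomological_solution_chart {ω : Fin d → ℝ} (hω : IsDiophantine ω)
    {h : AngPar d m → Chart d} (hp : TorusPeriodic h) {V : Set (Fin m → ℝ)}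
    (ha : ∀ v, ∀ lam ∈ V, AnalyticAt ℝ h (v, lam))
    (h1 : ∀ lam ∈ V, liftAvg (fun x => (h x).1) lam = 0)
    (h2 : ∀ lam ∈ V, liftAvg (fun x => (h x).2.1) lam = 0)
    (h3 : ∀ i, ∀ lam ∈ V, liftAvg (fun x => (h x).2.2 i) lam = 0) :
    ∃ ψ : AngPar d m → Chart d, TorusPeriodic ψ ∧
      (∀ v, ∀ lam ∈ V, AnalyticAt ℝ ψ (v, lam)) ∧
      ∀ v, ∀ lam ∈ V, ψ (v + ω, lam) - ψ (v, lam) = h (v, lam) := by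
  obtain ⟨ψ1, p1, a1, e1⟩ := exists_cohomological_solution hω (h := fun x => (h x).1)
    (fun n v y => by simp only [hp n v y]) (fun v lam hl => (ha v lam hl).chart_fst) h1
  obtain ⟨ψ2, p2, a2, e2⟩ := exists_cohomological_solution hω (h := fun x => (h x).2.1)
    (fun n v y => by simp only [hp n v y]) (fun v lam hl => (ha v lam hl).chart_mid) h2
  choose ψ3 p3 a3 e3 using fun i => exists_cohomological_solution hω (h := fun x => (h x).2.2 i)
    (fun n v y => by simp only [hp n v y]) (fun v lam hl => (ha v lam hl).chart_ang i) (h3 i)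
  refine ⟨fun x => (ψ1 x, ψ2 x, fun i => ψ3 i x), fun n v y => ?_, fun v lam hl => ?_,
    fun v lam hl => ?_⟩
  · simp only [p1 n v y, p2 n v y, p3 _ n v y]
  · exact AnalyticAt.chart_mk (a1 v lam hl) (a2 v lam hl) fun i => a3 i v lam hl
  · exact Prod.ext (e1 v lam hl) (Prod.ext (e2 v lam hl) (funext fun i => e3 i v lam hl))

/-- The data of the invariance equation in blown-up coordinates. -/
structure ParabolicData (d m : ℕ) where
  (k p q : ℕ)
  two_le : 2 ≤ k
  one_le : 1 ≤ q
  ω : Fin d → ℝ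
  dioph : IsDiophantine ω
  V : Set (Fin m → ℝ)
  isOpen : IsOpen V
  c : AngPar d m → ℝ
  a : AngPar d m → ℝ
  b : AngPar d m → Fin d → ℝ
  g : ℝ × Chart d × AngPar d m → Chart d
  periodic_c : TorusPeriodic c
  periodic_a : TorusPeriodic a
  periodic_b : TorusPeriodic b
  periodic_g : ∀ u W, TorusPeriodic fun x => g (u, W, x)
  analytic_c : ∀ v, ∀ lam ∈ V, AnalyticAt ℝ c (v, lam)
  analytic_a : ∀ v, ∀ lam ∈ V, AnalyticAt ℝ a (v, lam)
  analytic_b : ∀ v, ∀ lam ∈ V, AnalyticAt ℝ b (v, lam)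
  analytic_g : ∀ W v, ∀ lam ∈ V, AnalyticAt ℝ g (0, W, v, lam)
  pos_c : ∀ lam ∈ V, 0 < liftAvg c lam
  pos_a : ∀ lam ∈ V, 0 < liftAvg a lam
  g_zero : ∀ W v, ∀ lam ∈ V,
    g (0, W, v, lam) = (c (v, lam) * W.2.1, a (v, lam) * W.1 ^ k, W.1 ^ p • b (v, lam))

namespace ParabolicData

variable (P : ParabolicData d m)

/-- The average of `c`. -/
noncomputable def cAvg (lam : Fin m → ℝ) : ℝ := liftAvg P.c lam

/-- The average of `a`. -/
noncomputable def aAvg (lam : Fin m → ℝ) : ℝ := liftAvg P.a lam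

/-- The average of `b`. -/
noncomputable def bAvg (lam : Fin m → ℝ) (i : Fin d) : ℝ := liftAvg (fun x => P.b x i) lam

/-- The coefficient of `u^k` in the inner dynamics. -/
noncomputable def r₁ (lam : Fin m → ℝ) : ℝ := -√(P.cAvg lam * P.aAvg lam / (2 * (P.k + 1)))

/-- The leading coefficients of the parameterization. -/
noncomputable def w₀ (lam : Fin m → ℝ) : Chart d :=
  (1, 2 * P.r₁ lam / P.cAvg lam, (P.q * P.r₁ lam)⁻¹ • P.bAvg lam)

variable {P} {lam : Fin m → ℝ} (hl : lam ∈ P.V)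

lemma cAvg_pos (hl : lam ∈ P.V) : 0 < P.cAvg lam := P.pos_c lam hl

lemma aAvg_pos (hl : lam ∈ P.V) : 0 < P.aAvg lam := P.pos_a lam hl

lemma r₁_neg (hl : lam ∈ P.V) : P.r₁ lam < 0 := by
  have := P.cAvg_pos hl
  have := P.aAvg_pos hl
  exact neg_neg_of_pos (Real.sqrt_pos.2 (by positivity))

lemma r₁_sq (hl : lam ∈ P.V) : 2 * (P.k + 1) * P.r₁ lam ^ 2 = P.cAvg lam * P.aAvg lam := by
  have := P.cAvg_pos hl
  have := P.aAvg_pos hl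
  rw [r₁, neg_sq, Real.sq_sqrt (by positivity)]
  field_simp

lemma q_pos : (0 : ℝ) < P.q := by exact_mod_cast P.one_le

lemma analyticAt_cAvg (hl : lam ∈ P.V) : AnalyticAt ℝ P.cAvg lam :=
  analyticAt_torus_average P.periodic_c fun v => P.analytic_c v lam hl

lemma analyticAt_aAvg (hl : lam ∈ P.V) : AnalyticAt ℝ P.aAvg lam :=
  analyticAt_torus_average P.periodic_a fun v => P.analytic_a v lam hl

lemma analyticAt_bAvg (hl : lam ∈ P.V) : AnalyticAt ℝ P.bAvg lam :=
  AnalyticAt.pi fun i => analyticAt_torus_average (h := fun x => P.b x i)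
    (fun n v y => by simp only [P.periodic_b n v y])
    fun v => analyticAt_pi_iff.1 (P.analytic_b v lam hl) i

lemma analyticAt_r₁ (hl : lam ∈ P.V) : AnalyticAt ℝ P.r₁ lam := by
  have h1 := P.cAvg_pos hl
  have h2 := P.aAvg_pos hl
  refine (AnalyticAt.real_sqrt (((analyticAt_cAvg hl).mul (analyticAt_aAvg hl)).div
    analyticAt_const (by positivity)) ?_).neg
  simp only [Pi.div_apply, Pi.mul_apply]
  positivity

lemma analyticAt_w₀ (hl : lam ∈ P.V) : AnalyticAt ℝ P.w₀ lam := by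
  have h1 := P.cAvg_pos hl
  have h2 := P.r₁_neg hl
  have h3 := P.q_pos
  refine analyticAt_const.prod (AnalyticAt.prod ?_ ?_)
  · exact (analyticAt_const.mul (analyticAt_r₁ hl)).div (analyticAt_cAvg hl) h1.ne'
  · exact ((analyticAt_const.mul (analyticAt_r₁ hl)).inv (mul_ne_zero h3.ne' h2.ne)).smul
      (analyticAt_bAvg hl)

/-- Solution of the averaged equations for the coefficients of degree `n` and for the correction
of the inner dynamics. -/
lemma exists_averaged_solution {E : (Fin m → ℝ) → Chart d} (hE : ∀ lam ∈ P.V, AnalyticAt ℝ E lam)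
    {n : ℕ} (hn : 1 ≤ n) :
    ∃ (v : (Fin m → ℝ) → Chart d) (σ : (Fin m → ℝ) → ℝ), (∀ lam ∈ P.V, AnalyticAt ℝ v lam) ∧
      (∀ lam ∈ P.V, AnalyticAt ℝ σ lam) ∧ (n = P.k - 1 ∨ σ = 0) ∧ ∀ lam ∈ P.V,
      (E lam).1 + P.r₁ lam * (n + 2) * (v lam).1 + 2 * σ lam - P.cAvg lam * (v lam).2.1 = 0 ∧
      (E lam).2.1 + P.r₁ lam * (n + P.k + 1) * (v lam).2.1 + σ lam * (P.k + 1) * (P.w₀ lam).2.1 -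
        P.aAvg lam * (P.k * (v lam).1) = 0 ∧
      ∀ i, (E lam).2.2 i + P.r₁ lam * (n + P.q) * (v lam).2.2 i + σ lam * P.q * (P.w₀ lam).2.2 i -
        P.bAvg lam i * (P.p * (v lam).1) = 0 := by
  have hk1 : (1 : ℝ) ≤ P.k := by exact_mod_cast (by have := P.two_le; omega : 1 ≤ P.k)
  have hn0 : (0 : ℝ) < n := by exact_mod_cast hn
  suffices main : ∃ v1 v2 σ : (Fin m → ℝ) → ℝ, (∀ lam ∈ P.V, AnalyticAt ℝ v1 lam) ∧
      (∀ lam ∈ P.V, AnalyticAt ℝ v2 lam) ∧ (∀ lam ∈ P.V, AnalyticAt ℝ σ lam) ∧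
      (n = P.k - 1 ∨ σ = 0) ∧ ∀ lam ∈ P.V,
      (E lam).1 + P.r₁ lam * (n + 2) * v1 lam + 2 * σ lam - P.cAvg lam * v2 lam = 0 ∧
      (E lam).2.1 + P.r₁ lam * (n + P.k + 1) * v2 lam + σ lam * (P.k + 1) * (P.w₀ lam).2.1 -
        P.aAvg lam * (P.k * v1 lam) = 0 by
    obtain ⟨v1, v2, σ, h1, h2, hσ, hc, he⟩ := main
    refine ⟨fun lam => (v1 lam, v2 lam, fun i => (P.r₁ lam * (n + P.q))⁻¹ *
      (P.bAvg lam i * (P.p * v1 lam) - (E lam).2.2 i - σ lam * P.q * (P.w₀ lam).2.2 i)), σ,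
      fun lam hl => ?_, hσ, hc, fun lam hl => ⟨(he lam hl).1, (he lam hl).2, fun i => ?_⟩⟩
    · have a1 := analyticAt_r₁ hl
      have a2 := analyticAt_pi_iff.1 (analyticAt_bAvg hl)
      have a3 := fun i => (hE lam hl).chart_ang i
      have a4 := fun i => (analyticAt_w₀ hl).chart_ang i
      have a5 := h1 lam hl
      have a6 := hσ lam hl
      have h0 : P.r₁ lam * (n + P.q) ≠ 0 :=
        mul_ne_zero (P.r₁_neg hl).ne (by have := P.q_pos; positivity)
      refine AnalyticAt.chart_mk a5 (h2 lam hl) fun i => ?_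
      exact ((a1.mul analyticAt_const).inv h0).mul
        ((((a2 i).mul (analyticAt_const.mul a5)).sub (a3 i)).sub ((a6.mul analyticAt_const).mul (a4 i)))
    · have h0 : P.r₁ lam * (n + P.q) ≠ 0 :=
        mul_ne_zero (P.r₁_neg hl).ne (by have := P.q_pos; positivity)
      simp only
      rw [mul_inv_cancel_left₀ h0]
      ring
  have aE1 := fun lam hl => (hE lam hl).chart_fst
  have aE2 := fun lam hl => (hE lam hl).chart_mid
  -- With 2 (k+1) r₁² equal to the product of the averages of `c` and `a`, the determinant of the
  -- system for the first two components is r₁² (n - (k-1)) (n + 2(k+1)). At the resonance n = k - 1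
  -- the first component of `v` is normalized to 0 and the system is solved for σ and the second
  -- one. The angular components cause no trouble because r₁ (n + q) ≠ 0.
  by_cases hnk : n = P.k - 1
  · have hnk' : (n : ℝ) = P.k - 1 := by
      rw [hnk, Nat.cast_sub (by have := P.two_le; omega), Nat.cast_one]
    let σ : (Fin m → ℝ) → ℝ := fun lam =>
      -(P.cAvg lam * (E lam).2.1 + 2 * P.k * P.r₁ lam * (E lam).1) / (P.r₁ lam * (6 * P.k + 2))
    have hσ : ∀ lam ∈ P.V, AnalyticAt ℝ σ lam := fun lam hl =>
      ((((analyticAt_cAvg hl).mul (aE2 lam hl)).add ((analyticAt_const.mul (analyticAt_r₁ hl)).mul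
        (aE1 lam hl))).neg).div ((analyticAt_r₁ hl).mul analyticAt_const)
        (mul_ne_zero (P.r₁_neg hl).ne (by positivity))
    refine ⟨fun _ => 0, fun lam => ((E lam).1 + 2 * σ lam) / P.cAvg lam, σ,
      fun _ _ => analyticAt_const, fun lam hl => ?_, hσ, .inl hnk, fun lam hl => ⟨?_, ?_⟩⟩
    · exact ((aE1 lam hl).add (analyticAt_const.mul (hσ lam hl))).div (analyticAt_cAvg hl)
        (P.cAvg_pos hl).ne'
    · have := (P.cAvg_pos hl).ne'
      field_simp
      ring
    · have h1 := (P.cAvg_pos hl).ne'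
      have h2 := (P.r₁_neg hl).ne
      have h3 : (6 * (P.k : ℝ) + 2) ≠ 0 := by positivity
      simp only [σ, w₀, hnk']
      field_simp
      ring
  · let δ : ℝ := (n - (P.k - 1)) * (n + 2 * (P.k + 1))
    have hδ : δ ≠ 0 := by
      refine mul_ne_zero (fun h => hnk ?_) (by positivity)
      have : (n : ℝ) + 1 = P.k := by linarith
      have : n + 1 = P.k := by exact_mod_cast this
      omega
    let v1 : (Fin m → ℝ) → ℝ := fun lam =>
      -((E lam).1 * P.r₁ lam * (n + P.k + 1) + P.cAvg lam * (E lam).2.1) / (P.r₁ lam ^ 2 * δ)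
    have hv1 : ∀ lam ∈ P.V, AnalyticAt ℝ v1 lam := fun lam hl =>
      (((((aE1 lam hl).mul (analyticAt_r₁ hl)).mul analyticAt_const).add
        ((analyticAt_cAvg hl).mul (aE2 lam hl))).neg).div (((analyticAt_r₁ hl).pow 2).mul analyticAt_const)
        (mul_ne_zero (pow_ne_zero 2 (P.r₁_neg hl).ne) hδ)
    refine ⟨v1, fun lam => (P.r₁ lam * (n + 2) * v1 lam + (E lam).1) / P.cAvg lam, 0, hv1,
      fun lam hl => ?_, fun _ _ => analyticAt_const, .inr rfl, fun lam hl => ⟨?_, ?_⟩⟩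
    · exact (((analyticAt_r₁ hl).mul analyticAt_const).mul (hv1 lam hl) |>.add (aE1 lam hl)).div
        (analyticAt_cAvg hl) (P.cAvg_pos hl).ne'
    · have := (P.cAvg_pos hl).ne'
      simp only [Pi.zero_apply]
      field_simp
      ring
    · have h1 := (P.cAvg_pos hl).ne'
      have h2 := (P.r₁_neg hl).ne
      have h4 := r₁_sq hl
      have h5 : v1 lam * (P.r₁ lam ^ 2 * δ) =
          -((E lam).1 * P.r₁ lam * (n + P.k + 1) + P.cAvg lam * (E lam).2.1) :=
        div_mul_cancel₀ _ (mul_ne_zero (pow_ne_zero 2 h2) hδ)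
      simp only [δ] at h5
      simp only [Pi.zero_apply, zero_mul, add_zero]
      field_simp
      generalize v1 lam = x at h5 ⊢
      linear_combination h5 + P.k * x * h4
end ParabolicData

end Parabolic

/-! ### Approximate solutions of every order -/

section FormalSolution

variable {d m : ℕ}

namespace ParabolicData

variable (P : ParabolicData d m)

/-- The quotient of the inner dynamics by `u`. -/
noncomputable def rho (r₂ : (Fin m → ℝ) → ℝ) (u : ℝ) (lam : Fin m → ℝ) : ℝ :=
  1 + P.r₁ lam * u ^ (P.k - 1) + r₂ lam * u ^ (2 * P.k - 2)

/-- The error of the invariance equation. -/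
noncomputable def err (r₂ : (Fin m → ℝ) → ℝ) (W : ℝ × AngPar d m → Chart d) (q : ℝ × AngPar d m) :
    Chart d :=
  diagPow P.k P.q (P.rho r₂ q.1 q.2.2) (W (P.rho r₂ q.1 q.2.2 * q.1, q.2.1 + P.ω, q.2.2)) - W q -
    q.1 ^ (P.k - 1) • P.g (q.1, W q, q.2)

/-- Parameterizations with the right regularity and value at `u = 0`. -/
structure IsFormal (r₂ : (Fin m → ℝ) → ℝ) (W : ℝ × AngPar d m → Chart d) : Prop where
  analytic_r₂ : ∀ lam ∈ P.V, AnalyticAt ℝ r₂ lam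
  periodic : ∀ u, TorusPeriodic fun x => W (u, x)
  analytic : ∀ v, ∀ lam ∈ P.V, AnalyticAt ℝ W (0, v, lam)
  zero : ∀ v, ∀ lam ∈ P.V, W (0, v, lam) = P.w₀ lam

variable {P} {r₂ : (Fin m → ℝ) → ℝ} {W : ℝ × AngPar d m → Chart d} {lam : Fin m → ℝ}

lemma rho_zero : P.rho r₂ 0 lam = 1 := by
  have := P.two_le
  simp [rho, show P.k - 1 ≠ 0 by omega, show 2 * P.k - 2 ≠ 0 by omega]

lemma IsFormal.analyticAt_err (h : P.IsFormal r₂ W) (v : Fin d → ℝ) (hl : lam ∈ P.V) :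
    AnalyticAt ℝ (P.err r₂ W) (0, v, lam) := by
  have eu : AnalyticAt ℝ (fun q : ℝ × AngPar d m => q.1) (0, v, lam) := analyticAt_fst
  have eθ : AnalyticAt ℝ (fun q : ℝ × AngPar d m => q.2.1) (0, v, lam) :=
    analyticAt_fst.comp analyticAt_snd
  have el : AnalyticAt ℝ (fun q : ℝ × AngPar d m => q.2.2) (0, v, lam) :=
    analyticAt_snd.comp analyticAt_snd
  have er1 : AnalyticAt ℝ (fun q : ℝ × AngPar d m => P.r₁ q.2.2) (0, v, lam) :=
    AnalyticAt.comp (f := fun q : ℝ × AngPar d m => q.2.2) (analyticAt_r₁ hl) el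
  have er2 : AnalyticAt ℝ (fun q : ℝ × AngPar d m => r₂ q.2.2) (0, v, lam) :=
    AnalyticAt.comp (f := fun q : ℝ × AngPar d m => q.2.2) (h.analytic_r₂ lam hl) el
  have eρ : AnalyticAt ℝ (fun q : ℝ × AngPar d m => P.rho r₂ q.1 q.2.2) (0, v, lam) :=
    (analyticAt_const.add (er1.mul (eu.pow _))).add (er2.mul (eu.pow _))
  have eW := h.analytic v lam hl
  have eWp : AnalyticAt ℝ (fun q : ℝ × AngPar d m =>
      W (P.rho r₂ q.1 q.2.2 * q.1, q.2.1 + P.ω, q.2.2)) (0, v, lam) :=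
    (h.analytic (v + P.ω) lam hl).comp_of_eq
      ((eρ.mul eu).prod ((eθ.add analyticAt_const).prod el)) (by simp)
  have eg : AnalyticAt ℝ (fun q : ℝ × AngPar d m => P.g (q.1, W q, q.2)) (0, v, lam) :=
    (P.analytic_g (W (0, v, lam)) v lam hl).comp_of_eq (eu.prod (eW.prod analyticAt_snd)) rfl
  have eD : AnalyticAt ℝ (fun q : ℝ × AngPar d m => diagPow P.k P.q (P.rho r₂ q.1 q.2.2)
      (W (P.rho r₂ q.1 q.2.2 * q.1, q.2.1 + P.ω, q.2.2))) (0, v, lam) := by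
    simp only [diagPow_apply]
    exact AnalyticAt.chart_mk ((eρ.pow _).mul eWp.chart_fst) ((eρ.pow _).mul eWp.chart_mid)
      fun i => (eρ.pow _).mul (eWp.chart_ang i)
  exact (eD.sub eW).sub ((eu.pow _).smul eg)

lemma IsFormal.periodic_err (h : P.IsFormal r₂ W) (u : ℝ) : TorusPeriodic fun x => P.err r₂ W (u, x) := by
  intro n v y
  have h1 := h.periodic u n v y
  have h2 := h.periodic (P.rho r₂ u y * u) n (v + P.ω) y
  have h3 := P.periodic_g u (W (u, v, y)) n v y
  simp only at h1 h2 h3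
  simp only [err]
  rw [show (v + fun i => (n i : ℝ)) + P.ω = v + P.ω + fun i => (n i : ℝ) by abel, h1, h2, h3]

/-- Only directions tangent to u = 0 occur in the step, and there the field is explicit, so its
derivative is computed along a line. -/
lemma fderiv_g (v : Fin d → ℝ) (hl : lam ∈ P.V) (w X : Chart d) :
    fderiv ℝ (fun y : ℝ × Chart d => P.g (y.1, y.2, v, lam)) (0, w) (0, X) =
      (P.c (v, lam) * X.2.1, P.a (v, lam) * (P.k * w.1 ^ (P.k - 1) * X.1),
        (P.p * w.1 ^ (P.p - 1) * X.1) • P.b (v, lam)) := by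
  have ha : AnalyticAt ℝ (fun y : ℝ × Chart d => P.g (y.1, y.2, v, lam)) (0, w) :=
    (P.analytic_g w v lam hl).comp_of_eq
      (analyticAt_fst.prod (analyticAt_snd.prod (analyticAt_const.prod analyticAt_const))) rfl
  have hγ : HasDerivAt (fun t : ℝ => ((0 : ℝ), w + t • X)) ((0 : ℝ), X) 0 := by
    have := ((hasDerivAt_id (0 : ℝ)).smul_const X).const_add w
    simpa using (hasDerivAt_const (0 : ℝ) (0 : ℝ)).prodMk this
  have h1 : HasDerivAt (fun t : ℝ => P.g (0, w + t • X, v, lam))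
      (fderiv ℝ (fun y : ℝ × Chart d => P.g (y.1, y.2, v, lam)) (0, w) (0, X)) 0 := by
    have h0 : HasFDerivAt (fun y : ℝ × Chart d => P.g (y.1, y.2, v, lam))
      (fderiv ℝ (fun y : ℝ × Chart d => P.g (y.1, y.2, v, lam)) (0, w))
      ((fun t : ℝ => ((0 : ℝ), w + t • X)) 0) := by
      simpa using ha.differentiableAt.hasFDerivAt
    exact h0.comp_hasDerivAt 0 hγ
  have hlin : ∀ x y : ℝ, HasDerivAt (fun t : ℝ => x + t * y) y 0 := fun x y => by
    simpa using ((hasDerivAt_id (0 : ℝ)).mul_const y).const_add x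
  have hpow : ∀ n : ℕ, HasDerivAt (fun t : ℝ => (w.1 + t * X.1) ^ n) (n * w.1 ^ (n - 1) * X.1) 0 :=
    fun n => by simpa using (hlin w.1 X.1).fun_pow n
  have h2 := ((hlin w.2.1 X.2.1).const_mul (P.c (v, lam))).prodMk
    (((hpow P.k).const_mul (P.a (v, lam))).prodMk ((hpow P.p).smul_const (P.b (v, lam))))
  refine h1.unique (h2.congr_of_eventuallyEq (.of_forall fun t => ?_))
  simp [P.g_zero _ v lam hl]

/-- Raising the order of the error by one. -/
theorem IsFormal.exists_succ (h : P.IsFormal r₂ W) {n : ℕ} {e₀ : AngPar d m → Chart d}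
    (pe : TorusPeriodic e₀) (ae : ∀ v, ∀ lam ∈ P.V, AnalyticAt ℝ e₀ (v, lam))
    (he : ∀ v, ∀ lam ∈ P.V, (fun u : ℝ => P.err r₂ W (u, v, lam) - u ^ (n + P.k - 1) • e₀ (v, lam))
      =o[𝓝 0] fun u : ℝ => u ^ (n + P.k - 1))
    {x : (Fin m → ℝ) → Chart d} {σ : (Fin m → ℝ) → ℝ} (ax : ∀ lam ∈ P.V, AnalyticAt ℝ x lam)
    (aσ : ∀ lam ∈ P.V, AnalyticAt ℝ σ lam) (hσ : n = P.k - 1 ∨ σ = 0) (hx : 1 ≤ n ∨ x = 0)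
    (h1 : ∀ lam ∈ P.V, liftAvg (fun y => (e₀ y).1) lam + P.r₁ lam * (n + 2) * (x lam).1 + 2 * σ lam -
      P.cAvg lam * (x lam).2.1 = 0)
    (h2 : ∀ lam ∈ P.V, liftAvg (fun y => (e₀ y).2.1) lam + P.r₁ lam * (n + P.k + 1) * (x lam).2.1 +
      σ lam * (P.k + 1) * (P.w₀ lam).2.1 - P.aAvg lam * (P.k * (x lam).1) = 0)
    (h3 : ∀ lam ∈ P.V, ∀ i, liftAvg (fun y => (e₀ y).2.2 i) lam +
      P.r₁ lam * (n + P.q) * (x lam).2.2 i + σ lam * P.q * (P.w₀ lam).2.2 i -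
        P.bAvg lam i * (P.p * (x lam).1) = 0) :
    ∃ r₂' W', P.IsFormal r₂' W' ∧ ∀ v, ∀ lam ∈ P.V,
      (fun u : ℝ => P.err r₂' W' (u, v, lam)) =O[𝓝 0] fun u : ℝ => u ^ (n + 1 + P.k - 1) := by
  have hk := P.two_le
  let S : (Fin m → ℝ) → Chart d := fun lam =>
    P.r₁ lam • ((n : ℝ) • x lam + diagWeight P.k P.q (x lam)) + σ lam • diagWeight P.k P.q (P.w₀ lam)
  -- The coefficient of u^(n+k-1) in the new error before the oscillating correction. The hypotheses
  -- `h1`, `h2`, `h3` say exactly that its average is zero.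
  let T : AngPar d m → Chart d := fun y => e₀ y + S y.2 -
    (P.c y * (x y.2).2.1, P.a y * (P.k * (x y.2).1), (P.p * (x y.2).1) • P.b y)
  have aS : ∀ v, ∀ lam ∈ P.V, AnalyticAt ℝ (fun y : AngPar d m => S y.2) (v, lam) := by
    intro v lam hl
    have a1 := analyticAt_r₁ hl
    have a2 := ax lam hl
    have a3 := aσ lam hl
    have a4 := analyticAt_w₀ hl
    have a5 : AnalyticAt ℝ S lam := by
      have b1 : AnalyticAt ℝ (fun lam => (n : ℝ) • x lam) lam := by
        have := a2.const_smul (c := (n : ℝ))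
        exact this
      refine (a1.smul (b1.add ?_)).add (a3.smul ?_)
      · exact ((diagWeight P.k P.q).analyticAt _).comp a2
      · exact ((diagWeight P.k P.q).analyticAt _).comp a4
    exact a5.comp_of_eq (f := fun y : AngPar d m => y.2) analyticAt_snd rfl
  have axx : ∀ v, ∀ lam ∈ P.V, AnalyticAt ℝ (fun y : AngPar d m => x y.2) (v, lam) :=
    fun v lam hl => AnalyticAt.comp (f := fun y : AngPar d m => y.2) (ax lam hl) analyticAt_snd
  have aT : ∀ v, ∀ lam ∈ P.V, AnalyticAt ℝ T (v, lam) := by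
    intro v lam hl
    refine ((ae v lam hl).add (aS v lam hl)).sub (AnalyticAt.chart_mk ?_ ?_ fun i => ?_)
    · exact (P.analytic_c v lam hl).mul (axx v lam hl).chart_mid
    · exact (P.analytic_a v lam hl).mul (analyticAt_const.mul (axx v lam hl).chart_fst)
    · exact (analyticAt_const.mul (axx v lam hl).chart_fst).mul
        (analyticAt_pi_iff.1 (P.analytic_b v lam hl) i)
  have pT : TorusPeriodic T := fun N v y => by
    simp only [T, pe N v y, P.periodic_c N v y, P.periodic_a N v y, P.periodic_b N v y]
  obtain ⟨ψ, pψ, aψ, eψ⟩ := exists_cohomological_solution_chart P.dioph pT aT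
    (fun lam hl => by
      have := liftAvg_add_const_sub_mul (f := fun y => (e₀ y).1) (c := P.c)
        (fun N v y => by simp only [pe N v y]) P.periodic_c (fun v => (ae v lam hl).chart_fst)
        (fun v => P.analytic_c v lam hl) (fun lam => (S lam).1) (fun lam => (x lam).2.1)
      refine this.trans (Eq.trans ?_ (h1 lam hl))
      simp only [S, Prod.fst_add, Prod.smul_fst, diagWeight_apply, smul_eq_mul, cAvg, w₀]
      ring)
    (fun lam hl => by
      have := liftAvg_add_const_sub_mul (f := fun y => (e₀ y).2.1) (c := P.a)
        (fun N v y => by simp only [pe N v y]) P.periodic_a (fun v => (ae v lam hl).chart_mid)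
        (fun v => P.analytic_a v lam hl) (fun lam => (S lam).2.1) (fun lam => P.k * (x lam).1)
      refine this.trans (Eq.trans ?_ (h2 lam hl))
      simp only [S, Prod.fst_add, Prod.snd_add, Prod.smul_fst, Prod.smul_snd, diagWeight_apply,
        smul_eq_mul, aAvg]
      ring)
    (fun i lam hl => by
      have := liftAvg_add_const_sub_mul (f := fun y => (e₀ y).2.2 i) (c := fun y => P.b y i)
        (fun N v y => by simp only [pe N v y]) (fun N v y => by simp only [P.periodic_b N v y])
        (fun v => (ae v lam hl).chart_ang i)
        (fun v => analyticAt_pi_iff.1 (P.analytic_b v lam hl) i) (fun lam => (S lam).2.2 i)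
        (fun lam => P.p * (x lam).1)
      refine Eq.trans ?_ (this.trans (Eq.trans ?_ (h3 lam hl i)))
      · congr 1
        funext y
        simp [T, mul_comm]
      simp only [S, Prod.snd_add, Prod.smul_snd, diagWeight_apply, Pi.add_apply, Pi.smul_apply,
        smul_eq_mul, bAvg]
      ring)
  -- The minus sign turns the contribution of this term into -(ψ(θ + ω) - ψ(θ)), which cancels `T`.
  let W' : ℝ × AngPar d m → Chart d := fun q =>
    W q + q.1 ^ n • x q.2.2 + q.1 ^ (n + P.k - 1) • (-ψ q.2)
  have hF : P.IsFormal (fun lam => r₂ lam + σ lam) W' := by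
    refine ⟨fun lam hl => (h.analytic_r₂ lam hl).add (aσ lam hl), fun u N v y => ?_,
      fun v lam hl => ?_, fun v lam hl => ?_⟩
    · have h1 := h.periodic u N v y
      simp only at h1
      simp only [W', h1, pψ N v y]
    · have eu : AnalyticAt ℝ (fun q : ℝ × AngPar d m => q.1) (0, v, lam) := analyticAt_fst
      refine ((h.analytic v lam hl).add ((eu.pow _).smul ?_)).add ((eu.pow _).smul (AnalyticAt.neg ?_))
      · exact (axx v lam hl).comp_of_eq (f := fun q : ℝ × AngPar d m => q.2) analyticAt_snd rfl
      · exact (aψ v lam hl).comp_of_eq (f := fun q : ℝ × AngPar d m => q.2) analyticAt_snd rfl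
    · simp only [W', h.zero v lam hl]
      rw [zero_pow (by omega : n + P.k - 1 ≠ 0), zero_smul, add_zero]
      rcases hx with hx | hx
      · rw [zero_pow (by omega), zero_smul, add_zero]
      · simp [hx]
  refine ⟨_, W', hF, fun v lam hl => ?_⟩
  have key : (fun u : ℝ => P.err (fun lam => r₂ lam + σ lam) W' (u, v, lam)) =o[𝓝 0]
      fun u : ℝ => u ^ (n + P.k - 1) := by
    have aline : ∀ v, AnalyticAt ℝ (fun u : ℝ => W (u, v, lam)) 0 := fun v =>
      (h.analytic v lam hl).comp_of_eq (f := fun u : ℝ => (u, v, lam))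
        (analyticAt_id.prod analyticAt_const) rfl
    have aG : AnalyticAt ℝ (fun y : ℝ × Chart d => P.g (y.1, y.2, v, lam)) (0, P.w₀ lam) :=
      (P.analytic_g _ v lam hl).comp_of_eq
        (analyticAt_fst.prod (analyticAt_snd.prod (analyticAt_const.prod analyticAt_const))) rfl
    have hstep := isLittleO_step (hasStrictDerivAt_diagPow P.k P.q) (diagPow_one P.k P.q)
      (Wp := fun u => W (u, v + P.ω, lam)) (W := fun u => W (u, v, lam)) (w₀ := P.w₀ lam)
      ⟨_, (aline _).hasStrictDerivAt⟩ (h.zero _ lam hl) (aline v).continuousAt (h.zero _ lam hl)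
      aG.hasStrictFDerivAt (n := n) hk (v := x lam) (ψp := -ψ (v + P.ω, lam)) (ψ := -ψ (v, lam))
      (r₁ := P.r₁ lam) (r₂ := r₂ lam) (σ := σ lam) (hx.imp_right fun h => by rw [h]; rfl)
      (hσ.imp_right fun h => by rw [h]; rfl)
    refine (hstep.add (he v lam hl)).congr (fun u => ?_) fun u => rfl
    have e1 := eψ v lam hl
    have e2 : fderiv ℝ (fun y : ℝ × Chart d => P.g (y.1, y.2, v, lam)) (0, P.w₀ lam) (0, x lam) =
        (P.c (v, lam) * (x lam).2.1, P.a (v, lam) * (P.k * (x lam).1), (P.p * (x lam).1) • P.b (v, lam)) := by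
      rw [fderiv_g v hl]
      simp [w₀]
    rw [e2]
    simp only [T] at e1
    have e3 : P.r₁ lam • ((n : ℝ) • x lam + diagWeight P.k P.q (x lam)) +
        σ lam • diagWeight P.k P.q (P.w₀ lam) = S lam := rfl
    rw [e3]
    simp only [err, W', rho]
    generalize (P.c (v, lam) * (x lam).2.1, P.a (v, lam) * (P.k * (x lam).1),
      (P.p * (x lam).1) • P.b (v, lam)) = y at e1 ⊢
    have e4 : S lam + -ψ (v + P.ω, lam) - -ψ (v, lam) - y = -e₀ (v, lam) := by
      linear_combination (norm := module) -e1
    rw [e4]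
    module
  have ha : AnalyticAt ℝ (fun u : ℝ => P.err (fun lam => r₂ lam + σ lam) W' (u, v, lam)) 0 :=
    (hF.analyticAt_err v hl).comp_of_eq (f := fun u : ℝ => (u, v, lam))
      (analyticAt_id.prod analyticAt_const) rfl
  refine (isBigO_succ_of_isLittleO ha key).congr_right fun u => ?_
  rw [show n + P.k - 1 + 1 = n + 1 + P.k - 1 by omega]

/-- Approximate solutions of the invariance equation, to any order. -/
theorem exists_formal (P : ParabolicData d m) (n : ℕ) : ∃ r₂ W, P.IsFormal r₂ W ∧ ∀ v, ∀ lam ∈ P.V,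
    (fun u : ℝ => P.err r₂ W (u, v, lam)) =O[𝓝 0] fun u : ℝ => u ^ (n + 1 + P.k - 1) := by
  have hk := P.two_le
  induction n with
  | zero =>
    have hF : P.IsFormal 0 (fun q => P.w₀ q.2.2) := by
      refine ⟨fun _ _ => analyticAt_const, fun u N v y => rfl, fun v lam hl => ?_, fun v lam hl => rfl⟩
      exact AnalyticAt.comp (f := fun q : ℝ × AngPar d m => q.2.2) (analyticAt_w₀ hl)
        (analyticAt_snd.comp analyticAt_snd)
    -- The error of the constant parameterization w₀ has leading coefficient r₁ D'(1) w₀ - g(0, w₀),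
    -- whose average vanishes by the choice of w₀ and r₁. The superfluous `0 +` and `* 1` give the
    -- components the shape of `liftAvg_add_const_sub_mul`.
    let e₀ : AngPar d m → Chart d := fun y => (0 + P.r₁ y.2 * 2 - P.c y * (P.w₀ y.2).2.1,
      0 + P.r₁ y.2 * (P.k + 1) * (P.w₀ y.2).2.1 - P.a y * 1,
      fun i => 0 + P.r₁ y.2 * P.q * (P.w₀ y.2).2.2 i - P.b y i * 1)
    have pz : TorusPeriodic (fun _ : AngPar d m => (0 : ℝ)) := fun _ _ _ => rfl
    refine hF.exists_succ (n := 0) (e₀ := e₀) (x := 0) (σ := 0) (fun N v y => ?_)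
      (fun v lam hl => ?_) (fun v lam hl => ?_) (fun _ _ => analyticAt_const)
      (fun _ _ => analyticAt_const) (.inr rfl) (.inr rfl) (fun lam hl => ?_) (fun lam hl => ?_)
      (fun lam hl i => ?_)
    · simp only [e₀, P.periodic_c N v y, P.periodic_a N v y, P.periodic_b N v y]
    · have el : AnalyticAt ℝ (fun q : AngPar d m => q.2) (v, lam) := analyticAt_snd
      have a1 : AnalyticAt ℝ (fun q : AngPar d m => P.r₁ q.2) (v, lam) :=
        AnalyticAt.comp (f := fun q : AngPar d m => q.2) (analyticAt_r₁ hl) el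
      have a2 : AnalyticAt ℝ (fun q : AngPar d m => P.w₀ q.2) (v, lam) :=
        AnalyticAt.comp (f := fun q : AngPar d m => q.2) (analyticAt_w₀ hl) el
      refine AnalyticAt.chart_mk ?_ ?_ fun i => ?_
      · exact (analyticAt_const.add (a1.mul analyticAt_const)).sub
          ((P.analytic_c v lam hl).mul a2.chart_mid)
      · exact (analyticAt_const.add ((a1.mul analyticAt_const).mul a2.chart_mid)).sub
          ((P.analytic_a v lam hl).mul analyticAt_const)
      · exact (analyticAt_const.add ((a1.mul analyticAt_const).mul (a2.chart_ang i))).sub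
          ((analyticAt_pi_iff.1 (P.analytic_b v lam hl) i).mul analyticAt_const)
    · have aG : AnalyticAt ℝ (fun u : ℝ => P.g (u, P.w₀ lam, v, lam)) 0 :=
        (P.analytic_g _ v lam hl).comp_of_eq
          (analyticAt_id.prod (analyticAt_const.prod (analyticAt_const.prod analyticAt_const))) rfl
      have hρ : Tendsto (fun u : ℝ => 1 + P.r₁ lam * u ^ (P.k - 1)) (𝓝 0) (𝓝 1) := by
        have : Continuous fun u : ℝ => 1 + P.r₁ lam * u ^ (P.k - 1) := by fun_prop
        simpa [show P.k - 1 ≠ 0 by omega] using this.tendsto 0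
      have t1 : (fun u : ℝ => diagPow P.k P.q (1 + P.r₁ lam * u ^ (P.k - 1)) (P.w₀ lam) - P.w₀ lam -
          u ^ (P.k - 1) • P.r₁ lam • diagWeight P.k P.q (P.w₀ lam)) =o[𝓝 0] fun u : ℝ => u ^ (P.k - 1) := by
        have h1 := ((hasStrictDerivAt_diagPow (𝕜 := ℝ) P.k P.q).clm_apply
          (hasStrictDerivAt_const (1 : ℝ) (P.w₀ lam))).hasDerivAt.hasFDerivAt.isLittleO.comp_tendsto hρ
        have h2 : (fun u : ℝ => P.r₁ lam * u ^ (P.k - 1)) =O[𝓝 0] fun u : ℝ => u ^ (P.k - 1) :=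
          (isBigO_refl _ _).const_mul_left _
        refine IsLittleO.trans_isBigO (h1.congr (fun u => ?_) fun u => ?_) h2
        · simp only [Function.comp_apply, diagPow_one, ContinuousLinearMap.id_apply, map_zero, add_zero,
            ContinuousLinearMap.toSpanSingleton_apply, add_sub_cancel_left, smul_smul]
          rw [mul_comm (P.r₁ lam)]
        · simp
      have t2 : (fun u : ℝ => u ^ (P.k - 1) • (P.g (u, P.w₀ lam, v, lam) - P.g (0, P.w₀ lam, v, lam)))
          =o[𝓝 0] fun u : ℝ => u ^ (P.k - 1) := by
        have h1 : (fun u : ℝ => P.g (u, P.w₀ lam, v, lam) - P.g (0, P.w₀ lam, v, lam)) =o[𝓝 0]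
            fun _ : ℝ => (1 : ℝ) := by
          rw [isLittleO_one_iff]
          simpa using aG.continuousAt.tendsto.sub_const (P.g (0, P.w₀ lam, v, lam))
        refine ((isBigO_refl (fun u : ℝ => u ^ (P.k - 1)) (𝓝 0)).smul_isLittleO h1).congr_right
          fun u => by rw [smul_eq_mul, mul_one]
      refine (t1.sub t2).congr (fun u => ?_) fun u => by rw [zero_add]
      have e1 : e₀ (v, lam) = P.r₁ lam • diagWeight P.k P.q (P.w₀ lam) - P.g (0, P.w₀ lam, v, lam) := by
        rw [P.g_zero _ v lam hl]
        refine Prod.ext ?_ (Prod.ext ?_ (funext fun i => ?_))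
        · simp [e₀, w₀]
        · simp [e₀, w₀]; ring
        · simp [e₀, w₀]; ring
      rw [e1]
      simp only [err, rho, Pi.zero_apply, zero_mul, add_zero, zero_add]
      module
    · have := liftAvg_add_const_sub_mul pz P.periodic_c (fun v => analyticAt_const)
        (fun v => P.analytic_c v lam hl) (fun lam => P.r₁ lam * 2) (fun lam => (P.w₀ lam).2.1)
      have h0 := P.cAvg_pos hl
      have hz : liftAvg (fun _ : AngPar d m => (0 : ℝ)) lam = 0 := by simp [liftAvg]
      rw [hz, zero_add] at this
      rw [show liftAvg (fun y => (e₀ y).1) lam = _ from this]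
      change P.r₁ lam * 2 - P.cAvg lam * (2 * P.r₁ lam / P.cAvg lam) + _ + _ - _ = 0
      simp only [Pi.zero_apply, Prod.fst_zero, Prod.snd_zero]
      field_simp
      ring
    · have := liftAvg_add_const_sub_mul pz P.periodic_a (fun v => analyticAt_const)
        (fun v => P.analytic_a v lam hl) (fun lam => P.r₁ lam * (P.k + 1) * (P.w₀ lam).2.1) (fun lam => 1)
      have h0 := P.cAvg_pos hl
      have h4 := r₁_sq hl
      have hz : liftAvg (fun _ : AngPar d m => (0 : ℝ)) lam = 0 := by simp [liftAvg]
      rw [hz, zero_add] at this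
      rw [show liftAvg (fun y => (e₀ y).2.1) lam = _ from this]
      change P.r₁ lam * (P.k + 1) * (2 * P.r₁ lam / P.cAvg lam) - P.aAvg lam * 1 + _ + _ - _ = 0
      simp only [Pi.zero_apply, Prod.fst_zero, Prod.snd_zero]
      field_simp
      linear_combination h4
    · have := liftAvg_add_const_sub_mul (c := fun x => P.b x i) pz
        (fun N v y => by simp only [P.periodic_b N v y]) (fun v => analyticAt_const)
        (fun v => analyticAt_pi_iff.1 (P.analytic_b v lam hl) i)
        (fun lam => P.r₁ lam * P.q * (P.w₀ lam).2.2 i) (fun lam => 1)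
      have h0 := (P.r₁_neg hl).ne
      have h1 := P.q_pos.ne'
      have hz : liftAvg (fun _ : AngPar d m => (0 : ℝ)) lam = 0 := by simp [liftAvg]
      rw [hz, zero_add] at this
      rw [show liftAvg (fun y => (e₀ y).2.2 i) lam = _ from this]
      change P.r₁ lam * P.q * ((P.q * P.r₁ lam)⁻¹ * P.bAvg lam i) - P.bAvg lam i * 1 + _ + _ - _ = 0
      simp only [Pi.zero_apply, Prod.fst_zero, Prod.snd_zero]
      field_simp
      ring
  | succ n ih =>
    obtain ⟨r₂, W, hF, hO⟩ := ih
    have aerr : ∀ v, ∀ lam ∈ P.V, AnalyticAt ℝ (fun u : ℝ => P.err r₂ W (u, v, lam)) 0 :=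
      fun v lam hl => (hF.analyticAt_err v hl).comp_of_eq (f := fun u : ℝ => (u, v, lam))
        (analyticAt_id.prod analyticAt_const) rfl
    set N := n + 1 + P.k - 1 with hN
    -- The leading coefficient of the error is an iterated divided difference at u = 0, so it is
    -- analytic jointly in the angles and the parameter, and periodic.
    let e₀ : AngPar d m → Chart d := fun x => uDiv^[N] (P.err r₂ W) (0, x)
    have ae' : ∀ v, ∀ lam ∈ P.V, AnalyticAt ℝ (uDiv^[N] (P.err r₂ W)) (0, v, lam) :=
      fun v lam hl => analyticAt_uDiv_iterate (FC := ℂ × ℂ × (Fin d → ℂ)) (hF.analyticAt_err v hl) N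
    have ae : ∀ v, ∀ lam ∈ P.V, AnalyticAt ℝ e₀ (v, lam) := fun v lam hl =>
      (ae' v lam hl).comp_of_eq (f := fun x : AngPar d m => ((0 : ℝ), x))
        (analyticAt_const.prod analyticAt_id) rfl
    have pe : TorusPeriodic e₀ := fun M v y => by
      have : (fun u => P.err r₂ W (u, (v + fun i => (M i : ℝ)), y)) = fun u => P.err r₂ W (u, v, y) :=
        funext fun u => hF.periodic_err u M v y
      simp only [e₀, uDiv_iterate_apply, this]
    let E : (Fin m → ℝ) → Chart d := fun lam => (liftAvg (fun y => (e₀ y).1) lam,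
      liftAvg (fun y => (e₀ y).2.1) lam, fun i => liftAvg (fun y => (e₀ y).2.2 i) lam)
    have aE : ∀ lam ∈ P.V, AnalyticAt ℝ E lam := by
      refine fun lam hl => AnalyticAt.chart_mk ?_ ?_ fun i => ?_
      · exact analyticAt_torus_average (h := fun y => (e₀ y).1) (fun N v y => by simp only [pe N v y])
          fun v => (ae v lam hl).chart_fst
      · exact analyticAt_torus_average (h := fun y => (e₀ y).2.1) (fun N v y => by simp only [pe N v y])
          fun v => (ae v lam hl).chart_mid
      · exact analyticAt_torus_average (h := fun y => (e₀ y).2.2 i)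
          (fun N v y => by simp only [pe N v y]) fun v => (ae v lam hl).chart_ang i
    obtain ⟨x, σ, ax, aσ, hσ, heq⟩ := exists_averaged_solution aE (n := n + 1) (by omega)
    refine hF.exists_succ pe ae (fun v lam hl => ?_) ax aσ hσ (.inl (by omega))
      (fun lam hl => (heq lam hl).1) (fun lam hl => (heq lam hl).2.1) fun lam hl => (heq lam hl).2.2
    have hc : ContinuousAt (fun u : ℝ => uDiv^[N] (P.err r₂ W) (u, v, lam)) 0 :=
      (ae' v lam hl).continuousAt.comp (f := fun u : ℝ => (u, v, lam)) (by fun_prop)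
    have h1 : (fun u : ℝ => uDiv^[N] (P.err r₂ W) (u, v, lam) - e₀ (v, lam)) =o[𝓝 0]
        fun _ : ℝ => (1 : ℝ) := by
      rw [isLittleO_one_iff]
      simpa [e₀] using hc.tendsto.sub_const (e₀ (v, lam))
    refine ((isBigO_refl (fun u : ℝ => u ^ N) (𝓝 0)).smul_isLittleO h1).congr (fun u => ?_)
      fun u => by rw [smul_eq_mul, mul_one]
    rw [smul_sub, uDiv_iterate_of_isBigO (aerr v lam hl) (hO v lam hl)]

end ParabolicData

end FormalSolution

/-! ### A fixed point theorem with weights along orbits -/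

section FixedPoint

variable {E F : Type*} [NormedAddCommGroup E] [NormedSpace ℂ E] [NormedAddCommGroup F] [NormedSpace ℂ F]

/-- By Bernoulli's inequality (s / s')^N ≤ s / (s + N ν), a gain of about N ν / s, which must beat
the losses (D₁ + M + 1) / s. The bound N ν ≤ s controls the cross term at the price of a second M +
1, whence the 2M + 2. -/
lemma one_add_div_mul_inv_pow_le {s s' ν D₁ M C : ℝ} {N : ℕ} (hs : 0 < s) (hν : 0 < ν) (hD : 0 ≤ D₁)
    (hM : 0 ≤ M) (hC : 0 ≤ C) (hs' : s + ν ≤ s') (hN : D₁ + 2 * M + 2 ≤ N * ν) (hsN : N * ν ≤ s) :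
    C / s ^ (N + 1) + ((1 + D₁ / s) * (C / s' ^ N) + M / s * (C / s ^ N)) ≤ C / s ^ N := by
  have h1 : C / s' ^ N ≤ C / s ^ N * (s / (s + N * ν)) := by
    have hb : 1 + N * (ν / s) ≤ (1 + ν / s) ^ N :=
      one_add_mul_le_pow (by have := div_pos hν hs; linarith) N
    have e1 : s ^ N * (1 + N * (ν / s)) ≤ s' ^ N := by
      calc s ^ N * (1 + N * (ν / s)) ≤ s ^ N * (1 + ν / s) ^ N := by gcongr
        _ = (s + ν) ^ N := by rw [← mul_pow]; congr 1; field_simp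
        _ ≤ s' ^ N := by gcongr
    have hp : 0 < s ^ N * (1 + N * (ν / s)) := by positivity
    calc C / s' ^ N ≤ C / (s ^ N * (1 + N * (ν / s))) := div_le_div_of_nonneg_left hC hp e1
      _ = _ := by field_simp
  have hX : 0 ≤ C / s ^ N := by positivity
  have h2 : C / s ^ (N + 1) = C / s ^ N * (1 / s) := by rw [pow_succ]; field_simp
  have h3 : (1 + D₁ / s) * (s / (s + N * ν)) ≤ 1 - (M + 1) / s := by
    have : (0 : ℝ) < s + N * ν := by positivity
    rw [show (1 + D₁ / s) * (s / (s + N * ν)) = (s + D₁) / (s + N * ν) by field_simp,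
      show 1 - (M + 1) / s = (s - (M + 1)) / s by field_simp, div_le_div_iff₀ this hs]
    have h4 := mul_le_mul_of_nonneg_left hsN (by linarith : 0 ≤ M + 1)
    have h5 := mul_le_mul_of_nonneg_right hN hs.le
    linarith
  calc C / s ^ (N + 1) + ((1 + D₁ / s) * (C / s' ^ N) + M / s * (C / s ^ N))
      ≤ C / s ^ N * (1 / s) + ((1 + D₁ / s) * (C / s ^ N * (s / (s + N * ν))) + M / s * (C / s ^ N)) := by
        rw [h2]; gcongr
    _ = C / s ^ N * ((1 + D₁ / s) * (s / (s + N * ν)) + (M + 1) / s) := by ring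
    _ ≤ C / s ^ N * 1 := by gcongr; linarith
    _ = C / s ^ N := mul_one _

/-- Fixed points of operators `S` which are contracting in the sense of weighted estimates along the
orbits of a map `T` for which `s` increases at least by `ν`. -/
theorem exists_fixedPoint [FiniteDimensional ℂ E] [CompleteSpace F] {Ω : Set E} (hΩ : IsOpen Ω)
    {T : E → E} (hT : MapsTo T Ω Ω) {s : E → ℝ} {ν D₁ M C R : ℝ} {N : ℕ} (hν : 0 < ν) (hD : 0 ≤ D₁)
    (hM : 0 ≤ M) (hC : 0 ≤ C) (hs0 : ∀ x ∈ Ω, 0 < s x) (hs : ∀ x ∈ Ω, s x + ν ≤ s (T x))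
    (hN : D₁ + 2 * M + 2 ≤ N * ν) (hsN : ∀ x ∈ Ω, N * ν ≤ s x) (hR : ∀ x ∈ Ω, C / s x ^ N ≤ R)
    {S : (E → F) → E → F}
    (hS0 : ∀ x ∈ Ω, ‖S 0 x‖ ≤ C / s x ^ (N + 1))
    (hS : ∀ f g : E → F, (∀ x ∈ Ω, ‖f x‖ ≤ R) → (∀ x ∈ Ω, ‖g x‖ ≤ R) → ∀ x ∈ Ω,
      ‖S f x - S g x‖ ≤ (1 + D₁ / s x) * ‖f (T x) - g (T x)‖ + M / s x * ‖f x - g x‖)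
    (hSd : ∀ f : E → F, DifferentiableOn ℂ f Ω → (∀ x ∈ Ω, ‖f x‖ ≤ R) → DifferentiableOn ℂ (S f) Ω) :
    ∃ f : E → F, AnalyticOnNhd ℂ f Ω ∧ (∀ x ∈ Ω, ‖f x‖ ≤ C / s x ^ N) ∧ (∀ x ∈ Ω, S f x = f x) ∧
      (∀ j, ∀ x ∈ Ω, ‖S^[j] 0 x‖ ≤ R) ∧ ∀ x ∈ Ω, Tendsto (fun j => S^[j] 0 x) atTop (𝓝 (f x)) := by
  -- The sum of all increments is bounded at once. The initial increment costs C / s^(N+1); the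
  -- others are controlled by shorter sums at T x and at x, and `one_add_div_mul_inv_pow_le`
  -- reproduces the same bound. No pointwise contraction is available, as the factor in front of f
  -- (T x) is 1 + D₁ / s.
  have key : ∀ J : ℕ, ∀ x ∈ Ω, ∑ j ∈ Finset.range J, ‖S^[j + 1] 0 x - S^[j] 0 x‖ ≤ C / s x ^ N := by
    intro J
    induction J with
    | zero => intro x hx; simpa using div_nonneg hC (pow_nonneg (hs0 x hx).le N)
    | succ J ih =>
      -- By telescoping, the iterates used so far stay in the range where the Lipschitz estimate for
      -- `S` is valid.
      have hb : ∀ j ≤ J, ∀ x ∈ Ω, ‖S^[j] 0 x‖ ≤ R := by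
        intro j hj x hx
        refine le_trans ?_ (hR x hx)
        have h1 : S^[j] 0 x = ∑ i ∈ Finset.range j, (S^[i + 1] 0 x - S^[i] 0 x) := by
          rw [Finset.sum_range_sub (fun i => S^[i] 0 x)]; simp
        rw [h1]
        refine (norm_sum_le _ _).trans (le_trans ?_ (ih x hx))
        exact Finset.sum_le_sum_of_subset_of_nonneg (Finset.range_mono hj) fun _ _ _ => norm_nonneg _
      intro x hx
      rw [Finset.sum_range_succ']
      have hsx := hs0 x hx
      have h0 : ‖S^[0 + 1] 0 x - S^[0] 0 x‖ ≤ C / s x ^ (N + 1) := by simpa using hS0 x hx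
      have h1 : ∑ j ∈ Finset.range J, ‖S^[j + 1 + 1] 0 x - S^[j + 1] 0 x‖ ≤
          (1 + D₁ / s x) * (C / s (T x) ^ N) + M / s x * (C / s x ^ N) := by
        calc _ ≤ ∑ j ∈ Finset.range J, ((1 + D₁ / s x) * ‖S^[j + 1] 0 (T x) - S^[j] 0 (T x)‖ +
              M / s x * ‖S^[j + 1] 0 x - S^[j] 0 x‖) := by
              refine Finset.sum_le_sum fun j hj => ?_
              rw [Finset.mem_range] at hj
              rw [Function.iterate_succ_apply', Function.iterate_succ_apply' S j]
              have := hS (S^[j + 1] 0) (S^[j] 0) (hb _ (by omega)) (hb _ (by omega)) x hx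
              rwa [Function.iterate_succ_apply'] at this
          _ = (1 + D₁ / s x) * ∑ j ∈ Finset.range J, ‖S^[j + 1] 0 (T x) - S^[j] 0 (T x)‖ +
              M / s x * ∑ j ∈ Finset.range J, ‖S^[j + 1] 0 x - S^[j] 0 x‖ := by
              rw [Finset.sum_add_distrib, Finset.mul_sum, Finset.mul_sum]
          _ ≤ _ := by
              have := ih (T x) (hT hx)
              have := ih x hx
              gcongr
      have h2 := one_add_div_mul_inv_pow_le hsx hν hD hM hC (hs x hx) hN (hsN x hx)
      linarith
  have hb : ∀ j, ∀ x ∈ Ω, ‖S^[j] 0 x‖ ≤ C / s x ^ N := by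
    intro j x hx
    have h1 : S^[j] 0 x = ∑ i ∈ Finset.range j, (S^[i + 1] 0 x - S^[i] 0 x) := by
      rw [Finset.sum_range_sub (fun i => S^[i] 0 x)]; simp
    rw [h1]
    exact (norm_sum_le _ _).trans (key j x hx)
  have hconv : ∀ x ∈ Ω, ∃ y, Tendsto (fun j => S^[j] 0 x) atTop (𝓝 y) := by
    intro x hx
    refine cauchySeq_tendsto_of_complete (cauchySeq_of_summable_dist ?_)
    refine summable_of_sum_range_le (c := C / s x ^ N) (fun _ => dist_nonneg) fun J => ?_
    simpa only [dist_eq_norm', Nat.succ_eq_add_one] using key J x hx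
  classical
  let f : E → F := fun x => if hx : x ∈ Ω then (hconv x hx).choose else 0
  have hf : ∀ x ∈ Ω, Tendsto (fun j => S^[j] 0 x) atTop (𝓝 (f x)) := by
    intro x hx
    simp only [f, dif_pos hx]
    exact (hconv x hx).choose_spec
  have hfb : ∀ x ∈ Ω, ‖f x‖ ≤ C / s x ^ N := fun x hx =>
    le_of_tendsto (hf x hx).norm (.of_forall fun j => hb j x hx)
  have hd : ∀ j, DifferentiableOn ℂ (S^[j] 0) Ω := by
    intro j
    induction j with
    | zero => exact differentiableOn_const (0 : F)
    | succ j ih =>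
      rw [Function.iterate_succ_apply']
      exact hSd _ ih fun x hx => (hb j x hx).trans (hR x hx)
  have hG : GateauxOn f Ω := GateauxOn.of_tendsto hΩ
    (fun j => (hd j).gateauxOn hΩ) (fun j x hx => (hb j x hx).trans (hR x hx)) hf
  refine ⟨f, hG.analyticOnNhd hΩ fun x hx => (hfb x hx).trans (hR x hx), hfb, fun x hx => ?_,
    fun j x hx => (hb j x hx).trans (hR x hx), hf⟩
  refine tendsto_nhds_unique (f := fun j => S^[j + 1] 0 x) (l := atTop) ?_
    ((tendsto_add_atTop_iff_nat 1).2 (hf x hx))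
  rw [tendsto_iff_norm_sub_tendsto_zero]
  refine squeeze_zero (fun _ => norm_nonneg _) (fun j => ?_) (?_ : Tendsto (fun j =>
    (1 + D₁ / s x) * ‖S^[j] 0 (T x) - f (T x)‖ + M / s x * ‖S^[j] 0 x - f x‖) atTop (𝓝 0))
  · rw [Function.iterate_succ_apply']
    exact hS _ _ (fun y hy => (hb j y hy).trans (hR y hy)) (fun y hy => (hfb y hy).trans (hR y hy)) x hx
  · have h1 := (tendsto_iff_norm_sub_tendsto_zero.1 (hf _ (hT hx))).const_mul (1 + D₁ / s x)
    have h2 := (tendsto_iff_norm_sub_tendsto_zero.1 (hf x hx)).const_mul (M / s x)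
    simpa using h1.add h2

end FixedPoint

/-! ### The inner dynamics near infinity in the variable w -/

section ComplexGeometry

lemma one_add_pow_le_one_add_mul {x : ℝ} (h0 : 0 ≤ x) (h1 : x ≤ 1) (n : ℕ) :
    (1 + x) ^ n ≤ 1 + (2 ^ n - 1) * x := by
  induction n with
  | zero => simp
  | succ n ih =>
    have h2 : (1 : ℝ) ≤ 2 ^ n := one_le_pow₀ (by norm_num)
    calc (1 + x) ^ (n + 1) = (1 + x) ^ n * (1 + x) := pow_succ _ _
      _ ≤ (1 + (2 ^ n - 1) * x) * (1 + x) := by gcongr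
      _ ≤ 1 + (2 ^ (n + 1) - 1) * x := by
        have : 0 ≤ (2 ^ n - 1) * (x * (1 - x)) :=
          mul_nonneg (by linarith) (mul_nonneg h0 (by linarith))
        rw [pow_succ]; nlinarith

/-- All three exponents are at most k + q + 2, so one constant serves for every component. -/
lemma norm_diagPow_le {d : ℕ} (k q : ℕ) {y : ℂ} {t : ℝ} (ht : t ≤ 1) (hy : ‖y - 1‖ ≤ t)
    (w : ℂ × ℂ × (Fin d → ℂ)) :
    ‖diagPow k q y w‖ ≤ (1 + 2 ^ (k + q + 2) * t) * ‖w‖ := by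
  have ht0 : 0 ≤ t := (norm_nonneg _).trans hy
  have hy1 : ‖y‖ ≤ 1 + t := by
    have := norm_add_le (y - 1) 1
    simp only [sub_add_cancel, norm_one] at this
    linarith
  have hp : ∀ j ≤ k + q + 2, ‖y ^ j‖ ≤ 1 + 2 ^ (k + q + 2) * t := by
    intro j hj
    rw [norm_pow]
    calc ‖y‖ ^ j ≤ (1 + t) ^ j := by gcongr
      _ ≤ (1 + t) ^ (k + q + 2) := pow_le_pow_right₀ (by linarith) hj
      _ ≤ 1 + (2 ^ (k + q + 2) - 1) * t := one_add_pow_le_one_add_mul ht0 ht _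
      _ ≤ _ := by linarith
  have h0 : (0 : ℝ) ≤ 1 + 2 ^ (k + q + 2) * t := by positivity
  rw [diagPow_apply, norm_prod_le_iff, norm_prod_le_iff]
  refine ⟨?_, ?_, ?_⟩
  · rw [norm_mul]
    exact mul_le_mul (hp 2 (by omega)) (norm_fst_le w) (norm_nonneg _) h0
  · rw [norm_mul]
    exact mul_le_mul (hp (k + 1) (by omega)) ((norm_fst_le w.2).trans (norm_snd_le w)) (norm_nonneg _) h0
  · rw [norm_smul]
    exact mul_le_mul (hp q (by omega)) ((norm_snd_le w.2).trans (norm_snd_le w)) (norm_nonneg _) h0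

/-- The branch of `w ^ (-1 / κ)` which is positive on the positive axis. -/
noncomputable def negRoot (κ : ℕ) (w : ℂ) : ℂ := Complex.exp (-(Complex.log w / κ))

lemma negRoot_pow {κ : ℕ} (hκ : κ ≠ 0) {w : ℂ} (hw : w ≠ 0) : negRoot κ w ^ κ = w⁻¹ := by
  have : (κ : ℂ) ≠ 0 := by exact_mod_cast hκ
  rw [negRoot, ← Complex.exp_nat_mul, mul_neg, mul_div_cancel₀ _ this, Complex.exp_neg,
    Complex.exp_log hw]

lemma negRoot_ofReal {κ : ℕ} (hκ : κ ≠ 0) {u : ℝ} (hu : 0 < u) : negRoot κ ((u ^ κ)⁻¹ : ℝ) = u := by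
  have : (κ : ℝ) ≠ 0 := by exact_mod_cast hκ
  rw [negRoot, ← Complex.ofReal_log (by positivity), Real.log_inv, Real.log_pow]
  rw [show (-(((-(κ * Real.log u) : ℝ) : ℂ) / κ)) = ((Real.log u : ℝ) : ℂ) by
    push_cast; field_simp, ← Complex.ofReal_exp, Real.exp_log hu]

lemma norm_negRoot_lt {κ : ℕ} (hκ : κ ≠ 0) {w : ℂ} {ε : ℝ} (hε : 0 < ε) (hw : (ε ^ κ)⁻¹ < w.re) :
    ‖negRoot κ w‖ < ε := by
  have h0 : 0 < w.re := lt_trans (by positivity) hw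
  have h1 : w ≠ 0 := fun h => by simp [h] at h0
  refine lt_of_pow_lt_pow_left₀ κ hε.le ?_
  rw [← norm_pow, negRoot_pow hκ h1, norm_inv]
  exact inv_lt_of_inv_lt₀ (by positivity) (hw.trans_le (Complex.re_le_norm w))

lemma mem_slitPlane_of_re_pos {w : ℂ} (hw : 0 < w.re) : w ∈ Complex.slitPlane := .inl hw

lemma differentiableAt_negRoot (κ : ℕ) {w : ℂ} (hw : 0 < w.re) : DifferentiableAt ℂ (negRoot κ) w := by
  have := (Complex.differentiableAt_log (mem_slitPlane_of_re_pos hw))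
  unfold negRoot
  fun_prop

/-- The inner dynamics in the variable `w = u ^ (-κ)`. -/
noncomputable def innerStep (κ : ℕ) (w ρ : ℂ) : ℂ := Complex.exp (Complex.log w - κ * Complex.log ρ)

/-- The hypothesis on logarithms rules out a change of branch; without it the roots could differ by
a root of unity. -/
lemma negRoot_innerStep {κ : ℕ} (hκ : κ ≠ 0) {w ρ : ℂ} (hρ : ρ ≠ 0)
    (hlog : Complex.log (innerStep κ w ρ) = Complex.log w - κ * Complex.log ρ) :
    negRoot κ (innerStep κ w ρ) = ρ * negRoot κ w := by
  have : (κ : ℂ) ≠ 0 := by exact_mod_cast hκ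
  rw [negRoot, negRoot, hlog, show -((Complex.log w - κ * Complex.log ρ) / κ) =
    Complex.log ρ + -(Complex.log w / κ) by field_simp; ring, Complex.exp_add, Complex.exp_log hρ]

lemma innerStep_ofReal {κ : ℕ} {u ρ : ℝ} (hu : 0 < u) (hρ : 0 < ρ) :
    innerStep κ ((u ^ κ)⁻¹ : ℝ) ρ = (((ρ * u) ^ κ)⁻¹ : ℝ) := by
  have hlog : Real.log (((ρ * u) ^ κ)⁻¹) = Real.log ((u ^ κ)⁻¹) - κ * Real.log ρ := by
    rw [Real.log_inv, Real.log_inv, Real.log_pow, Real.log_pow, Real.log_mul hρ.ne' hu.ne']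
    ring
  have hpos : 0 < ((ρ * u) ^ κ)⁻¹ := by positivity
  rw [innerStep, ← Complex.ofReal_log (by positivity), ← Complex.ofReal_log hρ.le,
    ← Real.exp_log hpos, hlog]
  push_cast
  ring_nf

/-- Estimates for one step of the inner dynamics near infinity. -/
lemma exists_innerStep_bound {κ : ℕ} (hκ : κ ≠ 0) {ν R R₂ : ℝ} (hν : 0 < ν) (hR : 0 < R)
    (hR₂ : 0 ≤ R₂) :
    ∃ L > 0, ∀ w a b : ℂ, L < w.re → ‖a‖ ≤ R → ‖b‖ ≤ R₂ → 2 * ν + κ * |a.im| ≤ -(κ * a.re) →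
      ∀ ρ, ρ = 1 + a * w⁻¹ + b * (w⁻¹) ^ 2 →
      0 < ρ.re ∧ ‖ρ - 1‖ ≤ 2 * R / w.re ∧
      Complex.log (innerStep κ w ρ) = Complex.log w - κ * Complex.log ρ ∧
      w.re + ν ≤ (innerStep κ w ρ).re ∧
      (innerStep κ w ρ).re - |(innerStep κ w ρ).im| ≥ w.re - |w.im| := by
  have hκ0 : (0 : ℝ) < κ := by exact_mod_cast Nat.pos_of_ne_zero hκ
  -- The branch of (1 + z)^(-κ): one step multiplies w by f(ρ - 1), and f(z) = 1 - κ z + o(z).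
  let f : ℂ → ℂ := fun z => Complex.exp (-(κ * Complex.log (1 + z)))
  have hf : HasDerivAt f (-κ) 0 := by
    have h1 : HasDerivAt (fun z : ℂ => 1 + z) 1 0 := by simpa using (hasDerivAt_id (0 : ℂ)).const_add 1
    have h2 := ((h1.clog (by simp)).const_mul (κ : ℂ)).neg.cexp
    simpa [f] using h2
  have hε : 0 < ν / (8 * R) := by positivity
  have hf0 : f 0 = 1 := by simp [f]
  have e1 : ∀ᶠ z in 𝓝 (0 : ℂ), ‖f z - 1 + κ * z‖ ≤ ν / (8 * R) * ‖z‖ := by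
    filter_upwards [hf.hasFDerivAt.isLittleO.bound hε] with z hz
    simp only [hf0, sub_zero] at hz
    refine le_trans (le_of_eq ?_) hz
    congr 1
    simp; ring
  have e2 : ∀ᶠ z in 𝓝 (0 : ℂ), ‖(κ : ℂ) * Complex.log (1 + z)‖ < Real.pi / 2 := by
    have hc : ContinuousAt (fun z : ℂ => (κ : ℂ) * Complex.log (1 + z)) 0 :=
      continuousAt_const.mul (ContinuousAt.clog (by fun_prop) (by simp))
    have := hc.norm.tendsto
    simp only [add_zero, Complex.log_one, mul_zero, norm_zero] at this
    exact this.eventually_lt_const (by positivity)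
  obtain ⟨δ, hδ, hball⟩ := Metric.eventually_nhds_iff_ball.1 (e1.and e2)
  -- Each summand serves one estimate: 2R/δ puts ρ - 1 in the ball of radius δ, 4R gives |ρ - 1| ≤
  -- 1/2, 4κR₂/ν makes the contribution of b at most ν/4, and R₂/R makes |b/w| at most R.
  refine ⟨1 + 2 * R / δ + 4 * R + 4 * κ * R₂ / ν + R₂ / R, by positivity, ?_⟩
  intro w a b hw ha hb hab ρ hρ
  have q1 : 0 < 2 * R / δ := by positivity
  have q2 : 0 ≤ 4 * κ * R₂ / ν := by positivity
  have q3 : 0 ≤ R₂ / R := by positivity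
  have hw1 : 1 < w.re := by linarith
  have hw0 : 0 < w.re := by linarith
  have hwn : w ≠ 0 := fun h => by simp [h] at hw0
  have hnw : w.re ≤ ‖w‖ := Complex.re_le_norm w
  have hnw0 : 0 < ‖w‖ := by linarith
  have hz : ρ - 1 = w⁻¹ * (a + b * w⁻¹) := by rw [hρ]; ring
  have hinv : ‖w⁻¹‖ ≤ 1 / w.re := by
    rw [norm_inv, ← one_div]; exact one_div_le_one_div_of_le hw0 hnw
  have hab2 : ‖a + b * w⁻¹‖ ≤ 2 * R := by
    refine (norm_add_le _ _).trans ?_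
    rw [norm_mul]
    have h3 : R₂ / R ≤ w.re := by linarith
    rw [div_le_iff₀ hR] at h3
    have : ‖b‖ * ‖w⁻¹‖ ≤ R := by
      calc ‖b‖ * ‖w⁻¹‖ ≤ R₂ * (1 / w.re) := by gcongr
        _ ≤ R := by rw [mul_one_div, div_le_iff₀ hw0]; linarith
    linarith
  have hz1 : ‖ρ - 1‖ ≤ 2 * R / w.re := by
    rw [hz, norm_mul]
    calc ‖w⁻¹‖ * ‖a + b * w⁻¹‖ ≤ 1 / w.re * (2 * R) := by gcongr
      _ = _ := by ring
  have hzw : ‖w‖ * ‖ρ - 1‖ ≤ 2 * R := by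
    rw [hz, norm_mul, norm_inv, mul_inv_cancel_left₀ hnw0.ne']; exact hab2
  have hzδ : ρ - 1 ∈ Metric.ball (0 : ℂ) δ := by
    rw [mem_ball_zero_iff]
    refine hz1.trans_lt ?_
    rw [div_lt_iff₀ hw0]
    have : 2 * R / δ < w.re := by linarith
    rw [div_lt_iff₀ hδ] at this
    linarith
  obtain ⟨h1, h2⟩ := hball _ hzδ
  rw [add_sub_cancel] at h2
  have hρre : 0 < ρ.re := by
    have h3 : ‖ρ - 1‖ ≤ 1 / 2 := by
      refine hz1.trans ?_
      rw [div_le_iff₀ hw0]; linarith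
    have h4 := (Complex.abs_re_le_norm (ρ - 1)).trans h3
    rw [Complex.sub_re, Complex.one_re, abs_le] at h4
    linarith
  have hlogw : |(Complex.log w).im| < Real.pi / 2 := by
    rw [Complex.log_im]; exact Complex.abs_arg_lt_pi_div_two_iff.2 (.inl hw0)
  have hlogρ := (Complex.abs_im_le_norm _).trans_lt h2
  -- Both imaginary parts are smaller than π / 2 in modulus, so their difference stays in the
  -- principal strip.
  have hlog : Complex.log (innerStep κ w ρ) = Complex.log w - κ * Complex.log ρ := by
    rw [abs_lt] at hlogw hlogρ
    refine Complex.log_exp ?_ ?_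
    · rw [Complex.sub_im]; linarith
    · rw [Complex.sub_im]; linarith
  have hstep : innerStep κ w ρ = w + w * (f (ρ - 1) - 1) := by
    simp only [f, add_sub_cancel, innerStep]
    rw [sub_eq_add_neg, Complex.exp_add, Complex.exp_log hwn]; ring
  -- One step is the translation by -κ a up to ν / 2. As -κ Re a ≥ 2ν + κ |Im a|, the real part
  -- grows by at least ν and outgrows the modulus of the imaginary part.
  have hE : ‖innerStep κ w ρ - w + κ * a‖ ≤ ν / 2 := by
    have e3 : innerStep κ w ρ - w + κ * a = w * (f (ρ - 1) - 1 + κ * (ρ - 1)) - κ * (b * w⁻¹) := by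
      rw [hstep, hz]; field_simp; ring
    rw [e3]
    refine (norm_sub_le _ _).trans ?_
    have e4 : ‖w * (f (ρ - 1) - 1 + κ * (ρ - 1))‖ ≤ ν / 4 := by
      rw [norm_mul]
      calc ‖w‖ * ‖f (ρ - 1) - 1 + κ * (ρ - 1)‖ ≤ ‖w‖ * (ν / (8 * R) * ‖ρ - 1‖) := by gcongr
        _ = ν / (8 * R) * (‖w‖ * ‖ρ - 1‖) := by ring
        _ ≤ ν / (8 * R) * (2 * R) := by gcongr
        _ = ν / 4 := by field_simp; ring
    have e5 : ‖(κ : ℂ) * (b * w⁻¹)‖ ≤ ν / 4 := by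
      rw [norm_mul, norm_mul, Complex.norm_natCast]
      have e6 : 4 * κ * R₂ / ν ≤ w.re := by linarith
      rw [div_le_iff₀ hν] at e6
      calc (κ : ℝ) * (‖b‖ * ‖w⁻¹‖) ≤ κ * (R₂ * (1 / w.re)) := by gcongr
        _ = κ * R₂ / w.re := by ring
        _ ≤ ν / 4 := by rw [div_le_iff₀ hw0]; linarith
    linarith
  have hre := (Complex.abs_re_le_norm _).trans hE
  have him := (Complex.abs_im_le_norm _).trans hE
  simp only [Complex.add_re, Complex.sub_re, Complex.mul_re, Complex.natCast_re, Complex.natCast_im,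
    zero_mul, sub_zero] at hre
  simp only [Complex.add_im, Complex.sub_im, Complex.mul_im, Complex.natCast_re, Complex.natCast_im,
    zero_mul, add_zero] at him
  have him2 : |(innerStep κ w ρ).im| ≤ |w.im| + κ * |a.im| + ν / 2 := by
    have e7 : (innerStep κ w ρ).im = ((innerStep κ w ρ).im - w.im + κ * a.im) + w.im - κ * a.im := by ring
    have e8 : |κ * a.im| = κ * |a.im| := by rw [abs_mul, abs_of_pos hκ0]
    rw [e7]
    refine (abs_sub _ _).trans ?_
    have := abs_add_le ((innerStep κ w ρ).im - w.im + κ * a.im) w.im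
    linarith
  rw [abs_le] at hre
  have hai : 0 ≤ κ * |a.im| := by positivity
  exact ⟨hρre, hz1, hlog, by linarith, by linarith⟩

end ComplexGeometry

/-! ### The fixed point problem on the complex wedge, and its real solution -/

section ComplexModel

/-- The complexification of `Chart d`. -/
abbrev ChartC (d : ℕ) : Type := ℂ × ℂ × (Fin d → ℂ)

/-- The complexification of `AngPar d m`. -/
abbrev AngParC (d m : ℕ) : Type := (Fin d → ℂ) × (Fin m → ℂ)

variable {d m : ℕ}

lemma diagPow_inc (k q : ℕ) (y : ℝ) (w : Chart d) :
    diagPow k q (y : ℂ) (inc w : ChartC d) = inc (diagPow k q y w) := by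
  rw [diagPow_apply, diagPow_apply]
  refine Prod.ext ?_ (Prod.ext ?_ (funext fun i => ?_))
  · change (y : ℂ) ^ 2 * (w.1 : ℂ) = ((y ^ 2 * w.1 : ℝ) : ℂ)
    push_cast; rfl
  · change (y : ℂ) ^ (k + 1) * (w.2.1 : ℂ) = ((y ^ (k + 1) * w.2.1 : ℝ) : ℂ)
    push_cast; rfl
  · change (y : ℂ) ^ q * (w.2.2 i : ℂ) = ((y ^ q * w.2.2 i : ℝ) : ℂ)
    push_cast; rfl

/-- The complex `δ`-neighbourhood of `ℝ^d × Λ₀`. -/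
def tube (d : ℕ) (Λ₀ : Set (Fin m → ℝ)) (δ : ℝ) : Set (AngParC d m) :=
  {y | ∃ v : Fin d → ℝ, ∃ lam ∈ Λ₀, y ∈ Metric.ball (inc (v, lam)) δ}

lemma isOpen_tube (Λ₀ : Set (Fin m → ℝ)) (δ : ℝ) : IsOpen (tube d Λ₀ δ) := by
  have : tube d Λ₀ δ = ⋃ v : Fin d → ℝ, ⋃ lam ∈ Λ₀, Metric.ball (inc (v, lam)) δ := by
    ext y; simp [tube]
  rw [this]
  exact isOpen_iUnion fun v => isOpen_biUnion fun lam _ => Metric.isOpen_ball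

lemma tube_add_inc {Λ₀ : Set (Fin m → ℝ)} {δ : ℝ} {y : AngParC d m} (hy : y ∈ tube d Λ₀ δ)
    (ω : Fin d → ℝ) : (y.1 + inc ω, y.2) ∈ tube d Λ₀ δ := by
  obtain ⟨v, lam, hl, h⟩ := hy
  refine ⟨v + ω, lam, hl, ?_⟩
  rw [Metric.mem_ball] at h ⊢
  convert h using 1
  rw [Prod.dist_eq, Prod.dist_eq]
  congr 1
  change dist (y.1 + inc ω) (inc (v + ω)) = _
  rw [map_add, dist_add_right]
  rfl

lemma inc_mem_tube {Λ₀ : Set (Fin m → ℝ)} {δ : ℝ} (hδ : 0 < δ) {lam : Fin m → ℝ}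
    (h : lam ∈ Metric.thickening δ Λ₀) (v : Fin d → ℝ) : (inc (v, lam) : AngParC d m) ∈ tube d Λ₀ δ := by
  obtain ⟨l, hl, h⟩ := Metric.mem_thickening_iff.1 h
  refine ⟨v, l, hl, inc_mem_ball.2 ?_⟩
  rw [Metric.mem_ball, Prod.dist_eq]
  simpa [hδ] using h

/-- The complex domain in the variable `w = u ^ (-(k - 1))`. -/
def wDomain (d : ℕ) (Λ₀ : Set (Fin m → ℝ)) (δ L : ℝ) : Set (ℂ × AngParC d m) :=
  {x | L + |x.1.im| < x.1.re ∧ x.2 ∈ tube d Λ₀ δ}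

lemma isOpen_wDomain (Λ₀ : Set (Fin m → ℝ)) (δ L : ℝ) : IsOpen (wDomain d Λ₀ δ L) := by
  refine IsOpen.inter ?_ ((isOpen_tube Λ₀ δ).preimage continuous_snd)
  have h1 : Continuous fun x : ℂ × AngParC d m => x.1.re := Complex.continuous_re.comp continuous_fst
  have h2 : Continuous fun x : ℂ × AngParC d m => x.1.im := Complex.continuous_im.comp continuous_fst
  exact isOpen_lt (continuous_const.add h2.abs) h1

/-- The point of the complex domain which corresponds to a real point. -/
noncomputable def realPoint (κ : ℕ) (u : ℝ) (x : AngPar d m) : ℂ × AngParC d m :=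
  (((u ^ κ)⁻¹ : ℝ), inc x)

lemma realPoint_mem {κ : ℕ} {Λ₀ : Set (Fin m → ℝ)} {δ L u : ℝ} (hδ : 0 < δ) (hL : L < (u ^ κ)⁻¹)
    {lam : Fin m → ℝ} (h : lam ∈ Metric.thickening δ Λ₀) (v : Fin d → ℝ) :
    realPoint κ u (v, lam) ∈ wDomain d Λ₀ δ L := by
  refine ⟨?_, inc_mem_tube hδ h v⟩
  simp only [realPoint, Complex.ofReal_im, Complex.ofReal_re, abs_zero, add_zero]
  exact hL

variable (P : ParabolicData d m)

/-- An approximate solution together with complex extensions. -/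
structure ComplexExt where
  N : ℕ
  r₂ : (Fin m → ℝ) → ℝ
  W : ℝ × AngPar d m → Chart d
  formal : P.IsFormal r₂ W
  (r₁C r₂C : (Fin m → ℂ) → ℂ)
  gC : ℂ × ChartC d × AngParC d m → ChartC d
  WC : ℂ × AngParC d m → ChartC d

namespace ComplexExt

variable {P} (X : ComplexExt P)

/-- The quotient of the inner dynamics by `u`. -/
noncomputable def rhoC (x : ℂ × AngParC d m) : ℂ :=
  1 + X.r₁C x.2.2 * x.1⁻¹ + X.r₂C x.2.2 * (x.1⁻¹) ^ 2

/-- The inner dynamics. -/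
noncomputable def stepC (x : ℂ × AngParC d m) : ℂ × AngParC d m :=
  (innerStep (P.k - 1) x.1 (X.rhoC x), x.2.1 + inc P.ω, x.2.2)

/-- The variable `u`. -/
noncomputable def uPoint (_X : ComplexExt P) (x : ℂ × AngParC d m) : ℂ × AngParC d m :=
  (negRoot (P.k - 1) x.1, x.2)

/-- The operator whose fixed points are the corrections to the approximate solution. -/
noncomputable def op (f : ℂ × AngParC d m → ChartC d) (x : ℂ × AngParC d m) : ChartC d :=
  diagPow P.k P.q (X.rhoC x) (X.WC (X.uPoint (X.stepC x)) + f (X.stepC x)) - X.WC (X.uPoint x) -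
    x.1⁻¹ • X.gC ((X.uPoint x).1, X.WC (X.uPoint x) + f x, x.2)

end ComplexExt

/-- An approximate solution and complex extensions, with the estimates needed for the existence of a
true solution nearby. -/
structure ComplexModel (Λ₀ : Set (Fin m → ℝ)) extends ComplexExt P where
  (δ L ν A A₂ M C R B : ℝ)
  δ_pos : 0 < δ
  L_pos : 0 < L
  ν_pos : 0 < ν
  A_pos : 0 < A
  M_nonneg : 0 ≤ M
  C_nonneg : 0 ≤ C
  two_le_N : 2 ≤ N
  thickening_subset : Metric.thickening δ Λ₀ ⊆ P.V
  large_N : 2 ^ (P.k + P.q + 2) * (2 * A) + 2 * M + 2 ≤ N * ν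
  large_L : N * ν ≤ L
  large_L' : 2 * A ≤ L
  small_C : C / L ^ N ≤ R
  inner : ∀ w a b : ℂ, L < w.re → ‖a‖ ≤ A → ‖b‖ ≤ A₂ →
    2 * ν + (P.k - 1 : ℕ) * |a.im| ≤ -((P.k - 1 : ℕ) * a.re) →
      ∀ ρ, ρ = 1 + a * w⁻¹ + b * (w⁻¹) ^ 2 →
      0 < ρ.re ∧ ‖ρ - 1‖ ≤ 2 * A / w.re ∧
      Complex.log (innerStep (P.k - 1) w ρ) = Complex.log w - (P.k - 1 : ℕ) * Complex.log ρ ∧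
      w.re + ν ≤ (innerStep (P.k - 1) w ρ).re ∧
      (innerStep (P.k - 1) w ρ).re - |(innerStep (P.k - 1) w ρ).im| ≥ w.re - |w.im|
  norm_r₁C : ∀ x ∈ tube d Λ₀ δ, ‖r₁C x.2‖ ≤ A
  norm_r₂C : ∀ x ∈ tube d Λ₀ δ, ‖r₂C x.2‖ ≤ A₂
  re_r₁C : ∀ x ∈ tube d Λ₀ δ,
    2 * ν + (P.k - 1 : ℕ) * |(r₁C x.2).im| ≤ -((P.k - 1 : ℕ) * (r₁C x.2).re)
  diff_r₁C : ∀ x ∈ tube d Λ₀ δ, DifferentiableAt ℂ r₁C x.2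
  diff_r₂C : ∀ x ∈ tube d Λ₀ δ, DifferentiableAt ℂ r₂C x.2
  diff_WC : ∀ x ∈ wDomain d Λ₀ δ L, DifferentiableAt ℂ WC (negRoot (P.k - 1) x.1, x.2)
  diff_gC : ∀ x ∈ wDomain d Λ₀ δ L, ∀ Y, ‖Y‖ ≤ R → DifferentiableAt ℂ gC
    (negRoot (P.k - 1) x.1, WC (negRoot (P.k - 1) x.1, x.2) + Y, x.2)
  lip_gC : ∀ x ∈ wDomain d Λ₀ δ L, ∀ Y Y', ‖Y‖ ≤ R → ‖Y'‖ ≤ R →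
    ‖gC (negRoot (P.k - 1) x.1, WC (negRoot (P.k - 1) x.1, x.2) + Y, x.2) -
      gC (negRoot (P.k - 1) x.1, WC (negRoot (P.k - 1) x.1, x.2) + Y', x.2)‖ ≤ M * ‖Y - Y'‖
  norm_op_zero : ∀ x ∈ wDomain d Λ₀ δ L, ‖toComplexExt.op 0 x‖ ≤ C / x.1.re ^ (N + 1)
  real_r₁C : ∀ lam ∈ Metric.thickening δ Λ₀, r₁C (inc lam) = P.r₁ lam
  real_r₂C : ∀ lam ∈ Metric.thickening δ Λ₀, r₂C (inc lam) = r₂ lam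
  real_WC : ∀ u : ℝ, 0 < u → L < (u ^ (P.k - 1))⁻¹ → ∀ v, ∀ lam ∈ Metric.thickening δ Λ₀,
    WC ((u : ℂ), inc (v, lam)) = inc (W (u, v, lam))
  real_gC : ∀ u : ℝ, 0 < u → L < (u ^ (P.k - 1))⁻¹ → ∀ v, ∀ lam ∈ Metric.thickening δ Λ₀,
    ∀ Y, ‖Y‖ ≤ R → gC ((u : ℂ), inc (W (u, v, lam) + Y), inc (v, lam)) =
      inc (P.g (u, W (u, v, lam) + Y, v, lam))
  analytic_W : ∀ u : ℝ, 0 ≤ u → L * u ^ (P.k - 1) < 1 → ∀ v, ∀ lam ∈ Metric.thickening δ Λ₀,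
    AnalyticAt ℝ W (u, v, lam)
  norm_W_sub : ∀ u : ℝ, 0 ≤ u → L * u ^ (P.k - 1) < 1 → ∀ v, ∀ lam ∈ Metric.thickening δ Λ₀,
    ‖W (u, v, lam) - P.w₀ lam‖ ≤ B * u

namespace ComplexModel

variable {P} {Λ₀ : Set (Fin m → ℝ)} (X : ComplexModel P Λ₀)

lemma inner_stepC {x : ℂ × AngParC d m} (hx : x ∈ wDomain d Λ₀ X.δ X.L) :
    0 < (X.rhoC x).re ∧ ‖X.rhoC x - 1‖ ≤ 2 * X.A / x.1.re ∧
      Complex.log (X.stepC x).1 = Complex.log x.1 - (P.k - 1 : ℕ) * Complex.log (X.rhoC x) ∧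
      x.1.re + X.ν ≤ (X.stepC x).1.re ∧
      (X.stepC x).1.re - |(X.stepC x).1.im| ≥ x.1.re - |x.1.im| :=
  X.inner x.1 _ _ ((le_add_of_nonneg_right (abs_nonneg _)).trans_lt hx.1) (X.norm_r₁C _ hx.2)
    (X.norm_r₂C _ hx.2) (X.re_r₁C _ hx.2) _ rfl

lemma L_lt_re {x : ℂ × AngParC d m} (hx : x ∈ wDomain d Λ₀ X.δ X.L) : X.L < x.1.re :=
  (le_add_of_nonneg_right (abs_nonneg _)).trans_lt hx.1

/-- The wedge is preserved since Re w - |Im w| does not decrease; the tube is preserved since the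
angles move by the real vector ω and the parameter is fixed. -/
lemma mapsTo_stepC : MapsTo X.stepC (wDomain d Λ₀ X.δ X.L) (wDomain d Λ₀ X.δ X.L) := by
  intro x hx
  obtain ⟨-, -, -, -, h⟩ := X.inner_stepC hx
  refine ⟨?_, tube_add_inc hx.2 _⟩
  have := hx.1
  linarith

lemma kappa_ne_zero (P : ParabolicData d m) : P.k - 1 ≠ 0 := by have := P.two_le; omega

lemma differentiableAt_rhoC {x : ℂ × AngParC d m} (hx : x ∈ wDomain d Λ₀ X.δ X.L) :
    DifferentiableAt ℂ X.rhoC x := by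
  have h0 : 0 < x.1.re := X.L_pos.trans (X.L_lt_re hx)
  have hw : x.1 ≠ 0 := fun h => by simp [h] at h0
  have h1 : DifferentiableAt ℂ (fun y : ℂ × AngParC d m => X.r₁C y.2.2) x :=
    (X.diff_r₁C _ hx.2).comp x (by fun_prop : DifferentiableAt ℂ (fun y : ℂ × AngParC d m => y.2.2) x)
  have h2 : DifferentiableAt ℂ (fun y : ℂ × AngParC d m => X.r₂C y.2.2) x :=
    (X.diff_r₂C _ hx.2).comp x (by fun_prop : DifferentiableAt ℂ (fun y : ℂ × AngParC d m => y.2.2) x)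
  have h3 : DifferentiableAt ℂ (fun y : ℂ × AngParC d m => y.1⁻¹) x :=
    (differentiableAt_fst).inv hw
  exact ((differentiableAt_const _).add (h1.mul h3)).add (h2.mul (h3.pow 2))

lemma differentiableAt_stepC {x : ℂ × AngParC d m} (hx : x ∈ wDomain d Λ₀ X.δ X.L) :
    DifferentiableAt ℂ X.stepC x := by
  have h0 : 0 < x.1.re := X.L_pos.trans (X.L_lt_re hx)
  have h1 := (X.differentiableAt_rhoC hx).clog (mem_slitPlane_of_re_pos (X.inner_stepC hx).1)
  have h2 : DifferentiableAt ℂ (fun y : ℂ × AngParC d m => Complex.log y.1) x :=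
    (differentiableAt_fst).clog (mem_slitPlane_of_re_pos h0)
  have h3 : DifferentiableAt ℂ (fun y : ℂ × AngParC d m => innerStep (P.k - 1) y.1 (X.rhoC y)) x :=
    (h2.sub (h1.const_mul _)).cexp
  exact h3.prodMk ((by fun_prop : DifferentiableAt ℂ
    (fun y : ℂ × AngParC d m => (y.2.1 + inc P.ω, y.2.2)) x))

lemma differentiableAt_WC {x : ℂ × AngParC d m} (hx : x ∈ wDomain d Λ₀ X.δ X.L) :
    DifferentiableAt ℂ (fun y => X.WC (X.uPoint y)) x := by
  have h0 : 0 < x.1.re := X.L_pos.trans (X.L_lt_re hx)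
  have h1 : DifferentiableAt ℂ X.uPoint x :=
    ((differentiableAt_negRoot _ h0).comp x differentiableAt_fst).prodMk differentiableAt_snd
  exact (X.diff_WC x hx).comp x h1

lemma differentiableOn_op {f : ℂ × AngParC d m → ChartC d}
    (hf : DifferentiableOn ℂ f (wDomain d Λ₀ X.δ X.L)) (hb : ∀ x ∈ wDomain d Λ₀ X.δ X.L, ‖f x‖ ≤ X.R) :
    DifferentiableOn ℂ (X.op f) (wDomain d Λ₀ X.δ X.L) := by
  intro x hx
  have hfd : ∀ y ∈ wDomain d Λ₀ X.δ X.L, DifferentiableAt ℂ f y := fun y hy =>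
    (hf y hy).differentiableAt ((isOpen_wDomain Λ₀ X.δ X.L).mem_nhds hy)
  have h0 : 0 < x.1.re := X.L_pos.trans (X.L_lt_re hx)
  have hw : x.1 ≠ 0 := fun h => by simp [h] at h0
  have hT := X.mapsTo_stepC hx
  have h1 : DifferentiableAt ℂ (fun y => X.WC (X.uPoint (X.stepC y)) + f (X.stepC y)) x :=
    ((X.differentiableAt_WC hT).comp x (X.differentiableAt_stepC hx)).add
      ((hfd _ hT).comp x (X.differentiableAt_stepC hx))
  have h2 : DifferentiableAt ℂ (fun y => diagPow (d := d) P.k P.q (X.rhoC y)) x :=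
    DifferentiableAt.comp (g := diagPow (d := d) P.k P.q) x (differentiable_diagPow P.k P.q _)
      (X.differentiableAt_rhoC hx)
  have h3 : DifferentiableAt ℂ (fun y : ℂ × AngParC d m => y.1⁻¹) x :=
    (differentiableAt_fst).inv hw
  have h4 : DifferentiableAt ℂ (fun y : ℂ × AngParC d m =>
      X.gC ((X.uPoint y).1, X.WC (X.uPoint y) + f y, y.2)) x := by
    have h5 : DifferentiableAt ℂ (fun y : ℂ × AngParC d m =>
        ((X.uPoint y).1, X.WC (X.uPoint y) + f y, y.2)) x :=
      ((differentiableAt_negRoot _ h0).comp x differentiableAt_fst).prodMk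
        (((X.differentiableAt_WC hx).add (hfd x hx)).prodMk differentiableAt_snd)
    exact (X.diff_gC x hx _ (hb x hx)).comp x h5
  exact (((h2.clm_apply h1).sub (X.differentiableAt_WC hx)).sub (h3.smul h4)).differentiableWithinAt

/-- The operator has a fixed point. -/
theorem exists_fixedPoint_op : ∃ f : ℂ × AngParC d m → ChartC d,
    AnalyticOnNhd ℂ f (wDomain d Λ₀ X.δ X.L) ∧
    (∀ x ∈ wDomain d Λ₀ X.δ X.L, ‖f x‖ ≤ X.C / x.1.re ^ X.N) ∧
    (∀ x ∈ wDomain d Λ₀ X.δ X.L, X.op f x = f x) ∧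
    (∀ j, ∀ x ∈ wDomain d Λ₀ X.δ X.L, ‖X.op^[j] 0 x‖ ≤ X.R) ∧
    ∀ x ∈ wDomain d Λ₀ X.δ X.L, Tendsto (fun j => X.op^[j] 0 x) atTop (𝓝 (f x)) := by
  have hre : ∀ x ∈ wDomain d Λ₀ X.δ X.L, 0 < x.1.re := fun x hx => X.L_pos.trans (X.L_lt_re hx)
  refine exists_fixedPoint (isOpen_wDomain Λ₀ X.δ X.L) X.mapsTo_stepC (s := fun x => x.1.re)
    (D₁ := 2 ^ (P.k + P.q + 2) * (2 * X.A)) X.ν_pos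
    (by have := X.A_pos; positivity) X.M_nonneg X.C_nonneg hre
    (fun x hx => (X.inner_stepC hx).2.2.2.1) X.large_N
    (fun x hx => X.large_L.trans (X.L_lt_re hx).le) (fun x hx => ?_) X.norm_op_zero
    (fun f g hf hg x hx => ?_) fun f hf hb => X.differentiableOn_op hf hb
  · refine le_trans ?_ X.small_C
    have := X.L_pos
    have := X.C_nonneg
    have := (X.L_lt_re hx).le
    gcongr
  · have h0 := hre x hx
    have hg1 := X.lip_gC x hx (f x) (g x) (hf x hx) (hg x hx)
    have hinv : ‖x.1⁻¹‖ ≤ 1 / x.1.re := by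
      rw [norm_inv, ← one_div]; exact one_div_le_one_div_of_le h0 (Complex.re_le_norm _)
    have ht : 2 * X.A / x.1.re ≤ 1 := by
      rw [div_le_one h0]; exact X.large_L'.trans (X.L_lt_re hx).le
    have hd := norm_diagPow_le P.k P.q ht (X.inner_stepC hx).2.1 (f (X.stepC x) - g (X.stepC x))
    have e : X.op f x - X.op g x = diagPow P.k P.q (X.rhoC x) (f (X.stepC x) - g (X.stepC x)) -
        x.1⁻¹ • (X.gC ((X.uPoint x).1, X.WC (X.uPoint x) + f x, x.2) -
          X.gC ((X.uPoint x).1, X.WC (X.uPoint x) + g x, x.2)) := by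
      simp only [ComplexExt.op, map_add, map_sub]
      module
    rw [e]
    refine (norm_sub_le _ _).trans (add_le_add ?_ ?_)
    · refine hd.trans (le_of_eq ?_)
      ring
    · rw [norm_smul]
      calc ‖x.1⁻¹‖ * _ ≤ 1 / x.1.re * (X.M * ‖f x - g x‖) := by
            refine mul_le_mul hinv hg1 (norm_nonneg _) (by positivity)
        _ = X.M / x.1.re * ‖f x - g x‖ := by ring

section Real

variable {u : ℝ} {lam : Fin m → ℝ} (v : Fin d → ℝ)

lemma rhoC_realPoint (hl : lam ∈ Metric.thickening X.δ Λ₀) :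
    X.rhoC (realPoint (P.k - 1) u (v, lam)) = P.rho X.r₂ u lam := by
  have e : X.rhoC (realPoint (P.k - 1) u (v, lam)) = 1 + X.r₁C (inc lam) * (((u ^ (P.k - 1))⁻¹ : ℝ) : ℂ)⁻¹ +
    X.r₂C (inc lam) * ((((u ^ (P.k - 1))⁻¹ : ℝ) : ℂ)⁻¹) ^ 2 := rfl
  rw [e, X.real_r₁C lam hl, X.real_r₂C lam hl, ParabolicData.rho]
  have h2 : 2 * P.k - 2 = (P.k - 1) * 2 := by omega
  rw [h2, pow_mul]
  push_cast
  rw [inv_inv]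

lemma rho_pos (hL : X.L < (u ^ (P.k - 1))⁻¹) (hl : lam ∈ Metric.thickening X.δ Λ₀) : 0 < P.rho X.r₂ u lam := by
  have := (X.inner_stepC (realPoint_mem X.δ_pos hL hl (0 : Fin d → ℝ))).1
  rwa [X.rhoC_realPoint 0 hl, Complex.ofReal_re] at this

lemma stepC_realPoint (hu : 0 < u) (hL : X.L < (u ^ (P.k - 1))⁻¹)
    (hl : lam ∈ Metric.thickening X.δ Λ₀) : X.stepC (realPoint (P.k - 1) u (v, lam)) =
      realPoint (P.k - 1) (P.rho X.r₂ u lam * u) (v + P.ω, lam) := by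
  refine Prod.ext ?_ ?_
  · simp only [ComplexExt.stepC, X.rhoC_realPoint v hl]
    exact innerStep_ofReal hu (X.rho_pos hL hl)
  · refine Prod.ext ?_ rfl
    exact (map_add inc v P.ω).symm

lemma lt_inv_pow_step (hu : 0 < u) (hL : X.L < (u ^ (P.k - 1))⁻¹)
    (hl : lam ∈ Metric.thickening X.δ Λ₀) : X.L < ((P.rho X.r₂ u lam * u) ^ (P.k - 1))⁻¹ := by
  have h := X.L_lt_re (X.mapsTo_stepC (realPoint_mem X.δ_pos hL hl (0 : Fin d → ℝ)))
  rw [X.stepC_realPoint 0 hu hL hl] at h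
  simpa only [realPoint, Complex.ofReal_re] using h

lemma uPoint_realPoint (hu : 0 < u) (x : AngPar d m) :
    X.uPoint (realPoint (P.k - 1) u x) = ((u : ℂ), inc x) :=
  Prod.ext (negRoot_ofReal (kappa_ne_zero P) hu) rfl

/-- The operator `op` on real functions. -/
noncomputable def realOp (D : ℝ × AngPar d m → Chart d) (q : ℝ × AngPar d m) : Chart d :=
  diagPow P.k P.q (P.rho X.r₂ q.1 q.2.2) (X.W (P.rho X.r₂ q.1 q.2.2 * q.1, q.2.1 + P.ω, q.2.2) +
    D (P.rho X.r₂ q.1 q.2.2 * q.1, q.2.1 + P.ω, q.2.2)) - X.W q -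
    q.1 ^ (P.k - 1) • P.g (q.1, X.W q + D q, q.2)

lemma periodic_realOp {D : ℝ × AngPar d m → Chart d} (hD : ∀ u, TorusPeriodic fun x => D (u, x)) (u : ℝ) :
    TorusPeriodic fun x => X.realOp D (u, x) := by
  intro n v y
  have h1 := X.formal.periodic u n v y
  have h2 := X.formal.periodic (P.rho X.r₂ u y * u) n (v + P.ω) y
  have h3 := P.periodic_g u (X.W (u, v, y) + D (u, v, y)) n v y
  have h4 := hD u n v y
  have h5 := hD (P.rho X.r₂ u y * u) n (v + P.ω) y
  simp only at h1 h2 h3 h4 h5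
  simp only [realOp]
  rw [show (v + fun i => (n i : ℝ)) + P.ω = v + P.ω + fun i => (n i : ℝ) by abel, h1, h2, h4, h5, h3]

/-- Real points form an invariant set on which all extensions take their real values. This is what
lets iterates starting from 0 be real. -/
lemma op_realPoint (hu : 0 < u) (hL : X.L < (u ^ (P.k - 1))⁻¹) (hl : lam ∈ Metric.thickening X.δ Λ₀)
    {f : ℂ × AngParC d m → ChartC d} {D : ℝ × AngPar d m → Chart d}
    (hf : ∀ u : ℝ, 0 < u → X.L < (u ^ (P.k - 1))⁻¹ → ∀ v,
      f (realPoint (P.k - 1) u (v, lam)) = inc (D (u, v, lam)))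
    (hb : ‖f (realPoint (P.k - 1) u (v, lam))‖ ≤ X.R) :
    X.op f (realPoint (P.k - 1) u (v, lam)) = inc (X.realOp D (u, v, lam)) := by
  have hρ := X.rho_pos hL hl
  have hu' : 0 < P.rho X.r₂ u lam * u := mul_pos hρ hu
  have hL' := X.lt_inv_pow_step hu hL hl
  have hf1 := hf u hu hL v
  rw [hf1, norm_inc] at hb
  have e : (realPoint (P.k - 1) u (v, lam)).1⁻¹ = ((u ^ (P.k - 1) : ℝ) : ℂ) := by
    simp only [realPoint]; push_cast; rw [inv_inv]
  have e2 : (realPoint (P.k - 1) u (v, lam)).2 = inc (v, lam) := rfl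
  simp only [ComplexExt.op, realOp]
  rw [X.stepC_realPoint v hu hL hl, X.uPoint_realPoint hu, X.uPoint_realPoint hu', X.rhoC_realPoint v hl,
    e, e2, hf1, hf _ hu' hL' _, X.real_WC _ hu hL _ _ hl, X.real_WC _ hu' hL' _ _ hl, ← map_add, ← map_add,
    X.real_gC _ hu hL _ _ hl _ hb, diagPow_inc, ← inc_smul, ← map_sub, ← map_sub]

/-- The correction on real points. -/
theorem exists_correction : ∃ (f : ℂ × AngParC d m → ChartC d) (D : ℝ × AngPar d m → Chart d),
    AnalyticOnNhd ℂ f (wDomain d Λ₀ X.δ X.L) ∧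
    (∀ x ∈ wDomain d Λ₀ X.δ X.L, ‖f x‖ ≤ X.C / x.1.re ^ X.N) ∧
    (∀ u, TorusPeriodic fun x => D (u, x)) ∧
    (∀ u : ℝ, u ≤ 0 → ∀ x, D (u, x) = 0) ∧
    ∀ u : ℝ, 0 < u → X.L < (u ^ (P.k - 1))⁻¹ → ∀ v, ∀ lam ∈ Metric.thickening X.δ Λ₀,
      f (realPoint (P.k - 1) u (v, lam)) = inc (D (u, v, lam)) ∧
      P.err X.r₂ (fun q => X.W q + D q) (u, v, lam) = 0 := by
  obtain ⟨f, hfa, hfb, hfix, hbound, hlim⟩ := X.exists_fixedPoint_op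
  -- Periodicity and reality are checked on the iterates from 0 and passed to the limit, so no
  -- uniqueness of the fixed point is needed.
  have hper : ∀ j u, TorusPeriodic fun x => X.realOp^[j] 0 (u, x) := by
    intro j
    induction j with
    | zero => exact fun u n v y => rfl
    | succ j ih =>
      intro u
      simp only [Function.iterate_succ_apply']
      exact X.periodic_realOp ih u
  have hreal : ∀ j, ∀ lam ∈ Metric.thickening X.δ Λ₀, ∀ u : ℝ, 0 < u → X.L < (u ^ (P.k - 1))⁻¹ → ∀ v,
      X.op^[j] 0 (realPoint (P.k - 1) u (v, lam)) = inc (X.realOp^[j] 0 (u, v, lam)) := by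
    intro j lam hl
    induction j with
    | zero => exact fun u _ _ v => (map_zero inc).symm
    | succ j ih =>
      intro u hu hL v
      rw [Function.iterate_succ_apply', Function.iterate_succ_apply']
      exact X.op_realPoint v hu hL hl ih (hbound j _ (realPoint_mem X.δ_pos hL hl v))
  classical
  -- The default value 0 makes D vanish for u ≤ 0. The condition does not involve the angles, so
  -- periodicity survives.
  let D : ℝ × AngPar d m → Chart d := fun q =>
    if 0 < q.1 ∧ X.L < (q.1 ^ (P.k - 1))⁻¹ ∧ q.2.2 ∈ Metric.thickening X.δ Λ₀ then
      re (f (realPoint (P.k - 1) q.1 q.2)) else 0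
  have hD : ∀ u : ℝ, 0 < u → X.L < (u ^ (P.k - 1))⁻¹ → ∀ v, ∀ lam ∈ Metric.thickening X.δ Λ₀,
      D (u, v, lam) = re (f (realPoint (P.k - 1) u (v, lam))) := fun u hu hL v lam hl =>
    if_pos ⟨hu, hL, hl⟩
  have hlimD : ∀ u : ℝ, 0 < u → X.L < (u ^ (P.k - 1))⁻¹ → ∀ v, ∀ lam ∈ Metric.thickening X.δ Λ₀,
      Tendsto (fun j => X.realOp^[j] 0 (u, v, lam)) atTop (𝓝 (D (u, v, lam))) := by
    intro u hu hL v lam hl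
    have h1 := ((reL (E := Chart d)).continuous.tendsto _).comp
      (hlim _ (realPoint_mem X.δ_pos hL hl v))
    rw [hD u hu hL v lam hl]
    refine h1.congr fun j => ?_
    simp only [Function.comp_apply, hreal j lam hl u hu hL v]
    exact re_inc _
  have hfD : ∀ lam ∈ Metric.thickening X.δ Λ₀, ∀ u : ℝ, 0 < u → X.L < (u ^ (P.k - 1))⁻¹ → ∀ v,
      f (realPoint (P.k - 1) u (v, lam)) = inc (D (u, v, lam)) := by
    intro lam hl u hu hL v
    have h1 := ((isometry_inc (E := Chart d)).continuous.tendsto _).comp (hlimD u hu hL v lam hl)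
    refine tendsto_nhds_unique (hlim _ (realPoint_mem X.δ_pos hL hl v)) (h1.congr fun j => ?_)
    exact (hreal j lam hl u hu hL v).symm
  refine ⟨f, D, hfa, hfb, fun u n v y => ?_, fun u hu x => ?_, fun u hu hL v lam hl =>
    ⟨hfD lam hl u hu hL v, ?_⟩⟩
  · by_cases h : 0 < u ∧ X.L < (u ^ (P.k - 1))⁻¹ ∧ y ∈ Metric.thickening X.δ Λ₀
    · obtain ⟨hu, hL, hl⟩ := h
      exact tendsto_nhds_unique (hlimD u hu hL _ y hl)
        ((hlimD u hu hL v y hl).congr fun j => (hper j u n v y).symm)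
    · simp only [D, if_neg h]
  · exact if_neg fun h => absurd h.1 hu.not_gt
  · have hmem := realPoint_mem X.δ_pos hL hl v
    have h1 := hfix _ hmem
    rw [hfD lam hl u hu hL v] at h1
    have hR : ‖f (realPoint (P.k - 1) u (v, lam))‖ ≤ X.R := by
      refine le_of_tendsto (hlim _ hmem).norm (.of_forall fun j => hbound j _ hmem)
    rw [X.op_realPoint v hu hL hl (hfD lam hl) hR] at h1
    have h2 := inc_injective h1
    simp only [realOp] at h2
    simp only [ParabolicData.err]
    rw [← sub_eq_zero] at h2
    rw [← h2]
    module

end Real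

end ComplexModel

end ComplexModel

/-! ### Choice of the constants and verification of the estimates -/

section ModelExistence

variable {d m : ℕ}

/-- Periodicity reduces the angles to a compact cube, so radius and bound are uniform in `v`. The
base point may move with the parameter, as the leading coefficient w₀ does. -/
lemma exists_extension_of_periodic {Y YC F FC : Type*} [NormedAddCommGroup Y] [NormedSpace ℝ Y]
    [NormedAddCommGroup YC] [NormedSpace ℂ YC] [RealForm Y YC] [FiniteDimensional ℝ Y]
    [FiniteDimensional ℂ YC] [NormedAddCommGroup F] [NormedSpace ℝ F] [NormedAddCommGroup FC]
    [NormedSpace ℂ FC] [RealForm F FC] [CompleteSpace FC] {f : Y × AngPar d m → F}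
    (hp : ∀ y, TorusPeriodic fun x => f (y, x)) {Λ₀ : Set (Fin m → ℝ)} (hΛ : IsCompact Λ₀)
    {y₀ : (Fin m → ℝ) → Y} (hy₀ : ContinuousOn y₀ Λ₀)
    (hf : ∀ v, ∀ lam ∈ Λ₀, AnalyticAt ℝ f (y₀ lam, v, lam)) :
    ∃ r > 0, ∃ M > 0, ∃ g : YC × AngParC d m → FC, ∀ v, ∀ lam ∈ Λ₀,
      DifferentiableOn ℂ g (Metric.ball (inc (y₀ lam, v, lam)) r) ∧
      (∀ z ∈ Metric.ball (inc (y₀ lam, v, lam)) r, ‖g z‖ ≤ M) ∧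
      ∀ x ∈ Metric.ball (y₀ lam, v, lam) r, g (inc x) = inc (f x) := by
  have hK : IsCompact ((fun x : AngPar d m => (y₀ x.2, x)) '' (Icc (0 : Fin d → ℝ) 1 ×ˢ Λ₀)) :=
    (isCompact_Icc.prod hΛ).image_of_continuousOn
      ((hy₀.comp continuousOn_snd fun x hx => hx.2).prodMk continuousOn_id)
  obtain ⟨r, hr, M, g, hg⟩ := exists_extension (FC := FC) (f := f) hK (by
    rintro _ ⟨x, hx, rfl⟩
    exact hf x.1 x.2 hx.2) (P := range fun n : Fin d → ℤ => ((0 : Y), (fun i => (n i : ℝ)), (0 : Fin m → ℝ)))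
    (by
      rintro _ ⟨n, rfl⟩ ⟨y, v, lam⟩
      have := hp y n v lam
      simpa using this)
  refine ⟨r, hr, max M 1, by positivity, g, fun v lam hl => ?_⟩
  obtain ⟨w, hw, n, rfl⟩ := exists_add_int v
  obtain ⟨h1, h2, h3⟩ := hg _ ⟨(w, lam), ⟨hw, hl⟩, rfl⟩ _ ⟨n, rfl⟩
  simp only [Prod.mk_add_mk, add_zero] at h1 h2 h3
  exact ⟨h1, fun z hz => (h2 z hz).trans (le_max_left _ _), h3⟩

lemma exists_extension_param {Λ₀ : Set (Fin m → ℝ)} (hΛ : IsCompact Λ₀) {f : (Fin m → ℝ) → ℝ}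
    (hf : ∀ lam ∈ Λ₀, AnalyticAt ℝ f lam) : ∃ r > 0, ∃ M > 0, ∃ g : (Fin m → ℂ) → ℂ, ∀ lam ∈ Λ₀,
      DifferentiableOn ℂ g (Metric.ball (inc lam) r) ∧
      (∀ z ∈ Metric.ball (inc lam) r, ‖g z‖ ≤ M) ∧
      ∀ x ∈ Metric.ball lam r, g (inc x) = f x := by
  obtain ⟨r, hr, M, g, hg⟩ := exists_extension (FC := ℂ) hΛ hf (P := {0})
    (by rintro _ rfl x; rw [add_zero])
  refine ⟨r, hr, max M 1, by positivity, g, fun lam hl => ?_⟩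
  obtain ⟨h1, h2, h3⟩ := hg _ hl _ rfl
  simp only [add_zero] at h1 h2 h3
  exact ⟨h1, fun z hz => (h2 z hz).trans (le_max_left _ _), h3⟩

set_option maxHeartbeats 1600000 in
-- many estimates for the same constants
theorem exists_complexModel (P : ParabolicData d m) {Λ₀ : Set (Fin m → ℝ)} (hΛ : IsCompact Λ₀)
    (hsub : Λ₀ ⊆ P.V) : Nonempty (ComplexModel P Λ₀) := by
  set κ := P.k - 1 with hκ
  have hκ0 : κ ≠ 0 := ComplexModel.kappa_ne_zero P
  have hκp : (0 : ℝ) < κ := by exact_mod_cast Nat.pos_of_ne_zero hκ0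
  have hk := P.two_le
  obtain ⟨δ₀, hδ₀, hthick⟩ := hΛ.exists_thickening_subset_open P.isOpen hsub
  -- extensions of `g` and `r₁`
  have cw₀ : ContinuousOn P.w₀ Λ₀ := fun lam hl =>
    (ParabolicData.analyticAt_w₀ (hsub hl)).continuousAt.continuousWithinAt
  obtain ⟨rg, hrg, Mg, hMg, gC', hgC'⟩ := exists_extension_of_periodic (d := d) (Y := ℝ × Chart d)
    (YC := ℂ × ChartC d) (FC := ChartC d)
    (f := fun q : (ℝ × Chart d) × AngPar d m => P.g (q.1.1, q.1.2, q.2)) (fun y => P.periodic_g y.1 y.2)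
    hΛ (y₀ := fun lam => ((0 : ℝ), P.w₀ lam)) (continuousOn_const.prodMk cw₀)
    (fun v lam hl => (P.analytic_g (P.w₀ lam) v lam (hsub hl)).comp_of_eq
      ((analyticAt_fst.comp analyticAt_fst).prod ((analyticAt_snd.comp analyticAt_fst).prod
        analyticAt_snd)) rfl)
  obtain ⟨rr, hrr, Mr, hMr, r₁C, hr₁C⟩ := exists_extension_param hΛ (f := P.r₁)
    fun lam hl => ParabolicData.analyticAt_r₁ (hsub hl)
  obtain ⟨ν₀, hν₀, hνr⟩ : ∃ ν₀ > 0, ∀ lam ∈ Λ₀, P.r₁ lam ≤ -ν₀ := by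
    rcases Λ₀.eq_empty_or_nonempty with h | h
    · exact ⟨1, one_pos, fun lam hl => by simp [h] at hl⟩
    · obtain ⟨l, hl, hmax⟩ := hΛ.exists_isMaxOn h (f := P.r₁) fun lam hl =>
        (ParabolicData.analyticAt_r₁ (hsub hl)).continuousAt.continuousWithinAt
      refine ⟨-P.r₁ l, neg_pos.2 (ParabolicData.r₁_neg (hsub hl)), fun lam hlam => ?_⟩
      rw [neg_neg]
      exact hmax hlam
  -- Near real parameters the extension of r₁ will differ from a real value ≤ -ν₀ by at most ν₀ / 4.
  -- Then both 2ν + κ |Im r₁| ≤ 3ν and -κ Re r₁ ≥ 3ν.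
  set ν := κ * ν₀ / 4 with hν
  have hνp : 0 < ν := by positivity
  set M := 8 * Mg / rg with hM
  have hMp : 0 < M := by positivity
  -- N depends only on the extensions of `g` near w₀ and of r₁, not on the approximate solution,
  -- which can therefore be taken of an order depending on N.
  obtain ⟨N, hN⟩ : ∃ N : ℕ, 2 ^ (P.k + P.q + 2) * (2 * Mr) + 2 * M + 2 ≤ N * ν ∧ 2 ≤ N := by
    obtain ⟨N, hN⟩ := exists_nat_ge ((2 ^ (P.k + P.q + 2) * (2 * Mr) + 2 * M + 2) / ν)
    refine ⟨N + 2, ?_, by omega⟩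
    rw [div_le_iff₀ hνp] at hN
    refine hN.trans ?_
    push_cast
    nlinarith
  -- the approximate solution
  obtain ⟨r₂, W, hF, hO⟩ := ParabolicData.exists_formal P (N * κ - 1)
  have hNκ : 1 ≤ N * κ := Nat.one_le_iff_ne_zero.2 (mul_ne_zero (by omega) hκ0)
  -- The error has order u^(κ (N+1)), that is w^(-(N+1)): one power of 1/w more than the weight of
  -- the fixed point space.
  have hn' : N * κ - 1 + 1 + P.k - 1 = κ * (N + 1) := by
    rw [Nat.sub_add_cancel hNκ, Nat.mul_comm N κ, Nat.mul_succ]; omega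
  rw [hn'] at hO
  let E₁ : ℝ × AngPar d m → Chart d := uDiv^[κ * (N + 1)] (P.err r₂ W)
  have hE₁ : ∀ v, ∀ lam ∈ P.V, ∀ u : ℝ, u ^ (κ * (N + 1)) • E₁ (u, v, lam) = P.err r₂ W (u, v, lam) :=
    fun v lam hl u => uDiv_iterate_of_isBigO
      ((hF.analyticAt_err v hl).comp_of_eq (f := fun u : ℝ => (u, v, lam))
        (analyticAt_id.prod analyticAt_const) rfl) (hO v lam hl) u
  -- The parameterization and the quotient of its error are extended as one map, so that they share
  -- radius and bound.
  obtain ⟨r₃, hr₃, M₃, hM₃, h₃, hh₃⟩ := exists_extension_of_periodic (d := d) (Y := ℝ) (YC := ℂ)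
    (FC := ChartC d × ChartC d) (f := fun q : ℝ × AngPar d m => (W q, E₁ q))
    (fun u n v y => by
      refine Prod.ext (hF.periodic u n v y) ?_
      have : (fun u => P.err r₂ W (u, (v + fun i => (n i : ℝ)), y)) = fun u => P.err r₂ W (u, v, y) :=
        funext fun u => hF.periodic_err u n v y
      simp only [E₁, uDiv_iterate_apply, this])
    hΛ (y₀ := fun _ => (0 : ℝ)) continuousOn_const
    (fun v lam hl => (hF.analytic v lam (hsub hl)).prod
      (analyticAt_uDiv_iterate (FC := ChartC d) (hF.analyticAt_err v (hsub hl)) _))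
  obtain ⟨r₄, hr₄, M₄, hM₄, r₂C, hr₂C⟩ := exists_extension_param hΛ (f := r₂)
    fun lam hl => hF.analytic_r₂ lam (hsub hl)
  let WC : ℂ × AngParC d m → ChartC d := fun z => (h₃ z).1
  let E₁C : ℂ × AngParC d m → ChartC d := fun z => (h₃ z).2
  let gC : ℂ × ChartC d × AngParC d m → ChartC d := fun z => gC' ((z.1, z.2.1), z.2.2)
  -- the constants
  obtain ⟨δ, hδ, hδ0, hδ1, hδr, hδr', hδ4, hδ3, hδ3', hδg, hδg'⟩ : ∃ δ > 0, δ ≤ δ₀ ∧ δ ≤ 1 ∧ δ < rr / 2 ∧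
      8 * Mr / rr * δ ≤ ν₀ / 4 ∧ δ ≤ r₄ ∧ δ < r₃ / 2 ∧ (1 + Mr + M₄) * δ < r₃ ∧ δ < rg / 2 ∧
      8 * M₃ / r₃ * δ < rg / 4 := by
    have hev : ∀ {c b : ℝ}, 0 < b → ∀ᶠ δ in 𝓝[>] (0 : ℝ), c * δ < b := by
      intro c b hb
      have : Tendsto (fun δ : ℝ => c * δ) (𝓝 0) (𝓝 0) := by
        simpa using (continuous_const_mul c).tendsto 0
      exact nhdsWithin_le_nhds (this.eventually_lt_const hb)
    have h1 := hev (c := 1) (b := min (min δ₀ 1) (min (min (rr / 2) r₄) (min (r₃ / 2) (rg / 2)))) (by positivity)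
    have h2 := hev (c := 8 * Mr / rr) (b := ν₀ / 4) (by positivity)
    have h3 := hev (c := 1 + Mr + M₄) (b := r₃) hr₃
    have h4 := hev (c := 8 * M₃ / r₃) (b := rg / 4) (by positivity)
    obtain ⟨δ, a1, a2, a3, a4, a5⟩ := (h1.and (h2.and (h3.and (h4.and self_mem_nhdsWithin)))).exists
    simp only [one_mul, lt_min_iff] at a1
    exact ⟨δ, a5, a1.1.1.le, a1.1.2.le, a1.2.1.1, a2.le, a1.2.1.2.le, a1.2.2.1, a3, a1.2.2.2, a4⟩
  obtain ⟨L₁, hL₁, hinner⟩ := exists_innerStep_bound hκ0 hνp hMr hM₄.le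
  -- The approximate solution stays within rg / 4 of w₀ and the correction within another rg / 4, so
  -- all arguments of `g` lie in the half ball where the Lipschitz constant M is valid.
  set R := rg / 4 with hR
  have hRp : 0 < R := by positivity
  obtain ⟨L, hL1, hLδ, hLN, hLA, hLC, hL1'⟩ : ∃ L : ℝ, L₁ ≤ L ∧ (δ ^ κ)⁻¹ ≤ L ∧ N * ν ≤ L ∧ 2 * Mr ≤ L ∧
      M₃ / R ≤ L ∧ 1 ≤ L := by
    refine ⟨max (max L₁ (δ ^ κ)⁻¹) (max (max (N * ν) (2 * Mr)) (max (M₃ / R) 1)), ?_, ?_, ?_, ?_, ?_, ?_⟩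
    all_goals simp only [le_max_iff, le_refl, true_or, or_true]
  have hLp : 0 < L := by linarith
  have hthick' : Metric.thickening δ Λ₀ ⊆ P.V := (Metric.thickening_mono hδ0 _).trans hthick
  -- points of the complex domain
  have hu : ∀ x ∈ wDomain d Λ₀ δ L, ‖negRoot κ x.1‖ < δ := fun x hx =>
    norm_negRoot_lt hκ0 hδ (hLδ.trans_lt ((le_add_of_nonneg_right (abs_nonneg _)).trans_lt hx.1))
  have hpt : ∀ {u : ℂ} {y : AngParC d m} {v : Fin d → ℝ} {lam : Fin m → ℝ}, ‖u‖ < δ →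
      y ∈ Metric.ball (inc (v, lam)) δ → (u, y) ∈ Metric.ball (inc ((0 : ℝ), v, lam) : ℂ × AngParC d m) δ := by
    intro u y v lam hu hy
    rw [Metric.mem_ball, Prod.dist_eq, max_lt_iff]
    refine ⟨?_, hy⟩
    change dist u ((0 : ℝ) : ℂ) < δ
    simpa using hu
  have hsnd : ∀ {y : AngParC d m} {v : Fin d → ℝ} {lam : Fin m → ℝ},
      y ∈ Metric.ball (inc (v, lam)) δ → y.2 ∈ Metric.ball (inc lam) δ := by
    intro y v lam hy
    rw [Metric.mem_ball, Prod.dist_eq, max_lt_iff] at hy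
    exact hy.2
  have hWclose : ∀ v : Fin d → ℝ, ∀ lam ∈ Λ₀, ∀ z ∈ Metric.ball (inc ((0 : ℝ), v, lam) : ℂ × AngParC d m) δ,
      ‖WC z - inc (P.w₀ lam)‖ < rg / 4 := by
    intro v lam hl z hz
    obtain ⟨a1, a2, a3⟩ := hh₃ v lam hl
    have h1 := dist_le_of_bounded a1 a2 (y := z) (z := inc ((0 : ℝ), v, lam))
      ((Metric.mem_ball.1 hz).trans hδ3) (by rw [dist_self]; positivity)
    have h2 : WC (inc ((0 : ℝ), v, lam)) = inc (P.w₀ lam) := by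
      have := a3 _ (Metric.mem_ball_self hr₃)
      rw [← hF.zero v lam (hsub hl)]
      exact congrArg Prod.fst this
    rw [← h2, ← dist_eq_norm]
    calc dist (WC z) (WC (inc ((0 : ℝ), v, lam))) ≤ dist (h₃ z) (h₃ (inc ((0 : ℝ), v, lam))) := le_max_left _ _
      _ ≤ 8 * M₃ / r₃ * δ := h1.trans (by have := (Metric.mem_ball.1 hz).le; gcongr)
      _ < rg / 4 := hδg'
  have hgpt : ∀ v : Fin d → ℝ, ∀ lam ∈ Λ₀, ∀ z ∈ Metric.ball (inc ((0 : ℝ), v, lam) : ℂ × AngParC d m) δ, ∀ Y, ‖Y‖ ≤ R →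
      dist (((z.1, WC z + Y), z.2) : (ℂ × ChartC d) × AngParC d m) (inc (((0 : ℝ), P.w₀ lam), v, lam)) <
        rg / 2 := by
    intro v lam hl z hz Y hY
    have h1 := hWclose v lam hl z hz
    rw [Metric.mem_ball, Prod.dist_eq, max_lt_iff] at hz
    rw [Prod.dist_eq, Prod.dist_eq, max_lt_iff, max_lt_iff]
    refine ⟨⟨hz.1.trans hδg, ?_⟩, hz.2.trans hδg⟩
    change dist (WC z + Y) (inc (P.w₀ lam)) < rg / 2
    rw [dist_eq_norm, add_sub_right_comm]
    refine (norm_add_le _ _).trans_lt ?_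
    linarith
  have hgdiff : ∀ v : Fin d → ℝ, ∀ lam ∈ Λ₀, ∀ z ∈ Metric.ball (inc ((0 : ℝ), v, lam) : ℂ × AngParC d m) δ, ∀ Y, ‖Y‖ ≤ R →
      DifferentiableAt ℂ gC (z.1, WC z + Y, z.2) := by
    intro v lam hl z hz Y hY
    have h1 : DifferentiableAt ℂ gC' ((z.1, WC z + Y), z.2) :=
      (hgC' v lam hl).1.differentiableAt (Metric.isOpen_ball.mem_nhds
        (Metric.mem_ball.2 ((hgpt v lam hl z hz Y hY).trans (by linarith))))
    exact h1.comp (f := fun q : ℂ × ChartC d × AngParC d m => ((q.1, q.2.1), q.2.2))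
      (z.1, WC z + Y, z.2) (by fun_prop)
  have hWdiff : ∀ v : Fin d → ℝ, ∀ lam ∈ Λ₀, DifferentiableOn ℂ WC (Metric.ball (inc ((0 : ℝ), v, lam)) r₃) :=
    fun v lam hl => (hh₃ v lam hl).1.fst
  have hEdiff : ∀ v : Fin d → ℝ, ∀ lam ∈ Λ₀, DifferentiableOn ℂ E₁C (Metric.ball (inc ((0 : ℝ), v, lam)) r₃) :=
    fun v lam hl => (hh₃ v lam hl).1.snd
  have hδr₃ : δ ≤ r₃ := by linarith
  have hδrr : δ ≤ rr := by linarith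
  -- the error for complex arguments
  let ρ' : ℂ × AngParC d m → ℂ := fun z => 1 + r₁C z.2.2 * z.1 ^ κ + r₂C z.2.2 * (z.1 ^ κ) ^ 2
  let errC : ℂ × AngParC d m → ChartC d := fun z =>
    diagPow P.k P.q (ρ' z) (WC (ρ' z * z.1, z.2.1 + inc P.ω, z.2.2)) - WC z -
      z.1 ^ κ • gC (z.1, WC z + 0, z.2)
  have hnext : ∀ v : Fin d → ℝ, ∀ lam ∈ Λ₀, ∀ z ∈ Metric.ball (inc ((0 : ℝ), v, lam) : ℂ × AngParC d m) δ,
      (ρ' z * z.1, z.2.1 + inc P.ω, z.2.2) ∈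
        Metric.ball (inc ((0 : ℝ), v + P.ω, lam) : ℂ × AngParC d m) r₃ := by
    intro v lam hl z hz
    rw [Metric.mem_ball, Prod.dist_eq, max_lt_iff] at hz
    have hz1 : ‖z.1‖ < δ := by
      have : dist z.1 ((0 : ℝ) : ℂ) < δ := hz.1
      simpa using this
    have hz2 : z.2.2 ∈ Metric.ball (inc lam) δ := hsnd hz.2
    have hzκ : ‖z.1 ^ κ‖ ≤ 1 := by
      rw [norm_pow]; exact pow_le_one₀ (norm_nonneg _) (by linarith)
    have b1 : ‖r₁C z.2.2‖ ≤ Mr := (hr₁C lam hl).2.1 _ (Metric.ball_subset_ball hδrr hz2)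
    have b2 : ‖r₂C z.2.2‖ ≤ M₄ := (hr₂C lam hl).2.1 _ (Metric.ball_subset_ball hδ4 hz2)
    have hρ' : ‖ρ' z‖ ≤ 1 + Mr + M₄ := by
      refine (norm_add₃_le).trans ?_
      have c1 : ‖r₁C z.2.2 * z.1 ^ κ‖ ≤ Mr := by
        rw [norm_mul]
        exact (mul_le_mul b1 hzκ (norm_nonneg _) hMr.le).trans_eq (mul_one _)
      have c2 : ‖r₂C z.2.2 * (z.1 ^ κ) ^ 2‖ ≤ M₄ := by
        rw [norm_mul, norm_pow (z.1 ^ κ)]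
        exact (mul_le_mul b2 (pow_le_one₀ (norm_nonneg _) hzκ) (by positivity) hM₄.le).trans_eq (mul_one _)
      rw [norm_one]; linarith
    rw [Metric.mem_ball, Prod.dist_eq, max_lt_iff]
    refine ⟨?_, ?_⟩
    · change dist (ρ' z * z.1) ((0 : ℝ) : ℂ) < r₃
      rw [Complex.ofReal_zero, dist_zero_right, norm_mul]
      refine lt_of_le_of_lt ?_ hδ3'
      exact mul_le_mul hρ' hz1.le (norm_nonneg _) (by positivity)
    · have hd : dist (z.2.1 + inc P.ω, z.2.2) (inc (v + P.ω, lam)) = dist z.2 (inc (v, lam)) := by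
        rw [Prod.dist_eq, Prod.dist_eq]
        congr 1
        change dist (z.2.1 + inc P.ω) (inc (v + P.ω)) = _
        rw [map_add, dist_add_right]
        rfl
      exact hd.trans_lt (hz.2.trans_le hδr₃)
  have hreal_close : ∀ v : Fin d → ℝ, ∀ lam ∈ Λ₀, ∀ y ∈ Metric.ball ((0 : ℝ), v, lam) δ, ∀ Y, ‖Y‖ ≤ R →
      gC (inc y.1, inc (W y + Y), inc y.2) = inc (P.g (y.1, W y + Y, y.2)) := by
    intro v lam hl y hy Y hY
    have h1 := hgpt v lam hl (inc y) (inc_mem_ball.2 hy) (inc Y) (by rwa [norm_inc])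
    have h2 : WC (inc y) = inc (W y) :=
      congrArg Prod.fst ((hh₃ v lam hl).2.2 y (Metric.ball_subset_ball hδr₃ hy))
    rw [h2, ← map_add] at h1
    have h3 : dist ((y.1, W y + Y), y.2) ((((0 : ℝ), P.w₀ lam), v, lam) : (ℝ × Chart d) × AngPar d m) < rg := by
      rw [← dist_inc]
      exact h1.trans (by linarith)
    exact (hgC' v lam hl).2.2 ((y.1, W y + Y), y.2) h3
  -- The factorization of the error by u^(κ (N+1)) is known at real points and extends to complex
  -- ones by the identity theorem.
  have herr : ∀ v : Fin d → ℝ, ∀ lam ∈ Λ₀, EqOn errC (fun z => z.1 ^ (κ * (N + 1)) • E₁C z)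
      (Metric.ball (inc ((0 : ℝ), v, lam)) δ) := by
    intro v lam hl
    refine eqOn_ball_of_eq_inc ?_ ?_ ?_
    · intro z hz
      have hz2 : z.2.2 ∈ Metric.ball (inc lam) δ := by
        have h1 := hz
        rw [Metric.mem_ball, Prod.dist_eq, max_lt_iff] at h1
        exact hsnd h1.2
      have d1 : DifferentiableAt ℂ (fun z : ℂ × AngParC d m => r₁C z.2.2) z :=
        ((hr₁C lam hl).1.differentiableAt (Metric.isOpen_ball.mem_nhds
          (Metric.ball_subset_ball hδrr hz2))).comp z
          (by fun_prop : DifferentiableAt ℂ (fun z : ℂ × AngParC d m => z.2.2) z)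
      have d2 : DifferentiableAt ℂ (fun z : ℂ × AngParC d m => r₂C z.2.2) z :=
        ((hr₂C lam hl).1.differentiableAt (Metric.isOpen_ball.mem_nhds
          (Metric.ball_subset_ball hδ4 hz2))).comp z
          (by fun_prop : DifferentiableAt ℂ (fun z : ℂ × AngParC d m => z.2.2) z)
      have d3 : DifferentiableAt ℂ (fun z : ℂ × AngParC d m => z.1 ^ κ) z := differentiableAt_fst.pow _
      have dρ : DifferentiableAt ℂ ρ' z :=
        ((differentiableAt_const _).add (d1.mul d3)).add (d2.mul (d3.pow 2))
      have dW : DifferentiableAt ℂ WC z := (hWdiff v lam hl).differentiableAt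
        (Metric.isOpen_ball.mem_nhds (Metric.ball_subset_ball hδr₃ hz))
      have dWp : DifferentiableAt ℂ (fun z : ℂ × AngParC d m =>
          WC (ρ' z * z.1, z.2.1 + inc P.ω, z.2.2)) z := by
        have e1 : DifferentiableAt ℂ (fun z : ℂ × AngParC d m =>
            (ρ' z * z.1, z.2.1 + inc P.ω, z.2.2)) z :=
          (dρ.mul differentiableAt_fst).prodMk (by fun_prop)
        exact DifferentiableAt.comp (g := WC)
          (f := fun z : ℂ × AngParC d m => (ρ' z * z.1, z.2.1 + inc P.ω, z.2.2)) z
          ((hWdiff (v + P.ω) lam hl).differentiableAt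
            (Metric.isOpen_ball.mem_nhds (hnext v lam hl z hz))) e1
      have dD : DifferentiableAt ℂ (fun z => diagPow (d := d) P.k P.q (ρ' z)) z :=
        DifferentiableAt.comp (g := diagPow (d := d) P.k P.q) z (differentiable_diagPow P.k P.q _) dρ
      have dg : DifferentiableAt ℂ (fun z : ℂ × AngParC d m => gC (z.1, WC z + 0, z.2)) z := by
        have e1 : DifferentiableAt ℂ (fun z : ℂ × AngParC d m => (z.1, WC z + 0, z.2)) z :=
          differentiableAt_fst.prodMk ((dW.add_const _).prodMk differentiableAt_snd)
        exact DifferentiableAt.comp (g := gC)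
          (f := fun z : ℂ × AngParC d m => (z.1, WC z + 0, z.2)) z
          (hgdiff v lam hl z hz 0 (by rw [norm_zero]; exact hRp.le)) e1
      exact (((dD.clm_apply dWp).sub dW).sub (d3.smul dg)).differentiableWithinAt
    · have h1 : DifferentiableOn ℂ (fun z : ℂ × AngParC d m => z.1 ^ (κ * (N + 1)))
          (Metric.ball (inc ((0 : ℝ), v, lam)) δ) := by fun_prop
      exact h1.smul ((hEdiff v lam hl).mono (Metric.ball_subset_ball hδr₃))
    · rintro ⟨u, v', l⟩ hy
      have hy2 : l ∈ Metric.ball lam δ := by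
        have h1 := hy
        rw [Metric.mem_ball, Prod.dist_eq, Prod.dist_eq, max_lt_iff, max_lt_iff] at h1
        exact h1.2.2
      have hlV : l ∈ P.V := hthick' (Metric.mem_thickening_iff.2 ⟨lam, hl, hy2⟩)
      have e1 : r₁C (inc l) = P.r₁ l := (hr₁C lam hl).2.2 l (Metric.ball_subset_ball hδrr hy2)
      have e2 : r₂C (inc l) = r₂ l := (hr₂C lam hl).2.2 l (Metric.ball_subset_ball hδ4 hy2)
      have e3 : ρ' (inc (u, v', l)) = ((P.rho r₂ u l : ℝ) : ℂ) := by
        change 1 + r₁C (inc l) * ((u : ℝ) : ℂ) ^ κ + r₂C (inc l) * (((u : ℝ) : ℂ) ^ κ) ^ 2 = _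
        rw [e1, e2, ParabolicData.rho, show 2 * P.k - 2 = κ * 2 by omega, pow_mul]
        push_cast; rfl
      have e4 : WC (inc (u, v', l)) = inc (W (u, v', l)) :=
        congrArg Prod.fst ((hh₃ v lam hl).2.2 _ (Metric.ball_subset_ball hδr₃ hy))
      have e5 : E₁C (inc (u, v', l)) = inc (E₁ (u, v', l)) :=
        congrArg Prod.snd ((hh₃ v lam hl).2.2 _ (Metric.ball_subset_ball hδr₃ hy))
      have e6 := hnext v lam hl _ (inc_mem_ball.2 hy)
      have e7 : ((ρ' (inc (u, v', l)) * (inc (u, v', l) : ℂ × AngParC d m).1,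
          (inc (u, v', l) : ℂ × AngParC d m).2.1 + inc P.ω, (inc (u, v', l) : ℂ × AngParC d m).2.2) :
          ℂ × AngParC d m) = inc (P.rho r₂ u l * u, v' + P.ω, l) := by
        rw [e3]
        refine Prod.ext ?_ (Prod.ext ?_ rfl)
        · change _ * ((u : ℝ) : ℂ) = ((P.rho r₂ u l * u : ℝ) : ℂ)
          push_cast; rfl
        · exact (map_add inc v' P.ω).symm
      rw [e7, inc_mem_ball] at e6
      have e8 : WC (inc (P.rho r₂ u l * u, v' + P.ω, l)) = inc (W (P.rho r₂ u l * u, v' + P.ω, l)) :=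
        congrArg Prod.fst ((hh₃ _ lam hl).2.2 _ e6)
      have e9 := hreal_close v lam hl (u, v', l) hy 0 (by rw [norm_zero]; exact hRp.le)
      have e10 : gC ((inc (u, v', l) : ℂ × AngParC d m).1, inc (W (u, v', l)) + 0,
          (inc (u, v', l) : ℂ × AngParC d m).2) = inc (P.g (u, W (u, v', l), v', l)) := by
        rw [add_zero] at e9 ⊢
        exact e9
      have e11 : (inc (u, v', l) : ℂ × AngParC d m).1 = ((u : ℝ) : ℂ) := rfl
      simp only [errC]
      rw [e7, e8, e3, e4, e10, e5, e11, ← Complex.ofReal_pow, ← Complex.ofReal_pow, diagPow_inc,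
        ← inc_smul, ← inc_smul, ← map_sub, ← map_sub, hE₁ v' l hlV u]
      rfl
  have hre1 : ∀ x ∈ tube d Λ₀ δ, 2 * ν + κ * |(r₁C x.2).im| ≤ -(κ * (r₁C x.2).re) := by
    rintro x ⟨v, lam, hl, hx⟩
    have h1 := dist_le_of_bounded (hr₁C lam hl).1 (hr₁C lam hl).2.1
      ((Metric.mem_ball.1 (hsnd hx)).trans hδr) (z := inc lam) (by rw [dist_self]; positivity)
    have h2 : ‖r₁C x.2 - P.r₁ lam‖ ≤ ν₀ / 4 := by
      rw [← (hr₁C lam hl).2.2 lam (Metric.mem_ball_self hrr), ← dist_eq_norm]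
      refine h1.trans (le_trans ?_ hδr')
      have := (Metric.mem_ball.1 (hsnd hx)).le
      gcongr
    have h3 := (Complex.abs_re_le_norm _).trans h2
    have h4 := (Complex.abs_im_le_norm _).trans h2
    rw [Complex.sub_re, Complex.ofReal_re, abs_le] at h3
    rw [Complex.sub_im, Complex.ofReal_im, sub_zero] at h4
    have h5 := hνr lam hl
    have h6 : 2 * ν + κ * |(r₁C x.2).im| ≤ κ * (ν₀ / 2 + ν₀ / 4) := by
      rw [hν]
      nlinarith
    refine h6.trans ?_
    rw [← mul_neg]
    gcongr
    linarith
  have hre : ∀ x ∈ wDomain d Λ₀ δ L, L < x.1.re := fun x hx =>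
    (le_add_of_nonneg_right (abs_nonneg _)).trans_lt hx.1
  have hball : ∀ x ∈ wDomain d Λ₀ δ L, ∃ v : Fin d → ℝ, ∃ lam ∈ Λ₀,
      (negRoot κ x.1, x.2) ∈ Metric.ball (inc ((0 : ℝ), v, lam) : ℂ × AngParC d m) δ := by
    intro x hx
    obtain ⟨v, lam, hl, hx2⟩ := hx.2
    exact ⟨v, lam, hl, hpt (hu x hx) hx2⟩
  have hreu : ∀ u : ℝ, 0 ≤ u → L * u ^ κ < 1 → u < δ := by
    intro u hu0 hLu
    refine lt_of_pow_lt_pow_left₀ κ hδ.le ?_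
    have h1 : 1 ≤ L * δ ^ κ := by
      rw [inv_le_iff_one_le_mul₀ (by positivity)] at hLδ
      exact hLδ
    nlinarith
  have hrealball : ∀ u : ℝ, 0 ≤ u → L * u ^ κ < 1 → ∀ v, ∀ lam ∈ Metric.thickening δ Λ₀, ∃ l ∈ Λ₀,
      ((u, v, lam) : ℝ × AngPar d m) ∈ Metric.ball ((0 : ℝ), v, l) δ := by
    intro u hu0 hLu v lam hlam
    obtain ⟨l, hl, hd⟩ := Metric.mem_thickening_iff.1 hlam
    refine ⟨l, hl, ?_⟩
    rw [Metric.mem_ball, Prod.dist_eq, Prod.dist_eq, max_lt_iff, max_lt_iff]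
    refine ⟨?_, by simpa using hδ, hd⟩
    simpa [abs_of_nonneg hu0] using hreu u hu0 hLu
  have hconv : ∀ u : ℝ, 0 < u → L < (u ^ κ)⁻¹ → L * u ^ κ < 1 := fun u hu0 h => by
    rwa [lt_inv_comm₀ hLp (by positivity), lt_inv_comm₀ (by positivity) hLp,
      ← one_div, lt_div_iff₀ (by positivity)] at h
  refine ⟨{ N := N, r₂ := r₂, W := W, formal := hF, r₁C := r₁C, r₂C := r₂C, gC := gC, WC := WC
            δ := δ, L := L, ν := ν, A := Mr, A₂ := M₄, M := M, C := M₃, R := R, B := 8 * M₃ / r₃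
            δ_pos := hδ, L_pos := hLp, ν_pos := hνp, A_pos := hMr, M_nonneg := hMp.le
            C_nonneg := hM₃.le, two_le_N := hN.2, thickening_subset := hthick'
            large_N := hN.1, large_L := hLN, large_L' := hLA
            small_C := ?_, inner := ?_, norm_r₁C := ?_, norm_r₂C := ?_, re_r₁C := ?_
            diff_r₁C := ?_, diff_r₂C := ?_, diff_WC := ?_, diff_gC := ?_, lip_gC := ?_
            norm_op_zero := ?_, real_r₁C := ?_, real_r₂C := ?_, real_WC := ?_, real_gC := ?_
            analytic_W := ?_, norm_W_sub := ?_ }⟩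
  · rw [div_le_iff₀ hRp] at hLC
    rw [div_le_iff₀ (by positivity)]
    have : L ≤ L ^ N := le_self_pow₀ hL1' (by omega)
    nlinarith
  · exact fun w a b hw ha hb hab ρ hρ => hinner w a b (hL1.trans_lt hw) ha hb hab ρ hρ
  · rintro x ⟨v, lam, hl, hx⟩
    exact (hr₁C lam hl).2.1 _ (Metric.ball_subset_ball hδrr (hsnd hx))
  · rintro x ⟨v, lam, hl, hx⟩
    exact (hr₂C lam hl).2.1 _ (Metric.ball_subset_ball hδ4 (hsnd hx))
  · exact hre1
  · rintro x ⟨v, lam, hl, hx⟩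
    exact (hr₁C lam hl).1.differentiableAt (Metric.isOpen_ball.mem_nhds
      (Metric.ball_subset_ball hδrr (hsnd hx)))
  · rintro x ⟨v, lam, hl, hx⟩
    exact (hr₂C lam hl).1.differentiableAt (Metric.isOpen_ball.mem_nhds
      (Metric.ball_subset_ball hδ4 (hsnd hx)))
  · intro x hx
    obtain ⟨v, lam, hl, hz⟩ := hball x hx
    exact (hWdiff v lam hl).differentiableAt
      (Metric.isOpen_ball.mem_nhds (Metric.ball_subset_ball hδr₃ hz))
  · intro x hx Y hY
    obtain ⟨v, lam, hl, hz⟩ := hball x hx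
    exact hgdiff v lam hl _ hz Y hY
  · intro x hx Y Y' hY hY'
    obtain ⟨v, lam, hl, hz⟩ := hball x hx
    have h1 := dist_le_of_bounded (hgC' v lam hl).1 (hgC' v lam hl).2.1 (hgpt v lam hl _ hz Y hY)
      (hgpt v lam hl _ hz Y' hY')
    rw [← dist_eq_norm]
    refine h1.trans_eq ?_
    congr 1
    rw [Prod.dist_eq, Prod.dist_eq, dist_self, dist_self, dist_add_left, dist_eq_norm]
    simp
  · intro x hx
    obtain ⟨v, lam, hl, hz⟩ := hball x hx
    have hx0 : 0 < x.1.re := hLp.trans (hre x hx)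
    have hxn : x.1 ≠ 0 := fun h => by simp [h] at hx0
    have hroot := negRoot_pow hκ0 hxn
    have h1 := herr v lam hl hz
    have h2 : ‖E₁C (negRoot κ x.1, x.2)‖ ≤ M₃ :=
      (norm_snd_le _).trans ((hh₃ v lam hl).2.1 _ (Metric.ball_subset_ball hδr₃ hz))
    set ρ : ℂ := 1 + r₁C x.2.2 * x.1⁻¹ + r₂C x.2.2 * (x.1⁻¹) ^ 2 with hρ
    have h3 : ρ' (negRoot κ x.1, x.2) = ρ := by simp only [ρ', hroot, hρ]
    obtain ⟨w, l, hl', hx2⟩ := hx.2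
    have h4 := hinner x.1 _ _ (hL1.trans_lt (hre x hx))
      ((hr₁C l hl').2.1 _ (Metric.ball_subset_ball hδrr (hsnd hx2)))
      ((hr₂C l hl').2.1 _ (Metric.ball_subset_ball hδ4 (hsnd hx2))) (hre1 _ hx.2) ρ rfl
    have h5 : ρ ≠ 0 := fun h => by have := h4.1; simp [h] at this
    have h6 := negRoot_innerStep hκ0 h5 h4.2.2.1
    -- The operator applied to 0 is the error of the approximate solution, read at u = w^(-1/κ); the
    -- factorization then gives its decay.
    have h7 : errC (negRoot κ x.1, x.2) =
        ComplexExt.op ⟨N, r₂, W, hF, r₁C, r₂C, gC, WC⟩ 0 x := by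
      simp only [errC, ComplexExt.op, ComplexExt.uPoint, ComplexExt.stepC, ComplexExt.rhoC, h3,
        Pi.zero_apply, add_zero, hroot]
      rw [← hκ, ← hρ, h6]
    rw [← h7, h1]
    simp only
    rw [norm_smul, pow_mul, hroot, norm_pow, norm_inv, div_eq_mul_inv, mul_comm, ← inv_pow]
    have : ‖x.1‖⁻¹ ≤ x.1.re⁻¹ := inv_anti₀ hx0 (Complex.re_le_norm _)
    gcongr
  · intro lam hlam
    obtain ⟨l, hl, hd⟩ := Metric.mem_thickening_iff.1 hlam
    exact (hr₁C l hl).2.2 lam (Metric.ball_subset_ball hδrr hd)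
  · intro lam hlam
    obtain ⟨l, hl, hd⟩ := Metric.mem_thickening_iff.1 hlam
    exact (hr₂C l hl).2.2 lam (Metric.ball_subset_ball hδ4 hd)
  · intro u hu0 hLu v lam hlam
    obtain ⟨l, hl, hb⟩ := hrealball u hu0.le (hconv u hu0 hLu) v lam hlam
    exact congrArg Prod.fst ((hh₃ v l hl).2.2 _ (Metric.ball_subset_ball hδr₃ hb))
  · intro u hu0 hLu v lam hlam Y hY
    obtain ⟨l, hl, hb⟩ := hrealball u hu0.le (hconv u hu0 hLu) v lam hlam
    exact hreal_close v l hl (u, v, lam) hb Y hY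
  · intro u hu0 hLu v lam hlam
    obtain ⟨l, hl, hb⟩ := hrealball u hu0 hLu v lam hlam
    have hb' := Metric.ball_subset_ball hδr₃ hb
    refine analyticAt_of_inc_eq (g := WC) ?_ ?_
    · have h1 : GateauxOn WC (Metric.ball (inc ((0 : ℝ), v, l) : ℂ × AngParC d m) r₃) :=
        (hWdiff v l hl).gateauxOn Metric.isOpen_ball
      exact h1.analyticOnNhd Metric.isOpen_ball
        (fun z hz => (norm_fst_le _).trans ((hh₃ v l hl).2.1 z hz)) _ (inc_mem_ball.2 hb')
    · filter_upwards [Metric.isOpen_ball.mem_nhds hb'] with y hy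
      exact congrArg Prod.fst ((hh₃ v l hl).2.2 y hy)
  · intro u hu0 hLu v lam hlam
    obtain ⟨l, hl, hb⟩ := hrealball u hu0 hLu v lam hlam
    have hb0 : ((0, v, lam) : ℝ × AngPar d m) ∈ Metric.ball ((0 : ℝ), v, l) δ := by
      rw [Metric.mem_ball, Prod.dist_eq, max_lt_iff] at hb ⊢
      exact ⟨by simpa using hδ, hb.2⟩
    have h1 := dist_le_of_bounded (hh₃ v l hl).1 (hh₃ v l hl).2.1
      ((Metric.mem_ball.1 (inc_mem_ball.2 hb)).trans hδ3)
      ((Metric.mem_ball.1 (inc_mem_ball.2 hb0)).trans hδ3)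
    rw [(hh₃ v l hl).2.2 _ (Metric.ball_subset_ball hδr₃ hb),
      (hh₃ v l hl).2.2 _ (Metric.ball_subset_ball hδr₃ hb0), dist_inc, dist_inc] at h1
    rw [← hF.zero v lam (hthick' hlam), ← dist_eq_norm]
    refine (le_max_left _ _).trans (h1.trans_eq ?_)
    congr 1
    simp [Prod.dist_eq, abs_of_nonneg hu0, hu0]

end ModelExistence

/-! ### Regularity at u = 0 and the solution in blown-up coordinates -/

section Solution

/-- The quadratic bound gives derivative 0 on u ≤ 0, and the linear bound on the derivative gives
its continuity across u = 0. Extending by zero replaces one-sided regularity by regularity on an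
open set. -/
lemma contDiffOn_of_zero_of_nonpos {E F : Type*} [NormedAddCommGroup E] [NormedSpace ℝ E]
    [NormedAddCommGroup F] [NormedSpace ℝ F] [CompleteSpace F] {D : ℝ × E → F} {s : Set E} {ρ C : ℝ}
    (hs : IsOpen s) (h0 : ∀ u : ℝ, u ≤ 0 → ∀ x, D (u, x) = 0)
    (ha : ∀ u ∈ Ioo 0 ρ, ∀ x ∈ s, AnalyticAt ℝ D (u, x))
    (hb : ∀ u ∈ Ioo 0 ρ, ∀ x ∈ s, ‖D (u, x)‖ ≤ C * u ^ 2)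
    (hd : ∀ u ∈ Ioo 0 ρ, ∀ x ∈ s, ‖fderiv ℝ D (u, x)‖ ≤ C * u) : ContDiffOn ℝ 1 D (Iio ρ ×ˢ s) := by
  have hopen : IsOpen (Iio ρ ×ˢ s) := isOpen_Iio.prod hs
  have key : ∀ (q q₀ : ℝ × E), q₀.1 ≤ 0 → 0 < q.1 → q.1 ≤ ‖q - q₀‖ := fun q q₀ h1 h2 =>
    (by linarith : q.1 ≤ q.1 - q₀.1).trans ((le_abs_self _).trans (norm_fst_le (q - q₀)))
  have hder : ∀ u : ℝ, u ≤ 0 → u < ρ → ∀ x ∈ s, HasFDerivAt D (0 : ℝ × E →L[ℝ] F) (u, x) := by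
    intro u hu huρ x hx
    rw [hasFDerivAt_iff_isLittleO]
    refine IsBigO.trans_isLittleO (g := fun q : ℝ × E => ‖q - (u, x)‖ ^ 2) ?_ ?_
    · refine IsBigO.of_bound |C| ?_
      filter_upwards [hopen.mem_nhds (show (u, x) ∈ Iio ρ ×ˢ s from ⟨huρ, hx⟩)] with q hq
      rw [h0 u hu x, sub_zero, zero_apply, sub_zero]
      rcases le_or_gt q.1 0 with h | h
      · rw [show q = (q.1, q.2) from rfl, h0 _ h, norm_zero]; positivity
      · have h1 := hb q.1 ⟨h, hq.1⟩ q.2 hq.2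
        have h2 := key q (u, x) hu h
        refine h1.trans ?_
        rw [norm_pow, norm_norm]
        have := le_abs_self C
        gcongr
    · have h1 : Tendsto (fun q : ℝ × E => q - (u, x)) (𝓝 (u, x)) (𝓝 0) := by
        have : Continuous fun q : ℝ × E => q - (u, x) := by fun_prop
        simpa using this.tendsto (u, x)
      exact (isLittleO_norm_pow_id (one_lt_two)).comp_tendsto h1
  rw [← zero_add (1 : WithTop ℕ∞), contDiffOn_succ_iff_fderiv_of_isOpen hopen, contDiffOn_zero]
  refine ⟨fun q hq => ?_, by simp, fun q hq => ContinuousAt.continuousWithinAt ?_⟩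
  · rcases le_or_gt q.1 0 with h | h
    · exact (hder q.1 h hq.1 q.2 hq.2).differentiableAt.differentiableWithinAt
    · exact (ha q.1 ⟨h, hq.1⟩ q.2 hq.2).differentiableAt.differentiableWithinAt
  · rcases le_or_gt q.1 0 with h | h
    · have e : fderiv ℝ D q = 0 := (hder q.1 h hq.1 q.2 hq.2).fderiv
      rw [ContinuousAt, e, tendsto_zero_iff_norm_tendsto_zero]
      have h1 : Tendsto (fun q' : ℝ × E => |C| * ‖q' - q‖) (𝓝 q) (𝓝 0) := by
        have : Continuous fun q' : ℝ × E => |C| * ‖q' - q‖ := by fun_prop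
        simpa using this.tendsto q
      refine squeeze_zero' (.of_forall fun _ => norm_nonneg _) ?_ h1
      filter_upwards [hopen.mem_nhds hq] with q' hq'
      rcases le_or_gt q'.1 0 with h' | h'
      · rw [(hder q'.1 h' hq'.1 q'.2 hq'.2).fderiv, norm_zero]; positivity
      · refine (hd q'.1 ⟨h', hq'.1⟩ q'.2 hq'.2).trans ?_
        have := le_abs_self C
        have h2 := key q' q h h'
        gcongr
    · exact (ha q.1 ⟨h, hq.1⟩ q.2 hq.2).fderiv.continuousAt

lemma exists_norm_inv_pow_sub_one_lt (κ : ℕ) : ∃ c : ℝ, 0 < c ∧ c ≤ 1 / 2 ∧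
    ∀ z : ℂ, ‖z‖ < c → 1 + z ≠ 0 ∧ ‖((1 + z) ^ κ)⁻¹ - 1‖ < 1 / 4 := by
  have h : ContinuousAt (fun z : ℂ => ((1 + z) ^ κ)⁻¹) 0 :=
    ContinuousAt.inv₀ (by fun_prop) (by simp)
  obtain ⟨c, hc, hc'⟩ := Metric.continuousAt_iff.1 h (1 / 4) (by norm_num)
  refine ⟨min c (1 / 2), by positivity, min_le_right _ _, fun z hz => ⟨fun h0 => ?_, ?_⟩⟩
  · have h1 : z = -1 := by linear_combination h0
    have := hz.trans_le (min_le_right _ _)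
    rw [h1] at this
    norm_num at this
  · have := hc' (x := z) (by rw [dist_zero_right]; exact hz.trans_le (min_le_left _ _))
    rw [dist_eq_norm] at this
    simpa using this

variable {d m : ℕ} {P : ParabolicData d m} {Λ₀ : Set (Fin m → ℝ)}

namespace ComplexModel

variable (X : ComplexModel P Λ₀)

/-- The radius is proportional to u: for z = u (1 + ζ) with |ζ| < c one has w = u^(-κ) η with η
within 1/4 of 1. Hence Re w exceeds 3/4 and |Im w| stays below 1/4 of u^(-κ), which leaves room for
L < u^(-κ) / 2. -/
lemma exists_mem_wDomain : ∃ c : ℝ, 0 < c ∧ c ≤ 1 / 2 ∧ ∀ u : ℝ, 0 < u → u ≤ X.δ / 2 →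
    2 * X.L < (u ^ (P.k - 1))⁻¹ → ∀ v : Fin d → ℝ, ∀ lam ∈ Metric.thickening (X.δ / 2) Λ₀,
    ∀ z ∈ Metric.ball (inc (u, v, lam) : ℂ × AngParC d m) (c * u),
      z.1 ≠ 0 ∧ ((z.1 ^ (P.k - 1))⁻¹, z.2) ∈ wDomain d Λ₀ X.δ X.L ∧
      (u ^ (P.k - 1))⁻¹ / 2 ≤ ((z.1 ^ (P.k - 1))⁻¹).re := by
  obtain ⟨c, hc, hc2, h⟩ := exists_norm_inv_pow_sub_one_lt (P.k - 1)
  refine ⟨c, hc, hc2, fun u hu huδ hL v lam hl z hz => ?_⟩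
  rw [Metric.mem_ball, Prod.dist_eq, max_lt_iff] at hz
  have hu' : (u : ℂ) ≠ 0 := by exact_mod_cast hu.ne'
  set ζ : ℂ := z.1 / u - 1 with hζ
  have hz1 : z.1 = u * (1 + ζ) := by rw [hζ]; field_simp; ring
  have hn : ‖ζ‖ < c := by
    have h1 : dist z.1 (u : ℂ) = u * ‖ζ‖ := by
      rw [dist_eq_norm, hz1, show (u : ℂ) * (1 + ζ) - u = u * ζ by ring, norm_mul, Complex.norm_real,
        Real.norm_of_nonneg hu.le]
    have h2 : dist z.1 (u : ℂ) < c * u := hz.1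
    rw [h1, mul_comm c] at h2
    exact lt_of_mul_lt_mul_left h2 hu.le
  obtain ⟨h1, h2⟩ := h ζ hn
  set w₀ : ℝ := (u ^ (P.k - 1))⁻¹ with hw₀
  have hw : 0 < w₀ := by positivity
  set η : ℂ := ((1 + ζ) ^ (P.k - 1))⁻¹ with hη
  have e : (z.1 ^ (P.k - 1))⁻¹ = (w₀ : ℂ) * η := by
    rw [hz1, mul_pow, mul_inv, hη, hw₀]; push_cast; rfl
  have hre : 3 / 4 < η.re := by
    have := (Complex.abs_re_le_norm (η - 1)).trans_lt h2
    rw [Complex.sub_re, Complex.one_re, abs_lt] at this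
    linarith [this.1]
  have him : |η.im| < 1 / 4 := by
    have := (Complex.abs_im_le_norm (η - 1)).trans_lt h2
    simpa using this
  refine ⟨by rw [hz1]; exact mul_ne_zero hu' h1, ⟨?_, ?_⟩, ?_⟩
  · simp only [e, Complex.re_ofReal_mul, Complex.im_ofReal_mul, abs_mul, abs_of_pos hw]
    nlinarith
  · obtain ⟨l, hl, hll⟩ := Metric.mem_thickening_iff.1 hl
    refine ⟨v, l, hl, ?_⟩
    have h3 : dist (inc (v, lam) : AngParC d m) (inc (v, l)) < X.δ / 2 := by
      rw [dist_inc, Prod.dist_eq, dist_self, max_lt_iff]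
      exact ⟨by linarith, hll⟩
    have h4 : dist z.2 (inc (v, lam) : AngParC d m) < X.δ / 2 := by
      refine hz.2.trans_le ?_
      nlinarith
    rw [Metric.mem_ball]
    linarith [dist_triangle z.2 (inc (v, lam) : AngParC d m) (inc (v, l))]
  · rw [e, Complex.re_ofReal_mul]
    nlinarith

/-- The correction is analytic for `u > 0` and small, with its derivative, as `u → 0`. -/
theorem exists_correction_estimates : ∃ (D : ℝ × AngPar d m → Chart d) (C : ℝ), 0 ≤ C ∧
    (∀ u, TorusPeriodic fun x => D (u, x)) ∧
    (∀ u : ℝ, u ≤ 0 → ∀ x, D (u, x) = 0) ∧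
    ∀ u : ℝ, 0 < u → u ≤ 1 → u ≤ X.δ / 2 → 2 * X.L < (u ^ (P.k - 1))⁻¹ →
      ∀ v, ∀ lam ∈ Metric.thickening (X.δ / 2) Λ₀,
      AnalyticAt ℝ D (u, v, lam) ∧ ‖D (u, v, lam)‖ ≤ C * u ^ 2 ∧ ‖fderiv ℝ D (u, v, lam)‖ ≤ C * u ∧
      P.err X.r₂ (fun q => X.W q + D q) (u, v, lam) = 0 := by
  obtain ⟨f, D, hfa, hfb, hper, hneg, hsol⟩ := X.exists_correction
  obtain ⟨c, hc, hc2, hball⟩ := X.exists_mem_wDomain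
  have hC := X.C_nonneg
  have hLp := X.L_pos
  set κ := P.k - 1 with hκ
  have hκ0 : κ ≠ 0 := kappa_ne_zero P
  set K := X.C * 2 ^ X.N with hK
  have hK0 : 0 ≤ K := by positivity
  have hδ : X.δ / 2 ≤ X.δ := by linarith [X.δ_pos]
  refine ⟨D, K + 8 * K / c, by positivity, hper, hneg, fun u hu hu1 huδ hL v lam hl => ?_⟩
  set F : ℂ × AngParC d m → ChartC d := fun z => f ((z.1 ^ κ)⁻¹, z.2) with hF
  have hcu : 0 < c * u := by positivity
  have hFa : ∀ z ∈ Metric.ball (inc (u, v, lam) : ℂ × AngParC d m) (c * u), AnalyticAt ℂ F z := by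
    intro z hz
    obtain ⟨h1, h2, -⟩ := hball u hu huδ hL v lam hl z hz
    exact (hfa _ h2).comp_of_eq (((analyticAt_fst.pow κ).inv (pow_ne_zero _ h1)).prod analyticAt_snd) rfl
  have hFb : ∀ z ∈ Metric.ball (inc (u, v, lam) : ℂ × AngParC d m) (c * u), ‖F z‖ ≤ K * u ^ 2 := by
    intro z hz
    obtain ⟨-, h2, h3⟩ := hball u hu huδ hL v lam hl z hz
    have h4 : 0 < (u ^ κ)⁻¹ / 2 := by positivity
    calc ‖F z‖ ≤ X.C / ((z.1 ^ κ)⁻¹).re ^ X.N := hfb _ h2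
      _ ≤ X.C / ((u ^ κ)⁻¹ / 2) ^ X.N := by gcongr
      _ = K * u ^ (κ * X.N) := by
        rw [hK, div_pow, inv_pow, ← pow_mul]; field_simp
      -- Here κ N ≥ 2 is used; the exponent 2 suffices for a C¹ extension after one power is lost in
      -- the Cauchy estimate.
      _ ≤ K * u ^ 2 := by
        refine mul_le_mul_of_nonneg_left (pow_le_pow_of_le_one hu.le hu1 ?_) hK0
        have := X.two_le_N
        nlinarith [Nat.one_le_iff_ne_zero.2 hκ0]
  have hnear : ∀ y ∈ Metric.ball (u, v, lam) (c * u), F (inc y) = inc (D y) := by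
    rintro ⟨u', v', l⟩ hy
    have hy' := hy
    rw [Metric.mem_ball, Prod.dist_eq, Prod.dist_eq, max_lt_iff, max_lt_iff] at hy
    have h0 : 0 < u' := by
      have := hy.1
      rw [Real.dist_eq, abs_lt] at this
      nlinarith [this.1]
    obtain ⟨-, h2, -⟩ := hball u hu huδ hL v lam hl _ (inc_mem_ball.2 hy')
    have e : (((inc (u', v', l) : ℂ × AngParC d m).1 ^ κ)⁻¹, (inc (u', v', l) : ℂ × AngParC d m).2) =
        realPoint κ u' (v', l) := by
      refine Prod.ext ?_ rfl
      change (((u' : ℂ)) ^ κ)⁻¹ = (((u' ^ κ)⁻¹ : ℝ) : ℂ)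
      push_cast; rfl
    rw [e] at h2
    have hL' : X.L < (u' ^ κ)⁻¹ := by
      have := X.L_lt_re h2
      simpa only [realPoint, Complex.ofReal_re] using this
    have hl' : l ∈ Metric.thickening X.δ Λ₀ := by
      obtain ⟨l₀, hl₀, h5⟩ := Metric.mem_thickening_iff.1 hl
      refine Metric.mem_thickening_iff.2 ⟨l₀, hl₀, ?_⟩
      have h6 := dist_triangle l lam l₀
      have h7 : dist l lam < c * u := hy.2.2
      nlinarith
    simp only [hF, e]
    exact (hsol u' h0 hL' v' l hl').1
  have hmem : (u, v, lam) ∈ Metric.ball (u, v, lam) (c * u) := Metric.mem_ball_self hcu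
  have h2C : K ≤ K + 8 * K / c := by
    have : 0 ≤ 8 * K / c := by positivity
    linarith
  refine ⟨analyticAt_of_inc_eq (hFa _ (Metric.mem_ball_self hcu))
    (by filter_upwards [Metric.isOpen_ball.mem_nhds hmem] using hnear), ?_, ?_, ?_⟩
  · have := hFb _ (Metric.mem_ball_self hcu)
    rw [hnear _ hmem, norm_inc] at this
    exact this.trans (by gcongr)
  -- Cauchy estimate on a complex ball of radius c u, where the function is bounded by K u²: the
  -- derivative is at most (8K/c) u.
  · refine norm_fderiv_le_of_lip' ℝ (by positivity) ?_
    have h1 : Metric.ball (u, v, lam) (c * u / 2) ∈ 𝓝 (u, v, lam) := Metric.ball_mem_nhds _ (by positivity)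
    filter_upwards [h1] with y hy
    have hsub : Metric.ball (u, v, lam) (c * u / 2) ⊆ Metric.ball (u, v, lam) (c * u) :=
      Metric.ball_subset_ball (by linarith)
    have h3 := dist_le_of_bounded (fun z hz => (hFa z hz).differentiableAt.differentiableWithinAt) hFb
      (Metric.mem_ball.1 (inc_mem_ball.2 hy)) (Metric.mem_ball.1 (Metric.mem_ball_self (by positivity)))
    rw [hnear _ (hsub hy), hnear _ hmem, dist_inc, dist_inc, dist_eq_norm, dist_eq_norm] at h3
    refine h3.trans (mul_le_mul_of_nonneg_right ?_ (norm_nonneg _))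
    have e : 8 * (K * u ^ 2) / (c * u) = 8 * K / c * u := by field_simp
    rw [e]
    gcongr
    linarith
  · exact (hsol u hu (by linarith) v lam (Metric.thickening_mono hδ _ hl)).2

end ComplexModel

/-- Existence of the parameterization in blown-up coordinates. -/
theorem ParabolicData.exists_solution (P : ParabolicData d m) (hΛ : IsCompact Λ₀) (hsub : Λ₀ ⊆ P.V) :
    ∃ (r₂ : (Fin m → ℝ) → ℝ) (W : ℝ × AngPar d m → Chart d) (V : Set (Fin m → ℝ)) (ρ C : ℝ),
      IsOpen V ∧ Λ₀ ⊆ V ∧ V ⊆ P.V ∧ 0 < ρ ∧ AnalyticOnNhd ℝ r₂ V ∧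
      (∀ u, TorusPeriodic fun x => W (u, x)) ∧
      AnalyticOnNhd ℝ W (Ioo 0 ρ ×ˢ (univ ×ˢ V)) ∧
      ContDiffOn ℝ 1 W (Ico 0 ρ ×ˢ (univ ×ˢ V)) ∧
      (∀ u ∈ Ico 0 ρ, ∀ v, ∀ lam ∈ V, ‖W (u, v, lam) - P.w₀ lam‖ ≤ C * u) ∧
      (∀ u ∈ Ico 0 ρ, ∀ v, ∀ lam ∈ V, P.err r₂ W (u, v, lam) = 0) ∧
      ∀ u ∈ Ioo 0 ρ, ∀ lam ∈ Λ₀, P.rho r₂ u lam ∈ Ioo 0 1 := by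
  obtain ⟨X⟩ := exists_complexModel P hΛ hsub
  obtain ⟨D, C, hC, hper, hneg, hD⟩ := X.exists_correction_estimates
  have hLp := X.L_pos
  have hδp := X.δ_pos
  have hδ : X.δ / 2 ≤ X.δ := by linarith
  have hκ0 := ComplexModel.kappa_ne_zero P
  have hVP : Metric.thickening (X.δ / 2) Λ₀ ⊆ P.V :=
    (Metric.thickening_mono hδ _).trans X.thickening_subset
  -- On the compact set Λ₀ the maximum of r₁ is negative and r₂ is bounded, so u^(k-1) ≤ u makes the
  -- quadratic term negligible uniformly.
  obtain ⟨ε, hε, hcontr⟩ : ∃ ε : ℝ, 0 < ε ∧ ∀ u ∈ Ioo 0 ε, u ≤ 1 → ∀ lam ∈ Λ₀,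
      P.r₁ lam + X.r₂ lam * u ^ (P.k - 1) < 0 := by
    have hc1 : ContinuousOn (fun lam => P.r₁ lam) Λ₀ := fun lam hl =>
      (ParabolicData.analyticAt_r₁ (hsub hl)).continuousAt.continuousWithinAt
    have hc2 : ContinuousOn X.r₂ Λ₀ := fun lam hl =>
      (X.formal.analytic_r₂ lam (hsub hl)).continuousAt.continuousWithinAt
    rcases Λ₀.eq_empty_or_nonempty with h | h
    · exact ⟨1, one_pos, fun u _ _ lam hl => by simp [h] at hl⟩
    · obtain ⟨l₀, hl₀, hmax⟩ := hΛ.exists_isMaxOn h hc1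
      obtain ⟨M, hM⟩ := hΛ.exists_bound_of_continuousOn hc2
      have hη : P.r₁ l₀ < 0 := ParabolicData.r₁_neg (hsub hl₀)
      have hM0 : 0 ≤ M := (norm_nonneg _).trans (hM l₀ hl₀)
      refine ⟨-P.r₁ l₀ / (M + 1), div_pos (by linarith) (by linarith), fun u hu hu1 lam hl => ?_⟩
      have h1 : P.r₁ lam ≤ P.r₁ l₀ := hmax hl
      have h2 : X.r₂ lam ≤ M := (le_abs_self _).trans (hM lam hl)
      have h3 : u ^ (P.k - 1) ≤ u := pow_le_of_le_one hu.1.le hu1 hκ0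
      have h4 := hu.2
      rw [lt_div_iff₀ (by linarith)] at h4
      have h5 : 0 ≤ u ^ (P.k - 1) := pow_nonneg hu.1.le _
      nlinarith [hu.1, mul_le_mul_of_nonneg_right h2 h5]
  set ρ : ℝ := min (min 1 (X.δ / 2)) (min (1 / (2 * X.L)) ε) with hρ
  have hρ0 : 0 < ρ := by positivity
  have hsmall : ∀ u ∈ Ico 0 ρ, u ≤ 1 ∧ u ≤ X.δ / 2 ∧ u < ε ∧ 2 * X.L * u ^ (P.k - 1) < 1 := by
    intro u hu
    have h2 := hu.2
    simp only [hρ, lt_min_iff] at h2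
    refine ⟨h2.1.1.le, h2.1.2.le, h2.2.2, ?_⟩
    have h3 : u ^ (P.k - 1) ≤ u := pow_le_of_le_one hu.1 h2.1.1.le hκ0
    have h4 := h2.2.1
    rw [lt_div_iff₀ (by positivity)] at h4
    nlinarith
  have hinv : ∀ u ∈ Ioo 0 ρ, 2 * X.L < (u ^ (P.k - 1))⁻¹ := by
    intro u hu
    have h1 := (hsmall u ⟨hu.1.le, hu.2⟩).2.2.2
    rwa [lt_inv_comm₀ (by positivity) (pow_pos hu.1 _), ← one_div, lt_div_iff₀ (by positivity), mul_comm]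
  have hDu := fun u (hu : u ∈ Ioo 0 ρ) =>
    hD u hu.1 (hsmall u ⟨hu.1.le, hu.2⟩).1 (hsmall u ⟨hu.1.le, hu.2⟩).2.1 (hinv u hu)
  have hWa : ∀ u ∈ Ico 0 ρ, ∀ v, ∀ lam ∈ Metric.thickening (X.δ / 2) Λ₀,
      AnalyticAt ℝ X.W (u, v, lam) := fun u hu v lam hl =>
    X.analytic_W u hu.1 (by nlinarith [(hsmall u hu).2.2.2, pow_nonneg hu.1 (P.k - 1)]) v lam
      (Metric.thickening_mono hδ _ hl)
  have hopen : IsOpen ((univ : Set (Fin d → ℝ)) ×ˢ Metric.thickening (X.δ / 2) Λ₀) :=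
    isOpen_univ.prod Metric.isOpen_thickening
  have hD1 : ContDiffOn ℝ 1 D (Iio ρ ×ˢ (univ ×ˢ Metric.thickening (X.δ / 2) Λ₀)) :=
    contDiffOn_of_zero_of_nonpos hopen hneg (fun u hu x hx => (hDu u hu x.1 x.2 hx.2).1)
      (fun u hu x hx => (hDu u hu x.1 x.2 hx.2).2.1) (fun u hu x hx => (hDu u hu x.1 x.2 hx.2).2.2.1)
  refine ⟨X.r₂, fun q => X.W q + D q, Metric.thickening (X.δ / 2) Λ₀, ρ, X.B + C,
    Metric.isOpen_thickening, Metric.self_subset_thickening (by positivity) _, hVP, hρ0,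
    fun lam hl => X.formal.analytic_r₂ lam (hVP hl), fun u n v y => ?_, ?_, ?_, ?_, ?_, ?_⟩
  · exact congrArg₂ (· + ·) (X.formal.periodic u n v y) (hper u n v y)
  · rintro ⟨u, v, lam⟩ ⟨hu, -, hl⟩
    exact (hWa u ⟨hu.1.le, hu.2⟩ v lam hl).add (hDu u hu v lam hl).1
  · refine ContDiffOn.add ?_ (hD1.mono (prod_mono_left Ico_subset_Iio_self))
    rintro ⟨u, v, lam⟩ ⟨hu, -, hl⟩
    exact (hWa u hu v lam hl).contDiffAt.contDiffWithinAt
  · intro u hu v lam hl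
    have h1 := X.norm_W_sub u hu.1 (by nlinarith [(hsmall u hu).2.2.2, pow_nonneg hu.1 (P.k - 1)]) v lam
      (Metric.thickening_mono hδ _ hl)
    have h2 : ‖D (u, v, lam)‖ ≤ C * u := by
      rcases hu.1.eq_or_lt with h | h
      · rw [← h, hneg 0 le_rfl]; simp
      · refine (hDu u ⟨h, hu.2⟩ v lam hl).2.1.trans ?_
        have := (hsmall u hu).1
        have h4 : u ^ 2 ≤ u := by nlinarith
        gcongr
    calc ‖X.W (u, v, lam) + D (u, v, lam) - P.w₀ lam‖
        = ‖(X.W (u, v, lam) - P.w₀ lam) + D (u, v, lam)‖ := by congr 1; abel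
      _ ≤ X.B * u + C * u := (norm_add_le _ _).trans (add_le_add h1 h2)
      _ = _ := by ring
  · intro u hu v lam hl
    -- At u = 0 the equation is trivial: ρ = 1 and W = w₀ does not depend on the angles.
    rcases hu.1.eq_or_lt with h | h
    · subst h
      simp only [ParabolicData.err, ParabolicData.rho_zero, zero_pow hκ0, mul_zero, zero_smul, hneg 0 le_rfl,
        X.formal.zero _ lam (hVP hl), diagPow_one]
      simp
    · exact (hDu u ⟨h, hu.2⟩ v lam hl).2.2.2
  · intro u hu lam hl
    refine ⟨X.rho_pos (by linarith [hinv u hu]) (Metric.self_subset_thickening hδp _ hl), ?_⟩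
    have h1 := hcontr u ⟨hu.1, (hsmall u ⟨hu.1.le, hu.2⟩).2.2.1⟩ (hsmall u ⟨hu.1.le, hu.2⟩).1 lam hl
    have e : P.rho X.r₂ u lam = 1 + u ^ (P.k - 1) * (P.r₁ lam + X.r₂ lam * u ^ (P.k - 1)) := by
      rw [ParabolicData.rho, show 2 * P.k - 2 = (P.k - 1) + (P.k - 1) by omega, pow_add]
      ring
    have h2 : 0 < u ^ (P.k - 1) := pow_pos hu.1 _
    rw [e]
    nlinarith

end Solution

/-! ### Blowing up functions of the original variables -/

section BlowUp

variable {d m : ℕ} {F FC : Type*} [NormedAddCommGroup F] [NormedSpace ℝ F] [NormedAddCommGroup FC]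
  [NormedSpace ℂ FC]

/-- The variables of the lift of a map on `ℝ² × (ℝ/ℤ)^d` depending on parameters. -/
abbrev LiftVar (d m : ℕ) : Type := ℝ × ℝ × (Fin d → ℝ) × (Fin m → ℝ)

/-- A function in the variables of the blow-up `x = u² X`, `y = u^(k+1) Y`. -/
def blowUp (k : ℕ) (Φ : LiftVar d m → F) (z : ℝ × Chart d × AngPar d m) : F :=
  Φ (z.1 ^ 2 * z.2.1.1, z.1 ^ (k + 1) * z.2.1.2.1, z.2.2)

/-- The quotient of a function in the variables of the blow-up by `u^(2n)`. -/
noncomputable def blowUpQuot (k n : ℕ) (Φ : LiftVar d m → F) : ℝ × Chart d × AngPar d m → F :=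
  uDiv^[2 * n] (blowUp k Φ)

/-- The coefficient of `x^n`. -/
noncomputable def leadCoef (k n : ℕ) (Φ : LiftVar d m → F) (x : AngPar d m) : F :=
  blowUpQuot k n Φ (0, (1, 0, 0), x)

/-- The shift of the angles in the blow-up. -/
def angShift (q : ℕ) (z : ℝ × Chart d × AngPar d m) : AngPar d m :=
  (z.2.2.1 + z.1 ^ q • z.2.1.2.2, z.2.2.2)

/-- The quotient of a function in the variables of the blow-up by `u^(2n)`, with its value at `u = 0`
replaced by a monomial. -/
noncomputable def blowUpField (k n q : ℕ) (Φ : LiftVar d m → F) (z : ℝ × Chart d × AngPar d m) : F :=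
  blowUpQuot k n Φ (z.1, z.2.1, angShift q z) - blowUpQuot k n Φ (0, z.2.1, angShift q z) +
    z.2.1.1 ^ n • leadCoef k n Φ (angShift q z)

variable {k n q : ℕ} {Φ : LiftVar d m → F} {v : Fin d → ℝ} {lam : Fin m → ℝ}

lemma angShift_zero (hq : q ≠ 0) (W : Chart d) (x : AngPar d m) : angShift q (0, W, x) = x := by
  simp [angShift, hq]

lemma analyticAt_angShift (z : ℝ × Chart d × AngPar d m) : AnalyticAt ℝ (angShift (d := d) (m := m) q) z := by
  have e1 : AnalyticAt ℝ (fun z : ℝ × Chart d × AngPar d m => z.1) z := analyticAt_fst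
  have e2 : AnalyticAt ℝ (fun z : ℝ × Chart d × AngPar d m => z.2) z := analyticAt_snd
  have e3 : AnalyticAt ℝ (fun z : ℝ × Chart d × AngPar d m => z.2.2) z := analyticAt_snd.comp e2
  have e4 : AnalyticAt ℝ (fun z : ℝ × Chart d × AngPar d m => z.2.1.2) z :=
    analyticAt_snd.comp (analyticAt_fst.comp e2)
  have e5 : AnalyticAt ℝ (fun z : ℝ × Chart d × AngPar d m => z.2.1.2.2) z := analyticAt_snd.comp e4
  have e6 : AnalyticAt ℝ (fun z : ℝ × Chart d × AngPar d m => z.2.2.1) z := analyticAt_fst.comp e3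
  have e7 : AnalyticAt ℝ (fun z : ℝ × Chart d × AngPar d m => z.2.2.2) z := analyticAt_snd.comp e3
  exact (e6.add ((e1.pow q).smul e5)).prod e7

lemma analyticAt_blowUp (h : AnalyticAt ℝ Φ (0, 0, v, lam)) (W : Chart d) :
    AnalyticAt ℝ (blowUp k Φ) (0, W, v, lam) := by
  have e1 : AnalyticAt ℝ (fun z : ℝ × Chart d × AngPar d m => z.1) (0, W, v, lam) := analyticAt_fst
  have e2 : AnalyticAt ℝ (fun z : ℝ × Chart d × AngPar d m => z.2.1) (0, W, v, lam) :=
    analyticAt_fst.comp analyticAt_snd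
  have e3 : AnalyticAt ℝ (fun z : ℝ × Chart d × AngPar d m => z.2.2) (0, W, v, lam) :=
    analyticAt_snd.comp analyticAt_snd
  exact h.comp_of_eq (((e1.pow 2).mul e2.chart_fst).prod (((e1.pow (k + 1)).mul e2.chart_mid).prod e3))
    (by simp)

section Complete

variable [CompleteSpace F]

lemma analyticAt_blowUpQuot [CompleteSpace FC] [RealForm F FC] (h : AnalyticAt ℝ Φ (0, 0, v, lam)) (W : Chart d) :
    AnalyticAt ℝ (blowUpQuot k n Φ) (0, W, v, lam) :=
  analyticAt_uDiv_iterate (FC := FC) (analyticAt_blowUp h W) _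

lemma analyticAt_leadCoef [CompleteSpace FC] [RealForm F FC] (h : AnalyticAt ℝ Φ (0, 0, v, lam)) :
    AnalyticAt ℝ (leadCoef k n Φ) (v, lam) :=
  (analyticAt_blowUpQuot (FC := FC) h (1, 0, 0)).comp_of_eq
    (analyticAt_const.prod (analyticAt_const.prod analyticAt_id)) rfl

lemma analyticAt_blowUpField [CompleteSpace FC] [RealForm F FC] (hq : q ≠ 0) (h : AnalyticAt ℝ Φ (0, 0, v, lam)) (W : Chart d) :
    AnalyticAt ℝ (blowUpField k n q Φ) (0, W, v, lam) := by
  have e1 : AnalyticAt ℝ (fun z : ℝ × Chart d × AngPar d m => z.1) (0, W, v, lam) := analyticAt_fst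
  have e2 : AnalyticAt ℝ (fun z : ℝ × Chart d × AngPar d m => z.2.1) (0, W, v, lam) :=
    analyticAt_fst.comp analyticAt_snd
  have e3 : AnalyticAt ℝ (angShift q) ((0, W, v, lam) : ℝ × Chart d × AngPar d m) := analyticAt_angShift _
  have h0 := angShift_zero hq W (v, lam)
  have hQ := analyticAt_blowUpQuot (FC := FC) (k := k) (n := n) h W
  have h1 : AnalyticAt ℝ (fun z : ℝ × Chart d × AngPar d m =>
      blowUpQuot k n Φ (z.1, z.2.1, angShift q z)) (0, W, v, lam) :=
    hQ.comp_of_eq (e1.prod (e2.prod e3)) (by simp only [h0])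
  have h2 : AnalyticAt ℝ (fun z : ℝ × Chart d × AngPar d m =>
      blowUpQuot k n Φ (0, z.2.1, angShift q z)) (0, W, v, lam) :=
    hQ.comp_of_eq (analyticAt_const.prod (e2.prod e3)) (by simp only [h0])
  have h3 : AnalyticAt ℝ (fun z : ℝ × Chart d × AngPar d m => leadCoef k n Φ (angShift q z))
      (0, W, v, lam) := (analyticAt_leadCoef (FC := FC) h).comp_of_eq e3 h0
  exact (h1.sub h2).add ((e2.chart_fst.pow n).smul h3)

end Complete

/-- No order condition is used. The conditions on A and B are available only for parameters in Λ,
whereas the value at u = 0 is needed on an open set of parameters; the definition enforces it there.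
-/
lemma blowUpField_zero (hq : q ≠ 0) (W : Chart d) (x : AngPar d m) :
    blowUpField k n q Φ (0, W, x) = W.1 ^ n • leadCoef k n Φ x := by
  simp only [blowUpField, angShift_zero hq, sub_self, zero_add]

lemma periodic_blowUpQuot (h : ∀ x y, TorusPeriodic fun w => Φ (x, y, w)) (u : ℝ) (W : Chart d) :
    TorusPeriodic fun x => blowUpQuot k n Φ (u, W, x) := by
  intro j v y
  simp only [blowUpQuot, uDiv_iterate_apply]
  exact congrArg (fun φ => (Function.swap dslope 0)^[2 * n] φ u) (funext fun _ => h _ _ j v y)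

lemma periodic_leadCoef (h : ∀ x y, TorusPeriodic fun w => Φ (x, y, w)) :
    TorusPeriodic (leadCoef k n Φ) := periodic_blowUpQuot h 0 _

lemma periodic_blowUpField (h : ∀ x y, TorusPeriodic fun w => Φ (x, y, w)) (u : ℝ) (W : Chart d) :
    TorusPeriodic fun x => blowUpField k n q Φ (u, W, x) := by
  intro j v y
  have e : angShift q (u, W, (v + fun i => (j i : ℝ)), y) =
      ((angShift q (u, W, v, y)).1 + fun i => (j i : ℝ), (angShift q (u, W, v, y)).2) := by
    simp only [angShift]
    exact Prod.ext (by simp only; abel) rfl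
  simp only [blowUpField, e]
  have h1 := fun u' => periodic_blowUpQuot (k := k) (n := n) h u' W j (angShift q (u, W, v, y)).1
    (angShift q (u, W, v, y)).2
  have h2 := periodic_leadCoef (k := k) (n := n) h j (angShift q (u, W, v, y)).1
    (angShift q (u, W, v, y)).2
  simp only at h1
  rw [h1, h1, h2]

lemma isBigO_pow_pow_of_le {a b : ℕ} (h : b ≤ a) : (fun u : ℝ => u ^ a) =O[𝓝 0] fun u => u ^ b := by
  refine IsBigO.of_bound 1 ?_
  filter_upwards [Metric.closedBall_mem_nhds (0 : ℝ) one_pos] with u hu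
  rw [one_mul, norm_pow, norm_pow]
  exact pow_le_pow_of_le_one (norm_nonneg _) (by simpa using hu) h

/-- Since y has order u^(k+1) with k + 1 ≥ 3 and ‖(x, y)‖ has order u², the first term has order k +
1 + 2(n-1) ≥ 2n + 1 and the second 2n + 2. Both are beyond the order 2n of x^n. -/
lemma HasReducedOrder.isBigO_blowUp {f : ℝ × ℝ → F} (hf : HasReducedOrder n f) (hn : 1 ≤ n) (hk : 2 ≤ k)
    (X Y : ℝ) : (fun u : ℝ => f (u ^ 2 * X, u ^ (k + 1) * Y)) =O[𝓝 0] fun u => u ^ (2 * n + 1) := by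
  obtain ⟨f₁, f₂, h, h1, h2⟩ := hf
  have ht : Tendsto (fun u : ℝ => (u ^ 2 * X, u ^ (k + 1) * Y)) (𝓝 0) (𝓝 (0, 0)) := by
    have : Continuous fun u : ℝ => (u ^ 2 * X, u ^ (k + 1) * Y) := by fun_prop
    simpa using this.tendsto 0
  have hp : ∀ {a b : ℕ}, b ≤ a → (fun u : ℝ => u ^ a) =O[𝓝 0] fun u => u ^ b := fun hab =>
    isBigO_pow_pow_of_le hab
  have hz : (fun u : ℝ => (u ^ 2 * X, u ^ (k + 1) * Y)) =O[𝓝 0] fun u => u ^ 2 :=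
    ((isBigO_refl (fun u : ℝ => u ^ 2) _).mul (isBigO_const_const X one_ne_zero _)).congr_right
      (by simp) |>.prod_left
    (((hp (by omega : 2 ≤ k + 1)).mul (isBigO_const_const Y one_ne_zero _)).congr_right (by simp))
  have e1 := (h1.comp_tendsto ht).trans ((hz.norm_left.pow (n - 1)))
  have e2 := (h2.comp_tendsto ht).trans ((hz.norm_left.pow (n + 1)))
  have e3 : (fun u : ℝ => u ^ (k + 1) * Y) =O[𝓝 0] fun u => u ^ (k + 1) :=
    ((isBigO_refl (fun u : ℝ => u ^ (k + 1)) _).mul (isBigO_const_const Y one_ne_zero _)).congr_right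
      (by simp)
  have e4 := (e3.smul e1).congr_right (g₂ := fun u : ℝ => u ^ (k + 1 + 2 * (n - 1))) fun u => by
    rw [smul_eq_mul, ← pow_mul, ← pow_add]
  have e5 := e4.trans (hp (by omega : 2 * n + 1 ≤ k + 1 + 2 * (n - 1)))
  have e6 : (fun u : ℝ => f₂ (u ^ 2 * X, u ^ (k + 1) * Y)) =O[𝓝 0] fun u => u ^ (2 * n + 1) := by
    refine e2.trans ?_
    simp only [← pow_mul]
    exact hp (by omega)
  refine (e5.add e6).congr_left fun u => ?_
  rw [h]
  rfl

lemma isBigO_leading {φ : ℝ → F} {n : ℕ} {L : F} (h : (fun u => φ u - u ^ n • L) =O[𝓝 0] fun u => u ^ (n + 1)) :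
    φ =O[𝓝 0] fun u => u ^ n := by
  have h1 := h.trans (isBigO_pow_pow_of_le n.le_succ)
  have h2 : (fun u : ℝ => u ^ n • L) =O[𝓝 0] fun u => u ^ n :=
    ((isBigO_refl (fun u : ℝ => u ^ n) (𝓝 0)).smul (isBigO_const_const L (one_ne_zero (α := ℝ)) _)).congr_right
      (by simp)
  exact (h1.add h2).congr_left fun u => by simp

lemma eq_leading {φ ψ : ℝ → F} {n : ℕ} {L : F} (h : (fun u => φ u - u ^ n • L) =O[𝓝 0] fun u => u ^ (n + 1))
    (hψ : ∀ u, u ^ n • ψ u = φ u) (hc : ContinuousAt ψ 0) : ψ 0 = L := by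
  have h1 : Tendsto (fun u => ψ u - L) (𝓝[≠] 0) (𝓝 (ψ 0 - L)) :=
    (hc.tendsto.sub_const L).mono_left nhdsWithin_le_nhds
  obtain ⟨C, hC⟩ := h.bound
  have h2 : Tendsto (fun u : ℝ => C * ‖u‖) (𝓝[≠] 0) (𝓝 0) := by
    have : Continuous fun u : ℝ => C * ‖u‖ := by fun_prop
    simpa using (this.tendsto 0).mono_left nhdsWithin_le_nhds
  have h3 : Tendsto (fun u => ψ u - L) (𝓝[≠] 0) (𝓝 0) := by
    refine squeeze_zero_norm' ?_ h2
    filter_upwards [nhdsWithin_le_nhds hC, self_mem_nhdsWithin] with u hu hu0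
    have hu0' : 0 < ‖u ^ n‖ := norm_pos_iff.2 (pow_ne_zero n hu0)
    rw [← hψ, ← smul_sub, norm_smul, pow_succ, norm_mul] at hu
    refine le_of_mul_le_mul_left (hu.trans_eq ?_) hu0'
    ring
  exact sub_eq_zero.1 (tendsto_nhds_unique h1 h3)

section Reduced

variable {L : (Fin d → ℝ) → F} {f : (Fin d → ℝ) → ℝ × ℝ → F}

lemma isBigO_blowUp_sub (hn : 1 ≤ n) (hk : 2 ≤ k) (hf : ∀ v, HasReducedOrder n (f v))
    (hΦ : ∀ x y v, Φ (x, y, v, lam) = x ^ n • L v + f v (x, y)) (W : Chart d) (v : Fin d → ℝ) :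
    (fun u => blowUp k Φ (u, W, v, lam) - u ^ (2 * n) • W.1 ^ n • L v) =O[𝓝 0] fun u => u ^ (2 * n + 1) := by
  refine ((hf v).isBigO_blowUp hn hk W.1 W.2.1).congr_left fun u => ?_
  simp only [blowUp, hΦ]
  rw [mul_pow, ← pow_mul, mul_smul, add_sub_cancel_left]

lemma blowUpQuot_zero [CompleteSpace F] [CompleteSpace FC] [RealForm F FC]
    (hn : 1 ≤ n) (hk : 2 ≤ k) (ha : ∀ v, AnalyticAt ℝ Φ (0, 0, v, lam))
    (hf : ∀ v, HasReducedOrder n (f v))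
    (hΦ : ∀ x y v, Φ (x, y, v, lam) = x ^ n • L v + f v (x, y)) (W : Chart d) (v : Fin d → ℝ) :
    blowUpQuot k n Φ (0, W, v, lam) = W.1 ^ n • L v ∧
      ∀ u, u ^ (2 * n) • blowUpQuot k n Φ (u, W, v, lam) = blowUp k Φ (u, W, v, lam) := by
  have h1 := isBigO_blowUp_sub hn hk hf hΦ W v
  have h2 : AnalyticAt ℝ (fun u : ℝ => blowUp k Φ (u, W, v, lam)) 0 :=
    (analyticAt_blowUp (ha v) W).comp_of_eq (analyticAt_id.prod analyticAt_const) rfl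
  have h3 := uDiv_iterate_of_isBigO h2 (isBigO_leading h1)
  refine ⟨eq_leading (ψ := fun u => blowUpQuot k n Φ (u, W, v, lam)) h1 h3 ?_, h3⟩
  exact (analyticAt_blowUpQuot (FC := FC) (ha v) W).continuousAt.comp (f := fun u : ℝ => (u, W, v, lam))
    (by fun_prop)

lemma leadCoef_eq [CompleteSpace F] [CompleteSpace FC] [RealForm F FC]
    (hn : 1 ≤ n) (hk : 2 ≤ k) (ha : ∀ v, AnalyticAt ℝ Φ (0, 0, v, lam))
    (hf : ∀ v, HasReducedOrder n (f v))
    (hΦ : ∀ x y v, Φ (x, y, v, lam) = x ^ n • L v + f v (x, y)) (v : Fin d → ℝ) :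
    leadCoef k n Φ (v, lam) = L v := by
  rw [leadCoef, (blowUpQuot_zero (FC := FC) hn hk ha hf hΦ _ v).1, one_pow, one_smul]

/-- Under the order condition the enforced value at u = 0 is the true one, so nothing is changed for
these parameters. -/
lemma pow_smul_blowUpField [CompleteSpace F] [CompleteSpace FC] [RealForm F FC]
    (hn : 1 ≤ n) (hk : 2 ≤ k) (ha : ∀ v, AnalyticAt ℝ Φ (0, 0, v, lam))
    (hf : ∀ v, HasReducedOrder n (f v))
    (hΦ : ∀ x y v, Φ (x, y, v, lam) = x ^ n • L v + f v (x, y)) (u : ℝ) (W : Chart d) (v : Fin d → ℝ) :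
    u ^ (2 * n) • blowUpField k n q Φ (u, W, v, lam) = blowUp k Φ (u, W, v + u ^ q • W.2.2, lam) := by
  have e := blowUpQuot_zero (FC := FC) hn hk ha hf hΦ W (v + u ^ q • W.2.2)
  simp only [blowUpField, angShift, leadCoef_eq (FC := FC) hn hk ha hf hΦ, e.1, sub_add_cancel, e.2]

end Reduced

end BlowUp

/-! ### From the map in reduced form to the equation in blown-up coordinates -/

section Reduction

variable {d m : ℕ} {F FC : Type*} [NormedAddCommGroup F] [NormedSpace ℝ F]

lemma toTorus_add_int (v : Fin d → ℝ) (n : Fin d → ℤ) : toTorus (v + fun i => (n i : ℝ)) = toTorus v :=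
  (toTorus_eq_iff.2 ⟨n, rfl⟩).symm

/-- Analyticity is an open condition, uniformly over the compact unit cube of angles; periodicity
carries it to all angles. -/
lemma isOpen_setOf_analyticAt [CompleteSpace F] {Ψ : LiftVar d m → F}
    (h : ∀ x y, TorusPeriodic fun w => Ψ (x, y, w)) :
    IsOpen {lam : Fin m → ℝ | ∀ v, AnalyticAt ℝ Ψ (0, 0, v, lam)} := by
  rw [isOpen_iff_mem_nhds]
  intro lam hlam
  have h1 : ∀ᶠ l in 𝓝 lam, ∀ v ∈ Icc (0 : Fin d → ℝ) 1, AnalyticAt ℝ Ψ (0, 0, v, l) := by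
    refine isCompact_Icc.eventually_forall_of_forall_eventually fun v _ => ?_
    have hc : Continuous fun z : (Fin m → ℝ) × (Fin d → ℝ) => ((0 : ℝ), (0 : ℝ), z.2, z.1) := by fun_prop
    exact (hc.tendsto (lam, v)).eventually (hlam v).eventually_analyticAt
  filter_upwards [h1] with l hl v
  obtain ⟨x, hx, n, rfl⟩ := exists_add_int v
  have e1 : AnalyticAt ℝ (fun z : LiftVar d m => (z.1, z.2.1, z.2.2.1 - fun i => (n i : ℝ), z.2.2.2))
      (0, 0, x + fun i => (n i : ℝ), l) := by
    have e2 : AnalyticAt ℝ (fun z : LiftVar d m => z.2.2) (0, 0, x + fun i => (n i : ℝ), l) :=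
      analyticAt_snd.comp analyticAt_snd
    have e3 : AnalyticAt ℝ (fun z : LiftVar d m => z.2.1) (0, 0, x + fun i => (n i : ℝ), l) :=
      analyticAt_fst.comp analyticAt_snd
    have e4 : AnalyticAt ℝ (fun z : LiftVar d m => z.2.2.1) (0, 0, x + fun i => (n i : ℝ), l) :=
      analyticAt_fst.comp e2
    have e5 : AnalyticAt ℝ (fun z : LiftVar d m => z.2.2.2) (0, 0, x + fun i => (n i : ℝ), l) :=
      analyticAt_snd.comp e2
    exact analyticAt_fst.prod (e3.prod ((e4.sub analyticAt_const).prod e5))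
  refine ((hl x hx).comp_of_eq e1 (by simp)).congr (.of_forall fun z => ?_)
  have := h z.1 z.2.1 n (z.2.2.1 - fun i => (n i : ℝ)) z.2.2.2
  simp only [sub_add_cancel] at this
  exact this.symm

lemma analyticAt_liftAvg {f : AngPar d m → ℝ} (hp : TorusPeriodic f) {lam : Fin m → ℝ}
    (ha : ∀ v, AnalyticAt ℝ f (v, lam)) : AnalyticAt ℝ (liftAvg f) lam :=
  analyticAt_torus_average hp ha

lemma isOpen_setOf_liftAvg_pos {f : AngPar d m → ℝ} (hp : TorusPeriodic f) {V : Set (Fin m → ℝ)}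
    (hV : IsOpen V) (ha : ∀ v, ∀ lam ∈ V, AnalyticAt ℝ f (v, lam)) :
    IsOpen {lam | lam ∈ V ∧ 0 < liftAvg f lam} := by
  have hc : ContinuousOn (liftAvg f) V := fun lam hl =>
    (analyticAt_liftAvg hp fun v => ha v lam hl).continuousAt.continuousWithinAt
  exact hc.isOpen_inter_preimage hV isOpen_Ioi

/-- The parabolic data attached to a family of maps in blown-up coordinates. -/
theorem exists_parabolicData {k p : ℕ} (hk : 2 ≤ k) (hp : 1 ≤ p) (hkp : k < 2 * p + 1)
    {U : Set (ℝ × ℝ)} (hU : U ∈ 𝓝 ((0, 0) : ℝ × ℝ)) {Λ : Set (Fin m → ℝ)}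
    {ω : Fin d → ℝ} (hω : IsDiophantine ω)
    {c a : Torus d → (Fin m → ℝ) → ℝ} {b : Torus d → (Fin m → ℝ) → Fin d → ℝ}
    {A : ℝ × ℝ → Torus d → (Fin m → ℝ) → ℝ}
    {B : ℝ × ℝ → Torus d → (Fin m → ℝ) → Fin d → ℝ}
    (hF : AnalyticOnNhd ℝ (reducedLift k p ω c a b A B)
      {q | (q.1, q.2.1) ∈ U ∧ q.2.2.2 ∈ Λ})
    (hA : ∀ θ, ∀ lam ∈ Λ, HasReducedOrder k (fun z => A z θ lam))
    (hB : ∀ θ, ∀ lam ∈ Λ, HasReducedOrder p (fun z => B z θ lam))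
    (hc : ∀ lam ∈ Λ, 0 < torusAvg c lam) (ha : ∀ lam ∈ Λ, 0 < torusAvg a lam) :
    ∃ P : ParabolicData d m, P.k = k ∧ P.p = p ∧ P.q = 2 * p + 1 - k ∧ P.ω = ω ∧ Λ ⊆ P.V ∧
      (∀ lam ∈ Λ, P.cAvg lam = torusAvg c lam ∧ P.aAvg lam = torusAvg a lam ∧
        P.bAvg lam = torusAvg b lam) ∧
      ∀ (u : ℝ) (W : Chart d) (v : Fin d → ℝ), ∀ lam ∈ Λ,
        reducedLift k p ω c a b A B
          (u ^ 2 * W.1, u ^ (k + 1) * W.2.1, v + u ^ (2 * p + 1 - k) • W.2.2, lam) =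
        (u ^ 2 * W.1 + u ^ (k + 1) * (P.g (u, W, v, lam)).1,
          u ^ (k + 1) * W.2.1 + u ^ (2 * k) * (P.g (u, W, v, lam)).2.1,
          v + u ^ (2 * p + 1 - k) • W.2.2 + ω + u ^ (2 * p) • (P.g (u, W, v, lam)).2.2) := by
  set G := reducedLift k p ω c a b A B with hG
  set q := 2 * p + 1 - k with hq
  have hq0 : q ≠ 0 := by omega
  -- What remains is (x + c y, a x^k + A, x^p b + B), which is periodic in the angles.
  let Ψ : LiftVar d m → Chart d := fun z => G z - (0, z.2.1, z.2.2.1 + ω)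
  have hΨp : ∀ x y, TorusPeriodic fun w => Ψ (x, y, w) := by
    intro x y n v l
    simp only [Ψ, hG, reducedLift, toTorus_add_int]
    refine Prod.ext rfl (Prod.ext rfl ?_)
    simp only [Prod.snd_sub]
    abel
  let V₀ : Set (Fin m → ℝ) := {lam | ∀ v, AnalyticAt ℝ Ψ (0, 0, v, lam)}
  have hV₀ : IsOpen V₀ := isOpen_setOf_analyticAt hΨp
  have hΛ : Λ ⊆ V₀ := by
    intro lam hl v
    have h1 : AnalyticAt ℝ G (0, 0, v, lam) := hF _ ⟨mem_of_mem_nhds hU, hl⟩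
    have e2 : AnalyticAt ℝ (fun z : LiftVar d m => z.2.2) (0, 0, v, lam) :=
      analyticAt_snd.comp analyticAt_snd
    have e3 : AnalyticAt ℝ (fun z : LiftVar d m => z.2.1) (0, 0, v, lam) :=
      analyticAt_fst.comp analyticAt_snd
    have e4 : AnalyticAt ℝ (fun z : LiftVar d m => z.2.2.1) (0, 0, v, lam) := analyticAt_fst.comp e2
    exact h1.sub (analyticAt_const.prod (e3.prod (e4.add analyticAt_const)))
  let Φy : LiftVar d m → ℝ := fun z => (Ψ z).2.1
  let Φθ : LiftVar d m → Fin d → ℝ := fun z => (Ψ z).2.2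
  have hΦyp : ∀ x y, TorusPeriodic fun w => Φy (x, y, w) := fun x y n v l =>
    congrArg (fun W => W.2.1) (hΨp x y n v l)
  have hΦθp : ∀ x y, TorusPeriodic fun w => Φθ (x, y, w) := fun x y n v l =>
    congrArg (fun W => W.2.2) (hΨp x y n v l)
  have hΦya : ∀ v, ∀ lam ∈ V₀, AnalyticAt ℝ Φy (0, 0, v, lam) := fun v lam hl => (hl v).chart_mid
  have hΦθa : ∀ v, ∀ lam ∈ V₀, AnalyticAt ℝ Φθ (0, 0, v, lam) := fun v lam hl =>
    analyticAt_snd.comp (analyticAt_snd.comp (hl v))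
  have hΦy : ∀ lam x y v, Φy (x, y, v, lam) = x ^ k • a (toTorus v) lam + A (x, y) (toTorus v) lam := by
    intro lam x y v
    simp only [Φy, Ψ, hG, reducedLift, Prod.snd_sub, Prod.fst_sub, smul_eq_mul]
    ring
  have hΦθ : ∀ lam x y v, Φθ (x, y, v, lam) = x ^ p • b (toTorus v) lam + B (x, y) (toTorus v) lam := by
    intro lam x y v
    simp only [Φθ, Ψ, hG, reducedLift, Prod.snd_sub]
    abel
  let cl : AngPar d m → ℝ := fun x => c (toTorus x.1) x.2
  have hclp : TorusPeriodic cl := fun n v l => by simp only [cl, toTorus_add_int]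
  -- The coefficient `c` is recovered, for parameters outside Λ too, as the derivative in y of the
  -- first component on x = 0.
  have hcla : ∀ v, ∀ lam ∈ V₀, AnalyticAt ℝ cl (v, lam) := by
    intro v lam hl
    have h1 : AnalyticAt ℝ (fun z : ℝ × AngPar d m => (Ψ (0, z)).1) (0, v, lam) :=
      (hl v).chart_fst.comp_of_eq (analyticAt_const.prod analyticAt_id) rfl
    refine ((analyticAt_uDiv (FC := ℂ) h1).comp_of_eq (analyticAt_const.prod analyticAt_id)
      rfl : AnalyticAt ℝ (fun x => uDiv (fun z : ℝ × AngPar d m => (Ψ (0, z)).1) (0, x)) (v, lam)).congr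
      (.of_forall fun x => ?_)
    change dslope (fun u => (Ψ (0, u, x)).1) 0 0 = _
    simp only [dslope_same, Ψ, hG, reducedLift, cl, Prod.fst_sub, zero_add, sub_zero]
    exact ((hasDerivAt_id (0 : ℝ)).const_mul _).deriv.trans (mul_one _)
  -- Analyticity is assumed for the sums a x^k + A and x^p b + B only, and off Λ the splitting
  -- carries no information. The leading coefficients of the sums are analytic near Λ and agree with
  -- `a` and `b` on Λ.
  let al : AngPar d m → ℝ := leadCoef k k Φy
  let bl : AngPar d m → Fin d → ℝ := leadCoef k p Φθ
  have halp : TorusPeriodic al := periodic_leadCoef hΦyp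
  have hala : ∀ v, ∀ lam ∈ V₀, AnalyticAt ℝ al (v, lam) := fun v lam hl =>
    analyticAt_leadCoef (FC := ℂ) (hΦya v lam hl)
  have hal : ∀ lam ∈ Λ, ∀ v, al (v, lam) = a (toTorus v) lam := fun lam hl v =>
    leadCoef_eq (FC := ℂ) (f := fun v z => A z (toTorus v) lam) (by omega) hk
      (fun v => hΦya v lam (hΛ hl)) (fun v => hA _ lam hl) (hΦy lam) v
  have hbl : ∀ lam ∈ Λ, ∀ v, bl (v, lam) = b (toTorus v) lam := fun lam hl v =>
    leadCoef_eq (FC := Fin d → ℂ) (f := fun v z => B z (toTorus v) lam) hp hk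
      (fun v => hΦθa v lam (hΛ hl)) (fun v => hB _ lam hl) (hΦθ lam) v
  have hblp : TorusPeriodic bl := periodic_leadCoef hΦθp
  have hbla : ∀ v, ∀ lam ∈ V₀, AnalyticAt ℝ bl (v, lam) := fun v lam hl =>
    analyticAt_leadCoef (FC := Fin d → ℂ) (hΦθa v lam hl)
  have hcavg : ∀ lam, liftAvg cl lam = torusAvg c lam := fun lam => by
    simp only [liftAvg, torusAvg, cl, toTorus_torusLift]
  have haavg : ∀ lam ∈ Λ, liftAvg al lam = torusAvg a lam := fun lam hl => by
    simp only [liftAvg, torusAvg, hal lam hl, toTorus_torusLift]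
  have hbavg : ∀ lam ∈ Λ, (fun i => liftAvg (fun x => bl x i) lam) = torusAvg b lam := fun lam hl => by
    funext i
    have h1 : ∀ j, Integrable (fun θ => b θ lam j) := fun j => by
      have h2 : Integrable fun θ => (fun x => bl x j) (torusLift θ, lam) :=
        integrable_torusLift (fun n v l => congrFun (hblp n v l) j)
          fun v => analyticAt_pi_iff.1 (hbla v lam (hΛ hl)) j
      simpa only [hbl lam hl, toTorus_torusLift] using h2
    rw [torusAvg, MeasureTheory.eval_integral h1]
    simp only [liftAvg, hbl lam hl, toTorus_torusLift]
  let g : ℝ × Chart d × AngPar d m → Chart d := fun z =>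
    (cl (angShift q z) * z.2.1.2.1, blowUpField k k q Φy z, blowUpField k p q Φθ z)
  let P : ParabolicData d m :=
    { k := k, p := p, q := q, two_le := hk, one_le := by omega, ω := ω, dioph := hω
      V := {lam | lam ∈ V₀ ∧ 0 < liftAvg cl lam} ∩ {lam | lam ∈ V₀ ∧ 0 < liftAvg al lam}
      isOpen := (isOpen_setOf_liftAvg_pos hclp hV₀ hcla).inter (isOpen_setOf_liftAvg_pos halp hV₀ hala)
      c := cl, a := al, b := bl, g := g
      periodic_c := hclp
      periodic_a := halp
      periodic_b := hblp
      periodic_g := fun u W n v l => by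
        have e : angShift q (u, W, (v + fun i => (n i : ℝ)), l) =
            ((angShift q (u, W, v, l)).1 + fun i => (n i : ℝ), (angShift q (u, W, v, l)).2) :=
          Prod.ext (by simp only [angShift]; abel) rfl
        refine Prod.ext ?_ (Prod.ext (periodic_blowUpField hΦyp u W n v l)
          (periodic_blowUpField hΦθp u W n v l))
        simp only [g, e]
        rw [hclp n]
      analytic_c := fun v lam hl => hcla v lam hl.1.1
      analytic_a := fun v lam hl => hala v lam hl.1.1
      analytic_b := fun v lam hl => hbla v lam hl.1.1
      analytic_g := fun W v lam hl => by
        have e2 : AnalyticAt ℝ (fun z : ℝ × Chart d × AngPar d m => z.2.1) (0, W, v, lam) :=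
          analyticAt_fst.comp analyticAt_snd
        have e3 : AnalyticAt ℝ (fun z : ℝ × Chart d × AngPar d m => cl (angShift q z)) (0, W, v, lam) :=
          (hcla v lam hl.1.1).comp_of_eq (analyticAt_angShift _) (angShift_zero hq0 _ _)
        exact (e3.mul e2.chart_mid).prod
          ((analyticAt_blowUpField (FC := ℂ) hq0 (hΦya v lam hl.1.1) W).prod
            (analyticAt_blowUpField (FC := Fin d → ℂ) hq0 (hΦθa v lam hl.1.1) W))
      pos_c := fun lam hl => hl.1.2
      pos_a := fun lam hl => hl.2.2
      g_zero := fun W v lam hl => by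
        simp only [g, angShift_zero hq0, blowUpField_zero hq0, smul_eq_mul, mul_comm (W.1 ^ k)]
        rfl }
  refine ⟨P, rfl, rfl, rfl, rfl, fun lam hl => ⟨⟨hΛ hl, ?_⟩, hΛ hl, ?_⟩,
    fun lam hl => ⟨hcavg lam, haavg lam hl, hbavg lam hl⟩, fun u W v lam hl => ?_⟩
  · rw [hcavg]; exact hc lam hl
  · rw [haavg lam hl]; exact ha lam hl
  · have hy : u ^ (2 * k) • blowUpField k k q Φy (u, W, v, lam) = _ :=
      pow_smul_blowUpField (FC := ℂ) (f := fun v z => A z (toTorus v) lam) (by omega) hk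
        (fun v => hΦya v lam (hΛ hl)) (fun v => hA _ lam hl) (hΦy lam) u W v
    have hθ : u ^ (2 * p) • blowUpField k p q Φθ (u, W, v, lam) = _ :=
      pow_smul_blowUpField (FC := Fin d → ℂ) (f := fun v z => B z (toTorus v) lam) hp hk
        (fun v => hΦθa v lam (hΛ hl)) (fun v => hB _ lam hl) (hΦθ lam) u W v
    have e : P.g (u, W, v, lam) = (cl (v + u ^ q • W.2.2, lam) * W.2.1,
      blowUpField k k q Φy (u, W, v, lam), blowUpField k p q Φθ (u, W, v, lam)) := rfl
    rw [e]
    simp only [smul_eq_mul] at hy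
    rw [hy, hθ]
    refine Prod.ext ?_ (Prod.ext ?_ ?_)
    · simp only [hG, reducedLift, cl]; ring
    · simp only [blowUp, Φy, Ψ, Prod.snd_sub, Prod.fst_sub]; ring
    · simp only [blowUp, Φθ, Ψ, Prod.snd_sub]; abel

end Reduction

/-! ### Return to the original coordinates -/

section Assembly

variable {d m : ℕ}

/-- The orbit decreases, so it converges to a fixed point, and φ u < u leaves none in (0, ρ). -/
lemma tendsto_iterate_zero {φ : ℝ → ℝ} {ρ u : ℝ} (hφ : Continuous φ) (h0 : φ 0 = 0)
    (h : ∀ u ∈ Ioo 0 ρ, φ u ∈ Ioo 0 u) (hu : u ∈ Ico 0 ρ) :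
    (∀ n, φ^[n] u ∈ Ico 0 ρ) ∧ Tendsto (fun n => φ^[n] u) atTop (𝓝 0) := by
  have hstep : ∀ x ∈ Ico 0 ρ, φ x ∈ Ico 0 ρ ∧ φ x ≤ x := by
    intro x hx
    rcases hx.1.eq_or_lt with h1 | h1
    · rw [← h1, h0]; exact ⟨⟨le_rfl, hx.1.trans_lt hx.2⟩, le_rfl⟩
    · have := h x ⟨h1, hx.2⟩
      exact ⟨⟨this.1.le, this.2.trans hx.2⟩, this.2.le⟩
  have hmem : ∀ n, φ^[n] u ∈ Ico 0 ρ := by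
    intro n
    induction n with
    | zero => exact hu
    | succ n ih => rw [Function.iterate_succ_apply']; exact (hstep _ ih).1
  have hanti : Antitone fun n => φ^[n] u := antitone_nat_of_succ_le fun n => by
    rw [Function.iterate_succ_apply']; exact (hstep _ (hmem n)).2
  have hbdd : BddBelow (range fun n => φ^[n] u) := ⟨0, by rintro _ ⟨n, rfl⟩; exact (hmem n).1⟩
  have hlim := tendsto_atTop_ciInf hanti hbdd
  set l := ⨅ n, φ^[n] u with hl
  have hl0 : 0 ≤ l := le_ciInf fun n => (hmem n).1
  have hlρ : l < ρ := (ciInf_le hbdd 0).trans_lt hu.2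
  have hfix : φ l = l := isFixedPt_of_tendsto_iterate hlim hφ.continuousAt
  refine ⟨hmem, ?_⟩
  rcases hl0.eq_or_lt with h1 | h1
  · rwa [← h1] at hlim
  · exact absurd hfix (h l ⟨h1, hlρ⟩).2.ne

lemma reducedMap_toTorus (k p : ℕ) (ω : Fin d → ℝ)
    (c a : Torus d → (Fin m → ℝ) → ℝ) (b : Torus d → (Fin m → ℝ) → Fin d → ℝ)
    (A : ℝ × ℝ → Torus d → (Fin m → ℝ) → ℝ) (B : ℝ × ℝ → Torus d → (Fin m → ℝ) → Fin d → ℝ)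
    (lam : Fin m → ℝ) (x y : ℝ) (σ : Fin d → ℝ) :
    reducedMap k p ω c a b A B lam (x, y, toTorus σ) =
      ((reducedLift k p ω c a b A B (x, y, σ, lam)).1, (reducedLift k p ω c a b A B (x, y, σ, lam)).2.1,
        toTorus (reducedLift k p ω c a b A B (x, y, σ, lam)).2.2) := by
  simp only [reducedMap, reducedLift, toTorus_add]

namespace ParabolicData

variable {P : ParabolicData d m} {lam : Fin m → ℝ}

lemma polyR_fst (r₂ : (Fin m → ℝ) → ℝ) (u : ℝ) (θ : Torus d) :
    (polyR P.k P.ω P.r₁ r₂ u θ lam).1 = P.rho r₂ u lam * u := by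
  have := P.two_le
  have e1 : u ^ P.k = u ^ (P.k - 1) * u := by rw [← pow_succ]; congr 1; omega
  have e2 : u ^ (2 * P.k - 1) = u ^ (2 * P.k - 2) * u := by rw [← pow_succ]; congr 1; omega
  rw [polyR, rho, e1, e2]
  ring

lemma w₀_mid (hl : lam ∈ P.V) :
    (P.w₀ lam).2.1 = -√(2 * P.aAvg lam / (P.cAvg lam * (P.k + 1))) := by
  have hc := P.cAvg_pos hl
  have ha := P.aAvg_pos hl
  have e : 2 * P.aAvg lam / (P.cAvg lam * (P.k + 1)) =
      (2 * √(P.cAvg lam * P.aAvg lam / (2 * (P.k + 1))) / P.cAvg lam) ^ 2 := by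
    rw [div_pow, mul_pow, Real.sq_sqrt (by positivity)]
    field_simp
  rw [e, Real.sqrt_sq (by positivity)]
  simp only [w₀, r₁]
  ring

lemma w₀_ang (hq : (P.q : ℝ) = 2 * P.p - P.k + 1) :
    (P.w₀ lam).2.2 = -(√(2 * (P.k + 1) / (P.cAvg lam * P.aAvg lam)) / (2 * P.p - P.k + 1)) •
      P.bAvg lam := by
  rw [← inv_div (P.cAvg lam * P.aAvg lam), Real.sqrt_inv, ← hq]
  simp only [w₀, r₁]
  congr 1
  rw [mul_neg, inv_neg, mul_inv, mul_comm, ← div_eq_mul_inv]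

/-- The parameterization in the original coordinates. -/
noncomputable def param (P : ParabolicData d m) (W : ℝ × AngPar d m → Chart d) (u : ℝ) (θ : Torus d)
    (lam : Fin m → ℝ) : ℝ × ℝ × Torus d :=
  (u ^ 2 * (W (u, torusLift θ, lam)).1, u ^ (P.k + 1) * (W (u, torusLift θ, lam)).2.1,
    θ + toTorus (u ^ P.q • (W (u, torusLift θ, lam)).2.2))

lemma periodic_torusLift {W : ℝ × AngPar d m → Chart d} (hW : ∀ u, TorusPeriodic fun x => W (u, x)) (u : ℝ)
    (v : Fin d → ℝ) : W (u, torusLift (toTorus v), lam) = W (u, v, lam) :=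
  eq_of_toTorus_eq (f := fun v => W (u, v, lam)) (fun n v => hW u n v lam) (by simp)

lemma param_toTorus {W : ℝ × AngPar d m → Chart d} (hW : ∀ u, TorusPeriodic fun x => W (u, x)) (u : ℝ)
    (v : Fin d → ℝ) : P.param W u (toTorus v) lam =
      (u ^ 2 * (W (u, v, lam)).1, u ^ (P.k + 1) * (W (u, v, lam)).2.1,
        toTorus (v + u ^ P.q • (W (u, v, lam)).2.2)) := by
  simp only [param, periodic_torusLift hW, toTorus_add]

lemma liftParam_param {W : ℝ × AngPar d m → Chart d} (hW : ∀ u, TorusPeriodic fun x => W (u, x)) :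
    liftParam (P.param W) (fun u θ lam => u ^ P.q • (W (u, torusLift θ, lam)).2.2) =
      fun z => (z.1 ^ 2 * (W z).1, z.1 ^ (P.k + 1) * (W z).2.1, z.2.1 + z.1 ^ P.q • (W z).2.2) := by
  funext z
  simp only [liftParam, param, periodic_torusLift hW]

/-- The invariance equation in the original coordinates. -/
lemma invariance {c a : Torus d → (Fin m → ℝ) → ℝ} {b : Torus d → (Fin m → ℝ) → Fin d → ℝ}
    {A : ℝ × ℝ → Torus d → (Fin m → ℝ) → ℝ} {B : ℝ × ℝ → Torus d → (Fin m → ℝ) → Fin d → ℝ}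
    {r₂ : (Fin m → ℝ) → ℝ} {W : ℝ × AngPar d m → Chart d} (hq : P.q = 2 * P.p + 1 - P.k)
    (hkp : P.k < 2 * P.p + 1)
    (hred : ∀ (u : ℝ) (W : Chart d) (v : Fin d → ℝ), reducedLift P.k P.p P.ω c a b A B
        (u ^ 2 * W.1, u ^ (P.k + 1) * W.2.1, v + u ^ (2 * P.p + 1 - P.k) • W.2.2, lam) =
      (u ^ 2 * W.1 + u ^ (P.k + 1) * (P.g (u, W, v, lam)).1,
        u ^ (P.k + 1) * W.2.1 + u ^ (2 * P.k) * (P.g (u, W, v, lam)).2.1,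
        v + u ^ (2 * P.p + 1 - P.k) • W.2.2 + P.ω + u ^ (2 * P.p) • (P.g (u, W, v, lam)).2.2))
    (hW : ∀ u, TorusPeriodic fun x => W (u, x)) {u : ℝ} (herr : ∀ v, P.err r₂ W (u, v, lam) = 0)
    (θ : Torus d) :
    reducedMap P.k P.p P.ω c a b A B lam (P.param W u θ lam) =
      P.param W (polyR P.k P.ω P.r₁ r₂ u θ lam).1 (polyR P.k P.ω P.r₁ r₂ u θ lam).2 lam := by
  have hk := P.two_le
  set v := torusLift θ with hv
  have hθ : θ = toTorus v := (toTorus_torusLift θ).symm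
  have h2 : (polyR P.k P.ω P.r₁ r₂ u θ lam).2 = toTorus (v + P.ω) := by
    rw [toTorus_add, ← hθ]; rfl
  rw [h2, polyR_fst, param_toTorus hW]
  rw [hθ, param_toTorus hW, reducedMap_toTorus, hq, hred]
  have h3 := herr v
  simp only [err, diagPow_apply] at h3
  set g := P.g (u, W (u, v, lam), v, lam) with hg
  set ρ := P.rho r₂ u lam with hρ
  set W' := W (ρ * u, v + P.ω, lam) with hW'
  set w := W (u, v, lam) with hw
  have e1 : ρ ^ 2 * W'.1 - w.1 - u ^ (P.k - 1) * g.1 = 0 := congrArg Prod.fst h3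
  have e2 : ρ ^ (P.k + 1) * W'.2.1 - w.2.1 - u ^ (P.k - 1) * g.2.1 = 0 :=
    congrArg (fun x : Chart d => x.2.1) h3
  have e3 : ρ ^ P.q • W'.2.2 - w.2.2 - u ^ (P.k - 1) • g.2.2 = 0 :=
    congrArg (fun x : Chart d => x.2.2) h3
  -- These three identities fix the weights 2, k + 1 and q: every component of the increment exceeds
  -- its own weight by the same power k - 1.
  have p1 : u ^ (P.k + 1) = u ^ 2 * u ^ (P.k - 1) := by rw [← pow_add]; congr 1; omega
  have p2 : u ^ (2 * P.k) = u ^ (P.k + 1) * u ^ (P.k - 1) := by rw [← pow_add]; congr 1; omega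
  have p3 : u ^ (2 * P.p) = u ^ P.q * u ^ (P.k - 1) := by rw [← pow_add]; congr 1; omega
  refine Prod.ext ?_ (Prod.ext ?_ ?_)
  · simp only
    rw [p1, mul_pow]
    linear_combination (-u ^ 2) * e1
  · simp only
    rw [p2, mul_pow]
    linear_combination (-u ^ (P.k + 1)) * e2
  · simp only
    congr 1
    rw [p3, ← hq, mul_pow]
    linear_combination (norm := module) (-u ^ P.q) • e3

end ParabolicData

end Assembly

end

/-! ### The stable manifold -/

theorem mainTheorem1 (d m k p : ℕ) (hk : 2 ≤ k) (hp : 1 ≤ p) (hkp : k < 2 * p + 1)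
    (U : Set (ℝ × ℝ)) (hU : U ∈ 𝓝 ((0, 0) : ℝ × ℝ)) (Λ : Set (Fin m → ℝ))
    (ω : Fin d → ℝ) (hω : IsDiophantine ω)
    (c a : Torus d → (Fin m → ℝ) → ℝ) (b : Torus d → (Fin m → ℝ) → Fin d → ℝ)
    (A : ℝ × ℝ → Torus d → (Fin m → ℝ) → ℝ)
    (B : ℝ × ℝ → Torus d → (Fin m → ℝ) → Fin d → ℝ)
    (hF : AnalyticOnNhd ℝ (reducedLift k p ω c a b A B)
      {q | (q.1, q.2.1) ∈ U ∧ q.2.2.2 ∈ Λ})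
    (hA : ∀ θ, ∀ lam ∈ Λ, HasReducedOrder k (fun z => A z θ lam))
    (hB : ∀ θ, ∀ lam ∈ Λ, HasReducedOrder p (fun z => B z θ lam))
    (hc : ∀ lam ∈ Λ, 0 < torusAvg c lam) (ha : ∀ lam ∈ Λ, 0 < torusAvg a lam)
    (Λ₀ : Set (Fin m → ℝ)) (hΛ₀ : IsCompact Λ₀) (hsub : Λ₀ ⊆ Λ) :
    ∃ ρ : ℝ, 0 < ρ ∧ ∃ V : Set (Fin m → ℝ), IsOpen V ∧ Λ₀ ⊆ V ∧
    ∃ (K : ℝ → Torus d → (Fin m → ℝ) → ℝ × ℝ × Torus d)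
      (κ : ℝ → Torus d → (Fin m → ℝ) → Fin d → ℝ)
      (Ky : (Fin m → ℝ) → ℝ) (Kθ : (Fin m → ℝ) → Fin d → ℝ) (r₁ r₂ : (Fin m → ℝ) → ℝ),
      -- regularity of the parameterization and of the coefficient of `u^(2k-1)` in `R`
      (∀ u ∈ Ico 0 ρ, ∀ θ, ∀ lam ∈ V, (K u θ lam).2.2 = θ + toTorus (κ u θ lam)) ∧
      ContDiffOn ℝ 1 (liftParam K κ) (Ico 0 ρ ×ˢ (univ ×ˢ V)) ∧
      AnalyticOnNhd ℝ (liftParam K κ) (Ioo 0 ρ ×ˢ (univ ×ˢ V)) ∧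
      AnalyticOnNhd ℝ r₂ V ∧
      -- the form of the parameterization
      (∃ C : ℝ, ∀ u ∈ Ico 0 ρ, ∀ θ, ∀ lam ∈ Λ₀,
        |(K u θ lam).1 - u ^ 2| ≤ C * u ^ 3 ∧
        |(K u θ lam).2.1 - Ky lam * u ^ (k + 1)| ≤ C * u ^ (k + 2) ∧
        ‖κ u θ lam - u ^ (2 * p + 1 - k) • Kθ lam‖ ≤ C * u ^ (2 * p + 2 - k)) ∧
      -- the leading coefficients
      (∀ lam ∈ Λ₀,
        Ky lam = -√(2 * torusAvg a lam / (torusAvg c lam * (k + 1))) ∧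
        Kθ lam = -(√(2 * (k + 1) / (torusAvg c lam * torusAvg a lam)) / (2 * p - k + 1)) •
          torusAvg b lam ∧
        r₁ lam = -√(torusAvg c lam * torusAvg a lam / (2 * (k + 1))) ∧
        r₁ lam < 0) ∧
      -- `R` contracts `[0, ρ)` towards `0`
      (∀ u ∈ Ioo 0 ρ, ∀ θ, ∀ lam ∈ Λ₀, (polyR k ω r₁ r₂ u θ lam).1 ∈ Ioo 0 u) ∧
      -- the invariance equation
      (∀ u ∈ Ico 0 ρ, ∀ θ, ∀ lam ∈ Λ₀,
        ((K u θ lam).1, (K u θ lam).2.1) ∈ U ∧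
        reducedMap k p ω c a b A B lam (K u θ lam) =
          K (polyR k ω r₁ r₂ u θ lam).1 (polyR k ω r₁ r₂ u θ lam).2 lam) ∧
      -- orbits on the image of `K` are asymptotic to the torus `x = y = 0`
      (∀ u ∈ Ico 0 ρ, ∀ θ, ∀ lam ∈ Λ₀,
        Tendsto (fun n : ℕ =>
          (((reducedMap k p ω c a b A B lam)^[n] (K u θ lam)).1,
            ((reducedMap k p ω c a b A B lam)^[n] (K u θ lam)).2.1))
          atTop (𝓝 (0, 0))) := by
  obtain ⟨P, rfl, rfl, hq, rfl, hΛ, havg, hred⟩ :=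
    exists_parabolicData hk hp hkp hU hω hF hA hB hc ha
  have hVsub : Λ₀ ⊆ P.V := hsub.trans hΛ
  obtain ⟨r₂, W, V, ρ₀, C, hV, hΛV, hVP, hρ₀, hr₂, hper, hWa, hW1, hWb, herr, hrho⟩ :=
    P.exists_solution hΛ₀ hVsub
  obtain ⟨M₀, hM₀⟩ : ∃ M, ∀ lam ∈ Λ₀, ‖P.w₀ lam‖ ≤ M :=
    hΛ₀.exists_bound_of_continuousOn fun lam hl =>
      (ParabolicData.analyticAt_w₀ (hVsub hl)).continuousAt.continuousWithinAt
  -- A bound for W over Λ₀ when u ≤ 1. It gives ‖(x, y)‖ ≤ u M on the image of K, which keeps the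
  -- image inside `U` for u M < ε and makes the orbits tend to 0.
  set M : ℝ := max M₀ 0 + |C| + 1 with hM
  have hM1 : 0 < M := by positivity
  obtain ⟨ε, hε, hεU⟩ := Metric.mem_nhds_iff.1 hU
  set ρ : ℝ := min ρ₀ (min 1 (ε / M)) with hρ
  have hρ0 : 0 < ρ := by positivity
  have hρρ : ρ ≤ ρ₀ := min_le_left _ _
  have hIco : Ico 0 ρ ⊆ Ico 0 ρ₀ := Ico_subset_Ico_right hρρ
  have hIoo : Ioo 0 ρ ⊆ Ioo 0 ρ₀ := Ioo_subset_Ioo_right hρρ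
  have hsmall : ∀ u ∈ Ico 0 ρ, u ≤ 1 ∧ u * M < ε := by
    intro u hu
    have h := hu.2
    simp only [hρ, lt_min_iff] at h
    exact ⟨h.2.1.le, (lt_div_iff₀ hM1).1 h.2.2⟩
  have hbound : ∀ u ∈ Ico 0 ρ, ∀ θ, ∀ lam ∈ Λ₀,
      ‖((P.param W u θ lam).1, (P.param W u θ lam).2.1)‖ ≤ u * M := by
    intro u hu θ lam hl
    have h1 := hWb u (hIco hu) (torusLift θ) lam (hΛV hl)
    obtain ⟨hu1, -⟩ := hsmall u hu
    have h2 : ‖W (u, torusLift θ, lam)‖ ≤ M := by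
      have h3 := norm_le_norm_add_norm_sub' (W (u, torusLift θ, lam)) (P.w₀ lam)
      have h4 := (hM₀ lam hl).trans (le_max_left M₀ 0)
      have h5 : C * u ≤ |C| := (mul_le_mul_of_nonneg_right (le_abs_self C) hu.1).trans
        (mul_le_of_le_one_right (abs_nonneg C) hu1)
      linarith
    have h6 : ∀ {n : ℕ}, n ≠ 0 → ∀ x : ℝ, ‖x‖ ≤ M → ‖u ^ n * x‖ ≤ u * M := by
      intro n hn x hx
      rw [norm_mul, norm_pow, Real.norm_of_nonneg hu.1]
      exact mul_le_mul (pow_le_of_le_one hu.1 hu1 hn) hx (norm_nonneg _) hu.1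
    exact norm_prod_le_iff.2 ⟨h6 two_ne_zero _ ((norm_fst_le _).trans h2),
      h6 (Nat.succ_ne_zero _) _ ((norm_fst_le _).trans ((norm_snd_le _).trans h2))⟩
  have hinv : ∀ u ∈ Ico 0 ρ, ∀ θ, ∀ lam ∈ Λ₀,
      reducedMap P.k P.p P.ω c a b A B lam (P.param W u θ lam) =
        P.param W (polyR P.k P.ω P.r₁ r₂ u θ lam).1 (polyR P.k P.ω P.r₁ r₂ u θ lam).2 lam :=
    fun u hu θ lam hl => ParabolicData.invariance hq hkp (fun u W v => hred u W v lam (hsub hl)) hper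
      (fun v => herr u (hIco hu) v lam (hΛV hl)) θ
  have hcontr : ∀ u ∈ Ioo 0 ρ, ∀ θ, ∀ lam ∈ Λ₀, (polyR P.k P.ω P.r₁ r₂ u θ lam).1 ∈ Ioo 0 u := by
    intro u hu θ lam hl
    have h1 := hrho u (hIoo hu) lam hl
    rw [ParabolicData.polyR_fst]
    exact ⟨mul_pos h1.1 hu.1, mul_lt_of_lt_one_left hu.1 h1.2⟩
  refine ⟨ρ, hρ0, V, hV, hΛV, P.param W, fun u θ lam => u ^ P.q • (W (u, torusLift θ, lam)).2.2,
    fun lam => (P.w₀ lam).2.1, fun lam => (P.w₀ lam).2.2, P.r₁, r₂, fun u _ θ lam _ => rfl, ?_, ?_, hr₂,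
    ⟨C, fun u hu θ lam hl => ?_⟩, fun lam hl => ?_, hcontr,
    fun u hu θ lam hl => ⟨hεU ?_, hinv u hu θ lam hl⟩, fun u hu θ lam hl => ?_⟩
  · rw [ParabolicData.liftParam_param hper]
    have h1 := hW1.mono (prod_mono_left (t := univ ×ˢ V) hIco)
    have e1 := h1.fst
    have e2 := h1.snd.fst
    have e3 := h1.snd.snd
    fun_prop
  · rw [ParabolicData.liftParam_param hper]
    rintro ⟨u, v, lam⟩ ⟨hu, hl⟩
    have h1 : AnalyticAt ℝ W (u, v, lam) := hWa _ ⟨hIoo hu, hl⟩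
    have e1 : AnalyticAt ℝ (fun z : ℝ × AngPar d m => z.1) (u, v, lam) := analyticAt_fst
    have e2 : AnalyticAt ℝ (fun z : ℝ × AngPar d m => z.2.1) (u, v, lam) :=
      analyticAt_fst.comp analyticAt_snd
    have e3 : AnalyticAt ℝ (fun z : ℝ × AngPar d m => (W z).2.2) (u, v, lam) :=
      analyticAt_snd.comp (analyticAt_snd.comp h1)
    exact ((e1.pow 2).mul h1.chart_fst).prod
      (((e1.pow (P.k + 1)).mul h1.chart_mid).prod (e2.add ((e1.pow P.q).smul e3)))
  · have h1 := hWb u (hIco hu) (torusLift θ) lam (hΛV hl)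
    have hu0 := hu.1
    have e : 2 * P.p + 2 - P.k = P.q + 1 := by omega
    refine ⟨?_, ?_, ?_⟩
    · have h2 : |(W (u, torusLift θ, lam)).1 - 1| ≤ C * u := (norm_fst_le _).trans h1
      calc |u ^ 2 * (W (u, torusLift θ, lam)).1 - u ^ 2|
          = u ^ 2 * |(W (u, torusLift θ, lam)).1 - 1| := by
            rw [← abs_of_nonneg (pow_nonneg hu0 2), ← abs_mul, abs_of_nonneg (pow_nonneg hu0 2)]
            congr 1; ring
        _ ≤ u ^ 2 * (C * u) := by gcongr
        _ = C * u ^ 3 := by ring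
    · have h2 : |(W (u, torusLift θ, lam)).2.1 - (P.w₀ lam).2.1| ≤ C * u :=
        (norm_fst_le _).trans ((norm_snd_le _).trans h1)
      calc |u ^ (P.k + 1) * (W (u, torusLift θ, lam)).2.1 - (P.w₀ lam).2.1 * u ^ (P.k + 1)|
          = u ^ (P.k + 1) * |(W (u, torusLift θ, lam)).2.1 - (P.w₀ lam).2.1| := by
            rw [← abs_of_nonneg (pow_nonneg hu0 (P.k + 1)), ← abs_mul,
              abs_of_nonneg (pow_nonneg hu0 (P.k + 1))]
            congr 1; ring
        _ ≤ u ^ (P.k + 1) * (C * u) := by gcongr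
        _ = C * u ^ (P.k + 2) := by ring
    · have h2 : ‖(W (u, torusLift θ, lam)).2.2 - (P.w₀ lam).2.2‖ ≤ C * u :=
        (norm_snd_le (W (u, torusLift θ, lam) - P.w₀ lam).2).trans ((norm_snd_le _).trans h1)
      rw [← hq, e, ← smul_sub, norm_smul, norm_pow, Real.norm_of_nonneg hu0]
      calc u ^ P.q * _ ≤ u ^ P.q * (C * u) := by gcongr
        _ = C * u ^ (P.q + 1) := by ring
  · obtain ⟨h1, h2, h3⟩ := havg lam (hsub hl)
    have hqr : (P.q : ℝ) = 2 * P.p - P.k + 1 := by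
      rw [hq, Nat.cast_sub hkp.le]; push_cast; ring
    refine ⟨?_, ?_, ?_, ParabolicData.r₁_neg (hVsub hl)⟩
    · rw [← h1, ← h2]; exact ParabolicData.w₀_mid (hVsub hl)
    · rw [← h1, ← h2, ← h3]; exact ParabolicData.w₀_ang hqr
    · rw [← h1, ← h2]; rfl
  · rw [Metric.mem_ball, show ((0 : ℝ), (0 : ℝ)) = 0 from rfl, dist_zero_right]
    exact (hbound u hu θ lam hl).trans_lt (hsmall u hu).2
  · let φ : ℝ → ℝ := fun u => u + P.r₁ lam * u ^ P.k + r₂ lam * u ^ (2 * P.k - 1)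
    have hφ : Continuous φ := by fun_prop
    have hφ0 : φ 0 = 0 := by
      simp [φ, show P.k ≠ 0 by omega, show 2 * P.k - 1 ≠ 0 by omega]
    obtain ⟨hmem, hlim⟩ := tendsto_iterate_zero hφ hφ0 (fun u hu => hcontr u hu 0 lam hl) hu
    -- The conjugacy sends orbits of F on the image of K to orbits of the one-dimensional map φ; the
    -- angle is irrelevant for the limit, so it is left existential.
    have hiter : ∀ n, ∃ θ' : Torus d, (reducedMap P.k P.p P.ω c a b A B lam)^[n] (P.param W u θ lam) =
        P.param W (φ^[n] u) θ' lam := by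
      intro n
      induction n with
      | zero => exact ⟨θ, rfl⟩
      | succ n ih =>
        obtain ⟨θ', h⟩ := ih
        refine ⟨θ' + toTorus P.ω, ?_⟩
        rw [Function.iterate_succ_apply', h, hinv _ (hmem n) θ' lam hl, Function.iterate_succ_apply']
        rfl
    rw [show ((0 : ℝ), (0 : ℝ)) = 0 from rfl]
    refine squeeze_zero_norm (fun n => ?_) (by simpa using hlim.mul_const M)
    obtain ⟨θ', h⟩ := hiter n
    rw [h]
    exact hbound _ (hmem n) θ' lam hl
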